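/- **Conventions.** Manifolds are smooth, real and finite dimensional. A *Lie groupoid* $G\rightrightarrows G^{(0)}$ has second countable manifolds $G$, $G^{(0)}$ of pure dimension, $G^{(0)}$ Hausdorff ($G$ need not be), smooth structure maps (source $s$, range $r$, unit $u$, inverse, product on $G^{(2)}=\{(a,b): s(a)=r(b)\}$), and $s$ is a submersion. Its *Lie algebroid* $\mathfrak{A}G$ is the restriction of $\ker Ts$ to the units, with anchor $Tr$ and the bracket $[X,Y]=[Z_X,Z_Y]|_{G^{(0)}}$, where $Z_X(a)=TR_a\,(X_{r(a)})$ is the right-invariant vector field of a section $X$. A *Lie subgroupoid* of $G$ is a Lie groupoid $H\rightrightarrows H^{(0)}$ such that $H\subset G$ and $H^{(0)}\subset G^{(0)}$ are embedded submanifolds (not necessarily closed, and $H^{(0)}$ need not be all of $G^{(0)}$) and the structure maps of $H$ are the restrictions of those of $G$. For a submanifold $V\subset M$ with normal bundle $\mathcal N_V^M=TM|_V/TV$, the *deformation to the normal cone* is the set $DNC(M,V)=(M\times\mathbb R^*)\sqcup(\mathcal N_V^M\times\{0\})$, with the smooth structure whose charts are those of $M\times\mathbb R^*$ together with, for every local chart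 $M\supset O\to \mathbb R^p\times\mathbb R^q$ of $M$ carrying $V\cap O$ to the slice $\mathbb R^p\times\{0\}$, the chart with inverse $(y,\xi,t)\mapsto \big((y,t\xi),t\big)$ for $t\neq0$ and $(y,\xi,0)\mapsto\big(\text{class of the vector }(0,\xi)\text{ at }(y,0),\,0\big)$. A smooth map $f:M\to M'$ with $f(V)\subset V'$ induces $DNC(f):DNC(M,V)\to DNC(M',V')$, given by $(x,t)\mapsto (f(x),t)$ for $t\ne0$ and, for $t=0$, by the map of normal bundles induced by $Tf$. **Statement.** Let $G\rightrightarrows G^{(0)}$ be a Lie groupoid and $H\rightrightarrows H^{(0)}$ a Lie subgroupoid of $G$. 1. $DNC(G,H)\rightrightarrows DNC(G^{(0)},H^{(0)})$ is a Lie groupoid, whose source, range, unit, inverse and product are obtained by functoriality from those of $G$ and $H$. (For $t\neq 0$ the product is $(a,t)(b,t)=(ab,t)$. For $t=0$ it sends the classes of $w\in T_aG$ and $z\in T_bG$, where $(a,b)\in H^{(2)}$ and $Ts(w)=Tr(z)$, to the class of $Tm(w,z)$, where $m:G^{(2)}\to G$ is the product of $G$.) 2. Its restriction to $t=0$ is a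 Lie groupoid $\mathcal N_H^G\rightrightarrows\mathcal N_{H^{(0)}}^{G^{(0)}}$ (the normal groupoid), which is a Lie subgroupoid of $DNC(G,H)$. 3. The differential of the inclusion $H\subset G$ restricts to a smooth embedding $\mathfrak AH\to\mathfrak AG$, and $DNC(\mathfrak AG,\mathfrak AH)$ is a Lie algebroid over $DNC(G^{(0)},H^{(0)})$: its projection, zero section, addition and scalar multiplications are obtained by functoriality from those of $\mathfrak AG$ and $\mathfrak AH$, and for each $t\neq0$ its anchor and bracket are those of $\mathfrak AG$, taken at fixed $t$. The Lie algebroid of $DNC(G,H)$ is isomorphic to $DNC(\mathfrak AG,\mathfrak AH)$: there is a diffeomorphism between their total spaces, over the identity of $DNC(G^{(0)},H^{(0)})$, which is an isomorphism of Lie algebroids and which for $t\neq 0$ is the evident identification of the fibre of the Lie algebroid of $DNC(G,H)$ at $(x,t)$ with $\mathfrak A_xG\times\{t\}$. -/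

import Mathlib

open Set
open scoped Manifold ContDiff Topology

/-- Hadamard division: if `k` is smooth and vanishes for `t = 0`, then `k / t`, extended by the
`t`-derivative of `k` for `t = 0`, is smooth. -/
theorem contDiffOn_smoothQuotient {E W : Type*} [NormedAddCommGroup E] [NormedSpace ℝ E]
    [NormedAddCommGroup W] [NormedSpace ℝ W] [CompleteSpace W]
    {Ω : Set (E × ℝ)} (hΩ : IsOpen Ω) {k : E × ℝ → W} (hk : ContDiffOn ℝ ∞ k Ω)
    (h0 : ∀ e, (e, (0 : ℝ)) ∈ Ω → k (e, 0) = 0) :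
    ContDiffOn ℝ ∞ (fun p : E × ℝ ↦ if p.2 = 0 then fderiv ℝ k p (0, 1) else p.2⁻¹ • k p) Ω := by
  rintro ⟨e₀, t₀⟩ hp
  by_cases ht : t₀ = 0
  swap
  · have h1 : ContDiffWithinAt ℝ ∞ (fun p : E × ℝ ↦ p.2⁻¹ • k p) Ω (e₀, t₀) :=
      (ContDiffWithinAt.inv contDiffWithinAt_snd ht).smul (hk _ hp)
    refine h1.congr_of_eventuallyEq ?_ (by simp [ht])
    have : ∀ᶠ p : E × ℝ in 𝓝 (e₀, t₀), p.2 ≠ 0 := continuousAt_snd.eventually_ne ht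
    filter_upwards [nhdsWithin_le_nhds this] with p hp using by simp [hp]
  subst ht
  obtain ⟨r, hr, hball⟩ := Metric.isOpen_iff.1 hΩ _ hp
  have hsub : ∀ e t, e ∈ Metric.ball e₀ r → |t| < r → (e, t) ∈ Ω := fun e t he ht ↦ hball (by
    rw [← ball_prod_same]; exact ⟨he, by simpa using ht⟩)
  set D : E × ℝ → W := fun p ↦ fderiv ℝ k p (0, 1) with hD
  have hDs : ContDiffOn ℝ ∞ D Ω :=
    (hk.fderiv_of_isOpen hΩ (m := ∞) (by simp)).clm_apply contDiffOn_const
  let b : ContDiffBump (0 : ℝ) := ⟨1, 2, one_pos, one_lt_two⟩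
  let U : Set (E × ℝ) := Metric.ball e₀ r ×ˢ Metric.ball 0 (r / 3)
  have hU : IsOpen U := Metric.isOpen_ball.prod Metric.isOpen_ball
  let g : E × ℝ → ℝ → W := fun p x ↦ b x • D (p.1, -x * p.2)
  have hg : ContDiffOn ℝ ((⊤ : ℕ∞) : ℕ∞ω) (Function.uncurry g) (U ×ˢ univ) := by
    rintro ⟨⟨e, t⟩, x⟩ ⟨⟨he, ht⟩, -⟩
    simp only [mem_ball_zero_iff, Real.norm_eq_abs] at ht
    apply ContDiffAt.contDiffWithinAt
    rcases lt_or_ge |x| 3 with hx | hx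
    · have hm : (e, -x * t) ∈ Ω := by
        refine hsub _ _ he ?_
        rw [abs_mul, abs_neg]
        nlinarith [abs_nonneg x, abs_nonneg t]
      have h2 : ContDiffAt ℝ ∞ (fun q : (E × ℝ) × ℝ ↦ (q.1.1, -q.2 * q.1.2)) ((e, t), x) := by
        fun_prop
      have h3 : ContDiffAt ℝ ∞ D (e, -x * t) := (hDs _ hm).contDiffAt (hΩ.mem_nhds hm)
      have h4 : ContDiffAt ℝ ∞ (fun q : (E × ℝ) × ℝ ↦ b q.2) ((e, t), x) :=
        (b.contDiff (n := (⊤ : ℕ∞))).contDiffAt.comp ((e, t), x) contDiffAt_snd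
      have h5 : ContDiffAt ℝ ∞ (D ∘ fun q : (E × ℝ) × ℝ ↦ (q.1.1, -q.2 * q.1.2)) ((e, t), x) :=
        ContDiffAt.comp (g := D) (f := fun q : (E × ℝ) × ℝ ↦ (q.1.1, -q.2 * q.1.2)) _ h3 h2
      exact h4.smul h5
    · have : Function.uncurry g =ᶠ[𝓝 ((e, t), x)] fun _ ↦ 0 := by
        have : ∀ᶠ q : (E × ℝ) × ℝ in 𝓝 ((e, t), x), 2 < |q.2| :=
          (continuous_snd.abs.continuousAt (x := ((e, t), x))).eventually
            (lt_mem_nhds (by show (2 : ℝ) < |x|; linarith))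
        filter_upwards [this] with q hq
        have : b q.2 = 0 := b.zero_of_le_dist (by simpa using hq.le)
        simp [Function.uncurry, g, this]
      exact contDiffAt_const.congr_of_eventuallyEq this
  have key := MeasureTheory.contDiffOn_convolution_right_with_param_comp
    (μ := MeasureTheory.volume) (f := indicator (Icc (0 : ℝ) 1) (fun _ ↦ (1 : ℝ)))
    (ContinuousLinearMap.lsmul ℝ ℝ) (s := U) (v := fun _ ↦ (0 : ℝ)) contDiffOn_const
    (g := g) (k := Metric.closedBall 0 2) hU (isCompact_closedBall _ _)
    (fun p x _ hx ↦ by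
      have : b x = 0 := b.zero_of_le_dist (by simpa using (not_le.1 (by simpa using hx)).le)
      simp [g, this])
    ((MeasureTheory.integrable_indicator_iff measurableSet_Icc).2
      (by simp)).locallyIntegrable hg
  have hmem : ((e₀, 0) : E × ℝ) ∈ U := ⟨Metric.mem_ball_self hr, Metric.mem_ball_self (by positivity)⟩
  have hfin := (key _ hmem).contDiffAt (hU.mem_nhds hmem)
  refine (hfin.congr_of_eventuallyEq ?_).contDiffWithinAt
  filter_upwards [hU.mem_nhds hmem] with p hp
  obtain ⟨he, ht⟩ := hp
  simp only [mem_ball_zero_iff, Real.norm_eq_abs] at ht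
  have hconv : (MeasureTheory.convolution (indicator (Icc (0 : ℝ) 1) (fun _ ↦ (1 : ℝ))) (g p)
      (ContinuousLinearMap.lsmul ℝ ℝ) MeasureTheory.volume) 0
      = ∫ s in (0 : ℝ)..1, D (p.1, s * p.2) := by
    rw [MeasureTheory.convolution, intervalIntegral.integral_of_le zero_le_one,
      ← MeasureTheory.integral_Icc_eq_integral_Ioc,
      ← MeasureTheory.integral_indicator measurableSet_Icc]
    congr 1
    ext s
    by_cases hs : s ∈ Icc (0 : ℝ) 1
    · have hb : b (-s) = 1 := b.one_of_mem_closedBall (by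
        simp only [mem_closedBall_zero_iff, Real.norm_eq_abs, abs_neg]
        exact abs_le.2 ⟨by linarith [hs.1], hs.2⟩)
      simp [hs, g, hb]
    · simp [hs]
  rw [hconv]
  by_cases hp0 : p.2 = 0
  · have : (p.1, (0 : ℝ)) = p := by rw [← hp0]
    simp [hp0, this, hD]
  · simp only [hp0, if_false]
    have hderiv : ∀ s ∈ uIcc (0 : ℝ) 1,
        HasDerivAt (fun s : ℝ ↦ p.2⁻¹ • k (p.1, s * p.2)) (D (p.1, s * p.2)) s := by
      intro s hs
      rw [uIcc_of_le zero_le_one] at hs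
      have hm : (p.1, s * p.2) ∈ Ω := hsub _ _ he (by
        rw [abs_mul, abs_of_nonneg hs.1]; nlinarith [abs_nonneg p.2, hs.2])
      have hkd : HasFDerivAt k (fderiv ℝ k (p.1, s * p.2)) (p.1, s * p.2) :=
        (((hk _ hm).contDiffAt (hΩ.mem_nhds hm)).differentiableAt (by simp)).hasFDerivAt
      have hc : HasDerivAt (fun s : ℝ ↦ (p.1, s * p.2)) ((0 : E), p.2) s :=
        (hasDerivAt_const s p.1).prodMk (by simpa using (hasDerivAt_id s).mul_const p.2)
      have := (hkd.comp_hasDerivAt s hc).const_smul p.2⁻¹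
      have h5 : p.2⁻¹ • (fderiv ℝ k (p.1, s * p.2)) (0, p.2) = D (p.1, s * p.2) := by
        rw [← map_smul]
        simp [hD, hp0]
      rw [← h5]
      exact this
    rw [intervalIntegral.integral_eq_sub_of_hasDerivAt hderiv]
    · have : (p.1, (0:ℝ)) ∈ Ω := hsub _ _ he (by simpa using hr)
      simp [h0 _ this]
    · apply ContinuousOn.intervalIntegrable
      rw [uIcc_of_le zero_le_one]
      refine hDs.continuousOn.comp (by fun_prop) fun s hs ↦ hsub _ _ he ?_
      rw [abs_mul, abs_of_nonneg hs.1]; nlinarith [abs_nonneg p.2, hs.2]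

/-- A smooth atlas on a set, from which a topology and a smooth structure are obtained: charts are
injective maps from subsets of `X` onto subsets of `E`, with open overlaps and smooth transition
maps. -/
structure SmoothAtlas (E X : Type*) [NormedAddCommGroup E] [NormedSpace ℝ E] where
  atlas : Set (PartialEquiv X E)
  exists_chart : ∀ x : X, ∃ e ∈ atlas, x ∈ e.source
  open_source : ∀ e ∈ atlas, ∀ e' ∈ atlas, IsOpen (e.symm.trans e').source
  contDiffOn : ∀ e ∈ atlas, ∀ e' ∈ atlas,
    ContDiffOn ℝ ∞ (e.symm.trans e') (e.symm.trans e').source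

namespace SmoothAtlas

variable {E X : Type*} [NormedAddCommGroup E] [NormedSpace ℝ E] (A : SmoothAtlas E X)

noncomputable def core : ChartedSpaceCore E X where
  atlas := A.atlas
  chartAt x := (A.exists_chart x).choose
  mem_chart_source x := (A.exists_chart x).choose_spec.2
  chart_mem_atlas x := (A.exists_chart x).choose_spec.1
  open_source e e' he he' := A.open_source e he e' he'
  continuousOn_toFun e e' he he' := (A.contDiffOn e he e' he').continuousOn

/-- The topology for which the charts are homeomorphisms on open sets. -/
@[reducible]
noncomputable def topology : TopologicalSpace X := A.core.toTopologicalSpace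

@[reducible]
noncomputable def charts : @ChartedSpace E _ X A.topology := A.core.toChartedSpace

theorem isManifold : @IsManifold ℝ _ E _ _ E _ 𝓘(ℝ, E) ∞ X A.topology A.charts := by
  let _ := A.topology
  let _ := A.charts
  refine isManifold_of_contDiffOn _ _ _ fun e e' he he' ↦ ?_
  obtain ⟨_, ⟨e, rfl⟩, _, ⟨he, rfl⟩, rfl⟩ := he
  obtain ⟨_, ⟨e', rfl⟩, _, ⟨he', rfl⟩, rfl⟩ := he'
  have := A.contDiffOn e he e' he'
  simp only [modelWithCornersSelf_coe, modelWithCornersSelf_coe_symm, range_id, inter_univ, preimage_id]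
  exact this

end SmoothAtlas

section Charts

variable {E M : Type*} [NormedAddCommGroup E] [NormedSpace ℝ E] [TopologicalSpace M]
  [ChartedSpace E M]

/-- The derivative at `x` of a map `ψ : M → E` on a manifold. -/
noncomputable def dchart (ψ : M → E) (x : M) : TangentSpace 𝓘(ℝ, E) x →L[ℝ] E :=
  mfderiv 𝓘(ℝ, E) 𝓘(ℝ, E) ψ x

variable {ψ ψ' : OpenPartialHomeomorph M E}

theorem contDiffOn_transition (h : ψ ∈ IsManifold.maximalAtlas 𝓘(ℝ, E) ∞ M)
    (h' : ψ' ∈ IsManifold.maximalAtlas 𝓘(ℝ, E) ∞ M) :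
    ContDiffOn ℝ ∞ (ψ' ∘ ψ.symm) (ψ.symm.trans ψ').source := by
  have := ModelWithCorners.contDiffOn_extendCoordChange h h'
  rw [ModelWithCorners.extendCoordChange_source] at this
  simpa using this

theorem mdifferentiable_of_mem (h : ψ ∈ IsManifold.maximalAtlas 𝓘(ℝ, E) ∞ M) :
    ψ.MDifferentiable 𝓘(ℝ, E) 𝓘(ℝ, E) :=
  ⟨(contMDiffOn_of_mem_maximalAtlas h).mdifferentiableOn (by simp),
    (contMDiffOn_symm_of_mem_maximalAtlas h).mdifferentiableOn (by simp)⟩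

theorem dchart_bijective (h : ψ ∈ IsManifold.maximalAtlas 𝓘(ℝ, E) ∞ M) {x : M}
    (hx : x ∈ ψ.source) : Function.Bijective (dchart ψ x) :=
  (mdifferentiable_of_mem h).mfderiv_bijective hx

theorem dchart_inverse_apply (h : ψ ∈ IsManifold.maximalAtlas 𝓘(ℝ, E) ∞ M) {x : M}
    (hx : x ∈ ψ.source) (w : TangentSpace 𝓘(ℝ, E) x) :
    (dchart ψ x).inverse (dchart ψ x w) = w := by
  let L : TangentSpace 𝓘(ℝ, E) x ≃L[ℝ] E := (mdifferentiable_of_mem h).mfderiv hx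
  have : dchart ψ x = (L : TangentSpace 𝓘(ℝ, E) x →L[ℝ] E) := by ext; rfl
  rw [this, ContinuousLinearMap.inverse_equiv]
  exact L.symm_apply_apply w

theorem dchart_apply_inverse (h : ψ ∈ IsManifold.maximalAtlas 𝓘(ℝ, E) ∞ M) {x : M}
    (hx : x ∈ ψ.source) (w : E) : dchart ψ x ((dchart ψ x).inverse w) = w := by
  obtain ⟨v, rfl⟩ := (dchart_bijective h hx).2 w
  rw [dchart_inverse_apply h hx]

theorem dchart_eq_fderiv (h : ψ ∈ IsManifold.maximalAtlas 𝓘(ℝ, E) ∞ M)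
    (h' : ψ' ∈ IsManifold.maximalAtlas 𝓘(ℝ, E) ∞ M) {x : M}
    (hx : x ∈ ψ.source) (hx' : x ∈ ψ'.source) (w : TangentSpace 𝓘(ℝ, E) x) :
    dchart ψ' x w = fderiv ℝ (ψ' ∘ ψ.symm) (ψ x) (dchart ψ x w) := by
  have hsrc : ψ x ∈ (ψ.symm.trans ψ').source := by simp [hx, hx']
  have hd : DifferentiableAt ℝ (ψ' ∘ ψ.symm) (ψ x) :=
    ((contDiffOn_transition h h' _ hsrc).contDiffAt
      ((ψ.symm.trans ψ').open_source.mem_nhds hsrc)).differentiableAt (by simp)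
  have h1 : (ψ' : M → E) =ᶠ[𝓝 x] (ψ' ∘ ψ.symm) ∘ ψ := by
    filter_upwards [ψ.open_source.mem_nhds hx] with y hy using by simp [hy]
  have h2 := mfderiv_comp x hd.mdifferentiableAt ((mdifferentiable_of_mem h).mdifferentiableAt hx)
  unfold dchart
  rw [h1.mfderiv_eq, h2, mfderiv_eq_fderiv]
  rfl

end Charts

section Deformation

variable {E' V E M : Type*} [NormedAddCommGroup E'] [NormedSpace ℝ E'] [TopologicalSpace V]
  [ChartedSpace E' V] [NormedAddCommGroup E] [NormedSpace ℝ E] [TopologicalSpace M]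
  [ChartedSpace E M]

/-- A smooth embedding of `V` into `M`; its image is an embedded submanifold of `M`, identified
with `V`. -/
structure SmoothEmbedding (E' V E M : Type*) [NormedAddCommGroup E'] [NormedSpace ℝ E']
    [TopologicalSpace V] [ChartedSpace E' V] [NormedAddCommGroup E] [NormedSpace ℝ E]
    [TopologicalSpace M] [ChartedSpace E M] where
  toFun : V → M
  isSmoothEmbedding : Manifold.IsSmoothEmbedding 𝓘(ℝ, E') 𝓘(ℝ, E) ∞ toFun

instance : CoeFun (SmoothEmbedding E' V E M) (fun _ ↦ V → M) := ⟨SmoothEmbedding.toFun⟩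

/-- The fibre `T_v M / T_v V` of the normal bundle. -/
abbrev SmoothEmbedding.NormalSpace (i : SmoothEmbedding E' V E M) (v : V) : Type _ :=
  TangentSpace 𝓘(ℝ, E) (i v) ⧸ LinearMap.range (mfderiv 𝓘(ℝ, E') 𝓘(ℝ, E) i v).toLinearMap

/-- The total space of the normal bundle. -/
structure NormalBundle (i : SmoothEmbedding E' V E M) where
  base : V
  vec : i.NormalSpace base

/-- The class in the normal bundle of a tangent vector at a point of the submanifold. -/
noncomputable def NormalBundle.mk' (i : SmoothEmbedding E' V E M) (v : V)
    (w : TangentSpace 𝓘(ℝ, E) (i v)) :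
    NormalBundle i := ⟨v, Submodule.Quotient.mk w⟩

/-- The deformation to the normal cone `DNC(M, V) = (M × ℝ*) ⊔ (N × {0})`, where `N` is the normal
bundle of `V` in `M`: `gen x t ht` is `(x, t)` with `t ≠ 0`, and `nor n` is `(n, 0)`. -/
inductive DNC (i : SmoothEmbedding E' V E M) where
  | gen (x : M) (t : ℝ) (ht : t ≠ 0) : DNC i
  | nor (n : NormalBundle i) : DNC i

/-- A chart `ψ` of `M`, with a linear projection `P` of the model space, in which the submanifold is
the slice `P ψ = 0`. The image of `P` is a model for the normal spaces. -/
structure AdaptedChart (i : SmoothEmbedding E' V E M) where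
  ψ : OpenPartialHomeomorph M E
  mem : ψ ∈ IsManifold.maximalAtlas 𝓘(ℝ, E) ∞ M
  P : E →L[ℝ] E
  idem : ∀ e, P (P e) = P e
  finrank_ker : Module.finrank ℝ P.ker = Module.finrank ℝ E'
  slice : ∀ x ∈ ψ.source, x ∈ range i ↔ P (ψ x) = 0

theorem SmoothEmbedding.injective (i : SmoothEmbedding E' V E M) : Function.Injective i :=
  i.isSmoothEmbedding.isEmbedding.injective

theorem SmoothEmbedding.mdifferentiableAt (i : SmoothEmbedding E' V E M) (v : V) :
    MDifferentiableAt 𝓘(ℝ, E') 𝓘(ℝ, E) i v :=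
  (i.isSmoothEmbedding.isImmersion.contMDiff v).mdifferentiableAt (by simp)

theorem SmoothEmbedding.mfderiv_injective (i : SmoothEmbedding E' V E M) (v : V) :
    Function.Injective (mfderiv 𝓘(ℝ, E') 𝓘(ℝ, E) i v) := by
  obtain ⟨F, _, _, hF⟩ := i.isSmoothEmbedding.isImmersion
  have h := hF v
  have h1 := h.mem_domChart_source
  have h2 := h.mem_codChart_source
  have heq : (h.codChart ∘ i : V → E) =ᶠ[𝓝 v] (fun e ↦ h.equiv (e, 0)) ∘ h.domChart := by
    filter_upwards [h.domChart.open_source.mem_nhds h1] with w hw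
    have := h.writtenInCharts (show h.domChart w ∈ (h.domChart.extend 𝓘(ℝ, E')).target by
      simpa using h.domChart.map_source hw)
    simpa [hw] using this
  have hl : DifferentiableAt ℝ (fun e : E' ↦ h.equiv (e, 0)) (h.domChart v) := by fun_prop
  have e1 := mfderiv_comp v
    ((mdifferentiable_of_mem h.codChart_mem_maximalAtlas).mdifferentiableAt h2)
    (i.mdifferentiableAt v)
  have e2 := mfderiv_comp v hl.mdifferentiableAt
    ((mdifferentiable_of_mem h.domChart_mem_maximalAtlas).mdifferentiableAt h1)
  rw [heq.mfderiv_eq, e2, mfderiv_eq_fderiv] at e1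
  have hfd : fderiv ℝ (fun e : E' ↦ h.equiv (e, 0)) (h.domChart v)
      = (h.equiv : (E' × F) →L[ℝ] E).comp (ContinuousLinearMap.inl ℝ E' F) :=
    ContinuousLinearMap.fderiv (𝕜 := ℝ)
      ((h.equiv : (E' × F) →L[ℝ] E).comp (ContinuousLinearMap.inl ℝ E' F))
  intro a b hab
  apply (dchart_bijective h.domChart_mem_maximalAtlas h1).1
  have h3 : ∀ a, (h.equiv : (E' × F) →L[ℝ] E) (dchart h.domChart v a, 0)
      = dchart h.codChart (i v) (mfderiv 𝓘(ℝ, E') 𝓘(ℝ, E) i v a) := by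
    intro a
    have := DFunLike.congr_fun e1 a
    rw [hfd] at this
    exact this
  have h4 := (h3 a).trans ((congrArg _ hab).trans (h3 b).symm)
  simpa using h4

theorem exists_adaptedChart [FiniteDimensional ℝ E] (i : SmoothEmbedding E' V E M) (v : V) :
    ∃ A : AdaptedChart i, i v ∈ A.ψ.source := by
  obtain ⟨F, _, _, hF⟩ := i.isSmoothEmbedding.isImmersion
  have h := hF v
  have hemb := i.isSmoothEmbedding.isEmbedding
  obtain ⟨W, hW, hWφ⟩ := hemb.isInducing.isOpen_iff.1 h.domChart.open_source
  set ψ := h.codChart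
  set φ := h.domChart
  have hslice : ∀ w ∈ φ.source, ψ (i w) = h.equiv (φ w, 0) := by
    intro w hw
    have := h.writtenInCharts (show φ w ∈ (φ.extend 𝓘(ℝ, E')).target by
      simpa using φ.map_source hw)
    have e : h.domChart.symm (φ w) = w := φ.left_inv hw
    simpa [e] using this
  have hO : IsOpen (W ∩ (ψ.source ∩ ψ ⁻¹' ((fun e ↦ (h.equiv.symm e).1) ⁻¹' φ.target))) :=
    hW.inter (ψ.isOpen_inter_preimage (φ.open_target.preimage (by fun_prop)))
  set O := W ∩ (ψ.source ∩ ψ ⁻¹' ((fun e ↦ (h.equiv.symm e).1) ⁻¹' φ.target))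
  let P : E →L[ℝ] E := (h.equiv : (E' × F) →L[ℝ] E).comp
    (((0 : (E' × F) →L[ℝ] E').prod (ContinuousLinearMap.snd ℝ E' F)).comp
      (h.equiv.symm : E →L[ℝ] E' × F))
  have hP : ∀ e, P e = h.equiv (0, (h.equiv.symm e).2) := fun e ↦ rfl
  have hP0 : ∀ e, P e = 0 ↔ (h.equiv.symm e).2 = 0 := fun e ↦ by
    rw [hP, map_eq_zero_iff _ h.equiv.injective]; simp
  have hsrc : ∀ x, x ∈ (ψ.restr O).source ↔ x ∈ O := fun x ↦ by
    rw [ψ.restr_source, hO.interior_eq]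
    exact ⟨fun h ↦ h.2, fun h ↦ ⟨h.2.1, h⟩⟩
  refine ⟨⟨ψ.restr O, restr_mem_maximalAtlas _ h.codChart_mem_maximalAtlas hO, P,
    fun e ↦ by simp [hP], ?_, ?_⟩, ?_⟩
  · let L : E' →ₗ[ℝ] E := h.equiv.toLinearEquiv.toLinearMap.comp (LinearMap.inl ℝ E' F)
    have hL : Function.Injective L := fun a b hab ↦ by
      have := h.equiv.injective hab
      simpa using this
    have hker : P.ker = LinearMap.range L := by
      ext e
      constructor
      · intro he
        have he' := (hP0 e).1 he
        refine ⟨(h.equiv.symm e).1, ?_⟩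
        have : (((h.equiv.symm e).1, 0) : E' × F) = h.equiv.symm e := by rw [← he']
        show h.equiv ((h.equiv.symm e).1, 0) = e
        rw [this]; simp
      · rintro ⟨a, rfl⟩
        refine (hP0 _).2 ?_
        show (h.equiv.symm (h.equiv (a, 0))).2 = 0
        simp
    rw [hker]
    exact LinearMap.finrank_range_of_inj hL
  · intro x hx
    rw [hsrc] at hx
    obtain ⟨hxW, hxψ, hxφ⟩ := hx
    show x ∈ range i ↔ P (ψ x) = 0
    rw [hP0]
    constructor
    · rintro ⟨w, rfl⟩
      have hw : w ∈ φ.source := hWφ ▸ hxW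
      rw [hslice w hw]; simp
    · intro h0
      refine ⟨φ.symm (h.equiv.symm (ψ x)).1, ?_⟩
      have hw : φ.symm (h.equiv.symm (ψ x)).1 ∈ φ.source := φ.map_target hxφ
      apply ψ.injOn (h.source_subset_preimage_source hw) hxψ
      rw [hslice _ hw, φ.right_inv hxφ]
      have : (((h.equiv.symm (ψ x)).1, 0) : E' × F) = h.equiv.symm (ψ x) := by rw [← h0]
      rw [this]; simp
  · show i v ∈ (ψ.restr O).source
    rw [hsrc]
    have hv : v ∈ φ.source := h.mem_domChart_source
    have hv' : v ∈ i ⁻¹' W := by rw [hWφ]; exact hv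
    refine ⟨hv', h.mem_codChart_source, ?_⟩
    show (h.equiv.symm (ψ (i v))).1 ∈ φ.target
    rw [hslice v hv]
    simpa using φ.map_source hv

namespace AdaptedChart

variable {i : SmoothEmbedding E' V E M} (A : AdaptedChart i)

theorem proj_dchart_eq_zero [FiniteDimensional ℝ E] {v : V} (hv : i v ∈ A.ψ.source)
    (w : TangentSpace 𝓘(ℝ, E) (i v)) :
    A.P (dchart A.ψ (i v) w) = 0 ↔
      w ∈ LinearMap.range (mfderiv 𝓘(ℝ, E') 𝓘(ℝ, E) i v).toLinearMap := by
  let L : E' →ₗ[ℝ] E :=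
    ((dchart A.ψ (i v)).comp (mfderiv 𝓘(ℝ, E') 𝓘(ℝ, E) i v)).toLinearMap
  have hLinj : Function.Injective L :=
    (dchart_bijective A.mem hv).1.comp (i.mfderiv_injective v)
  have hle : LinearMap.range L ≤ A.P.ker := by
    rintro _ ⟨a, rfl⟩
    have h0 : (A.P ∘ (A.ψ ∘ i) : V → E) =ᶠ[𝓝 v] fun _ ↦ 0 := by
      have := (i.mdifferentiableAt v).continuousAt.preimage_mem_nhds (A.ψ.open_source.mem_nhds hv)
      filter_upwards [this] with w hw using (A.slice _ hw).1 ⟨w, rfl⟩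
    have e1 := mfderiv_comp v
      ((mdifferentiable_of_mem A.mem).mdifferentiableAt hv) (i.mdifferentiableAt v)
    have e2 := mfderiv_comp v (A.P.differentiableAt (x := A.ψ (i v))).mdifferentiableAt
      (((mdifferentiable_of_mem A.mem).mdifferentiableAt hv).comp v (i.mdifferentiableAt v))
    rw [h0.mfderiv_eq, mfderiv_const, e1, mfderiv_eq_fderiv] at e2
    have := DFunLike.congr_fun e2 a
    erw [ContinuousLinearMap.fderiv] at this
    exact this.symm
  have heq : LinearMap.range L = A.P.ker :=
    Submodule.eq_of_le_of_finrank_eq hle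
      ((LinearMap.finrank_range_of_inj hLinj).trans A.finrank_ker.symm)
  have : A.P (dchart A.ψ (i v) w) = 0 ↔ dchart A.ψ (i v) w ∈ LinearMap.range L := by
    rw [heq]; rfl
  rw [this]
  constructor
  · rintro ⟨a, ha⟩
    exact ⟨a, (dchart_bijective A.mem hv).1 ha⟩
  · rintro ⟨a, rfl⟩
    exact ⟨a, rfl⟩

/-- The coordinate `ψ(v) + P dψ(ξ)` of a normal vector `ξ` at `v`. -/
noncomputable def coord (n : NormalBundle i) : E :=
  A.ψ (i n.base) + A.P (dchart A.ψ (i n.base)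
    (Function.surjInv (Submodule.Quotient.mk_surjective _) n.vec))

/-- The normal vector with coordinate `e`, at the point of coordinate `e - P e`. -/
noncomputable def lift (e : E) (h : ∃ v, i v = A.ψ.symm (e - A.P e)) : NormalBundle i :=
  .mk' i h.choose ((dchart A.ψ (i h.choose)).inverse (A.P e))

/-- The linear map `(1 - P) + tP`. -/
def scale (t : ℝ) (e : E) : E := e - A.P e + t • A.P e

@[simp] theorem proj_scale (t : ℝ) (e : E) : A.P (A.scale t e) = t • A.P e := by
  simp [scale, A.idem]

theorem scale_scale (s t : ℝ) (e : E) : A.scale s (A.scale t e) = A.scale (s * t) e := by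
  simp [scale, A.idem, mul_smul]

@[simp] theorem scale_one (e : E) : A.scale 1 e = e := by simp [scale]

@[simp] theorem scale_zero (e : E) : A.scale 0 e = e - A.P e := by simp [scale]

theorem contDiff_scale : ContDiff ℝ ∞ (fun p : E × ℝ ↦ A.scale p.2 p.1) := by
  unfold scale; fun_prop

theorem coord_mk [FiniteDimensional ℝ E] {v : V} (hv : i v ∈ A.ψ.source) (w : TangentSpace 𝓘(ℝ, E) (i v)) :
    A.coord (.mk' i v w) = A.ψ (i v) + A.P (dchart A.ψ (i v) w) := by
  unfold coord
  congr 1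
  show A.P (dchart A.ψ (i v) (Function.surjInv _ (Submodule.Quotient.mk w))) = _
  rw [← sub_eq_zero, ← map_sub, ← map_sub, A.proj_dchart_eq_zero hv,
    ← Submodule.Quotient.eq]
  exact Function.surjInv_eq (Submodule.Quotient.mk_surjective _) _

theorem proj_coord {n : NormalBundle i} (hn : i n.base ∈ A.ψ.source) :
    A.coord n - A.P (A.coord n) = A.ψ (i n.base) := by
  have : A.P (A.ψ (i n.base)) = 0 := (A.slice _ hn).1 ⟨_, rfl⟩
  simp [coord, A.idem, this]

theorem exists_base {e : E} (he : e - A.P e ∈ A.ψ.target) : ∃ v, i v = A.ψ.symm (e - A.P e) := by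
  apply (A.slice _ (A.ψ.map_target he)).2
  rw [A.ψ.right_inv he]; simp [A.idem]

theorem lift_base {e : E} (h : ∃ v, i v = A.ψ.symm (e - A.P e)) :
    i (A.lift e h).base = A.ψ.symm (e - A.P e) := h.choose_spec

theorem lift_base_mem {e : E} (he : e - A.P e ∈ A.ψ.target) :
    i (A.lift e (A.exists_base he)).base ∈ A.ψ.source := by
  rw [lift_base]; exact A.ψ.map_target he

theorem coord_lift [FiniteDimensional ℝ E] {e : E} (he : e - A.P e ∈ A.ψ.target) :
    A.coord (A.lift e (A.exists_base he)) = e := by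
  have h1 := A.lift_base_mem he
  have h2 := A.lift_base (A.exists_base he)
  have h3 : i (A.exists_base he).choose ∈ A.ψ.source := h1
  have h4 : i (A.exists_base he).choose = A.ψ.symm (e - A.P e) := h2
  unfold lift
  rw [A.coord_mk h3, dchart_apply_inverse A.mem h3, A.idem, h4, A.ψ.right_inv he]
  simp

theorem coord_mem {n : NormalBundle i} (hn : i n.base ∈ A.ψ.source) :
    A.coord n - A.P (A.coord n) ∈ A.ψ.target := by
  rw [A.proj_coord hn]; exact A.ψ.map_source hn

theorem coord_injOn [FiniteDimensional ℝ E] {n n' : NormalBundle i} (hn : i n.base ∈ A.ψ.source)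
    (hn' : i n'.base ∈ A.ψ.source) (h : A.coord n = A.coord n') : n = n' := by
  have hb : n.base = n'.base := by
    apply i.injective
    apply A.ψ.injOn hn hn'
    rw [← A.proj_coord hn, ← A.proj_coord hn', h]
  obtain ⟨v, ξ⟩ := n
  obtain ⟨v', ξ'⟩ := n'
  obtain rfl : v = v' := hb
  obtain ⟨w, rfl⟩ := Submodule.Quotient.mk_surjective _ ξ
  obtain ⟨w', rfl⟩ := Submodule.Quotient.mk_surjective _ ξ'
  have e1 := A.coord_mk hn w
  have e2 := A.coord_mk hn w'
  unfold NormalBundle.mk' at e1 e2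
  rw [e1, e2, add_right_inj, ← sub_eq_zero, ← map_sub, ← map_sub,
    A.proj_dchart_eq_zero hn, ← Submodule.Quotient.eq] at h
  rw [h]

theorem lift_coord [FiniteDimensional ℝ E] {n : NormalBundle i} (hn : i n.base ∈ A.ψ.source)
    (h : ∃ v, i v = A.ψ.symm (A.coord n - A.P (A.coord n))) : A.lift (A.coord n) h = n :=
  A.coord_injOn (A.lift_base_mem (A.coord_mem hn)) hn (A.coord_lift (A.coord_mem hn))

/-- Change of coordinates for normal vectors. -/
theorem coord_eq [FiniteDimensional ℝ E] (A' : AdaptedChart i) {n : NormalBundle i} (hn : i n.base ∈ A.ψ.source)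
    (hn' : i n.base ∈ A'.ψ.source) :
    A'.coord n = (A'.ψ ∘ A.ψ.symm) (A.coord n - A.P (A.coord n)) +
      A'.P (fderiv ℝ (A'.ψ ∘ A.ψ.symm) (A.coord n - A.P (A.coord n)) (A.P (A.coord n))) := by
  obtain ⟨v, ξ⟩ := n
  obtain ⟨w, rfl⟩ := Submodule.Quotient.mk_surjective _ ξ
  have hP : A.P (A.ψ (i v)) = 0 := (A.slice _ hn).1 ⟨_, rfl⟩
  have key : A'.P (dchart A'.ψ (i v)
      ((dchart A.ψ (i v)).inverse (A.P (dchart A.ψ (i v) w)))) = A'.P (dchart A'.ψ (i v) w) := by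
    rw [← sub_eq_zero, ← map_sub, ← map_sub, A'.proj_dchart_eq_zero hn',
      ← A.proj_dchart_eq_zero hn, map_sub, dchart_apply_inverse A.mem hn, map_sub, A.idem, sub_self]
  have e1 := A.coord_mk hn w
  have e2 := A'.coord_mk hn' w
  rw [A.proj_coord hn]
  unfold NormalBundle.mk' at e1 e2
  rw [e1, e2, map_add, hP, zero_add, A.idem, ← key,
    dchart_eq_fderiv A.mem A'.mem hn hn', dchart_apply_inverse A.mem hn]
  simp only [Function.comp_apply]
  rw [A.ψ.left_inv hn]

/-- The chart of the normal bundle given by an adapted chart (`n₀` is a junk value). -/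
noncomputable def normalChart [FiniteDimensional ℝ E] (n₀ : NormalBundle i) : PartialEquiv (NormalBundle i) E := by
  classical exact
  { toFun := A.coord
    invFun := fun e ↦ if h : ∃ v, i v = A.ψ.symm (e - A.P e) then A.lift e h else n₀
    source := {n | i n.base ∈ A.ψ.source}
    target := {e | e - A.P e ∈ A.ψ.target}
    map_source' := fun _ hn ↦ A.coord_mem hn
    map_target' := fun e he ↦ by
      rw [dif_pos (A.exists_base he)]; exact A.lift_base_mem he
    left_inv' := fun n hn ↦ by
      rw [dif_pos (A.exists_base (A.coord_mem hn))]; exact A.lift_coord hn _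
    right_inv' := fun e he ↦ by
      rw [dif_pos (A.exists_base he)]; exact A.coord_lift he }

/-- The chart of the deformation space given by an adapted chart `(ψ, P)`: it is
`(x, t) ↦ (ψ(x) - Pψ(x) + t⁻¹ Pψ(x), t)` for `t ≠ 0` and `(v, ξ) ↦ (ψ(v) + P dψ(ξ), 0)` on the
normal bundle. -/
noncomputable def dncChart [FiniteDimensional ℝ E] : PartialEquiv (DNC i) (E × ℝ) := by
  classical exact
  { toFun := fun p ↦ match p with
      | .gen x t _ => (A.scale t⁻¹ (A.ψ x), t)
      | .nor n => (A.coord n, 0)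
    invFun := fun q ↦
      if ht : q.2 = 0 then
        if h : ∃ v, i v = A.ψ.symm (q.1 - A.P q.1) then .nor (A.lift q.1 h)
        else .gen (A.ψ.symm q.1) 1 one_ne_zero
      else .gen (A.ψ.symm (A.scale q.2 q.1)) q.2 ht
    source := {p | match p with
      | .gen x _ _ => x ∈ A.ψ.source
      | .nor n => i n.base ∈ A.ψ.source}
    target := {q | A.scale q.2 q.1 ∈ A.ψ.target}
    map_source' := fun p hp ↦ by
      match p, hp with
      | .gen x t ht, hp =>
        simp only [mem_ofPred_eq] at hp ⊢
        rw [A.scale_scale, mul_inv_cancel₀ ht, A.scale_one]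
        exact A.ψ.map_source hp
      | .nor n, hp => simpa using A.coord_mem hp
    map_target' := fun q hq ↦ by
      by_cases ht : q.2 = 0
      · simp only [mem_ofPred_eq, ht, scale_zero] at hq
        rw [dif_pos ht, dif_pos (A.exists_base hq)]
        exact A.lift_base_mem hq
      · rw [dif_neg ht]
        exact A.ψ.map_target hq
    left_inv' := fun p hp ↦ by
      match p, hp with
      | .gen x t ht, hp =>
        simp only [ht, dif_neg, not_false_eq_true]
        congr 1
        rw [A.scale_scale, mul_inv_cancel₀ ht, A.scale_one]
        exact A.ψ.left_inv hp
      | .nor n, hp =>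
        simp only [dif_pos, dif_pos (A.exists_base (A.coord_mem hp))]
        congr 1
        exact A.lift_coord hp _
    right_inv' := fun q hq ↦ by
      obtain ⟨e, t⟩ := q
      by_cases ht : t = 0
      · subst ht
        simp only [mem_ofPred_eq, scale_zero] at hq
        simp only [dif_pos, dif_pos (A.exists_base hq), A.coord_lift hq]
      · simp only [ht, dif_neg, not_false_eq_true, A.ψ.right_inv hq, A.scale_scale,
          inv_mul_cancel₀ ht, A.scale_one] }

theorem proj_transition_eq_zero (A' : AdaptedChart i) {e : E}
    (he : e - A.P e ∈ (A.ψ.symm.trans A'.ψ).source) :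
    A'.P ((A'.ψ ∘ A.ψ.symm) (e - A.P e)) = 0 := by
  simp only [OpenPartialHomeomorph.trans_source, OpenPartialHomeomorph.symm_source, mem_inter_iff,
    mem_preimage] at he
  exact (A'.slice _ he.2).1 (A.exists_base he.1)

variable [FiniteDimensional ℝ E]

theorem normalChart_transition_source (A' : AdaptedChart i) (n₀ n₀' : NormalBundle i) :
    ((A.normalChart n₀).symm.trans (A'.normalChart n₀')).source =
      (fun e ↦ e - A.P e) ⁻¹' (A.ψ.symm.trans A'.ψ).source := by
  ext e
  simp only [PartialEquiv.trans_source, PartialEquiv.symm_source, mem_inter_iff, mem_preimage,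
    OpenPartialHomeomorph.trans_source, OpenPartialHomeomorph.symm_source]
  refine and_congr_right fun he ↦ ?_
  have he' : e - A.P e ∈ A.ψ.target := he
  have : (A.normalChart n₀).symm e = A.lift e (A.exists_base he') := dif_pos (A.exists_base he')
  rw [this]
  show i _ ∈ A'.ψ.source ↔ _
  rw [A.lift_base]

theorem normalChart_transition_contDiffOn (A' : AdaptedChart i) (n₀ n₀' : NormalBundle i) :
    ContDiffOn ℝ ∞ ((A.normalChart n₀).symm.trans (A'.normalChart n₀'))
      ((A.normalChart n₀).symm.trans (A'.normalChart n₀')).source := by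
  rw [normalChart_transition_source]
  have hτ := contDiffOn_transition A.mem A'.mem
  have hl : ContDiffOn ℝ ∞ (fun e ↦ e - A.P e)
      ((fun e ↦ e - A.P e) ⁻¹' (A.ψ.symm.trans A'.ψ).source) := by fun_prop
  have h1 := hτ.comp hl (mapsTo_preimage _ _)
  have h2 := (hτ.fderiv_of_isOpen (A.ψ.symm.trans A'.ψ).open_source (m := ∞) (by simp)).comp
    hl (mapsTo_preimage _ _)
  have h3 := h1.add (A'.P.contDiff.comp_contDiffOn
    (h2.clm_apply (A.P.contDiff.contDiffOn (n := ∞))))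
  refine h3.congr fun e he ↦ ?_
  simp only [mem_preimage, OpenPartialHomeomorph.trans_source,
    OpenPartialHomeomorph.symm_source, mem_inter_iff] at he
  have hb := A.lift_base_mem he.1
  have hb' : i (A.lift e (A.exists_base he.1)).base ∈ A'.ψ.source := by
    rw [A.lift_base]; exact he.2
  have : (A.normalChart n₀).symm e = A.lift e (A.exists_base he.1) :=
    dif_pos (A.exists_base he.1)
  rw [PartialEquiv.coe_trans, Function.comp_apply, this]
  have := A.coord_eq A' hb hb'
  rw [A.coord_lift he.1] at this
  exact this

theorem dncChart_symm_zero {e : E} (he : e - A.P e ∈ A.ψ.target) :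
    A.dncChart.symm (e, 0) = .nor (A.lift e (A.exists_base he)) := by
  show dite _ _ _ = _
  rw [dif_pos rfl, dif_pos (A.exists_base he)]

theorem dncChart_symm_ne {e : E} {t : ℝ} (ht : t ≠ 0) :
    A.dncChart.symm (e, t) = .gen (A.ψ.symm (A.scale t e)) t ht := by
  show dite _ _ _ = _
  rw [dif_neg ht]

theorem dncChart_transition_source (A' : AdaptedChart i) :
    (A.dncChart.symm.trans A'.dncChart).source =
      (fun q : E × ℝ ↦ A.scale q.2 q.1) ⁻¹' (A.ψ.symm.trans A'.ψ).source := by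
  ext ⟨e, t⟩
  simp only [PartialEquiv.trans_source, PartialEquiv.symm_source, mem_inter_iff, mem_preimage,
    OpenPartialHomeomorph.trans_source, OpenPartialHomeomorph.symm_source]
  refine and_congr_right fun he ↦ ?_
  by_cases ht : t = 0
  · subst ht
    have he' : e - A.P e ∈ A.ψ.target := by simpa using (show A.scale 0 e ∈ A.ψ.target from he)
    rw [A.dncChart_symm_zero he']
    show i _ ∈ A'.ψ.source ↔ _
    rw [A.lift_base, A.scale_zero]
  · rw [A.dncChart_symm_ne ht]
    rfl

theorem dncChart_transition_contDiffOn (A' : AdaptedChart i) :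
    ContDiffOn ℝ ∞ (A.dncChart.symm.trans A'.dncChart)
      (A.dncChart.symm.trans A'.dncChart).source := by
  rw [dncChart_transition_source]
  set T := (A.ψ.symm.trans A'.ψ).source
  have hT : IsOpen T := (A.ψ.symm.trans A'.ψ).open_source
  set Ω := (fun q : E × ℝ ↦ A.scale q.2 q.1) ⁻¹' T
  have hΩ : IsOpen Ω := hT.preimage A.contDiff_scale.continuous
  have hτ := contDiffOn_transition A.mem A'.mem
  set τ := A'.ψ ∘ A.ψ.symm with hτdef
  have h1 : ContDiffOn ℝ ∞ (fun q : E × ℝ ↦ τ (A.scale q.2 q.1)) Ω :=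
    hτ.comp A.contDiff_scale.contDiffOn (mapsTo_preimage _ _)
  have hk : ContDiffOn ℝ ∞ (fun q : E × ℝ ↦ A'.P (τ (A.scale q.2 q.1))) Ω :=
    A'.P.contDiff.comp_contDiffOn h1
  have hK := contDiffOn_smoothQuotient hΩ hk fun e he ↦ by
    have he' : A.scale 0 e ∈ T := he
    simp only [A.scale_zero] at he' ⊢
    exact A.proj_transition_eq_zero A' he'
  refine (((h1.sub hk).add hK).prodMk contDiffOn_snd).congr ?_
  rintro ⟨e, t⟩ he
  have he0 : A.scale t e ∈ T := he
  rw [PartialEquiv.coe_trans, Function.comp_apply]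
  by_cases ht : t = 0
  · subst ht
    have he1 := he0
    rw [A.scale_zero] at he1
    have he2 : e - A.P e ∈ A.ψ.target ∧ A.ψ.symm (e - A.P e) ∈ A'.ψ.source := by
      simpa [T] using he1
    have hb := A.lift_base_mem he2.1
    have hb' : i (A.lift e (A.exists_base he2.1)).base ∈ A'.ψ.source := by
      rw [A.lift_base]; exact he2.2
    have hc := A.coord_eq A' hb hb'
    rw [A.coord_lift he2.1] at hc
    rw [A.dncChart_symm_zero he2.1]
    show (A'.coord _, (0 : ℝ)) = _
    have hd : fderiv ℝ (fun q : E × ℝ ↦ A'.P (τ (A.scale q.2 q.1))) (e, 0) (0, 1) =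
        A'.P (fderiv ℝ τ (e - A.P e) (A.P e)) := by
      have d1 : HasFDerivAt τ (fderiv ℝ τ (A.scale 0 e)) (A.scale 0 e) :=
        (((hτ _ he0).contDiffAt (hT.mem_nhds he0)).differentiableAt (by simp)).hasFDerivAt
      have d2 : HasFDerivAt (fun q : E × ℝ ↦ A.scale q.2 q.1)
          (fderiv ℝ (fun q : E × ℝ ↦ A.scale q.2 q.1) (e, 0)) (e, 0) :=
        (A.contDiff_scale.differentiable (by simp) _).hasFDerivAt
      have d3 : fderiv ℝ (fun q : E × ℝ ↦ A.scale q.2 q.1) (e, 0) (0, 1) = A.P e := by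
        have l1 : HasDerivAt (fun t : ℝ ↦ A.scale t e) (A.P e) 0 := by
          unfold scale
          simpa using ((hasDerivAt_id (0 : ℝ)).smul_const (A.P e)).const_add (e - A.P e)
        have l2 : HasDerivAt (fun t : ℝ ↦ (e, t)) ((0 : E), (1 : ℝ)) 0 :=
          (hasDerivAt_const _ _).prodMk (hasDerivAt_id _)
        exact (d2.comp_hasDerivAt (0 : ℝ) l2).unique l1
      have d4 : HasFDerivAt (fun q : E × ℝ ↦ A'.P (τ (A.scale q.2 q.1))) _ (e, 0) :=
        A'.P.hasFDerivAt.comp (e, 0)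
          (HasFDerivAt.comp (f := fun q : E × ℝ ↦ A.scale q.2 q.1) (e, 0) d1 d2)
      rw [d4.fderiv]
      simp [d3]
    have hz := A.proj_transition_eq_zero A' he1
    simp only [if_true, hd, hc, A.scale_zero, ← hτdef] at hz ⊢
    simp [hz]
  · rw [A.dncChart_symm_ne ht]
    show (A'.scale t⁻¹ (A'.ψ _), t) = _
    simp [ht, scale, τ]

end AdaptedChart

/-- The chart `(x, t) ↦ (ψ(x), t)` of the part `t ≠ 0` of the deformation space. -/
noncomputable def DNC.genChart (i : SmoothEmbedding E' V E M) (ψ : OpenPartialHomeomorph M E) :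
    PartialEquiv (DNC i) (E × ℝ) := by
  classical exact
  { toFun := fun p ↦ match p with
      | .gen x t _ => (ψ x, t)
      | .nor _ => 0
    invFun := fun q ↦ if ht : q.2 = 0 then .gen (ψ.symm q.1) 1 one_ne_zero
      else .gen (ψ.symm q.1) q.2 ht
    source := {p | match p with
      | .gen x _ _ => x ∈ ψ.source
      | .nor _ => False}
    target := {q | q.1 ∈ ψ.target ∧ q.2 ≠ 0}
    map_source' := fun p hp ↦ by
      match p, hp with
      | .gen x t ht, hp => exact ⟨ψ.map_source hp, ht⟩
    map_target' := fun q hq ↦ by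
      rw [dif_neg hq.2]; exact ψ.map_target hq.1
    left_inv' := fun p hp ↦ by
      match p, hp with
      | .gen x t ht, hp =>
        simp only [ht, dif_neg, not_false_eq_true]
        congr 1
        exact ψ.left_inv hp
    right_inv' := fun q hq ↦ by
      rw [dif_neg hq.2]
      exact Prod.ext (ψ.right_inv hq.1) rfl }

namespace DNC

variable {i : SmoothEmbedding E' V E M} {ψ ψ' : OpenPartialHomeomorph M E}

theorem genChart_symm {e : E} {t : ℝ} (ht : t ≠ 0) :
    (genChart i ψ).symm (e, t) = .gen (ψ.symm e) t ht := dif_neg ht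

theorem genChart_trans_genChart_source :
    ((genChart i ψ).symm.trans (genChart i ψ')).source = (ψ.symm.trans ψ').source ×ˢ {0}ᶜ := by
  ext ⟨e, t⟩
  by_cases ht : t = 0
  · simp [genChart, ht]
  · simp only [PartialEquiv.trans_source, mem_inter_iff, mem_preimage, PartialEquiv.symm_source,
      genChart_symm ht]
    simp [genChart, ht]

theorem genChart_trans_genChart (hψ : ψ ∈ IsManifold.maximalAtlas 𝓘(ℝ, E) ∞ M)
    (hψ' : ψ' ∈ IsManifold.maximalAtlas 𝓘(ℝ, E) ∞ M) :
    ContDiffOn ℝ ∞ ((genChart i ψ).symm.trans (genChart i ψ'))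
      ((genChart i ψ).symm.trans (genChart i ψ')).source := by
  rw [genChart_trans_genChart_source]
  refine (((contDiffOn_transition hψ hψ').comp contDiffOn_fst fun q hq ↦ hq.1).prodMk
    contDiffOn_snd).congr ?_
  rintro ⟨e, t⟩ ⟨-, ht⟩
  rw [PartialEquiv.coe_trans, Function.comp_apply, genChart_symm ht]
  rfl

variable [FiniteDimensional ℝ E] (A : AdaptedChart i)

theorem genChart_trans_dncChart_source :
    ((genChart i ψ).symm.trans A.dncChart).source = (ψ.symm.trans A.ψ).source ×ˢ {0}ᶜ := by
  ext ⟨e, t⟩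
  by_cases ht : t = 0
  · simp [genChart, ht]
  · simp only [PartialEquiv.trans_source, mem_inter_iff, mem_preimage, PartialEquiv.symm_source,
      genChart_symm ht]
    simp [genChart, AdaptedChart.dncChart, ht]

theorem genChart_trans_dncChart (hψ : ψ ∈ IsManifold.maximalAtlas 𝓘(ℝ, E) ∞ M) :
    ContDiffOn ℝ ∞ ((genChart i ψ).symm.trans A.dncChart)
      ((genChart i ψ).symm.trans A.dncChart).source := by
  rw [genChart_trans_dncChart_source]
  have h1 : ContDiffOn ℝ ∞ (fun q : E × ℝ ↦ q.2⁻¹) ((ψ.symm.trans A.ψ).source ×ˢ {0}ᶜ) :=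
    contDiffOn_snd.inv fun q hq ↦ hq.2
  refine ((A.contDiff_scale.comp_contDiffOn (((contDiffOn_transition hψ A.mem).comp contDiffOn_fst
    fun q hq ↦ hq.1).prodMk h1)).prodMk contDiffOn_snd).congr ?_
  rintro ⟨e, t⟩ ⟨-, ht⟩
  rw [PartialEquiv.coe_trans, Function.comp_apply, genChart_symm ht]
  rfl

theorem dncChart_trans_genChart_source :
    (A.dncChart.symm.trans (genChart i ψ)).source =
      (fun q : E × ℝ ↦ A.scale q.2 q.1) ⁻¹' (A.ψ.symm.trans ψ).source ∩ {q | q.2 ≠ 0} := by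
  ext ⟨e, t⟩
  by_cases ht : t = 0
  · subst ht
    simp only [PartialEquiv.trans_source, mem_inter_iff, mem_preimage, PartialEquiv.symm_source]
    constructor
    · rintro ⟨he, h⟩
      have he' : e - A.P e ∈ A.ψ.target := by simpa using (show A.scale 0 e ∈ A.ψ.target from he)
      rw [A.dncChart_symm_zero he'] at h
      exact h.elim
    · rintro ⟨-, h⟩
      exact (h rfl).elim
  · simp only [PartialEquiv.trans_source, mem_inter_iff, mem_preimage, PartialEquiv.symm_source,
      A.dncChart_symm_ne ht]
    simp [genChart, AdaptedChart.dncChart, ht]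

theorem dncChart_trans_genChart (hψ : ψ ∈ IsManifold.maximalAtlas 𝓘(ℝ, E) ∞ M) :
    ContDiffOn ℝ ∞ (A.dncChart.symm.trans (genChart i ψ))
      (A.dncChart.symm.trans (genChart i ψ)).source := by
  rw [dncChart_trans_genChart_source]
  refine (((contDiffOn_transition A.mem hψ).comp A.contDiff_scale.contDiffOn
    fun q hq ↦ hq.1).prodMk contDiffOn_snd).congr ?_
  rintro ⟨e, t⟩ ⟨-, ht⟩
  rw [PartialEquiv.coe_trans, Function.comp_apply, A.dncChart_symm_ne ht]
  rfl

/-- The smooth atlas of the deformation to the normal cone: it consists of the charts of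
`M × ℝ*`, and of the charts deduced from the charts of `M` adapted to the submanifold. In an adapted
chart, with `e = (y, ξ)` and `y ∈ ker P`, `ξ ∈ im P`, the inverse chart sends `(y, ξ, t)` to
`(ψ⁻¹(y + tξ), t)` for `t ≠ 0`, and to the normal vector `ξ` at `ψ⁻¹(y)` for `t = 0`. -/
noncomputable def smoothAtlas [IsManifold 𝓘(ℝ, E) ∞ M] (i : SmoothEmbedding E' V E M) :
    SmoothAtlas (E × ℝ) (DNC i) where
  atlas := {e | (∃ ψ ∈ IsManifold.maximalAtlas 𝓘(ℝ, E) ∞ M, e = genChart i ψ) ∨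
    ∃ A : AdaptedChart i, e = A.dncChart}
  exists_chart p := by
    match p with
    | .gen x t ht =>
      exact ⟨_, .inl ⟨_, IsManifold.chart_mem_maximalAtlas x, rfl⟩, mem_chart_source E x⟩
    | .nor n =>
      obtain ⟨A, hA⟩ := exists_adaptedChart i n.base
      exact ⟨_, .inr ⟨A, rfl⟩, hA⟩
  open_source := by
    rintro _ (⟨ψ, hψ, rfl⟩ | ⟨A, rfl⟩) _ (⟨ψ', hψ', rfl⟩ | ⟨A', rfl⟩)
    · rw [genChart_trans_genChart_source]
      exact (ψ.symm.trans ψ').open_source.prod isOpen_compl_singleton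
    · rw [genChart_trans_dncChart_source]
      exact (ψ.symm.trans A'.ψ).open_source.prod isOpen_compl_singleton
    · rw [dncChart_trans_genChart_source]
      exact ((A.ψ.symm.trans ψ').open_source.preimage A.contDiff_scale.continuous).inter
        (isOpen_ne.preimage continuous_snd)
    · rw [A.dncChart_transition_source]
      exact (A.ψ.symm.trans A'.ψ).open_source.preimage A.contDiff_scale.continuous
  contDiffOn := by
    rintro _ (⟨ψ, hψ, rfl⟩ | ⟨A, rfl⟩) _ (⟨ψ', hψ', rfl⟩ | ⟨A', rfl⟩)
    · exact genChart_trans_genChart hψ hψ'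
    · exact genChart_trans_dncChart A' hψ
    · exact dncChart_trans_genChart A hψ'
    · exact A.dncChart_transition_contDiffOn A'

noncomputable instance [IsManifold 𝓘(ℝ, E) ∞ M] : TopologicalSpace (DNC i) :=
  (smoothAtlas i).topology

noncomputable instance [IsManifold 𝓘(ℝ, E) ∞ M] : ChartedSpace (E × ℝ) (DNC i) :=
  (smoothAtlas i).charts

instance [IsManifold 𝓘(ℝ, E) ∞ M] : IsManifold 𝓘(ℝ, E × ℝ) ∞ (DNC i) :=
  (smoothAtlas i).isManifold

end DNC

/-- The smooth atlas of the normal bundle. -/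
noncomputable def NormalBundle.smoothAtlas [FiniteDimensional ℝ E] (i : SmoothEmbedding E' V E M) :
    SmoothAtlas E (NormalBundle i) where
  atlas := {e | ∃ (A : AdaptedChart i) (n₀ : NormalBundle i), e = A.normalChart n₀}
  exists_chart n := by
    obtain ⟨A, hA⟩ := exists_adaptedChart i n.base
    exact ⟨_, ⟨A, n, rfl⟩, hA⟩
  open_source := by
    rintro _ ⟨A, n, rfl⟩ _ ⟨A', n', rfl⟩
    rw [A.normalChart_transition_source]
    exact (A.ψ.symm.trans A'.ψ).open_source.preimage (by fun_prop)
  contDiffOn := by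
    rintro _ ⟨A, n, rfl⟩ _ ⟨A', n', rfl⟩
    exact A.normalChart_transition_contDiffOn A' n n'

section

variable [FiniteDimensional ℝ E] {i : SmoothEmbedding E' V E M}

noncomputable instance : TopologicalSpace (NormalBundle i) := (NormalBundle.smoothAtlas i).topology

noncomputable instance : ChartedSpace E (NormalBundle i) := (NormalBundle.smoothAtlas i).charts

instance : IsManifold 𝓘(ℝ, E) ∞ (NormalBundle i) := (NormalBundle.smoothAtlas i).isManifold

end

end Deformation

/-- A Lie groupoid `G ⇉ G₀`. The product `mul a b` is meaningful only for composable pairs,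
that is, when `s a = r b`; its values on other pairs are irrelevant. The manifold `G` of arrows is
not required to be Hausdorff. -/
structure LieGroupoid (E E₀ G G₀ : Type*) [NormedAddCommGroup E] [NormedSpace ℝ E]
    [NormedAddCommGroup E₀] [NormedSpace ℝ E₀] [TopologicalSpace G] [ChartedSpace E G]
    [TopologicalSpace G₀] [ChartedSpace E₀ G₀] [IsManifold 𝓘(ℝ, E) ∞ G]
    [IsManifold 𝓘(ℝ, E₀) ∞ G₀] where
  s : G → G₀
  r : G → G₀
  u : G₀ → G
  inv : G → G
  mul : G → G → G
  s_u : ∀ x, s (u x) = x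
  r_u : ∀ x, r (u x) = x
  s_inv : ∀ a, s (inv a) = r a
  r_inv : ∀ a, r (inv a) = s a
  inv_inv : ∀ a, inv (inv a) = a
  s_mul : ∀ a b, s a = r b → s (mul a b) = s b
  r_mul : ∀ a b, s a = r b → r (mul a b) = r a
  mul_u : ∀ a, mul a (u (s a)) = a
  u_mul : ∀ a, mul (u (r a)) a = a
  inv_mul : ∀ a, mul (inv a) a = u (s a)
  mul_assoc : ∀ a b c, s a = r b → s b = r c → mul (mul a b) c = mul a (mul b c)
  secondCountable_arrows : SecondCountableTopology G
  secondCountable_units : SecondCountableTopology G₀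
  t2_units : T2Space G₀
  isSubmersion_s : Manifold.IsSubmersion 𝓘(ℝ, E) 𝓘(ℝ, E₀) ∞ s
  contMDiff_r : ContMDiff 𝓘(ℝ, E) 𝓘(ℝ, E₀) ∞ r
  contMDiff_u : ContMDiff 𝓘(ℝ, E₀) 𝓘(ℝ, E) ∞ u
  contMDiff_inv : ContMDiff 𝓘(ℝ, E) 𝓘(ℝ, E) ∞ inv
  contMDiffOn_mul : ContMDiffOn (𝓘(ℝ, E).prod 𝓘(ℝ, E)) 𝓘(ℝ, E) ∞
    (fun p : G × G ↦ mul p.1 p.2) {p | s p.1 = r p.2}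

section Groupoid

variable {E E₀ G G₀ : Type*} [NormedAddCommGroup E] [NormedSpace ℝ E]
  [NormedAddCommGroup E₀] [NormedSpace ℝ E₀] [TopologicalSpace G] [ChartedSpace E G]
  [TopologicalSpace G₀] [ChartedSpace E₀ G₀] [IsManifold 𝓘(ℝ, E) ∞ G]
  [IsManifold 𝓘(ℝ, E₀) ∞ G₀]

namespace LieGroupoid

/-- The fibre `ker (T s)` at the unit `u x` of the Lie algebroid. -/
noncomputable def fiber (𝒢 : LieGroupoid E E₀ G G₀) (x : G₀) :
    Submodule ℝ (TangentSpace 𝓘(ℝ, E) (𝒢.u x)) :=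
  LinearMap.ker (mfderiv 𝓘(ℝ, E) 𝓘(ℝ, E₀) 𝒢.s (𝒢.u x)).toLinearMap

/-- The total space of the Lie algebroid of a Lie groupoid: the restriction of `ker (T s)` to the
units. -/
structure Alg (𝒢 : LieGroupoid E E₀ G G₀) where
  base : G₀
  vec : 𝒢.fiber base

variable {𝒢 : LieGroupoid E E₀ G G₀}

/-- A pair of charts in which the source map is a linear surjection `p`, with a linear
section `σ` of `p`. -/
structure VertChart (𝒢 : LieGroupoid E E₀ G G₀) where
  ψ : OpenPartialHomeomorph G E
  χ : OpenPartialHomeomorph G₀ E₀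
  mem : ψ ∈ IsManifold.maximalAtlas 𝓘(ℝ, E) ∞ G
  mem' : χ ∈ IsManifold.maximalAtlas 𝓘(ℝ, E₀) ∞ G₀
  p : E →L[ℝ] E₀
  σ : E₀ →L[ℝ] E
  p_σ : ∀ e, p (σ e) = e
  s_mem : ∀ a ∈ ψ.source, 𝒢.s a ∈ χ.source
  s_eq : ∀ a ∈ ψ.source, χ (𝒢.s a) = p (ψ a)

theorem exists_vertChart (𝒢 : LieGroupoid E E₀ G G₀) (a : G) :
    ∃ C : VertChart 𝒢, a ∈ C.ψ.source := by
  obtain ⟨F, _, _, hF⟩ := 𝒢.isSubmersion_s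
  have h := hF a
  refine ⟨⟨h.domChart, h.codChart, h.domChart_mem_maximalAtlas, h.codChart_mem_maximalAtlas,
    (ContinuousLinearMap.fst ℝ E₀ F).comp (h.equiv : E →L[ℝ] E₀ × F),
    (h.equiv.symm : E₀ × F →L[ℝ] E).comp (ContinuousLinearMap.inl ℝ E₀ F), fun e ↦ by simp,
    h.source_subset_preimage_source, fun b hb ↦ ?_⟩, h.mem_domChart_source⟩
  have := h.writtenInCharts (show h.domChart b ∈ (h.domChart.extend 𝓘(ℝ, E)).target by
    simpa using h.domChart.map_source hb)
  have e : h.domChart.symm (h.domChart b) = b := h.domChart.left_inv hb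
  simpa [e] using this

namespace VertChart

variable (C : VertChart 𝒢)

theorem base_mem {x : G₀} (hx : 𝒢.u x ∈ C.ψ.source) : x ∈ C.χ.source := by
  simpa [𝒢.s_u] using C.s_mem _ hx

theorem mem_fiber_iff {x : G₀} (hx : 𝒢.u x ∈ C.ψ.source) (w : TangentSpace 𝓘(ℝ, E) (𝒢.u x)) :
    w ∈ 𝒢.fiber x ↔ C.p (dchart C.ψ (𝒢.u x) w) = 0 := by
  have hs : MDifferentiableAt 𝓘(ℝ, E) 𝓘(ℝ, E₀) 𝒢.s (𝒢.u x) := by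
    obtain ⟨F, _, _, hF⟩ := 𝒢.isSubmersion_s
    exact ((hF (𝒢.u x)).contMDiffAt).mdifferentiableAt (by simp)
  have hψ := (mdifferentiable_of_mem C.mem).mdifferentiableAt hx
  have hχ := (mdifferentiable_of_mem C.mem').mdifferentiableAt (C.s_mem _ hx)
  have heq : (C.χ ∘ 𝒢.s : G → E₀) =ᶠ[𝓝 (𝒢.u x)] C.p ∘ C.ψ := by
    filter_upwards [C.ψ.open_source.mem_nhds hx] with a ha using C.s_eq a ha
  have e1 := mfderiv_comp (𝒢.u x) hχ hs
  have e2 := mfderiv_comp (𝒢.u x)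
    (C.p.differentiableAt (x := C.ψ (𝒢.u x))).mdifferentiableAt hψ
  rw [heq.mfderiv_eq, e2, mfderiv_eq_fderiv] at e1
  have hfd : fderiv ℝ C.p (C.ψ (𝒢.u x)) = C.p := C.p.fderiv
  rw [hfd] at e1
  have key : C.p (dchart C.ψ (𝒢.u x) w) =
      dchart C.χ (𝒢.s (𝒢.u x)) (mfderiv 𝓘(ℝ, E) 𝓘(ℝ, E₀) 𝒢.s (𝒢.u x) w) :=
    DFunLike.congr_fun e1 w
  rw [key]
  constructor
  · intro hw
    have hw' : mfderiv 𝓘(ℝ, E) 𝓘(ℝ, E₀) 𝒢.s (𝒢.u x) w = 0 := hw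
    rw [hw', map_zero]
  · intro hw
    show mfderiv 𝓘(ℝ, E) 𝓘(ℝ, E₀) 𝒢.s (𝒢.u x) w = 0
    exact (dchart_bijective C.mem' (C.s_mem _ hx)).1 (hw.trans (map_zero _).symm)

/-- The coordinate `σ(χ(x)) + dψ(v)` of an element `v` of the fibre at `x`. -/
noncomputable def coord (a : 𝒢.Alg) : E :=
  C.σ (C.χ a.base) + dchart C.ψ (𝒢.u a.base) a.vec

theorem p_coord {a : 𝒢.Alg} (ha : 𝒢.u a.base ∈ C.ψ.source) : C.p (C.coord a) = C.χ a.base := by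
  simp [coord, C.p_σ, (C.mem_fiber_iff ha _).1 a.vec.2]

theorem coord_injOn {a b : 𝒢.Alg} (ha : 𝒢.u a.base ∈ C.ψ.source)
    (hb : 𝒢.u b.base ∈ C.ψ.source) (h : C.coord a = C.coord b) : a = b := by
  have hbase : a.base = b.base := by
    apply C.χ.injOn (C.base_mem ha) (C.base_mem hb)
    rw [← C.p_coord ha, ← C.p_coord hb, h]
  obtain ⟨x, v⟩ := a
  obtain ⟨y, w⟩ := b
  obtain rfl : x = y := hbase
  congr 1
  exact Subtype.ext ((dchart_bijective C.mem ha).1 (add_left_cancel h))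

/-- The element of the Lie algebroid with a given coordinate. -/
noncomputable def lift (e : E) (h : 𝒢.u (C.χ.symm (C.p e)) ∈ C.ψ.source) : 𝒢.Alg where
  base := C.χ.symm (C.p e)
  vec := ⟨(dchart C.ψ (𝒢.u (C.χ.symm (C.p e)))).inverse (e - C.σ (C.p e)), by
    rw [C.mem_fiber_iff h, dchart_apply_inverse C.mem h]; simp [C.p_σ]⟩

theorem coord_lift {e : E} (he : C.p e ∈ C.χ.target)
    (h : 𝒢.u (C.χ.symm (C.p e)) ∈ C.ψ.source) : C.coord (C.lift e h) = e := by
  show C.σ (C.χ (C.χ.symm (C.p e))) + dchart C.ψ (𝒢.u (C.χ.symm (C.p e)))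
    ((dchart C.ψ (𝒢.u (C.χ.symm (C.p e)))).inverse (e - C.σ (C.p e))) = e
  rw [dchart_apply_inverse C.mem h, C.χ.right_inv he]
  abel

theorem coord_mem {a : 𝒢.Alg} (ha : 𝒢.u a.base ∈ C.ψ.source) :
    C.p (C.coord a) ∈ C.χ.target ∧ 𝒢.u (C.χ.symm (C.p (C.coord a))) ∈ C.ψ.source := by
  rw [C.p_coord ha, C.χ.left_inv (C.base_mem ha)]
  exact ⟨C.χ.map_source (C.base_mem ha), ha⟩

/-- The chart `(x, v) ↦ σ(χ(x)) + dψ(v)` of the Lie algebroid. -/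
noncomputable def algChart : PartialEquiv 𝒢.Alg E := by
  classical exact
  { toFun := C.coord
    invFun := fun e ↦ if h : 𝒢.u (C.χ.symm (C.p e)) ∈ C.ψ.source then C.lift e h
      else ⟨C.χ.symm (C.p e), 0⟩
    source := {a | 𝒢.u a.base ∈ C.ψ.source}
    target := {e | C.p e ∈ C.χ.target ∧ 𝒢.u (C.χ.symm (C.p e)) ∈ C.ψ.source}
    map_source' := fun a ha ↦ C.coord_mem ha
    map_target' := fun e he ↦ by rw [dif_pos he.2]; exact he.2
    left_inv' := fun a ha ↦ by
      have h := C.coord_mem ha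
      rw [dif_pos h.2]
      exact C.coord_injOn h.2 ha (C.coord_lift h.1 h.2)
    right_inv' := fun e he ↦ by rw [dif_pos he.2]; exact C.coord_lift he.1 he.2 }

theorem algChart_symm {e : E} (h : 𝒢.u (C.χ.symm (C.p e)) ∈ C.ψ.source) :
    C.algChart.symm e = C.lift e h := dif_pos h

variable (C' : VertChart 𝒢)

theorem transition_source : (C.algChart.symm.trans C'.algChart).source =
    C.p ⁻¹' (C.χ.target ∩ C.χ.symm ⁻¹' (𝒢.u ⁻¹' (C.ψ.source ∩ C'.ψ.source))) := by
  ext e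
  simp only [PartialEquiv.trans_source, PartialEquiv.symm_source, mem_inter_iff, mem_preimage]
  constructor
  · rintro ⟨⟨h1, h2⟩, h3⟩
    rw [C.algChart_symm h2] at h3
    exact ⟨h1, h2, h3⟩
  · rintro ⟨h1, h2, h3⟩
    refine ⟨⟨h1, h2⟩, ?_⟩
    rw [C.algChart_symm h2]
    exact h3

theorem isOpen_transition : IsOpen
    (C.χ.target ∩ C.χ.symm ⁻¹' (𝒢.u ⁻¹' (C.ψ.source ∩ C'.ψ.source))) :=
  C.χ.isOpen_inter_preimage_symm
    ((C.ψ.open_source.inter C'.ψ.open_source).preimage 𝒢.contMDiff_u.continuous)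

theorem transition_contDiffOn : ContDiffOn ℝ ∞ (C.algChart.symm.trans C'.algChart)
    (C.algChart.symm.trans C'.algChart).source := by
  rw [transition_source]
  set T := C.χ.target ∩ C.χ.symm ⁻¹' (𝒢.u ⁻¹' (C.ψ.source ∩ C'.ψ.source))
  have hp : ContDiffOn ℝ ∞ C.p (C.p ⁻¹' T) := C.p.contDiff.contDiffOn
  have hmaps : MapsTo C.p (C.p ⁻¹' T) T := mapsTo_preimage _ _
  have h1 : ContDiffOn ℝ ∞ (C'.χ ∘ C.χ.symm) T :=
    (contDiffOn_transition C.mem' C'.mem').mono fun e he ↦ by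
      simpa using ⟨he.1, C'.base_mem he.2.2⟩
  have h2 : ContDiffOn ℝ ∞ (C.ψ ∘ 𝒢.u ∘ C.χ.symm) T := by
    rw [← contMDiffOn_iff_contDiffOn]
    refine (contMDiffOn_of_mem_maximalAtlas C.mem).comp
      (𝒢.contMDiff_u.comp_contMDiffOn
        ((contMDiffOn_symm_of_mem_maximalAtlas C.mem').mono inter_subset_left)) ?_
    exact fun e he ↦ he.2.1
  have hτ := contDiffOn_transition C.mem C'.mem
  have h3 : ContDiffOn ℝ ∞
      (fderiv ℝ (C'.ψ ∘ C.ψ.symm) ∘ (C.ψ ∘ 𝒢.u ∘ C.χ.symm)) T :=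
    (hτ.fderiv_of_isOpen (C.ψ.symm.trans C'.ψ).open_source (m := ∞) (by simp)).comp h2
      fun e he ↦ by
        have : 𝒢.u (C.χ.symm e) ∈ C.ψ.source := he.2.1
        have : 𝒢.u (C.χ.symm e) ∈ C'.ψ.source := he.2.2
        simp [*]
  have h4 := (C'.σ.contDiff.comp_contDiffOn (h1.comp hp hmaps)).add
    ((h3.comp hp hmaps).clm_apply
      (contDiffOn_id.sub ((C.σ.contDiff.comp C.p.contDiff).contDiffOn (n := ∞))))
  refine h4.congr fun e he ↦ ?_
  obtain ⟨ht, hs, hs'⟩ := he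
  have hs : 𝒢.u (C.χ.symm (C.p e)) ∈ C.ψ.source := hs
  have hs' : 𝒢.u (C.χ.symm (C.p e)) ∈ C'.ψ.source := hs'
  rw [PartialEquiv.coe_trans, Function.comp_apply, C.algChart_symm hs]
  have d := dchart_eq_fderiv C.mem C'.mem hs hs'
    ((dchart C.ψ (𝒢.u (C.χ.symm (C.p e)))).inverse (e - C.σ (C.p e)))
  rw [dchart_apply_inverse C.mem hs] at d
  exact congrArg (C'.σ (C'.χ (C.χ.symm (C.p e))) + ·) d

end VertChart

/-- The smooth atlas of the Lie algebroid of a Lie groupoid. -/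
noncomputable def algAtlas (𝒢 : LieGroupoid E E₀ G G₀) : SmoothAtlas E 𝒢.Alg where
  atlas := range VertChart.algChart
  exists_chart a := by
    obtain ⟨C, hC⟩ := 𝒢.exists_vertChart (𝒢.u a.base)
    exact ⟨_, ⟨C, rfl⟩, hC⟩
  open_source := by
    rintro _ ⟨C, rfl⟩ _ ⟨C', rfl⟩
    rw [C.transition_source]
    exact (C.isOpen_transition C').preimage C.p.continuous
  contDiffOn := by
    rintro _ ⟨C, rfl⟩ _ ⟨C', rfl⟩
    exact C.transition_contDiffOn C'

noncomputable instance : TopologicalSpace 𝒢.Alg := 𝒢.algAtlas.topology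

noncomputable instance : ChartedSpace E 𝒢.Alg := 𝒢.algAtlas.charts

instance : IsManifold 𝓘(ℝ, E) ∞ 𝒢.Alg := 𝒢.algAtlas.isManifold

end LieGroupoid

end Groupoid

section Groupoid

variable {E E₀ G G₀ : Type*} [NormedAddCommGroup E] [NormedSpace ℝ E]
  [NormedAddCommGroup E₀] [NormedSpace ℝ E₀] [TopologicalSpace G] [ChartedSpace E G]
  [TopologicalSpace G₀] [ChartedSpace E₀ G₀] [IsManifold 𝓘(ℝ, E) ∞ G]
  [IsManifold 𝓘(ℝ, E₀) ∞ G₀]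

namespace LieGroupoid

/-- The inclusion of the Lie algebroid in the tangent bundle of `G`. -/
def Alg.toTangent {𝒢 : LieGroupoid E E₀ G G₀} (a : 𝒢.Alg) : TangentBundle 𝓘(ℝ, E) G :=
  ⟨𝒢.u a.base, a.vec.1⟩

/-- Smooth sections of the Lie algebroid. -/
def IsSmoothSection (𝒢 : LieGroupoid E E₀ G G₀) (X : ∀ x, 𝒢.fiber x) : Prop :=
  ContMDiff 𝓘(ℝ, E₀) 𝓘(ℝ, E) ∞ fun x ↦ (⟨x, X x⟩ : 𝒢.Alg)

/-- The anchor `T r`. -/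
noncomputable def anchor (𝒢 : LieGroupoid E E₀ G G₀) (a : 𝒢.Alg) : TangentSpace 𝓘(ℝ, E₀) a.base :=
  mfderiv 𝓘(ℝ, E) 𝓘(ℝ, E₀) 𝒢.r (𝒢.u a.base) a.vec.1

/-- The right invariant vector field `Z_X(a) = T R_a (X(r a))` associated with a section `X`, where
`R_a` is right multiplication by `a`, defined on the fibre of the source map over `r a`. -/
noncomputable def rightInvariant (𝒢 : LieGroupoid E E₀ G G₀) (X : ∀ x, 𝒢.fiber x) (a : G) :
    TangentSpace 𝓘(ℝ, E) a :=
  mfderivWithin 𝓘(ℝ, E) 𝓘(ℝ, E) (fun b ↦ 𝒢.mul b a) {b | 𝒢.s b = 𝒢.r a} (𝒢.u (𝒢.r a))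
    (X (𝒢.r a)).1

/-- The bracket `[Z_X, Z_Y]` restricted to the units. -/
noncomputable def bracket (𝒢 : LieGroupoid E E₀ G G₀) (X Y : ∀ x, 𝒢.fiber x) (x : G₀) :
    TangentSpace 𝓘(ℝ, E) (𝒢.u x) :=
  VectorField.mlieBracket 𝓘(ℝ, E) (𝒢.rightInvariant X) (𝒢.rightInvariant Y) (𝒢.u x)

end LieGroupoid

/-- A tangent vector at a point `y`, as an element of the model vector space. Two tangent vectors at
`y` and at `z` are compared in this way only when `y = z`. -/
def modelVec {F M : Type*} [NormedAddCommGroup F] [NormedSpace ℝ F] [TopologicalSpace M]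
    [ChartedSpace F M] {y : M} (v : TangentSpace 𝓘(ℝ, F) y) : F := v

/-- Smooth sections of `proj : A → M`. -/
def IsSmoothSection (F₀ F : Type*) {A M : Type*} [NormedAddCommGroup F] [NormedSpace ℝ F]
    [NormedAddCommGroup F₀] [NormedSpace ℝ F₀] [TopologicalSpace A] [ChartedSpace F A]
    [TopologicalSpace M] [ChartedSpace F₀ M] (proj : A → M) (X : M → A) : Prop :=
  ContMDiff 𝓘(ℝ, F₀) 𝓘(ℝ, F) ∞ X ∧ ∀ y, proj (X y) = y

/-- A Lie algebroid with total space `A` over the manifold `M`. Addition is meaningful for two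
elements of the same fibre, and the bracket for two smooth sections. -/
structure LieAlgebroid (F F₀ A M : Type*) [NormedAddCommGroup F] [NormedSpace ℝ F]
    [NormedAddCommGroup F₀] [NormedSpace ℝ F₀] [TopologicalSpace A] [ChartedSpace F A]
    [TopologicalSpace M] [ChartedSpace F₀ M] [IsManifold 𝓘(ℝ, F₀) ∞ M] where
  proj : A → M
  zero : M → A
  add : A → A → A
  smul : ℝ → A → A
  contMDiff_proj : ContMDiff 𝓘(ℝ, F) 𝓘(ℝ, F₀) ∞ proj
  proj_zero : ∀ y, proj (zero y) = y
  proj_add : ∀ a b, proj a = proj b → proj (add a b) = proj a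
  proj_smul : ∀ c a, proj (smul c a) = proj a
  /-- Local triviality: around each point there is a smooth trivialization `(proj, Θ)`, with
  inverse `Ξ`, which is linear on the fibres. -/
  locallyTrivial : ∀ y, ∃ (U : Set M) (n : ℕ) (Θ : A → EuclideanSpace ℝ (Fin n))
    (Ξ : M × EuclideanSpace ℝ (Fin n) → A), IsOpen U ∧ y ∈ U ∧
    ContMDiffOn 𝓘(ℝ, F) 𝓘(ℝ, EuclideanSpace ℝ (Fin n)) ∞ Θ (proj ⁻¹' U) ∧
    ContMDiffOn (𝓘(ℝ, F₀).prod 𝓘(ℝ, EuclideanSpace ℝ (Fin n))) 𝓘(ℝ, F) ∞ Ξ (U ×ˢ univ) ∧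
    (∀ a, proj a ∈ U → Ξ (proj a, Θ a) = a) ∧
    (∀ z ∈ U, ∀ w, proj (Ξ (z, w)) = z ∧ Θ (Ξ (z, w)) = w) ∧
    (∀ z ∈ U, Θ (zero z) = 0) ∧
    (∀ a b, proj a ∈ U → proj a = proj b → Θ (add a b) = Θ a + Θ b) ∧
    (∀ c a, proj a ∈ U → Θ (smul c a) = c • Θ a)
  anchor : ∀ a, TangentSpace 𝓘(ℝ, F₀) (proj a)
  contMDiff_anchor : ContMDiff 𝓘(ℝ, F) 𝓘(ℝ, F₀).tangent ∞
    fun a ↦ (⟨proj a, anchor a⟩ : TangentBundle 𝓘(ℝ, F₀) M)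
  anchor_add : ∀ a b, proj a = proj b → modelVec (anchor (add a b)) = modelVec (anchor a) + modelVec (anchor b)
  anchor_smul : ∀ c a, modelVec (anchor (smul c a)) = c • modelVec (anchor a)
  bracket : (M → A) → (M → A) → M → A
  bracket_section : ∀ X Y, IsSmoothSection F₀ F proj X →
    IsSmoothSection F₀ F proj Y →
    IsSmoothSection F₀ F proj (bracket X Y)
  bracket_add : ∀ X Y Z, IsSmoothSection F₀ F proj X →
    IsSmoothSection F₀ F proj Y →
    IsSmoothSection F₀ F proj Z →
    ∀ y, bracket X (fun y ↦ add (Y y) (Z y)) y = add (bracket X Y y) (bracket X Z y)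
  bracket_swap : ∀ X Y, IsSmoothSection F₀ F proj X →
    IsSmoothSection F₀ F proj Y →
    ∀ y, bracket X Y y = smul (-1) (bracket Y X y)
  jacobi : ∀ X Y Z, IsSmoothSection F₀ F proj X →
    IsSmoothSection F₀ F proj Y →
    IsSmoothSection F₀ F proj Z →
    ∀ y, bracket X (bracket Y Z) y =
      add (bracket (bracket X Y) Z y) (bracket Y (bracket X Z) y)
  anchor_bracket : ∀ X Y, IsSmoothSection F₀ F proj X →
    IsSmoothSection F₀ F proj Y →
    ∀ y, modelVec (anchor (bracket X Y y)) =
      modelVec (VectorField.mlieBracket 𝓘(ℝ, F₀) (fun z ↦ modelVec (F := F₀) (anchor (X z)))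
        (fun z ↦ modelVec (F := F₀) (anchor (Y z))) y)
  leibniz : ∀ X Y, IsSmoothSection F₀ F proj X →
    IsSmoothSection F₀ F proj Y →
    ∀ f : M → ℝ, ContMDiff 𝓘(ℝ, F₀) 𝓘(ℝ, ℝ) ∞ f → ∀ y,
      bracket X (fun z ↦ smul (f z) (Y z)) y =
        add (smul (f y) (bracket X Y y))
          (smul (mfderiv 𝓘(ℝ, F₀) 𝓘(ℝ, ℝ) f y (modelVec (F := F₀) (anchor (X y)))) (Y y))

/-- `Φ` is an isomorphism of Lie algebroids, over the identity of the units, from the Lie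
algebroid of the Lie groupoid `𝒢` to the Lie algebroid `𝓛`. -/
structure LieAlgebroid.IsIsoOf {F A : Type*} [NormedAddCommGroup F] [NormedSpace ℝ F]
    [TopologicalSpace A] [ChartedSpace F A] (𝓛 : LieAlgebroid F E₀ A G₀)
    (𝒢 : LieGroupoid E E₀ G G₀) (Φ : Diffeomorph 𝓘(ℝ, E) 𝓘(ℝ, F) 𝒢.Alg A ∞) : Prop where
  proj_eq : ∀ a, 𝓛.proj (Φ a) = a.base
  zero_eq : ∀ x, Φ ⟨x, 0⟩ = 𝓛.zero x
  add_eq : ∀ (x : G₀) (v w : 𝒢.fiber x), Φ ⟨x, v + w⟩ = 𝓛.add (Φ ⟨x, v⟩) (Φ ⟨x, w⟩)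
  smul_eq : ∀ (c : ℝ) (x : G₀) (v : 𝒢.fiber x), Φ ⟨x, c • v⟩ = 𝓛.smul c (Φ ⟨x, v⟩)
  anchor_eq : ∀ a, modelVec (𝓛.anchor (Φ a)) = modelVec (𝒢.anchor a)
  bracket_eq : ∀ X Y : ∀ x, 𝒢.fiber x, 𝒢.IsSmoothSection X → 𝒢.IsSmoothSection Y →
    ∀ x, ∃ w : 𝒢.fiber x, w.1 = 𝒢.bracket X Y x ∧
      𝓛.bracket (fun y ↦ Φ ⟨y, X y⟩) (fun y ↦ Φ ⟨y, Y y⟩) x = Φ ⟨x, w⟩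

variable {E' E₀' H H₀ : Type*} [NormedAddCommGroup E'] [NormedSpace ℝ E']
  [NormedAddCommGroup E₀'] [NormedSpace ℝ E₀'] [TopologicalSpace H] [ChartedSpace E' H]
  [TopologicalSpace H₀] [ChartedSpace E₀' H₀] [IsManifold 𝓘(ℝ, E') ∞ H]
  [IsManifold 𝓘(ℝ, E₀') ∞ H₀]

/-- A Lie subgroupoid: a Lie groupoid `ℋ` with an embedding (of arrows and of units) in `𝒢` which
is a morphism of groupoids. The units of `ℋ` need not be all the units of `𝒢`. -/
structure LieSubgroupoid (ℋ : LieGroupoid E' E₀' H H₀) (𝒢 : LieGroupoid E E₀ G G₀) where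
  hom : SmoothEmbedding E' H E G
  base : SmoothEmbedding E₀' H₀ E₀ G₀
  s_hom : ∀ h, 𝒢.s (hom h) = base (ℋ.s h)
  r_hom : ∀ h, 𝒢.r (hom h) = base (ℋ.r h)
  u_base : ∀ x, 𝒢.u (base x) = hom (ℋ.u x)
  inv_hom : ∀ h, 𝒢.inv (hom h) = hom (ℋ.inv h)
  mul_hom : ∀ h k, ℋ.s h = ℋ.r k → 𝒢.mul (hom h) (hom k) = hom (ℋ.mul h k)

/-- `Φ = DNC(f)` for a map of pairs `f : (M, V) → (N, W)` which restricts to `g : V → W`. -/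
def IsDNCMap {D V D₁ M C W C₁ N : Type*} [NormedAddCommGroup D] [NormedSpace ℝ D]
    [TopologicalSpace V] [ChartedSpace D V] [NormedAddCommGroup D₁] [NormedSpace ℝ D₁]
    [TopologicalSpace M] [ChartedSpace D₁ M] [NormedAddCommGroup C] [NormedSpace ℝ C]
    [TopologicalSpace W] [ChartedSpace C W] [NormedAddCommGroup C₁] [NormedSpace ℝ C₁]
    [TopologicalSpace N] [ChartedSpace C₁ N] (i : SmoothEmbedding D V D₁ M)
    (j : SmoothEmbedding C W C₁ N) (f : M → N) (g : V → W) (Φ : DNC i → DNC j) : Prop :=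
  (∀ x t ht, Φ (.gen x t ht) = .gen (f x) t ht) ∧
  ∀ v w, Φ (.nor (.mk' i v w)) = .nor (.mk' j (g v) (mfderiv 𝓘(ℝ, D₁) 𝓘(ℝ, C₁) f (i v) w))

/-- `Φ = DNC(m)` for a partial binary operation `m` on `M` which restricts to an operation `n` on
the submanifold `V`; here `m x y` is defined when `f x = g y`, and `n a b` when `f' a = g' b`. On
the normal bundle, `Φ` is given by the differential of `m` applied to vectors tangent to its
domain. -/
def IsDNCMul {D V D₁ M V₀ C₁ N : Type*} [NormedAddCommGroup D] [NormedSpace ℝ D]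
    [TopologicalSpace V] [ChartedSpace D V] [NormedAddCommGroup D₁] [NormedSpace ℝ D₁]
    [TopologicalSpace M] [ChartedSpace D₁ M] [NormedAddCommGroup C₁] [NormedSpace ℝ C₁]
    [TopologicalSpace N] [ChartedSpace C₁ N] (i : SmoothEmbedding D V D₁ M)
    (f g : M → N) (m : M → M → M) (f' g' : V → V₀) (n : V → V → V)
    (Φ : DNC i → DNC i → DNC i) : Prop :=
  (∀ x y t ht, f x = g y → Φ (.gen x t ht) (.gen y t ht) = .gen (m x y) t ht) ∧
  ∀ a b w z, f' a = g' b →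
    modelVec (mfderiv 𝓘(ℝ, D₁) 𝓘(ℝ, C₁) f (i a) w) = modelVec (mfderiv 𝓘(ℝ, D₁) 𝓘(ℝ, C₁) g (i b) z) →
    Φ (.nor (.mk' i a w)) (.nor (.mk' i b z)) =
      .nor (.mk' i (n a b) (mfderivWithin (𝓘(ℝ, D₁).prod 𝓘(ℝ, D₁)) 𝓘(ℝ, D₁)
        (fun p : M × M ↦ m p.1 p.2) {p | f p.1 = g p.2} (i a, i b) ((w, z) : D₁ × D₁)))

namespace LieSubgroupoid

variable [FiniteDimensional ℝ E] [FiniteDimensional ℝ E₀]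
  {ℋ : LieGroupoid E' E₀' H H₀} {𝒢 : LieGroupoid E E₀ G G₀} (ι : LieSubgroupoid ℋ 𝒢)

/-- The structure maps of `𝒟` are obtained from those of `𝒢` and `ℋ` by functoriality of the
deformation to the normal cone. -/
structure IsDNC (𝒟 : LieGroupoid (E × ℝ) (E₀ × ℝ) (DNC ι.hom) (DNC ι.base)) : Prop where
  s_eq : IsDNCMap ι.hom ι.base 𝒢.s ℋ.s 𝒟.s
  r_eq : IsDNCMap ι.hom ι.base 𝒢.r ℋ.r 𝒟.r
  u_eq : IsDNCMap ι.base ι.hom 𝒢.u ℋ.u 𝒟.u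
  inv_eq : IsDNCMap ι.hom ι.hom 𝒢.inv ℋ.inv 𝒟.inv
  mul_eq : IsDNCMul (C₁ := E₀) ι.hom 𝒢.s 𝒢.r 𝒢.mul ℋ.s ℋ.r ℋ.mul 𝒟.mul

/-- The embedding `j` of Lie algebroids is the restriction of the differential of the
embedding of `ℋ` in `𝒢`. -/
def IsAlgMap (j : SmoothEmbedding E' ℋ.Alg E 𝒢.Alg) : Prop :=
  ∀ a, (j a).base = ι.base a.base ∧
    (j a).toTangent = tangentMap 𝓘(ℝ, E') 𝓘(ℝ, E) ι.hom a.toTangent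

/-- `𝓛` is the Lie algebroid structure on `DNC(𝔄G, 𝔄H)`, over `DNC(G₀, H₀)`: its vector bundle
structure is obtained from those of `𝔄G` and `𝔄H` by functoriality, and for `t ≠ 0` its anchor and
its bracket are those of `𝔄G`, computed at fixed `t`. As the part `t ≠ 0` is dense, this determines
the anchor and the bracket. -/
structure IsDNCAlg {ι : LieSubgroupoid ℋ 𝒢} {j : SmoothEmbedding E' ℋ.Alg E 𝒢.Alg}
    (𝓛 : LieAlgebroid (E × ℝ) (E₀ × ℝ) (DNC j) (DNC ι.base)) : Prop where
  proj_eq : IsDNCMap j ι.base LieGroupoid.Alg.base LieGroupoid.Alg.base 𝓛.proj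
  zero_eq : IsDNCMap ι.base j (fun x ↦ ⟨x, 0⟩) (fun x ↦ ⟨x, 0⟩) 𝓛.zero
  smul_eq : ∀ c : ℝ, IsDNCMap j j (fun a ↦ ⟨a.base, c • a.vec⟩) (fun a ↦ ⟨a.base, c • a.vec⟩)
    (𝓛.smul c)
  add_eq : ∀ (m : 𝒢.Alg → 𝒢.Alg → 𝒢.Alg) (n : ℋ.Alg → ℋ.Alg → ℋ.Alg),
    (∀ x v w, m ⟨x, v⟩ ⟨x, w⟩ = ⟨x, v + w⟩) → (∀ x v w, n ⟨x, v⟩ ⟨x, w⟩ = ⟨x, v + w⟩) →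
    IsDNCMul (C₁ := E₀) j LieGroupoid.Alg.base LieGroupoid.Alg.base m
      LieGroupoid.Alg.base LieGroupoid.Alg.base n 𝓛.add
  anchor_eq : ∀ (a : 𝒢.Alg) (t : ℝ) (ht : t ≠ 0), modelVec (𝓛.anchor (.gen a t ht)) =
    modelVec (mfderiv 𝓘(ℝ, E₀) 𝓘(ℝ, E₀ × ℝ) (fun x ↦ (DNC.gen x t ht : DNC ι.base)) a.base
      (𝒢.anchor a))
  bracket_eq : ∀ X Y : DNC ι.base → DNC j,
    IsSmoothSection (E₀ × ℝ) (E × ℝ) 𝓛.proj X →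
    IsSmoothSection (E₀ × ℝ) (E × ℝ) 𝓛.proj Y →
    ∀ (t : ℝ) (ht : t ≠ 0) (X' Y' : ∀ x, 𝒢.fiber x),
      (∀ x, X (.gen x t ht) = .gen ⟨x, X' x⟩ t ht) →
      (∀ x, Y (.gen x t ht) = .gen ⟨x, Y' x⟩ t ht) →
      ∀ x, ∃ w : 𝒢.fiber x, w.1 = 𝒢.bracket X' Y' x ∧
        𝓛.bracket X Y (.gen x t ht) = .gen ⟨x, w⟩ t ht

end LieSubgroupoid

end Groupoid

/-! Two facts carry the proof, one analytic and one topological.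

The analytic fact is Hadamard division. In adapted coordinates the deformation of a map of pairs `f`
is `(y, ξ, t) ↦ (f₁(y, tξ), t⁻¹ f₂(y, tξ), t)`. The normal component `f₂` vanishes on the
submanifold, so the quotient extends smoothly to `t = 0`, where its value is the normal derivative.
`contMDiffOn_deformation` states this for a source `(W, ker Q)` with `W` a vector space. It yields
the smoothness of `DNC(f)`, and also that of the product near `t = 0`.

The topological fact is that the part `t ≠ 0` is dense, and that two limits of the same net in
`DNC(M, V)` are equal as soon as they have the same image in `M` (`DNC.eq_of_tendsto`). This holds
even if `M` is not Hausdorff. An identity between continuous maps is thus checked for `t ≠ 0`, where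
it is an identity in `G`, together with its image under the projection to `G`.

Groupoid structure. The maps `s`, `r`, `u` and the inversion are maps of pairs, so they are deformed
by functoriality. A submersion of pairs is linear in suitable adapted charts, compatibly with the
projections on the normal directions (`exists_submersionChart`); its deformation is then linear in
the deformed charts, hence a submersion. The product lives only on composable pairs. Instead of
deforming the fibred product, the product is extended to an open set of pairs: the first arrow is
moved, by means of a linear section of `s`, to an arrow whose source is the range of the second
(`mulExt`). The extension is a map of pairs and is deformed in charts. Since the deformed source is
a submersion, composable pairs and triples over `t = 0` are limits of composable ones with `t ≠ 0`;
density then gives independence of the charts and all the groupoid laws. The formula for `t = 0`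
results from evaluating the limit along curves with prescribed velocities. The normal groupoid is
the slice `t = 0`.

Lie algebroid of a groupoid. Its bracket is that of right-invariant vector fields, and everything
follows from one statement: a smooth map intertwines the brackets of fields which are related along
curves tangent to these fields (`mfderiv_mlieBracket_of_related`). Applied to `s` it shows that the
bracket is vertical; applied to right translations, that it is right-invariant, whence the Jacobi
identity; applied to `r`, that the anchor preserves brackets; applied to a morphism of groupoids,
that brackets are natural.

The isomorphism. A chart of the pair `(G, H)` in which `s` is linear gives a chart of `𝔄G` adapted
to `𝔄H`, with the same projection `P`. It therefore gives a chart of `DNC(𝔄G, 𝔄H)`. It also gives a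
chart of `DNC(G, H)` in which the source is linear, hence a chart of the Lie algebroid of `DNC(G,
H)`. These two charts have the same target, and the isomorphism is the identity in them. For `t ≠ 0`
it is the differential of the projection to `G`, which shows that the local definitions agree. The
Lie algebroid structure on `DNC(𝔄G, 𝔄H)` is transported by this diffeomorphism. What is left is to
recognise it: its linear operations are the functorial ones by density, and its anchor and bracket
for `t ≠ 0` are those of `𝔄G` because `a ↦ (a, t)` is a morphism of Lie groupoids. -/

set_option linter.unusedSectionVars false

/-! ### Charts of a smooth atlas as partial homeomorphisms -/

namespace SmoothAtlas

variable {E X : Type*} [NormedAddCommGroup E] [NormedSpace ℝ E] (A : SmoothAtlas E X)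

/-- A chart of a smooth atlas, as a partial homeomorphism. -/
noncomputable def homeo {e : PartialEquiv X E} (he : e ∈ A.atlas) :
    @OpenPartialHomeomorph X E A.topology _ :=
  A.core.openPartialHomeomorph e he

theorem homeo_mem {e : PartialEquiv X E} (he : e ∈ A.atlas) :
    letI := A.topology
    letI := A.charts
    A.homeo he ∈ IsManifold.maximalAtlas 𝓘(ℝ, E) ∞ X := by
  let _ := A.topology
  let _ := A.charts
  have := A.isManifold
  apply IsManifold.subset_maximalAtlas
  exact mem_iUnion₂.2 ⟨e, he, rfl⟩

end SmoothAtlas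

/-! ### Submersions, immersions and embeddings recognised in charts where the map is linear -/

section LinearCharts

variable {E M E₀ M₀ : Type*} [NormedAddCommGroup E] [NormedSpace ℝ E] [TopologicalSpace M]
  [ChartedSpace E M] [NormedAddCommGroup E₀] [NormedSpace ℝ E₀] [TopologicalSpace M₀]
  [ChartedSpace E₀ M₀]

/-- The definition asks for one complement valid at all points, whereas the kernel of `p` varies
with the point. All these kernels have dimension `dim E - dim E₀`, so each is identified with the
kernel for one fixed chart. -/
theorem isSubmersion_of_linear_charts [FiniteDimensional ℝ E] {f : M → M₀}
    (h : ∀ x, ∃ (ψ : OpenPartialHomeomorph M E) (χ : OpenPartialHomeomorph M₀ E₀) (p : E →L[ℝ] E₀),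
      x ∈ ψ.source ∧ ψ ∈ IsManifold.maximalAtlas 𝓘(ℝ, E) ∞ M ∧
      χ ∈ IsManifold.maximalAtlas 𝓘(ℝ, E₀) ∞ M₀ ∧ Function.Surjective p ∧
      ∀ y ∈ ψ.source, f y ∈ χ.source ∧ χ (f y) = p (ψ y)) :
    Manifold.IsSubmersion 𝓘(ℝ, E) 𝓘(ℝ, E₀) ∞ f := by
  cases isEmpty_or_nonempty M with
  | inl hM => exact ⟨PUnit, inferInstance, inferInstance, fun x ↦ isEmptyElim x⟩
  | inr hM =>
    obtain ⟨ψ₀, χ₀, p₀, -, -, -, hp₀, -⟩ := h hM.some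
    refine ⟨p₀.ker, inferInstance, inferInstance, fun x ↦ ?_⟩
    obtain ⟨ψ, χ, p, hx, hψ, hχ, hp, hf⟩ := h x
    have : FiniteDimensional ℝ E₀ := Module.Finite.of_surjective p.toLinearMap hp
    have hfin : Module.finrank ℝ p.ker = Module.finrank ℝ p₀.ker := by
      have h1 := LinearMap.finrank_range_add_finrank_ker p.toLinearMap
      have h2 := LinearMap.finrank_range_add_finrank_ker p₀.toLinearMap
      rw [LinearMap.range_eq_top.2 hp] at h1
      rw [LinearMap.range_eq_top.2 hp₀] at h2
      exact Nat.add_left_cancel (h1.trans h2.symm)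
    obtain ⟨c, hc⟩ := p.toLinearMap.ker.exists_isCompl
    obtain ⟨σ, hσ⟩ := p.toLinearMap.exists_rightInverse_of_surjective (LinearMap.range_eq_top.2 hp)
    have hσ' : ∀ e, p (σ e) = e := fun e ↦ LinearMap.congr_fun hσ e
    let κ : p.ker ≃ₗ[ℝ] p₀.ker := LinearEquiv.ofFinrankEq _ _ hfin
    let eq : E ≃ₗ[ℝ] E₀ × p₀.ker :=
      { toFun := fun e ↦ (p e, κ ⟨e - σ (p e), by simp [hσ']⟩)
        map_add' := fun a b ↦ by
          ext1
          · simp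
          · simp only [Prod.snd_add]
            rw [← map_add]; congr 1; ext1; simp; abel
        map_smul' := fun a b ↦ by
          ext1
          · simp
          · simp only [Prod.smul_snd, RingHom.id_apply]
            rw [← map_smul]; congr 1; ext1; simp [smul_sub]
        invFun := fun q ↦ σ q.1 + (κ.symm q.2 : E)
        left_inv := fun e ↦ by simp
        right_inv := fun q ↦ by
          have hk : p (κ.symm q.2 : E) = 0 := (κ.symm q.2).2
          ext1
          · simp [hσ', hk]
          · simp only
            rw [← LinearEquiv.eq_symm_apply]; ext1; simp [hσ', hk] }
    refine Manifold.IsSubmersionAtOfComplement.mk_of_charts eq.toContinuousLinearEquiv ψ χ hx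
      (hf x hx).1 hψ hχ (fun y hy ↦ (hf y hy).1) fun e he ↦ ?_
    have he' : e ∈ ψ.target := by simpa using he
    have := (hf _ (ψ.map_target he')).2
    rw [ψ.right_inv he'] at this
    simpa [eq] using this

/-- As for submersions, the complements of the ranges of the maps `l` all have the same dimension
and are identified with a single one. -/
theorem isImmersion_of_linear_charts [FiniteDimensional ℝ E₀] {f : M → M₀}
    (h : ∀ x, ∃ (ψ : OpenPartialHomeomorph M E) (χ : OpenPartialHomeomorph M₀ E₀) (l : E →L[ℝ] E₀),
      x ∈ ψ.source ∧ ψ ∈ IsManifold.maximalAtlas 𝓘(ℝ, E) ∞ M ∧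
      χ ∈ IsManifold.maximalAtlas 𝓘(ℝ, E₀) ∞ M₀ ∧ Function.Injective l ∧
      ∀ y ∈ ψ.source, f y ∈ χ.source ∧ χ (f y) = l (ψ y)) :
    Manifold.IsImmersion 𝓘(ℝ, E) 𝓘(ℝ, E₀) ∞ f := by
  cases isEmpty_or_nonempty M with
  | inl hM => exact ⟨PUnit, inferInstance, inferInstance, fun x ↦ isEmptyElim x⟩
  | inr hM =>
    obtain ⟨ψ₀, χ₀, l₀, -, -, -, hl₀, -⟩ := h hM.some
    obtain ⟨c₀, hc₀⟩ := (LinearMap.range l₀.toLinearMap).exists_isCompl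
    refine ⟨c₀, inferInstance, inferInstance, fun x ↦ ?_⟩
    obtain ⟨ψ, χ, l, hx, hψ, hχ, hl, hf⟩ := h x
    obtain ⟨c, hc⟩ := (LinearMap.range l.toLinearMap).exists_isCompl
    have hfin : Module.finrank ℝ c₀ = Module.finrank ℝ c := by
      have h1 := Submodule.finrank_add_eq_of_isCompl hc
      have h2 := Submodule.finrank_add_eq_of_isCompl hc₀
      rw [LinearMap.finrank_range_of_inj hl] at h1
      rw [LinearMap.finrank_range_of_inj hl₀] at h2
      omega
    have : FiniteDimensional ℝ E := Module.Finite.of_injective l.toLinearMap hl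
    let eq : (E × c₀) ≃ₗ[ℝ] E₀ :=
      ((LinearEquiv.ofInjective l.toLinearMap hl).prodCongr (LinearEquiv.ofFinrankEq _ _ hfin)).trans
        (Submodule.prodEquivOfIsCompl _ _ hc)
    refine Manifold.IsImmersionAtOfComplement.mk_of_charts eq.toContinuousLinearEquiv ψ χ hx
      (hf x hx).1 hψ hχ (fun y hy ↦ (hf y hy).1) fun e he ↦ ?_
    have he' : e ∈ ψ.target := by simpa using he
    have := (hf _ (ψ.map_target he')).2
    rw [ψ.right_inv he'] at this
    simpa [eq] using this

/-- An injective map which is given by linear embeddings in charts `ψ`, `χ` such that `ψ` is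
defined on the inverse image of the domain of `χ`, is a smooth embedding. -/
theorem isSmoothEmbedding_of_linear_charts [FiniteDimensional ℝ E₀] {f : M → M₀}
    (hinj : Function.Injective f)
    (h : ∀ x, ∃ (ψ : OpenPartialHomeomorph M E) (χ : OpenPartialHomeomorph M₀ E₀) (l : E →L[ℝ] E₀),
      x ∈ ψ.source ∧ ψ ∈ IsManifold.maximalAtlas 𝓘(ℝ, E) ∞ M ∧
      χ ∈ IsManifold.maximalAtlas 𝓘(ℝ, E₀) ∞ M₀ ∧ Function.Injective l ∧
      ψ.source = f ⁻¹' χ.source ∧ ∀ y ∈ ψ.source, χ (f y) = l (ψ y)) :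
    Manifold.IsSmoothEmbedding 𝓘(ℝ, E) 𝓘(ℝ, E₀) ∞ f := by
  have himm : Manifold.IsImmersion 𝓘(ℝ, E) 𝓘(ℝ, E₀) ∞ f :=
    isImmersion_of_linear_charts fun x ↦ by
      obtain ⟨ψ, χ, l, hx, hψ, hχ, hl, hs, hf⟩ := h x
      exact ⟨ψ, χ, l, hx, hψ, hχ, hl, fun y hy ↦ ⟨by rw [hs] at hy; exact hy, hf y hy⟩⟩
  refine ⟨himm, ⟨Topology.isInducing_iff_nhds.2 fun x ↦ le_antisymm
    himm.contMDiff.continuous.continuousAt.le_comap ?_, hinj⟩⟩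
  obtain ⟨ψ, χ, l, hx, hψ, hχ, hl, hs, hf⟩ := h x
  have hx' : f x ∈ χ.source := by rw [hs] at hx; exact hx
  have hcl : Topology.IsEmbedding l := by
    have : FiniteDimensional ℝ E := Module.Finite.of_injective l.toLinearMap hl
    exact (l.toLinearMap.isClosedEmbedding_of_injective (LinearMap.ker_eq_bot.2 hl)).isEmbedding
  intro U hU
  have h1 : ψ.symm ⁻¹' U ∈ 𝓝 (ψ x) := ψ.symm.continuousAt (ψ.map_source hx) (by
    rw [ψ.left_inv hx]; exact hU)
  rw [hcl.isInducing.nhds_eq_comap, Filter.mem_comap] at h1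
  obtain ⟨O, hO, hOU⟩ := h1
  rw [← hf x hx] at hO
  have h2 := Filter.inter_mem (Filter.mem_map.1 (χ.continuousAt hx' hO))
    (χ.open_source.mem_nhds hx')
  refine Filter.mem_comap.2 ⟨_, h2, fun y hy ↦ ?_⟩
  -- Here `ψ.source` has to be the whole preimage of `χ.source`: no point outside the domain of `ψ`
  -- is sent near `f x`.
  have hy' : y ∈ ψ.source := by rw [hs]; exact hy.2
  have h3 : ψ y ∈ l ⁻¹' O := by
    rw [mem_preimage, ← hf y hy']; exact hy.1
  have := hOU h3
  rwa [mem_preimage, ψ.left_inv hy'] at this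

end LinearCharts

/-! ### Criteria for charts and for smoothness in charts -/

section Charts

variable {E M E₀ M₀ : Type*} [NormedAddCommGroup E] [NormedSpace ℝ E] [TopologicalSpace M]
  [ChartedSpace E M] [NormedAddCommGroup E₀] [NormedSpace ℝ E₀] [TopologicalSpace M₀]
  [ChartedSpace E₀ M₀]

/-- A partial homeomorphism onto an open set of the model space is a chart if it is smooth with a
smooth inverse. -/
theorem mem_maximalAtlas_of_contMDiffOn [IsManifold 𝓘(ℝ, E) ∞ M] {ψ : OpenPartialHomeomorph M E}
    (h : ContMDiffOn 𝓘(ℝ, E) 𝓘(ℝ, E) ∞ ψ ψ.source)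
    (h' : ContMDiffOn 𝓘(ℝ, E) 𝓘(ℝ, E) ∞ ψ.symm ψ.target) :
    ψ ∈ IsManifold.maximalAtlas 𝓘(ℝ, E) ∞ M := by
  intro φ hφ
  have hφ' := IsManifold.subset_maximalAtlas (I := 𝓘(ℝ, E)) (n := ∞) hφ
  constructor
  · refine (contDiffGroupoid ∞ 𝓘(ℝ, E)).mem_of_eqOnSource ?_ (Setoid.refl _)
    rw [contDiffGroupoid, mem_groupoid_of_pregroupoid]
    simp only [contDiffPregroupoid, modelWithCornersSelf_coe, modelWithCornersSelf_coe_symm,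
      range_id, inter_univ, preimage_id, Function.comp_id, Function.id_comp]
    constructor
    · rw [← contMDiffOn_iff_contDiffOn]
      exact (contMDiffOn_of_mem_maximalAtlas hφ').comp (h'.mono fun e he ↦ by
        simp only [mfld_simps] at he; exact he.1) fun e he ↦ by
          simp only [mfld_simps] at he; exact he.2
    · rw [← contMDiffOn_iff_contDiffOn]
      exact h.comp ((contMDiffOn_symm_of_mem_maximalAtlas hφ').mono fun e he ↦ by
        simp only [mfld_simps] at he; exact he.1) fun e he ↦ by
          simp only [mfld_simps] at he; exact he.2
  · refine (contDiffGroupoid ∞ 𝓘(ℝ, E)).mem_of_eqOnSource ?_ (Setoid.refl _)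
    rw [contDiffGroupoid, mem_groupoid_of_pregroupoid]
    simp only [contDiffPregroupoid, modelWithCornersSelf_coe, modelWithCornersSelf_coe_symm,
      range_id, inter_univ, preimage_id, Function.comp_id, Function.id_comp]
    constructor
    · rw [← contMDiffOn_iff_contDiffOn]
      exact h.comp ((contMDiffOn_symm_of_mem_maximalAtlas hφ').mono fun e he ↦ by
        simp only [mfld_simps] at he; exact he.1) fun e he ↦ by
          simp only [mfld_simps] at he; exact he.2
    · rw [← contMDiffOn_iff_contDiffOn]
      exact (contMDiffOn_of_mem_maximalAtlas hφ').comp (h'.mono fun e he ↦ by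
        simp only [mfld_simps] at he; exact he.1) fun e he ↦ by
          simp only [mfld_simps] at he; exact he.2

variable {F K N : Type*} [NormedAddCommGroup F] [NormedSpace ℝ F] [TopologicalSpace K]
  {I : ModelWithCorners ℝ F K} [TopologicalSpace N] [ChartedSpace K N]

/-- Smoothness may be checked after composition with an inverse chart. -/
theorem contMDiffOn_of_comp_symm {ψ : OpenPartialHomeomorph M E} {f : M → N} {T : Set E}
    (hψ : ψ ∈ IsManifold.maximalAtlas 𝓘(ℝ, E) ∞ M)
    (h : ContMDiffOn 𝓘(ℝ, E) I ∞ (f ∘ ψ.symm) T) :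
    ContMDiffOn 𝓘(ℝ, E) I ∞ f (ψ.source ∩ ψ ⁻¹' T) := by
  have h1 := h.comp ((contMDiffOn_of_mem_maximalAtlas hψ).mono
    (inter_subset_left (t := ψ ⁻¹' T))) fun x hx ↦ hx.2
  refine h1.congr fun x hx ↦ ?_
  simp [ψ.left_inv hx.1]

/-- Smoothness may be checked after composition with a chart. -/
theorem contMDiffOn_of_chart_comp {χ : OpenPartialHomeomorph M₀ E₀} {f : N → M₀} {S : Set N}
    (hχ : χ ∈ IsManifold.maximalAtlas 𝓘(ℝ, E₀) ∞ M₀) (hS : MapsTo f S χ.source)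
    (h : ContMDiffOn I 𝓘(ℝ, E₀) ∞ (χ ∘ f) S) :
    ContMDiffOn I 𝓘(ℝ, E₀) ∞ f S := by
  refine ((contMDiffOn_symm_of_mem_maximalAtlas hχ).comp h fun x hx ↦ χ.map_source (hS hx)).congr
    fun x hx ↦ ?_
  simp [χ.left_inv (hS hx)]

end Charts

/-! ### Change of charts by the inverse function theorem -/

section LocalDiffeo

variable {E M : Type*} [NormedAddCommGroup E] [NormedSpace ℝ E] [TopologicalSpace M]
  [ChartedSpace E M]

/-- Modification of a chart by a map which is tangent to the identity. -/
theorem exists_chart_comp [CompleteSpace E] [IsManifold 𝓘(ℝ, E) ∞ M] {ψ : OpenPartialHomeomorph M E}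
    (hψ : ψ ∈ IsManifold.maximalAtlas 𝓘(ℝ, E) ∞ M) {x : M} (hx : x ∈ ψ.source) {T : Set E}
    (hT : IsOpen T) (hxT : ψ x ∈ T) {Ψ : E → E} (hΨ : ContDiffOn ℝ ∞ Ψ T)
    (hid : HasFDerivAt Ψ (ContinuousLinearMap.id ℝ E) (ψ x)) {N : Set M} (hN : N ∈ 𝓝 x) :
    ∃ ψ' ∈ IsManifold.maximalAtlas 𝓘(ℝ, E) ∞ M, x ∈ ψ'.source ∧
      ∀ y ∈ ψ'.source, y ∈ ψ.source ∧ y ∈ N ∧ ψ y ∈ T ∧ ψ' y = Ψ (ψ y) := by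
  have hc : ContDiffAt ℝ ∞ Ψ (ψ x) := (hΨ _ hxT).contDiffAt (hT.mem_nhds hxT)
  have hid' : HasFDerivAt Ψ ((ContinuousLinearEquiv.refl ℝ E : E ≃L[ℝ] E) : E →L[ℝ] E) (ψ x) := hid
  let Θ := hc.toOpenPartialHomeomorph Ψ hid' (by simp)
  have hΘ : ∀ e, Θ e = Ψ e := fun e ↦ rfl
  have hxΘ : ψ x ∈ Θ.source := hc.mem_toOpenPartialHomeomorph_source hid' (by simp)
  -- A chart needs an inverse which is smooth on its whole target. It is enough to restrict to the
  -- open set where the derivative of `Ψ` is invertible.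
  have hU : IsOpen (T ∩ fderiv ℝ Ψ ⁻¹' (range ((↑) : (E ≃L[ℝ] E) → E →L[ℝ] E))) :=
    (hΨ.continuousOn_fderiv_of_isOpen hT (by simp)).isOpen_inter_preimage hT
      ContinuousLinearEquiv.isOpen
  set U := T ∩ fderiv ℝ Ψ ⁻¹' (range ((↑) : (E ≃L[ℝ] E) → E →L[ℝ] E)) with hUdef
  have hxU : ψ x ∈ U := ⟨hxT, ContinuousLinearEquiv.refl ℝ E, hid'.fderiv.symm⟩
  obtain ⟨O, hON, hO, hxO⟩ := mem_nhds_iff.1 hN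
  let ψ' := (ψ.restrOpen O hO).trans (Θ.restrOpen U hU)
  have hsrc : ∀ y, y ∈ ψ'.source ↔ (y ∈ ψ.source ∧ y ∈ O) ∧ ψ y ∈ Θ.source ∧ ψ y ∈ U := by
    intro y; simp [ψ']
  refine ⟨ψ', mem_maximalAtlas_of_contMDiffOn ?_ ?_, ?_, fun y hy ↦ ?_⟩
  · have h1 : ContMDiffOn 𝓘(ℝ, E) 𝓘(ℝ, E) ∞ Ψ T := contMDiffOn_iff_contDiffOn.2 hΨ
    exact h1.comp ((contMDiffOn_of_mem_maximalAtlas hψ).mono fun y hy ↦ ((hsrc y).1 hy).1.1)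
      fun y hy ↦ ((hsrc y).1 hy).2.2.1
  · have h1 : ContMDiffOn 𝓘(ℝ, E) 𝓘(ℝ, E) ∞ Θ.symm ψ'.target := by
      rw [contMDiffOn_iff_contDiffOn]
      intro e he
      have he' : e ∈ Θ.target ∧ Θ.symm e ∈ U := by
        simp only [ψ', mfld_simps] at he; exact he.1
      obtain ⟨L, hL⟩ := he'.2.2
      apply ContDiffAt.contDiffWithinAt
      have hcL : ContDiffAt ℝ ∞ Ψ (Θ.symm e) :=
        (hΨ _ he'.2.1).contDiffAt (hT.mem_nhds he'.2.1)
      refine Θ.contDiffAt_symm (f₀' := L) he'.1 ?_ hcL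
      rw [hL]
      exact (hcL.differentiableAt (by simp)).hasFDerivAt
    refine (contMDiffOn_symm_of_mem_maximalAtlas hψ).comp h1 fun e he ↦ ?_
    simp only [ψ', mfld_simps] at he; exact he.2.1
  · exact (hsrc x).2 ⟨⟨hx, hxO⟩, hxΘ, hxU⟩
  · have h := (hsrc y).1 hy
    exact ⟨h.1.1, hON h.1.2, h.2.2.1, rfl⟩

end LocalDiffeo

/-! ### Linear algebra: a section compatible with the projections -/

section SubmersionChart

variable {E' V E M E₀' V₀ E₀ M₀ : Type*} [NormedAddCommGroup E'] [NormedSpace ℝ E']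
  [TopologicalSpace V] [ChartedSpace E' V] [NormedAddCommGroup E] [NormedSpace ℝ E]
  [TopologicalSpace M] [ChartedSpace E M] [NormedAddCommGroup E₀'] [NormedSpace ℝ E₀']
  [TopologicalSpace V₀] [ChartedSpace E₀' V₀] [NormedAddCommGroup E₀] [NormedSpace ℝ E₀]
  [TopologicalSpace M₀] [ChartedSpace E₀ M₀]

/-- Adapted charts of two pairs of manifolds, in which a map `f` is a linear surjection `p`
compatible with the projections, with a compatible linear section `σ`. -/
structure SubmersionChart (i : SmoothEmbedding E' V E M) (i₀ : SmoothEmbedding E₀' V₀ E₀ M₀)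
    (f : M → M₀) where
  A : AdaptedChart i
  B : AdaptedChart i₀
  p : E →L[ℝ] E₀
  σ : E₀ →L[ℝ] E
  p_σ : ∀ e, p (σ e) = e
  p_P : ∀ e, p (A.P e) = B.P (p e)
  P_σ : ∀ e, A.P (σ e) = σ (B.P e)
  mapsTo : ∀ x ∈ A.ψ.source, f x ∈ B.ψ.source
  eq : ∀ x ∈ A.ψ.source, B.ψ (f x) = p (A.ψ x)

/-- Linear model of a submersion of pairs. The subspace `ker P` is prescribed, but its complement is
not, so `P` may be replaced by a projection `Q` with the same kernel. Splitting `E` as `σ(E₀) ⊕ ker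
L`, with a section `σ` which sends `ker P₀` into `ker P`, makes `Q` compatible with both `L` and
`σ`. -/
theorem exists_compatible_section [FiniteDimensional ℝ E] [FiniteDimensional ℝ E₀]
    (P : E →L[ℝ] E) (hP : ∀ e, P (P e) = P e) (P₀ : E₀ →L[ℝ] E₀) (hP₀ : ∀ e, P₀ (P₀ e) = P₀ e)
    (L : E →L[ℝ] E₀) (hL : Function.Surjective L) (hLP : ∀ e, P e = 0 → P₀ (L e) = 0)
    (hLP' : ∀ y, P₀ y = 0 → ∃ e, P e = 0 ∧ L e = y) :
    ∃ (Q : E →L[ℝ] E) (σ : E₀ →L[ℝ] E), (∀ e, Q (Q e) = Q e) ∧ (∀ e, Q e = 0 ↔ P e = 0) ∧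
      (∀ y, L (σ y) = y) ∧ (∀ e, L (Q e) = P₀ (L e)) ∧ ∀ y, Q (σ y) = σ (P₀ y) := by
  obtain ⟨σ₂, hσ₂⟩ := L.toLinearMap.exists_rightInverse_of_surjective (LinearMap.range_eq_top.2 hL)
  have hσ₂' : ∀ y, L (σ₂ y) = y := fun y ↦ LinearMap.congr_fun hσ₂ y
  let l : P.ker →ₗ[ℝ] P₀.ker := L.toLinearMap.restrict fun e he ↦ hLP e he
  have hl : Function.Surjective l := fun ⟨y, hy⟩ ↦ by
    obtain ⟨e, he, rfl⟩ := hLP' y hy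
    exact ⟨⟨e, he⟩, rfl⟩
  obtain ⟨σ₁, hσ₁⟩ := l.exists_rightInverse_of_surjective (LinearMap.range_eq_top.2 hl)
  have hσ₁' : ∀ y, L (σ₁ y : E) = y := fun y ↦ congrArg Subtype.val (LinearMap.congr_fun hσ₁ y)
  let R₀ : E₀ →ₗ[ℝ] P₀.ker := (LinearMap.id - P₀.toLinearMap).codRestrict _ fun e ↦ by
    show P₀ (e - P₀ e) = 0
    simp [hP₀]
  -- A section with values in `ker P` is used on `ker P₀`, and an arbitrary section on the image of
  -- `P₀`.
  let σ : E₀ →ₗ[ℝ] E := P.ker.subtype ∘ₗ σ₁ ∘ₗ R₀ + σ₂ ∘ₗ P₀.toLinearMap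
  have hσ : ∀ y, L (σ y) = y := fun y ↦ by
    show L ((σ₁ (R₀ y) : E) + σ₂ (P₀ y)) = y
    rw [map_add, hσ₁', hσ₂']
    show y - P₀ y + P₀ y = y
    abel
  have hPσ : ∀ y, P₀ y = 0 → P (σ y) = 0 := fun y hy ↦ by
    show P ((σ₁ (R₀ y) : E) + σ₂ (P₀ y)) = 0
    rw [hy, map_zero, add_zero]
    exact (σ₁ (R₀ y)).2
  let σ' : E₀ →L[ℝ] E := σ.toContinuousLinearMap
  have hσσ : ∀ y, σ' y = σ y := fun y ↦ rfl
  let N : E →L[ℝ] E := ContinuousLinearMap.id ℝ E - σ'.comp L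
  have hN : ∀ e, N e = e - σ (L e) := fun e ↦ rfl
  have hLN : ∀ e, L (N e) = 0 := fun e ↦ by rw [hN, map_sub, hσ, sub_self]
  have hNσ : ∀ y, N (σ y) = 0 := fun e ↦ by rw [hN, hσ, sub_self]
  have hNN : ∀ e, N (N e) = N e := fun e ↦ by rw [hN (N e), hLN, map_zero, sub_zero]
  have hNP : ∀ e, P e = 0 → P (N e) = 0 := fun e he ↦ by
    rw [hN, map_sub, he, hPσ _ (hLP e he), sub_zero]
  have hPN : ∀ e, P (N (P e)) = P (N e) := fun e ↦ by
    have : P (N (e - P e)) = 0 := hNP _ (by rw [map_sub, hP, sub_self])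
    rw [map_sub, map_sub, sub_eq_zero] at this
    exact this.symm
  -- On the image of `σ` this is `P₀` carried by `σ`; on `ker L`, the image of `N`, it is `N P`,
  -- which is idempotent because `P N P = P N`.
  let Q : E →L[ℝ] E := σ'.comp (P₀.comp L) + N.comp (P.comp N)
  have hQ : ∀ e, Q e = σ (P₀ (L e)) + N (P (N e)) := fun e ↦ rfl
  have hLQ : ∀ e, L (Q e) = P₀ (L e) := fun e ↦ by rw [hQ, map_add, hLN, hσ, add_zero]
  have hNQ : ∀ e, N (Q e) = N (P (N e)) := fun e ↦ by
    rw [hQ, map_add, hNσ, hNN, zero_add]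
  refine ⟨Q, σ', fun e ↦ ?_, fun e ↦ ⟨fun h ↦ ?_, fun h ↦ ?_⟩, hσ, hLQ, fun y ↦ ?_⟩
  · rw [hQ (Q e), hLQ, hNQ, hP₀, hPN, hNN, ← hQ]
  · have h1 : P₀ (L e) = 0 := by rw [← hLQ, h, map_zero]
    have h2 : N (P (N e)) = 0 := by rw [← hNQ, h, map_zero]
    have h3 : P (N e) = 0 := by
      have := congrArg P h2
      rwa [hPN, hNN, map_zero] at this
    have h4 : e = N e + σ (L e) := by rw [hN]; abel
    rw [h4, map_add, h3, hPσ _ h1, add_zero]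
  · rw [hQ, hLP e h, hNP e h]; simp
  · rw [hσσ, hQ, hσ, hNσ]; simp [hσσ]

end SubmersionChart

/-! ### Adapted charts in which a submersion of pairs is linear -/

section SubmersionChart

variable {E' V E M E₀' V₀ E₀ M₀ : Type*} [NormedAddCommGroup E'] [NormedSpace ℝ E']
  [TopologicalSpace V] [ChartedSpace E' V] [NormedAddCommGroup E] [NormedSpace ℝ E]
  [TopologicalSpace M] [ChartedSpace E M] [NormedAddCommGroup E₀'] [NormedSpace ℝ E₀']
  [TopologicalSpace V₀] [ChartedSpace E₀' V₀] [NormedAddCommGroup E₀] [NormedSpace ℝ E₀]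
  [TopologicalSpace M₀] [ChartedSpace E₀ M₀]

theorem mfderiv_surjective_of_isSubmersion {f : M → M₀}
    (hf : Manifold.IsSubmersion 𝓘(ℝ, E) 𝓘(ℝ, E₀) ∞ f) (x : M) :
    Function.Surjective (mfderiv 𝓘(ℝ, E) 𝓘(ℝ, E₀) f x) := by
  obtain ⟨F, _, _, hF⟩ := hf
  have h := hF x
  have hd : MDifferentiableAt 𝓘(ℝ, E) 𝓘(ℝ, E₀) f x := h.contMDiffAt.mdifferentiableAt (by simp)
  have h1 := h.mem_domChart_source
  have h2 := h.mem_codChart_source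
  have heq : (h.codChart ∘ f : M → E₀) =ᶠ[𝓝 x] (Prod.fst ∘ h.equiv) ∘ h.domChart := by
    filter_upwards [h.domChart.open_source.mem_nhds h1] with w hw
    have := h.writtenInCharts (show h.domChart w ∈ (h.domChart.extend 𝓘(ℝ, E)).target by
      simpa using h.domChart.map_source hw)
    simpa [hw] using this
  let p : E →L[ℝ] E₀ := (ContinuousLinearMap.fst ℝ E₀ F).comp (h.equiv : E →L[ℝ] E₀ × F)
  have e1 := mfderiv_comp x
    ((mdifferentiable_of_mem h.codChart_mem_maximalAtlas).mdifferentiableAt h2) hd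
  have e2 := mfderiv_comp x (p.differentiableAt (x := h.domChart x)).mdifferentiableAt
    ((mdifferentiable_of_mem h.domChart_mem_maximalAtlas).mdifferentiableAt h1)
  have hp : (Prod.fst ∘ h.equiv : E → E₀) = p := rfl
  rw [heq.mfderiv_eq, hp, e2, mfderiv_eq_fderiv] at e1
  have hfd : fderiv ℝ p (h.domChart x) = p := p.fderiv
  rw [hfd] at e1
  intro y
  obtain ⟨w, hw⟩ := (dchart_bijective h.domChart_mem_maximalAtlas h1).2
    (h.equiv.symm (dchart h.codChart (f x) y, 0))
  refine ⟨w, (dchart_bijective h.codChart_mem_maximalAtlas h2).1 ?_⟩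
  have e3 : p (dchart h.domChart x w) =
    dchart h.codChart (f x) (mfderiv 𝓘(ℝ, E) 𝓘(ℝ, E₀) f x w) := DFunLike.congr_fun e1 w
  rw [← e3, hw]
  show (h.equiv (h.equiv.symm (dchart h.codChart (f x) y, 0))).1 = _
  simp

/-- All tangent spaces have the model space as underlying space, so a vector may be read at either
of two base points which are equal for a non-obvious reason. -/
theorem dchart_congr_point (ψ : M → E) {x y : M} (h : x = y) (w : E) :
    dchart ψ x (w : TangentSpace 𝓘(ℝ, E) x) =
      dchart ψ y (w : TangentSpace 𝓘(ℝ, E) y) := by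
  subst h; rfl

/-- The derivative of a map in charts. -/
theorem dchart_mfderiv {f : M → M₀} {x : M} {ψ : OpenPartialHomeomorph M E}
    {χ : OpenPartialHomeomorph M₀ E₀}
    (hf : MDifferentiableAt 𝓘(ℝ, E) 𝓘(ℝ, E₀) f x)
    (hψ : ψ ∈ IsManifold.maximalAtlas 𝓘(ℝ, E) ∞ M) (hx : x ∈ ψ.source)
    (hχ : χ ∈ IsManifold.maximalAtlas 𝓘(ℝ, E₀) ∞ M₀) (hx' : f x ∈ χ.source)
    {g : E → E₀} (hg : DifferentiableAt ℝ g (ψ x)) (hfg : ∀ᶠ y in 𝓝 x, χ (f y) = g (ψ y))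
    (w : TangentSpace 𝓘(ℝ, E) x) :
    dchart χ (f x) (mfderiv 𝓘(ℝ, E) 𝓘(ℝ, E₀) f x w) = fderiv ℝ g (ψ x) (dchart ψ x w) := by
  have e1 := mfderiv_comp x ((mdifferentiable_of_mem hχ).mdifferentiableAt hx') hf
  have e2 := mfderiv_comp x hg.mdifferentiableAt
    ((mdifferentiable_of_mem hψ).mdifferentiableAt hx)
  have heq : (χ ∘ f : M → E₀) =ᶠ[𝓝 x] g ∘ ψ := hfg
  rw [heq.mfderiv_eq, e2, mfderiv_eq_fderiv] at e1
  exact (DFunLike.congr_fun e1 w).symm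

/-- Around a point of the submanifold, a submersion of pairs has a submersion chart. -/
theorem exists_submersionChart [FiniteDimensional ℝ E] [FiniteDimensional ℝ E₀]
    [IsManifold 𝓘(ℝ, E) ∞ M] (i : SmoothEmbedding E' V E M)
    (i₀ : SmoothEmbedding E₀' V₀ E₀ M₀) {f : M → M₀} {g : V → V₀}
    (hf : Manifold.IsSubmersion 𝓘(ℝ, E) 𝓘(ℝ, E₀) ∞ f)
    (hg : Manifold.IsSubmersion 𝓘(ℝ, E') 𝓘(ℝ, E₀') ∞ g) (hfg : ∀ v, f (i v) = i₀ (g v)) (v : V) :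
    ∃ C : SubmersionChart i i₀ f, i v ∈ C.A.ψ.source := by
  obtain ⟨A, hA⟩ := exists_adaptedChart i v
  obtain ⟨B, hB⟩ := exists_adaptedChart i₀ (g v)
  rw [← hfg] at hB
  have hcf := hf.contMDiff
  have hcg := hg.contMDiff
  set e₀ := A.ψ (i v) with he₀
  set fh : E → E₀ := B.ψ ∘ f ∘ A.ψ.symm with hfh
  have hTo : IsOpen (A.ψ.target ∩ A.ψ.symm ⁻¹' (f ⁻¹' B.ψ.source)) :=
    A.ψ.isOpen_inter_preimage_symm (B.ψ.open_source.preimage hcf.continuous)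
  set T := A.ψ.target ∩ A.ψ.symm ⁻¹' (f ⁻¹' B.ψ.source) with hT
  have he₀T : e₀ ∈ T := ⟨A.ψ.map_source hA, by
    show f (A.ψ.symm (A.ψ (i v))) ∈ B.ψ.source
    rwa [A.ψ.left_inv hA]⟩
  have hfs : ContDiffOn ℝ ∞ fh T := by
    rw [← contMDiffOn_iff_contDiffOn]
    exact (contMDiffOn_of_mem_maximalAtlas B.mem).comp (hcf.comp_contMDiffOn
      ((contMDiffOn_symm_of_mem_maximalAtlas A.mem).mono inter_subset_left)) fun e he ↦ he.2
  have hfa : ContDiffAt ℝ ∞ fh e₀ := (hfs _ he₀T).contDiffAt (hTo.mem_nhds he₀T)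
  have hfd : HasFDerivAt fh (fderiv ℝ fh e₀) e₀ :=
    (hfa.differentiableAt (by simp)).hasFDerivAt
  set L := fderiv ℝ fh e₀ with hL
  have hPe₀ : A.P e₀ = 0 := (A.slice _ hA).1 ⟨v, rfl⟩
  have hslice : ∀ e ∈ T, A.P e = 0 → B.P (fh e) = 0 := by
    intro e he h0
    obtain ⟨w, hw⟩ := (A.slice _ (A.ψ.map_target he.1)).2 (by rwa [A.ψ.right_inv he.1])
    refine (B.slice _ he.2).1 ⟨g w, ?_⟩
    rw [← hfg, hw]
  have hLd : ∀ w, dchart B.ψ (f (i v)) (mfderiv 𝓘(ℝ, E) 𝓘(ℝ, E₀) f (i v) w) =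
      L (dchart A.ψ (i v) w) := fun w ↦
    dchart_mfderiv (hcf.mdifferentiableAt (by simp)) A.mem hA B.mem hB
      (hfa.differentiableAt (by simp)) (by
        filter_upwards [A.ψ.open_source.mem_nhds hA] with y hy
        simp [hfh, A.ψ.left_inv hy]) w
  have hLs : Function.Surjective L := by
    intro y
    obtain ⟨z, rfl⟩ := (dchart_bijective B.mem hB).2 y
    obtain ⟨w, rfl⟩ := mfderiv_surjective_of_isSubmersion hf _ z
    exact ⟨_, (hLd w).symm⟩
  -- The map `fh` sends the slice of `V` into that of `V₀`; differentiate along a line in the slice.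
  have hLP : ∀ e, A.P e = 0 → B.P (L e) = 0 := by
    intro k hk
    have h1 : HasDerivAt (fun τ : ℝ ↦ e₀ + τ • k) k 0 := by
      simpa using ((hasDerivAt_id (0 : ℝ)).smul_const k).const_add e₀
    have h2 : HasDerivAt (fun τ : ℝ ↦ B.P (fh (e₀ + τ • k))) (B.P (L k)) 0 := by
      have : HasFDerivAt fh L (e₀ + (0 : ℝ) • k) := by simpa using hfd
      exact B.P.hasFDerivAt.comp_hasDerivAt 0 (this.comp_hasDerivAt 0 h1)
    have h3 : (fun τ : ℝ ↦ B.P (fh (e₀ + τ • k))) =ᶠ[𝓝 0] fun _ ↦ 0 := by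
      have : ∀ᶠ τ : ℝ in 𝓝 0, e₀ + τ • k ∈ T :=
        h1.continuousAt.preimage_mem_nhds (hTo.mem_nhds (by simpa using he₀T))
      filter_upwards [this] with τ hτ
      exact hslice _ hτ (by simp [hPe₀, hk])
    exact h2.unique ((hasDerivAt_const (0 : ℝ) (0 : E₀)).congr_of_eventuallyEq h3)
  have hgs := mfderiv_surjective_of_isSubmersion hg v
  -- This is where the submersion `g` enters: a vector tangent to `V₀` is lifted to a vector tangent
  -- to `V`.
  have hLP' : ∀ y, B.P y = 0 → ∃ e, A.P e = 0 ∧ L e = y := by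
    intro y hy
    obtain ⟨z, rfl⟩ := (dchart_bijective B.mem hB).2 y
    have hB' : i₀ (g v) ∈ B.ψ.source := by rw [← hfg]; exact hB
    have e1 := mfderiv_comp v (hcf.mdifferentiableAt (x := i v) (by simp)) (i.mdifferentiableAt v)
    have e2 := mfderiv_comp v (i₀.mdifferentiableAt (g v))
      (hcg.mdifferentiableAt (x := v) (by simp))
    have hcomp : (f ∘ i : V → M₀) = i₀ ∘ g := funext hfg
    have hz : ∃ b, mfderiv 𝓘(ℝ, E₀') 𝓘(ℝ, E₀) i₀ (g v) b = (z : E₀) := by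
      have := (B.proj_dchart_eq_zero hB' (z : TangentSpace 𝓘(ℝ, E₀) (i₀ (g v)))).1 ((congrArg B.P (dchart_congr_point B.ψ (hfg v) z)).symm.trans hy)
      exact this
    obtain ⟨b, hb⟩ := hz
    obtain ⟨a, rfl⟩ := hgs b
    refine ⟨dchart A.ψ (i v) (mfderiv 𝓘(ℝ, E') 𝓘(ℝ, E) i v a),
      (A.proj_dchart_eq_zero hA _).2 ⟨a, rfl⟩, ?_⟩
    rw [← hLd]
    congr 1
    rw [hcomp, e2] at e1
    exact (DFunLike.congr_fun e1 a).symm.trans hb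
  obtain ⟨Q, σ, hQ, hQP, hσ, hLQ, hQσ⟩ :=
    exists_compatible_section A.P A.idem B.P B.idem L hLs hLP hLP'
  have hPσ : ∀ y, B.P y = 0 → A.P (σ y) = 0 := fun y hy ↦ by
    rw [← hQP, hQσ, hy, map_zero]
  -- The change of coordinates which makes `f` linear: `L ∘ Ψ = fh`. It is tangent to the identity
  -- at `e₀` because `L` is the derivative of `fh` there.
  set Ψ : E → E := fun e ↦ e + σ (fh e - L e) with hΨdef
  have hΨ : ContDiffOn ℝ ∞ Ψ T :=
    contDiffOn_id.add (σ.contDiff.comp_contDiffOn (hfs.sub L.contDiff.contDiffOn))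
  have hΨid : HasFDerivAt Ψ (ContinuousLinearMap.id ℝ E) e₀ := by
    have h1 := (hasFDerivAt_id e₀).add (σ.hasFDerivAt.comp e₀ (hfd.sub L.hasFDerivAt))
    exact HasFDerivAt.congr_fderiv (f := Ψ) h1 (by ext; simp)
  have hLΨ : ∀ e, L (Ψ e) = fh e := fun e ↦ by simp [hΨdef, hσ]
  have hPΨ : ∀ e ∈ T, A.P e = 0 → A.P (Ψ e) = 0 := fun e he h0 ↦ by
    simp only [hΨdef, map_add, h0, zero_add]
    exact hPσ _ (by rw [map_sub, hslice e he h0, hLP e h0, sub_zero])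
  have hΨa : ContDiffAt ℝ ∞ Ψ e₀ := (hΨ _ he₀T).contDiffAt (hTo.mem_nhds he₀T)
  -- `Ψ` preserves the slice `P = 0`; the converse, that `P (Ψ e) = 0` forces `P e = 0`, uses the
  -- local injectivity of `Ξ`. If `P (Ψ e) = 0`, then `Ξ e = e - P e = Ξ (e - P e)`, so `e = e - P
  -- e`.
  set Ξ : E → E := fun e ↦ A.P (Ψ e) + (e - A.P e) with hΞdef
  have hΞa : ContDiffAt ℝ ∞ Ξ e₀ :=
    (A.P.contDiff.contDiffAt.comp e₀ hΨa).add (contDiffAt_id.sub A.P.contDiff.contDiffAt)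
  have hΞid : HasFDerivAt Ξ ((ContinuousLinearEquiv.refl ℝ E : E ≃L[ℝ] E) : E →L[ℝ] E) e₀ := by
    have h1 := (A.P.hasFDerivAt.comp e₀ hΨid).add ((hasFDerivAt_id e₀).sub A.P.hasFDerivAt)
    exact HasFDerivAt.congr_fderiv (f := Ξ) h1 (by ext; simp)
  let Θ := hΞa.toOpenPartialHomeomorph Ξ hΞid (by simp)
  have hΘ : ∀ e, Θ e = Ξ e := fun e ↦ rfl
  have he₀Θ : e₀ ∈ Θ.source := hΞa.mem_toOpenPartialHomeomorph_source hΞid (by simp)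
  have hN : {e | e ∈ Θ.source ∧ e - A.P e ∈ Θ.source ∧ e - A.P e ∈ T} ∈ 𝓝 e₀ := by
    have hc : ContinuousAt (fun e ↦ e - A.P e) e₀ := by fun_prop
    have he : e₀ - A.P e₀ = e₀ := by rw [hPe₀, sub_zero]
    refine Filter.inter_mem (Θ.open_source.mem_nhds he₀Θ)
      (Filter.inter_mem (hc.preimage_mem_nhds ?_) (hc.preimage_mem_nhds ?_))
    · rw [he]; exact Θ.open_source.mem_nhds he₀Θ
    · rw [he]; exact hTo.mem_nhds he₀T
  obtain ⟨ψ', hψ', hx', hψ'e⟩ := exists_chart_comp A.mem hA hTo he₀T hΨ hΨid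
    ((A.ψ.continuousAt hA).preimage_mem_nhds hN)
  refine ⟨⟨⟨ψ', hψ', Q, hQ, ?_, fun x hx ↦ ?_⟩, B, L, σ, hσ, hLQ, hQσ, fun x hx ↦ ?_,
    fun x hx ↦ ?_⟩, hx'⟩
  · have : Q.ker = A.P.ker := by ext e; exact hQP e
    rw [this]; exact A.finrank_ker
  · obtain ⟨h1, h2, h3, h4⟩ := hψ'e x hx
    rw [A.slice x h1, hQP, h4]
    refine ⟨hPΨ _ h3, fun h0 ↦ ?_⟩
    obtain ⟨k1, k2, k3⟩ := h2
    have hPP : A.P (A.ψ x - A.P (A.ψ x)) = 0 := by rw [map_sub, A.idem, sub_self]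
    have : A.ψ x = A.ψ x - A.P (A.ψ x) := by
      apply Θ.injOn k1 k2
      rw [hΘ, hΘ]
      simp only [hΞdef]
      rw [h0, hPΨ _ k3 hPP, hPP, sub_zero]
    rw [this]; exact hPP
  · obtain ⟨h1, h2, h3, h4⟩ := hψ'e x hx
    have := h3.2
    rwa [mem_preimage, A.ψ.left_inv h1] at this
  · obtain ⟨h1, h2, h3, h4⟩ := hψ'e x hx
    show B.ψ (f x) = L (ψ' x)
    rw [h4, hLΨ]
    simp [hfh, A.ψ.left_inv h1]

end SubmersionChart

/-! ### The projections of the deformation space to `M` and to the line, and its charts -/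

section DNC

variable {E' V E M : Type*} [NormedAddCommGroup E'] [NormedSpace ℝ E'] [TopologicalSpace V]
  [ChartedSpace E' V] [NormedAddCommGroup E] [NormedSpace ℝ E] [TopologicalSpace M]
  [ChartedSpace E M] {i : SmoothEmbedding E' V E M}

namespace DNC

/-- The map `DNC(M, V) → M`. -/
def pt : DNC i → M
  | .gen x _ _ => x
  | .nor n => i n.base

/-- The map `DNC(M, V) → ℝ`. -/
def param : DNC i → ℝ
  | .gen _ t _ => t
  | .nor _ => 0

@[simp] theorem pt_gen (x : M) (t : ℝ) (ht : t ≠ 0) : pt (.gen x t ht : DNC i) = x := rfl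
@[simp] theorem pt_nor (n : NormalBundle i) : pt (.nor n : DNC i) = i n.base := rfl
@[simp] theorem param_gen (x : M) (t : ℝ) (ht : t ≠ 0) : param (.gen x t ht : DNC i) = t := rfl
@[simp] theorem param_nor (n : NormalBundle i) : param (.nor n : DNC i) = 0 := rfl

theorem eq_gen {p : DNC i} (h : param p ≠ 0) : p = .gen (pt p) (param p) h := by
  cases p with
  | gen x t ht => rfl
  | nor n => exact (h rfl).elim

theorem exists_nor {p : DNC i} (h : param p = 0) : ∃ n, p = .nor n := by
  cases p with
  | gen x t ht => exact (ht h).elim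
  | nor n => exact ⟨n, rfl⟩

open Classical in
/-- The map `(x, t) ↦ (x, t)` from `M × ℝ*`, with a junk value for `t = 0`. -/
noncomputable def genD (i : SmoothEmbedding E' V E M) (q : M × ℝ) : DNC i :=
  if h : q.2 = 0 then .gen q.1 1 one_ne_zero else .gen q.1 q.2 h

theorem genD_of_ne {x : M} {t : ℝ} (ht : t ≠ 0) : genD i (x, t) = .gen x t ht := dif_neg ht

end DNC

variable [FiniteDimensional ℝ E]

namespace AdaptedChart

variable [IsManifold 𝓘(ℝ, E) ∞ M] (A : AdaptedChart i)

/-- The chart of the deformation space given by an adapted chart. -/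
noncomputable def dnc : OpenPartialHomeomorph (DNC i) (E × ℝ) :=
  (DNC.smoothAtlas i).homeo (e := A.dncChart) (.inr ⟨A, rfl⟩)

theorem dnc_mem : A.dnc ∈ IsManifold.maximalAtlas 𝓘(ℝ, E × ℝ) ∞ (DNC i) :=
  (DNC.smoothAtlas i).homeo_mem _

theorem mem_dnc_source {p : DNC i} : p ∈ A.dnc.source ↔ p.pt ∈ A.ψ.source := by
  cases p <;> rfl

theorem mem_dnc_target {q : E × ℝ} : q ∈ A.dnc.target ↔ A.scale q.2 q.1 ∈ A.ψ.target := Iff.rfl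

theorem dnc_gen (x : M) (t : ℝ) (ht : t ≠ 0) : A.dnc (.gen x t ht) = (A.scale t⁻¹ (A.ψ x), t) := rfl

theorem dnc_nor (n : NormalBundle i) : A.dnc (.nor n) = (A.coord n, 0) := rfl

theorem dnc_snd (p : DNC i) : (A.dnc p).2 = p.param := by cases p <;> rfl

theorem dnc_symm_ne {e : E} {t : ℝ} (ht : t ≠ 0) :
    A.dnc.symm (e, t) = .gen (A.ψ.symm (A.scale t e)) t ht := A.dncChart_symm_ne ht

theorem dnc_symm_zero {e : E} (he : e - A.P e ∈ A.ψ.target) :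
    A.dnc.symm (e, 0) = .nor (A.lift e (A.exists_base he)) := A.dncChart_symm_zero he

theorem pt_dnc_symm {q : E × ℝ} (hq : q ∈ A.dnc.target) :
    (A.dnc.symm q).pt = A.ψ.symm (A.scale q.2 q.1) := by
  obtain ⟨e, t⟩ := q
  by_cases ht : t = 0
  · subst ht
    have hq' : e - A.P e ∈ A.ψ.target := by simpa using A.mem_dnc_target.1 hq
    rw [A.dnc_symm_zero hq', DNC.pt_nor, A.lift_base, scale_zero]
  · rw [A.dnc_symm_ne ht]; rfl

theorem scale_dnc {p : DNC i} (hp : p.pt ∈ A.ψ.source) :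
    A.scale (A.dnc p).2 (A.dnc p).1 = A.ψ p.pt := by
  have h := A.mem_dnc_source.2 hp
  have h1 := A.pt_dnc_symm (A.dnc.map_source h)
  rw [A.dnc.left_inv h] at h1
  rw [h1, A.ψ.right_inv (A.dnc.map_source h)]

/-- The chart of the normal bundle given by an adapted chart. -/
noncomputable def normal (n₀ : NormalBundle i) : OpenPartialHomeomorph (NormalBundle i) E :=
  (NormalBundle.smoothAtlas i).homeo (e := A.normalChart n₀) ⟨A, n₀, rfl⟩

omit [IsManifold 𝓘(ℝ, E) ∞ M] in
theorem normal_mem (n₀ : NormalBundle i) :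
    A.normal n₀ ∈ IsManifold.maximalAtlas 𝓘(ℝ, E) ∞ (NormalBundle i) :=
  (NormalBundle.smoothAtlas i).homeo_mem _

end AdaptedChart

namespace DNC

variable [IsManifold 𝓘(ℝ, E) ∞ M]

/-- The chart of the part `t ≠ 0` of the deformation space given by a chart of `M`. -/
noncomputable def genHomeo (i : SmoothEmbedding E' V E M) {ψ : OpenPartialHomeomorph M E}
    (hψ : ψ ∈ IsManifold.maximalAtlas 𝓘(ℝ, E) ∞ M) : OpenPartialHomeomorph (DNC i) (E × ℝ) :=
  (smoothAtlas i).homeo (e := genChart i ψ) (.inl ⟨ψ, hψ, rfl⟩)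

variable {ψ : OpenPartialHomeomorph M E} (hψ : ψ ∈ IsManifold.maximalAtlas 𝓘(ℝ, E) ∞ M)

theorem genHomeo_mem : genHomeo i hψ ∈ IsManifold.maximalAtlas 𝓘(ℝ, E × ℝ) ∞ (DNC i) :=
  (smoothAtlas i).homeo_mem _

theorem mem_genHomeo_source {p : DNC i} :
    p ∈ (genHomeo i hψ).source ↔ p.pt ∈ ψ.source ∧ p.param ≠ 0 := by
  cases p with
  | gen x t ht => exact ⟨fun h ↦ ⟨h, ht⟩, fun h ↦ h.1⟩
  | nor n => exact ⟨fun h ↦ h.elim, fun h ↦ (h.2 rfl).elim⟩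

theorem genHomeo_symm_apply {e : E} {t : ℝ} (ht : t ≠ 0) :
    (genHomeo i hψ).symm (e, t) = .gen (ψ.symm e) t ht := genChart_symm ht

/-- In the chart deduced from an adapted chart the projection is `(e, t) ↦ A.ψ.symm (A.scale t e)`,
which is smooth across `t = 0`. -/
theorem contMDiff_pt : ContMDiff 𝓘(ℝ, E × ℝ) 𝓘(ℝ, E) ∞ (pt : DNC i → M) := by
  intro p
  cases p with
  | gen x t ht =>
    have hψ := IsManifold.chart_mem_maximalAtlas (I := 𝓘(ℝ, E)) (n := ∞) x
    have hs := (mem_genHomeo_source (i := i) hψ (p := .gen x t ht)).2 ⟨mem_chart_source E x, ht⟩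
    have h1 : ContMDiffOn 𝓘(ℝ, E × ℝ) 𝓘(ℝ, E) ∞ (pt ∘ (genHomeo i hψ).symm)
        (genHomeo i hψ).target :=
      ((contMDiffOn_symm_of_mem_maximalAtlas hψ).comp contDiff_fst.contMDiff.contMDiffOn
        fun q hq ↦ hq.1).congr fun q hq ↦ by
          obtain ⟨e, t⟩ := q
          rw [Function.comp_apply, genHomeo_symm_apply hψ hq.2]; rfl
    refine (contMDiffOn_of_comp_symm (genHomeo_mem hψ) h1).contMDiffAt ?_
    exact Filter.inter_mem ((genHomeo i hψ).open_source.mem_nhds hs)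
      (Filter.mem_of_superset ((genHomeo i hψ).open_source.mem_nhds hs)
        (genHomeo i hψ).mapsTo)
  | nor n =>
    obtain ⟨A, hA⟩ := exists_adaptedChart i n.base
    have hs := A.mem_dnc_source.2 (show (DNC.nor n : DNC i).pt ∈ _ from hA)
    have h1 : ContMDiffOn 𝓘(ℝ, E × ℝ) 𝓘(ℝ, E) ∞ (pt ∘ A.dnc.symm) A.dnc.target :=
      ((contMDiffOn_symm_of_mem_maximalAtlas A.mem).comp A.contDiff_scale.contMDiff.contMDiffOn
        fun q hq ↦ hq).congr fun q hq ↦ A.pt_dnc_symm hq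
    refine (contMDiffOn_of_comp_symm A.dnc_mem h1).contMDiffAt ?_
    exact Filter.inter_mem (A.dnc.open_source.mem_nhds hs)
      (Filter.mem_of_superset (A.dnc.open_source.mem_nhds hs) A.dnc.mapsTo)

theorem contMDiff_param : ContMDiff 𝓘(ℝ, E × ℝ) 𝓘(ℝ, ℝ) ∞ (param : DNC i → ℝ) := by
  intro p
  cases p with
  | gen x t ht =>
    have hψ := IsManifold.chart_mem_maximalAtlas (I := 𝓘(ℝ, E)) (n := ∞) x
    have hs := (mem_genHomeo_source (i := i) hψ (p := .gen x t ht)).2 ⟨mem_chart_source E x, ht⟩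
    have h1 : ContMDiffOn 𝓘(ℝ, E × ℝ) 𝓘(ℝ, ℝ) ∞ param (genHomeo i hψ).source :=
      (contDiff_snd.contMDiff.comp_contMDiffOn
        (contMDiffOn_of_mem_maximalAtlas (genHomeo_mem hψ))).congr fun p hp ↦ by
          rw [mem_genHomeo_source] at hp
          rw [eq_gen hp.2]; rfl
    exact h1.contMDiffAt ((genHomeo i hψ).open_source.mem_nhds hs)
  | nor n =>
    obtain ⟨A, hA⟩ := exists_adaptedChart i n.base
    have hs := A.mem_dnc_source.2 (show (DNC.nor n : DNC i).pt ∈ _ from hA)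
    have h1 : ContMDiffOn 𝓘(ℝ, E × ℝ) 𝓘(ℝ, ℝ) ∞ param A.dnc.source :=
      (contDiff_snd.contMDiff.comp_contMDiffOn
        (contMDiffOn_of_mem_maximalAtlas A.dnc_mem)).congr fun p hp ↦ (A.dnc_snd p).symm
    exact h1.contMDiffAt (A.dnc.open_source.mem_nhds hs)

/-- The parameter varies together with the point. Smooth maps into the part `t ≠ 0` are then
obtained by composing with `genD`. -/
theorem contMDiffOn_genD : ContMDiffOn (𝓘(ℝ, E).prod 𝓘(ℝ, ℝ)) 𝓘(ℝ, E × ℝ) ∞ (genD i)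
    {q | q.2 ≠ 0} := by
  rintro ⟨x, t⟩ ht
  have hψ := IsManifold.chart_mem_maximalAtlas (I := 𝓘(ℝ, E)) (n := ∞) x
  have ho : IsOpen ((chartAt E x).source ×ˢ ({0}ᶜ : Set ℝ)) :=
    (chartAt E x).open_source.prod isOpen_compl_singleton
  have h : ContMDiffOn (𝓘(ℝ, E).prod 𝓘(ℝ, ℝ)) 𝓘(ℝ, E × ℝ) ∞ (genD i)
      ((chartAt E x).source ×ˢ {0}ᶜ) := by
    refine contMDiffOn_of_chart_comp (genHomeo_mem hψ) ?_ ?_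
    · rintro ⟨y, s⟩ ⟨hy, hs⟩
      rw [genD_of_ne hs, mem_genHomeo_source]
      exact ⟨hy, hs⟩
    · have h1 := ((contMDiffOn_of_mem_maximalAtlas hψ).comp
        (contMDiffOn_fst (I := 𝓘(ℝ, E)) (J := 𝓘(ℝ, ℝ)) (n := ∞)
          (s := (chartAt E x).source ×ˢ ({0}ᶜ : Set ℝ))) fun q hq ↦ hq.1).prodMk_space
        (contMDiffOn_snd (I := 𝓘(ℝ, E)) (J := 𝓘(ℝ, ℝ)) (n := ∞))
      refine h1.congr ?_
      rintro ⟨y, s⟩ ⟨hy, hs⟩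
      rw [Function.comp_apply, genD_of_ne hs]; rfl
  exact (h.contMDiffAt (ho.mem_nhds ⟨mem_chart_source E x, ht⟩)).contMDiffWithinAt

theorem contMDiff_gen {t : ℝ} (ht : t ≠ 0) :
    ContMDiff 𝓘(ℝ, E) 𝓘(ℝ, E × ℝ) ∞ (fun x ↦ (.gen x t ht : DNC i)) := by
  have h := (contMDiffOn_genD (i := i)).comp_contMDiff
    (f := fun x : M ↦ (x, t)) (contMDiff_id.prodMk contMDiff_const) fun x ↦ ht
  exact h.congr fun x ↦ (genD_of_ne ht).symm

end DNC

end DNC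

/-! ### The partial homothety `(1 - Q) + tQ` -/

section Scale

variable {W : Type*} [NormedAddCommGroup W] [NormedSpace ℝ W]

/-- The linear map `(1 - Q) + tQ`. -/
def scaleBy (Q : W →L[ℝ] W) (t : ℝ) (w : W) : W := w - Q w + t • Q w

theorem scaleBy_zero (Q : W →L[ℝ] W) (w : W) : scaleBy Q 0 w = w - Q w := by simp [scaleBy]

theorem contDiff_scaleBy (Q : W →L[ℝ] W) : ContDiff ℝ ∞ fun q : W × ℝ ↦ scaleBy Q q.2 q.1 := by
  unfold scaleBy; fun_prop

/-- The derivative for `t = 0` of `k((1 - Q)w + tQw)`. -/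
theorem fderiv_comp_scaleBy {F : Type*} [NormedAddCommGroup F] [NormedSpace ℝ F] (Q : W →L[ℝ] W)
    {k : W → F} {w : W} (hk : DifferentiableAt ℝ k (w - Q w)) :
    fderiv ℝ (fun q : W × ℝ ↦ k (scaleBy Q q.2 q.1)) (w, 0) (0, 1) =
      fderiv ℝ k (w - Q w) (Q w) := by
  have d1 : HasFDerivAt k (fderiv ℝ k (w - Q w)) (scaleBy Q 0 w) := by
    rw [scaleBy_zero]; exact hk.hasFDerivAt
  have d2 : HasFDerivAt (fun q : W × ℝ ↦ scaleBy Q q.2 q.1)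
      (fderiv ℝ (fun q : W × ℝ ↦ scaleBy Q q.2 q.1) (w, 0)) (w, 0) :=
    ((contDiff_scaleBy Q).differentiable (by simp) _).hasFDerivAt
  have d3 : fderiv ℝ (fun q : W × ℝ ↦ scaleBy Q q.2 q.1) (w, 0) (0, 1) = Q w := by
    have l1 : HasDerivAt (fun t : ℝ ↦ scaleBy Q t w) (Q w) 0 := by
      unfold scaleBy
      simpa using ((hasDerivAt_id (0 : ℝ)).smul_const (Q w)).const_add (w - Q w)
    have l2 : HasDerivAt (fun t : ℝ ↦ (w, t)) ((0 : W), (1 : ℝ)) 0 :=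
      (hasDerivAt_const _ _).prodMk (hasDerivAt_id _)
    exact (d2.comp_hasDerivAt (0 : ℝ) l2).unique l1
  have d4 : HasFDerivAt (fun q : W × ℝ ↦ k (scaleBy Q q.2 q.1)) _ (w, 0) :=
    HasFDerivAt.comp (f := fun q : W × ℝ ↦ scaleBy Q q.2 q.1) (w, 0) d1 d2
  rw [d4.fderiv, ContinuousLinearMap.comp_apply, d3]

end Scale

/-! ### Smoothness of the deformation of a map, by Hadamard division -/

section DNC

variable {E' V E M : Type*} [NormedAddCommGroup E'] [NormedSpace ℝ E'] [TopologicalSpace V]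
  [ChartedSpace E' V] [NormedAddCommGroup E] [NormedSpace ℝ E] [TopologicalSpace M]
  [ChartedSpace E M] [FiniteDimensional ℝ E] [IsManifold 𝓘(ℝ, E) ∞ M] {i : SmoothEmbedding E' V E M}

theorem dchart_mfderiv_space {W : Type*} [NormedAddCommGroup W] [NormedSpace ℝ W]
    {ψ : OpenPartialHomeomorph M E} (hψ : ψ ∈ IsManifold.maximalAtlas 𝓘(ℝ, E) ∞ M) {f : W → M}
    {w : W} (hf : MDifferentiableAt 𝓘(ℝ, W) 𝓘(ℝ, E) f w) (hw : f w ∈ ψ.source) (v : W) :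
    dchart ψ (f w) (mfderiv 𝓘(ℝ, W) 𝓘(ℝ, E) f w v) = fderiv ℝ (ψ ∘ f) w v := by
  have e1 := mfderiv_comp w ((mdifferentiable_of_mem hψ).mdifferentiableAt hw) hf
  rw [mfderiv_eq_fderiv] at e1
  exact (DFunLike.congr_fun e1 v).symm

/-- The deformation of a smooth map of pairs from an open subset of `(W, ker Q)` to `(M, V)` is
smooth. -/
theorem contMDiffOn_deformation {W : Type*} [NormedAddCommGroup W] [NormedSpace ℝ W]
    {Q : W →L[ℝ] W} {T : Set W} (hT : IsOpen T) {f : W → M}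
    (hf : ContMDiffOn 𝓘(ℝ, W) 𝓘(ℝ, E) ∞ f T) {F : W × ℝ → DNC i}
    (h1 : ∀ w t (ht : t ≠ 0), scaleBy Q t w ∈ T → F (w, t) = .gen (f (scaleBy Q t w)) t ht)
    (h0 : ∀ w, w - Q w ∈ T → ∃ (v : V) (z : TangentSpace 𝓘(ℝ, E) (i v)),
      F (w, 0) = .nor (.mk' i v z) ∧ i v = f (w - Q w) ∧
      modelVec z = modelVec (mfderiv 𝓘(ℝ, W) 𝓘(ℝ, E) f (w - Q w) (Q w))) :
    ContMDiffOn 𝓘(ℝ, W × ℝ) 𝓘(ℝ, E × ℝ) ∞ F {q | scaleBy Q q.2 q.1 ∈ T} := by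
  have hsc := (contDiff_scaleBy Q).continuous
  rintro ⟨w₀, t₀⟩ hw₀
  by_cases ht₀ : t₀ = 0
  swap
  · have ho : IsOpen ({q : W × ℝ | scaleBy Q q.2 q.1 ∈ T} ∩ {q | q.2 ≠ 0}) :=
      (hT.preimage hsc).inter (isOpen_ne.preimage continuous_snd)
    have h2 : ContMDiffOn 𝓘(ℝ, W × ℝ) 𝓘(ℝ, E × ℝ) ∞ F
        ({q : W × ℝ | scaleBy Q q.2 q.1 ∈ T} ∩ {q | q.2 ≠ 0}) := by
      refine (DNC.contMDiffOn_genD.comp ((hf.comp (contDiff_scaleBy Q).contMDiff.contMDiffOn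
        fun q hq ↦ hq.1).prodMk contDiff_snd.contMDiff.contMDiffOn) fun q hq ↦ hq.2).congr ?_
      rintro ⟨w, t⟩ ⟨hw, ht⟩
      rw [h1 w t ht hw]
      exact (DNC.genD_of_ne ht).symm
    exact (h2.contMDiffAt (ho.mem_nhds ⟨hw₀, ht₀⟩)).contMDiffWithinAt
  subst ht₀
  have hw₀' : w₀ - Q w₀ ∈ T := by simpa [scaleBy] using hw₀
  obtain ⟨v, z, -, hv, -⟩ := h0 w₀ hw₀'
  obtain ⟨A, hA⟩ := exists_adaptedChart i v
  have hT'o : IsOpen (T ∩ f ⁻¹' A.ψ.source) :=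
    hf.continuousOn.isOpen_inter_preimage hT A.ψ.open_source
  set T' := T ∩ f ⁻¹' A.ψ.source with hT'
  set τ : W → E := A.ψ ∘ f with hτdef
  have hτ : ContDiffOn ℝ ∞ τ T' := by
    rw [← contMDiffOn_iff_contDiffOn]
    exact (contMDiffOn_of_mem_maximalAtlas A.mem).comp (hf.mono inter_subset_left)
      fun w hw ↦ hw.2
  set Ω := {q : W × ℝ | scaleBy Q q.2 q.1 ∈ T'} with hΩdef
  have hΩ : IsOpen Ω := hT'o.preimage hsc
  have hPτ : ∀ w, w - Q w ∈ T' → A.P (τ (w - Q w)) = 0 := fun w hw ↦ by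
    obtain ⟨v, z, -, hv, -⟩ := h0 w hw.1
    exact (A.slice _ hw.2).1 ⟨v, hv⟩
  have h2 : ContDiffOn ℝ ∞ (fun q : W × ℝ ↦ τ (scaleBy Q q.2 q.1)) Ω :=
    hτ.comp (contDiff_scaleBy Q).contDiffOn fun q hq ↦ hq
  have hk : ContDiffOn ℝ ∞ (fun q : W × ℝ ↦ A.P (τ (scaleBy Q q.2 q.1))) Ω :=
    A.P.contDiff.comp_contDiffOn h2
  -- The normal component vanishes for `t = 0`, because `f` sends the slice into `V`. Its quotient
  -- by `t` is smooth, with the normal derivative of `f` as value for `t = 0`.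
  have hK := contDiffOn_smoothQuotient hΩ hk fun w hw ↦ by
    have hw' : w - Q w ∈ T' := by simpa [scaleBy, hΩdef] using hw
    rw [scaleBy_zero]
    exact hPτ w hw'
  have hF : ContDiffOn ℝ ∞ (A.dnc ∘ F) Ω := by
    refine (((h2.sub hk).add hK).prodMk contDiffOn_snd).congr ?_
    rintro ⟨w, t⟩ hw
    by_cases ht : t = 0
    · subst ht
      have hw' : w - Q w ∈ T' := by simpa [scaleBy, hΩdef] using hw
      obtain ⟨v, z, hFv, hv, hz⟩ := h0 w hw'.1
      have hvA : i v ∈ A.ψ.source := by rw [hv]; exact hw'.2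
      rw [Function.comp_apply, hFv, A.dnc_nor, A.coord_mk hvA]
      have hd : dchart A.ψ (i v) z = fderiv ℝ τ (w - Q w) (Q w) := by
        rw [← dchart_mfderiv_space A.mem ((hf.contMDiffAt (hT.mem_nhds hw'.1)).mdifferentiableAt
          (by simp)) hw'.2]
        have := dchart_congr_point A.ψ hv (modelVec z)
        rw [hz] at this
        rw [← hz] at this
        exact this.trans (congrArg (fun u : E ↦ (dchart A.ψ (f (w - Q w)) u)) hz)
      have hτd : DifferentiableAt ℝ τ (w - Q w) :=
        ((hτ _ hw').contDiffAt (hT'o.mem_nhds hw')).differentiableAt (by simp)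
      have h3 : fderiv ℝ (fun q : W × ℝ ↦ A.P (τ (scaleBy Q q.2 q.1))) (w, 0) (0, 1) =
          A.P (fderiv ℝ τ (w - Q w) (Q w)) := by
        rw [fderiv_comp_scaleBy Q (k := fun w ↦ A.P (τ w)) (A.P.differentiableAt.comp _ hτd)]
        have := fderiv_comp (w - Q w) A.P.differentiableAt hτd
        rw [A.P.fderiv] at this
        exact DFunLike.congr_fun this (Q w)
      simp only [if_true, h3, scaleBy_zero, hPτ w hw', hd, sub_zero]
      rw [hv]; rfl
    · rw [Function.comp_apply, h1 w t ht hw.1, A.dnc_gen]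
      simp only [ht, if_false]
      rfl
  have hmaps : MapsTo F Ω A.dnc.source := by
    rintro ⟨w, t⟩ hw
    rw [A.mem_dnc_source]
    by_cases ht : t = 0
    · subst ht
      have hw' : w - Q w ∈ T' := by simpa [scaleBy, hΩdef] using hw
      obtain ⟨v, z, hFv, hv, hz⟩ := h0 w hw'.1
      rw [hFv]
      show i v ∈ _
      rw [hv]; exact hw'.2
    · rw [h1 w t ht hw.1]; exact hw.2
  have hfin := contMDiffOn_of_chart_comp A.dnc_mem hmaps (contMDiffOn_iff_contDiffOn.2 hF)
  refine (hfin.contMDiffAt (hΩ.mem_nhds ?_)).contMDiffWithinAt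
  show scaleBy Q 0 w₀ ∈ T'
  rw [scaleBy_zero]
  exact ⟨hw₀', by show f (w₀ - Q w₀) ∈ A.ψ.source; rw [← hv]; exact hA⟩

end DNC

/-! ### The maps induced on normal bundles and on deformation spaces -/

section Functoriality

variable {D V D₁ M C W C₁ N : Type*} [NormedAddCommGroup D] [NormedSpace ℝ D]
  [TopologicalSpace V] [ChartedSpace D V] [NormedAddCommGroup D₁] [NormedSpace ℝ D₁]
  [TopologicalSpace M] [ChartedSpace D₁ M] [NormedAddCommGroup C] [NormedSpace ℝ C]
  [TopologicalSpace W] [ChartedSpace C W] [NormedAddCommGroup C₁] [NormedSpace ℝ C₁]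
  [TopologicalSpace N] [ChartedSpace C₁ N] {i : SmoothEmbedding D V D₁ M}
  {j : SmoothEmbedding C W C₁ N} {f : M → N} {g : V → W}

variable (i j f g) in
/-- The map of normal bundles induced by a map of pairs. -/
noncomputable def NormalBundle.map (n : NormalBundle i) : NormalBundle j :=
  .mk' j (g n.base) (mfderiv 𝓘(ℝ, D₁) 𝓘(ℝ, C₁) f (i n.base)
    (Function.surjInv (Submodule.Quotient.mk_surjective _) n.vec))

/-- Two representatives of a normal vector differ by a vector tangent to `V`. By the chain rule for
`f ∘ i = j ∘ g`, the differential of `f` sends it to a vector tangent to `W`. So the representative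
chosen in `NormalBundle.map` does not matter. -/
theorem NormalBundle.map_mk' {v : V} (hf : MDifferentiableAt 𝓘(ℝ, D₁) 𝓘(ℝ, C₁) f (i v))
    (hg : MDifferentiableAt 𝓘(ℝ, D) 𝓘(ℝ, C) g v) (hfg : ∀ v, f (i v) = j (g v))
    (w : TangentSpace 𝓘(ℝ, D₁) (i v)) :
    NormalBundle.map i j f g (.mk' i v w) =
      .mk' j (g v) (mfderiv 𝓘(ℝ, D₁) 𝓘(ℝ, C₁) f (i v) w) := by
  unfold NormalBundle.map NormalBundle.mk'
  congr 1
  refine (Submodule.Quotient.eq _).2 ?_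
  have h1 : Function.surjInv (Submodule.Quotient.mk_surjective _)
      (Submodule.Quotient.mk w : i.NormalSpace v) - w ∈
      LinearMap.range (mfderiv 𝓘(ℝ, D) 𝓘(ℝ, D₁) i v).toLinearMap := by
    rw [← Submodule.Quotient.eq]
    exact Function.surjInv_eq (Submodule.Quotient.mk_surjective _) _
  obtain ⟨a, ha⟩ := h1
  refine ⟨mfderiv 𝓘(ℝ, D) 𝓘(ℝ, C) g v a, ?_⟩
  have e1 := mfderiv_comp v hf (i.mdifferentiableAt v)
  have e2 := mfderiv_comp v (j.mdifferentiableAt (g v)) hg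
  have hcomp : (f ∘ i : V → N) = j ∘ g := funext hfg
  rw [hcomp, e2] at e1
  have e3 := DFunLike.congr_fun e1 a
  have e4 := map_sub (mfderiv 𝓘(ℝ, D₁) 𝓘(ℝ, C₁) f (i v)) (Function.surjInv
    (Submodule.Quotient.mk_surjective _) (Submodule.Quotient.mk w : i.NormalSpace v)) w
  refine e3.trans (Eq.trans ?_ e4)
  exact congrArg (mfderiv 𝓘(ℝ, D₁) 𝓘(ℝ, C₁) f (i v)) ha

variable (i j f g) in
/-- The map of deformation spaces induced by a map of pairs. -/
noncomputable def DNC.map : DNC i → DNC j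
  | .gen x t ht => .gen (f x) t ht
  | .nor n => .nor (n.map i j f g)

@[simp] theorem DNC.param_map (p : DNC i) : (DNC.map i j f g p).param = p.param := by
  cases p <;> rfl

theorem DNC.pt_map (hfg : ∀ v, f (i v) = j (g v)) (p : DNC i) :
    (DNC.map i j f g p).pt = f p.pt := by
  cases p with
  | gen x t ht => rfl
  | nor n => exact (hfg _).symm

theorem DNC.isDNCMap_map (hf : MDifferentiable 𝓘(ℝ, D₁) 𝓘(ℝ, C₁) f)
    (hg : MDifferentiable 𝓘(ℝ, D) 𝓘(ℝ, C) g) (hfg : ∀ v, f (i v) = j (g v)) :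
    IsDNCMap i j f g (DNC.map i j f g) :=
  ⟨fun _ _ _ ↦ rfl, fun v w ↦ congrArg DNC.nor (NormalBundle.map_mk' (hf _) (hg v) hfg w)⟩

/-- Near a normal vector, composition with an inverse adapted chart gives the deformation of `f ∘
A.ψ.symm`, defined on an open set of `(E, ker A.P)`; `contMDiffOn_deformation` applies. For `t ≠ 0`
the map is `f` times the identity. -/
theorem DNC.contMDiff_map [FiniteDimensional ℝ D₁] [FiniteDimensional ℝ C₁]
    [IsManifold 𝓘(ℝ, D₁) ∞ M] [IsManifold 𝓘(ℝ, C₁) ∞ N]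
    (hf : ContMDiff 𝓘(ℝ, D₁) 𝓘(ℝ, C₁) ∞ f)
    (hg : MDifferentiable 𝓘(ℝ, D) 𝓘(ℝ, C) g) (hfg : ∀ v, f (i v) = j (g v)) :
    ContMDiff 𝓘(ℝ, D₁ × ℝ) 𝓘(ℝ, C₁ × ℝ) ∞ (DNC.map i j f g) := by
  intro p
  by_cases hp : p.param = 0
  · obtain ⟨n, rfl⟩ := DNC.exists_nor hp
    obtain ⟨A, hA⟩ := exists_adaptedChart i n.base
    have hfA : ContMDiffOn 𝓘(ℝ, D₁) 𝓘(ℝ, C₁) ∞ (f ∘ A.ψ.symm) A.ψ.target :=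
      hf.comp_contMDiffOn (contMDiffOn_symm_of_mem_maximalAtlas A.mem)
    have h1 := contMDiffOn_deformation (i := j) (Q := A.P) A.ψ.open_target hfA
      (F := DNC.map i j f g ∘ A.dnc.symm) (fun w t ht hw ↦ by
        rw [Function.comp_apply, A.dnc_symm_ne ht]; rfl) (fun w hw ↦ by
        rw [Function.comp_apply, A.dnc_symm_zero hw]
        have hb := A.lift_base_mem hw
        refine ⟨_, _, congrArg DNC.nor (NormalBundle.map_mk' (hf.mdifferentiable (by simp) _)
          (hg _) hfg _), ?_, ?_⟩
        · rw [← hfg]; exact congrArg f (A.lift_base (A.exists_base hw))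
        · have hl : i (A.exists_base hw).choose = A.ψ.symm (w - A.P w) :=
            A.lift_base (A.exists_base hw)
          have e1 := mfderiv_comp (w - A.P w) (hf.mdifferentiable (by simp) (A.ψ.symm (w - A.P w)))
            ((mdifferentiable_of_mem A.mem).mdifferentiableAt_symm hw)
          have e2 := DFunLike.congr_fun e1 (A.P w)
          refine Eq.trans ?_ e2.symm
          have e3 : ∀ (x : M) (hx : x = A.ψ.symm (w - A.P w)),
              modelVec (mfderiv 𝓘(ℝ, D₁) 𝓘(ℝ, C₁) f x ((dchart A.ψ x).inverse (A.P w))) =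
              modelVec (mfderiv 𝓘(ℝ, D₁) 𝓘(ℝ, C₁) f (A.ψ.symm (w - A.P w))
                (mfderiv 𝓘(ℝ, D₁) 𝓘(ℝ, D₁) A.ψ.symm (w - A.P w) (A.P w))) := by
            rintro x rfl
            congr 2
            have hx : A.ψ.symm (w - A.P w) ∈ A.ψ.source := A.ψ.map_target hw
            apply (dchart_bijective A.mem hx).1
            rw [dchart_apply_inverse A.mem hx]
            have := (mdifferentiable_of_mem A.mem).comp_symm_deriv hw
            exact (DFunLike.congr_fun this (A.P w)).symm
          exact e3 _ hl)
    have hs := A.mem_dnc_source.2 (show (DNC.nor n : DNC i).pt ∈ _ from hA)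
    have h2 := contMDiffOn_of_comp_symm (T := A.dnc.target) A.dnc_mem h1
    refine h2.contMDiffAt ?_
    exact Filter.inter_mem (A.dnc.open_source.mem_nhds hs)
      (Filter.mem_of_superset (A.dnc.open_source.mem_nhds hs) A.dnc.mapsTo)
  · have ho : IsOpen {p : DNC i | p.param ≠ 0} :=
      isOpen_ne.preimage DNC.contMDiff_param.continuous
    have h1 : ContMDiffOn 𝓘(ℝ, D₁ × ℝ) 𝓘(ℝ, C₁ × ℝ) ∞ (DNC.map i j f g)
        {p : DNC i | p.param ≠ 0} := by
      refine (DNC.contMDiffOn_genD.comp ((hf.comp DNC.contMDiff_pt).prodMk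
        DNC.contMDiff_param).contMDiffOn fun q hq ↦ hq).congr fun p hp ↦ ?_
      rw [Function.comp_apply, DNC.genD_of_ne hp]
      conv_lhs => rw [DNC.eq_gen hp]
      rfl
    exact h1.contMDiffAt (ho.mem_nhds hp)

end Functoriality

/-! ### Curves with a given velocity -/

section Velocity

variable {E M C N D K : Type*} [NormedAddCommGroup E] [NormedSpace ℝ E] [TopologicalSpace M]
  [ChartedSpace E M] [NormedAddCommGroup C] [NormedSpace ℝ C] [TopologicalSpace N]
  [ChartedSpace C N] [NormedAddCommGroup D] [NormedSpace ℝ D] [TopologicalSpace K]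
  [ChartedSpace D K]

/-- The curve `α` passes through `x` for `t = 0`, with velocity `w`. -/
def HasVelocity (α : ℝ → M) (x : M) (w : TangentSpace 𝓘(ℝ, E) x) : Prop :=
  α 0 = x ∧ MDifferentiableAt 𝓘(ℝ, ℝ) 𝓘(ℝ, E) α 0 ∧
    modelVec (F := E) (mfderiv 𝓘(ℝ, ℝ) 𝓘(ℝ, E) α 0 (1 : ℝ)) = modelVec w

namespace HasVelocity

variable {α β : ℝ → M} {x : M} {w w' : TangentSpace 𝓘(ℝ, E) x}

theorem unique (h : HasVelocity α x w) (h' : HasVelocity α x w') : w = w' :=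
  h.2.2.symm.trans h'.2.2

theorem continuousAt (h : HasVelocity α x w) : ContinuousAt α 0 := h.2.1.continuousAt

theorem tendsto (h : HasVelocity α x w) : Filter.Tendsto α (𝓝 0) (𝓝 x) := by
  have := h.continuousAt
  rwa [ContinuousAt, h.1] at this

theorem congr (h : HasVelocity α x w) (hαβ : β =ᶠ[𝓝 0] α) : HasVelocity β x w :=
  ⟨hαβ.eq_of_nhds.trans h.1, h.2.1.congr_of_eventuallyEq hαβ, by
    rw [hαβ.mfderiv_eq]; exact h.2.2⟩

theorem comp {f : M → N} (h : HasVelocity α x w)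
    (hf : MDifferentiableAt 𝓘(ℝ, E) 𝓘(ℝ, C) f x) :
    HasVelocity (f ∘ α) (f x) (mfderiv 𝓘(ℝ, E) 𝓘(ℝ, C) f x w) := by
  obtain ⟨rfl, h1, h2⟩ := h
  obtain rfl : mfderiv 𝓘(ℝ, ℝ) 𝓘(ℝ, E) α 0 (1 : ℝ) = w := h2
  exact ⟨rfl, hf.comp 0 h1, DFunLike.congr_fun (mfderiv_comp 0 hf h1) (1 : ℝ)⟩

/-- A derivative within `S` need not be unique when `S` is not open, for instance on a source fibre.
Its value on the velocity of a curve contained in `S` is nevertheless forced, and only such values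
are used. -/
theorem compWithin {f : M → N} {S : Set M} (h : HasVelocity α x w)
    (hf : MDifferentiableWithinAt 𝓘(ℝ, E) 𝓘(ℝ, C) f S x) (hS : ∀ᶠ t in 𝓝 (0 : ℝ), α t ∈ S) :
    HasVelocity (f ∘ α) (f x) (mfderivWithin 𝓘(ℝ, E) 𝓘(ℝ, C) f S x w) := by
  obtain ⟨rfl, h1, h2⟩ := h
  obtain rfl : mfderiv 𝓘(ℝ, ℝ) 𝓘(ℝ, E) α 0 (1 : ℝ) = w := h2
  have h3 : HasMFDerivWithinAt 𝓘(ℝ, ℝ) 𝓘(ℝ, C) (f ∘ α) {t | α t ∈ S} 0 _ :=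
    HasMFDerivWithinAt.comp 0 hf.hasMFDerivWithinAt h1.hasMFDerivAt.hasMFDerivWithinAt
      fun t ht ↦ ht
  have h4 := h3.hasMFDerivAt hS
  exact ⟨rfl, h4.mdifferentiableAt, by rw [h4.mfderiv]; rfl⟩

/-- A curve given by its coordinates. -/
theorem of_chart {ψ : OpenPartialHomeomorph M E} (hψ : ψ ∈ IsManifold.maximalAtlas 𝓘(ℝ, E) ∞ M)
    (hx : x ∈ ψ.source) {c : ℝ → E} (hc0 : c 0 = ψ x) (hc : HasDerivAt c (dchart ψ x w) 0) :
    HasVelocity (ψ.symm ∘ c) x w := by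
  have h1 : c 0 ∈ ψ.target := by rw [hc0]; exact ψ.map_source hx
  have h2 := (mdifferentiable_of_mem hψ).mdifferentiableAt_symm h1
  have hcd : MDifferentiableAt 𝓘(ℝ, ℝ) 𝓘(ℝ, E) c 0 := hc.differentiableAt.mdifferentiableAt
  have hx0 : ψ.symm (c 0) = x := by rw [hc0, ψ.left_inv hx]
  refine ⟨hx0, h2.comp 0 hcd, ?_⟩
  have e1 := mfderiv_comp 0 h2 hcd
  have hc1 : mfderiv 𝓘(ℝ, ℝ) 𝓘(ℝ, E) c 0 (1 : ℝ) = dchart ψ x w := by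
    rw [mfderiv_eq_fderiv]
    have h3 : fderiv ℝ c 0 (1 : ℝ) = dchart ψ x w := by rw [fderiv_apply_one_eq_deriv, hc.deriv]
    exact h3
  have e2 := DFunLike.congr_fun e1 (1 : ℝ)
  refine Eq.trans e2 ?_
  have e3 : modelVec (mfderiv 𝓘(ℝ, E) 𝓘(ℝ, E) ψ.symm (c 0)
      (mfderiv 𝓘(ℝ, ℝ) 𝓘(ℝ, E) c 0 (1 : ℝ))) =
      modelVec (mfderiv 𝓘(ℝ, E) 𝓘(ℝ, E) ψ.symm (c 0) (dchart ψ x w)) :=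
    congrArg (mfderiv 𝓘(ℝ, E) 𝓘(ℝ, E) ψ.symm (c 0)) hc1
  refine e3.trans ?_
  rw [hc0]
  exact DFunLike.congr_fun ((mdifferentiable_of_mem hψ).symm_comp_deriv hx) w

theorem exists_curve (x : M) (w : TangentSpace 𝓘(ℝ, E) x) [IsManifold 𝓘(ℝ, E) ∞ M] :
    ∃ α : ℝ → M, HasVelocity α x w := by
  have hψ := IsManifold.chart_mem_maximalAtlas (I := 𝓘(ℝ, E)) (n := ∞) x
  refine ⟨_, of_chart hψ (mem_chart_source E x)
    (c := fun t ↦ chartAt E x x + t • dchart (chartAt E x) x w) (by simp) ?_⟩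
  simpa using ((hasDerivAt_id (0 : ℝ)).smul_const (dchart (chartAt E x) x w)).const_add
    (chartAt E x x)

theorem hasDerivAt_chart {ψ : OpenPartialHomeomorph M E} (h : HasVelocity α x w)
    (hψ : ψ ∈ IsManifold.maximalAtlas 𝓘(ℝ, E) ∞ M) (hx : x ∈ ψ.source) :
    HasDerivAt (ψ ∘ α) (dchart ψ x w) 0 := by
  obtain ⟨-, h1, h2⟩ := h.comp ((mdifferentiable_of_mem hψ).mdifferentiableAt hx)
  have h3 : DifferentiableAt ℝ (ψ ∘ α) 0 := h1.differentiableAt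
  rw [mfderiv_eq_fderiv] at h2
  have h4 : deriv (ψ ∘ α) 0 = dchart ψ x w := h2
  rw [← h4]
  exact h3.hasDerivAt

/-- The analogue for maps of two variables. It computes the differential of a product defined only
on composable pairs, through curves of composable pairs. -/
theorem prodMk {γ : ℝ → N} {y : N} {z : TangentSpace 𝓘(ℝ, C) y} (h : HasVelocity α x w)
    (h' : HasVelocity γ y z) {f : M × N → K} {S : Set (M × N)}
    (hf : MDifferentiableWithinAt (𝓘(ℝ, E).prod 𝓘(ℝ, C)) 𝓘(ℝ, D) f S (x, y))
    (hS : ∀ᶠ t in 𝓝 (0 : ℝ), (α t, γ t) ∈ S) :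
    HasVelocity (fun t ↦ f (α t, γ t)) (f (x, y))
      (mfderivWithin (𝓘(ℝ, E).prod 𝓘(ℝ, C)) 𝓘(ℝ, D) f S (x, y) ((w, z) : E × C)) := by
  obtain ⟨rfl, h1, h2⟩ := h
  obtain rfl : mfderiv 𝓘(ℝ, ℝ) 𝓘(ℝ, E) α 0 (1 : ℝ) = w := h2
  obtain ⟨rfl, k1, k2⟩ := h'
  obtain rfl : mfderiv 𝓘(ℝ, ℝ) 𝓘(ℝ, C) γ 0 (1 : ℝ) = z := k2
  have h3 : HasMFDerivWithinAt 𝓘(ℝ, ℝ) 𝓘(ℝ, D) (f ∘ fun t ↦ (α t, γ t))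
      {t | (α t, γ t) ∈ S} 0 _ :=
    HasMFDerivWithinAt.comp 0 (f := fun t ↦ (α t, γ t)) hf.hasMFDerivWithinAt
      (h1.hasMFDerivAt.prodMk k1.hasMFDerivAt).hasMFDerivWithinAt fun t ht ↦ ht
  have h4 := h3.hasMFDerivAt hS
  exact ⟨rfl, h4.mdifferentiableAt, by
    show modelVec (F := D) (mfderiv 𝓘(ℝ, ℝ) 𝓘(ℝ, D) (f ∘ fun t ↦ (α t, γ t)) 0 (1 : ℝ)) = _
    rw [h4.mfderiv]; rfl⟩

end HasVelocity

end Velocity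

/-! ### Limits in the deformation space: density of `t ≠ 0`, separation, countability; local
sections of submersions -/

section Limits

variable {E' V E M : Type*} [NormedAddCommGroup E'] [NormedSpace ℝ E'] [TopologicalSpace V]
  [ChartedSpace E' V] [NormedAddCommGroup E] [NormedSpace ℝ E] [TopologicalSpace M]
  [ChartedSpace E M] [FiniteDimensional ℝ E] [IsManifold 𝓘(ℝ, E) ∞ M] {i : SmoothEmbedding E' V E M}

namespace DNC

/-- A normal vector is the limit of `(α(t), t)`, where `α` is a curve whose velocity represents
it. -/
theorem tendsto_genD {α : ℝ → M} {v : V} {w : TangentSpace 𝓘(ℝ, E) (i v)}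
    (h : HasVelocity α (i v) w) :
    Filter.Tendsto (fun t ↦ genD i (α t, t)) (𝓝[≠] 0) (𝓝 (.nor (.mk' i v w))) := by
  obtain ⟨A, hA⟩ := exists_adaptedChart i v
  have hs : DNC.nor (.mk' i v w) ∈ A.dnc.source := A.mem_dnc_source.2 hA
  have hP0 : A.P (A.ψ (i v)) = 0 := (A.slice _ hA).1 ⟨v, rfl⟩
  have hd := h.hasDerivAt_chart A.mem hA
  have hPd : HasDerivAt (fun t ↦ A.P ((A.ψ ∘ α) t)) (A.P (dchart A.ψ (i v) w)) 0 :=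
    A.P.hasFDerivAt.comp_hasDerivAt 0 hd
  have h0 : (A.ψ ∘ α) 0 = A.ψ (i v) := congrArg A.ψ h.1
  have h1 : Filter.Tendsto (fun t ↦ A.scale t⁻¹ ((A.ψ ∘ α) t)) (𝓝[≠] 0)
      (𝓝 (A.coord (.mk' i v w))) := by
    rw [A.coord_mk hA]
    have l1 : Filter.Tendsto (A.ψ ∘ α) (𝓝[≠] 0) (𝓝 (A.ψ (i v))) := by
      have := hd.continuousAt.tendsto
      rw [h0] at this
      exact this.mono_left nhdsWithin_le_nhds
    have l2 : Filter.Tendsto (fun t ↦ A.P ((A.ψ ∘ α) t)) (𝓝[≠] 0) (𝓝 0) := by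
      have := (A.P.continuous.tendsto _).comp l1
      rwa [hP0] at this
    -- As `P ψ` vanishes on `V`, the normal coordinate `t⁻¹ P ψ(α(t))` is a difference quotient.
    have l3 := hasDerivAt_iff_tendsto_slope_zero.1 hPd
    simp only [zero_add, h0, hP0, sub_zero] at l3
    have l4 := (l1.sub l2).add l3
    rw [sub_zero] at l4
    exact l4
  have h2 : Filter.Tendsto (fun t ↦ (A.scale t⁻¹ ((A.ψ ∘ α) t), t)) (𝓝[≠] 0)
      (𝓝 (A.dnc (.nor (.mk' i v w)))) :=
    h1.prodMk_nhds (Filter.tendsto_id.mono_left nhdsWithin_le_nhds)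
  have h3 := (A.dnc.symm.continuousAt (A.dnc.map_source hs)).tendsto.comp h2
  rw [A.dnc.left_inv hs] at h3
  refine h3.congr' ?_
  filter_upwards [self_mem_nhdsWithin,
    nhdsWithin_le_nhds (h.tendsto.eventually (A.ψ.open_source.mem_nhds hA))] with t ht hαt
  rw [genD_of_ne ht, Function.comp_apply, A.dnc_symm_ne ht, A.scale_scale, mul_inv_cancel₀ ht,
    A.scale_one, Function.comp_apply, A.ψ.left_inv hαt]

omit [FiniteDimensional ℝ E] [IsManifold 𝓘(ℝ, E) ∞ M] in
theorem exists_mk' (n : NormalBundle i) : ∃ w : TangentSpace 𝓘(ℝ, E) (i n.base),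
    n = .mk' i n.base w := by
  obtain ⟨w, hw⟩ := Submodule.Quotient.mk_surjective _ n.vec
  exact ⟨w, by unfold NormalBundle.mk'; rw [hw]⟩

/-- A normal vector is a limit of points `(x, t)` for `t ≠ 0`. -/
theorem exists_tendsto (n : NormalBundle i) : ∃ α : ℝ → M,
    Filter.Tendsto (fun t ↦ genD i (α t, t)) (𝓝[≠] 0) (𝓝 (.nor n)) := by
  obtain ⟨w, hw⟩ := exists_mk' n
  obtain ⟨α, hα⟩ := HasVelocity.exists_curve _ w
  exact ⟨α, hw ▸ tendsto_genD hα⟩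

/-- Limits in the deformation space with the same image in `M` are equal, even if `M` is not
Hausdorff. -/
theorem eq_of_tendsto {X : Type*} {l : Filter X} [l.NeBot] {F : X → DNC i} {p q : DNC i}
    (hp : Filter.Tendsto F l (𝓝 p)) (hq : Filter.Tendsto F l (𝓝 q)) (h : p.pt = q.pt) : p = q := by
  have hparam : p.param = q.param :=
    tendsto_nhds_unique ((contMDiff_param.continuous.tendsto p).comp hp)
      ((contMDiff_param.continuous.tendsto q).comp hq)
  by_cases h0 : p.param = 0
  · obtain ⟨n, rfl⟩ := exists_nor h0
    obtain ⟨n', rfl⟩ := exists_nor (hparam ▸ h0)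
    -- Whether a point lies in the domain of this chart depends only on its image in `M`. Both
    -- limits thus lie in the same chart domain, which is Hausdorff.
    obtain ⟨A, hA⟩ := exists_adaptedChart i n.base
    have hp' : DNC.nor n ∈ A.dnc.source := A.mem_dnc_source.2 hA
    have hq' : DNC.nor n' ∈ A.dnc.source := A.mem_dnc_source.2 (by rw [← h]; exact hA)
    exact A.dnc.injOn hp' hq' (tendsto_nhds_unique ((A.dnc.continuousAt hp').tendsto.comp hp)
      ((A.dnc.continuousAt hq').tendsto.comp hq))
  · cases p with
    | nor n => exact (h0 rfl).elim
    | gen x t ht =>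
      cases q with
      | nor n => exact (h0 hparam).elim
      | gen y s hs =>
        obtain rfl : x = y := h
        obtain rfl : t = s := hparam
        rfl

/-- If no neighbourhoods separate `p` and `q`, the filter `𝓝 p ⊓ 𝓝 q` converges to both. Their
images in `M` then agree, and `eq_of_tendsto` applies. -/
instance [T2Space M] : T2Space (DNC i) := by
  rw [t2_iff_nhds]
  intro p q hne
  have hp : Filter.Tendsto id (𝓝 p ⊓ 𝓝 q) (𝓝 p) := inf_le_left
  have hq : Filter.Tendsto id (𝓝 p ⊓ 𝓝 q) (𝓝 q) := inf_le_right
  exact eq_of_tendsto hp hq (tendsto_nhds_unique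
    ((contMDiff_pt.continuous.tendsto p).comp hp) ((contMDiff_pt.continuous.tendsto q).comp hq))

/-- Countably many product charts cover the part `t ≠ 0`. The submanifold inherits second
countability from `M`, being embedded, so countably many adapted charts cover the normal bundle. -/
theorem secondCountableTopology [SecondCountableTopology M] :
    SecondCountableTopology (DNC i) := by
  have hV : SecondCountableTopology V := i.isSmoothEmbedding.isEmbedding.secondCountableTopology
  choose A hA using exists_adaptedChart i
  have hψ := fun x : M ↦ IsManifold.chart_mem_maximalAtlas (I := 𝓘(ℝ, E)) (n := ∞) x
  obtain ⟨s, hs, hsU⟩ := TopologicalSpace.countable_cover_nhds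
    fun x : M ↦ (chartAt E x).open_source.mem_nhds (mem_chart_source E x)
  obtain ⟨s', hs', hsU'⟩ := TopologicalSpace.countable_cover_nhds
    fun v : V ↦ ((A v).ψ.open_source.preimage
      i.isSmoothEmbedding.isEmbedding.continuous).mem_nhds (hA v)
  have := hs.to_subtype
  have := hs'.to_subtype
  let φ : s ⊕ s' → OpenPartialHomeomorph (DNC i) (E × ℝ) :=
    Sum.elim (fun x ↦ genHomeo i (hψ x)) fun v ↦ (A v).dnc
  have hφ : ∀ k, SecondCountableTopology (φ k).source := fun k ↦
    (φ k).secondCountableTopology_source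
  refine TopologicalSpace.secondCountableTopology_of_countable_cover
    (U := fun k ↦ (φ k).source) (fun k ↦ (φ k).open_source) ?_
  refine eq_univ_of_forall fun p ↦ ?_
  cases p with
  | gen x t ht =>
    have hx : x ∈ ⋃ x ∈ s, (chartAt E x).source := hsU ▸ mem_univ x
    obtain ⟨y, hy, hxy⟩ := mem_iUnion₂.1 hx
    exact mem_iUnion.2 ⟨.inl ⟨y, hy⟩, (mem_genHomeo_source (hψ y)).2 ⟨hxy, ht⟩⟩
  | nor n =>
    have hx : n.base ∈ ⋃ v ∈ s', i ⁻¹' (A v).ψ.source := hsU' ▸ mem_univ n.base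
    obtain ⟨y, hy, hxy⟩ := mem_iUnion₂.1 hx
    exact mem_iUnion.2 ⟨.inr ⟨y, hy⟩, (A y).mem_dnc_source.2 hxy⟩

end DNC

/-- A section of a map through a point: a submersion has smooth local sections. -/
theorem exists_local_section {C N : Type*} [NormedAddCommGroup C] [NormedSpace ℝ C]
    [TopologicalSpace N] [ChartedSpace C N] {f : M → N}
    (hf : Manifold.IsSubmersion 𝓘(ℝ, E) 𝓘(ℝ, C) ∞ f) (x : M) : ∃ σ : N → M,
      ContMDiffAt 𝓘(ℝ, C) 𝓘(ℝ, E) ∞ σ (f x) ∧ σ (f x) = x ∧ ∀ᶠ y in 𝓝 (f x), f (σ y) = y := by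
  obtain ⟨F, _, _, hF⟩ := hf
  have h := hF x
  have h1 := h.mem_domChart_source
  have h2 := h.mem_codChart_source
  set ψ := h.domChart
  set χ := h.codChart
  have hψ : ψ ∈ IsManifold.maximalAtlas 𝓘(ℝ, E) ∞ M := h.domChart_mem_maximalAtlas
  have hχ : χ ∈ IsManifold.maximalAtlas 𝓘(ℝ, C) ∞ N := h.codChart_mem_maximalAtlas
  have hw : ∀ y ∈ ψ.source, χ (f y) = (h.equiv (ψ y)).1 := fun y hy ↦ by
    have := h.writtenInCharts (show ψ y ∈ (ψ.extend 𝓘(ℝ, E)).target by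
      simpa using ψ.map_source hy)
    have e : h.domChart.symm (ψ y) = y := ψ.left_inv hy
    simpa [e] using this
  let S : C → E := fun c ↦ h.equiv.symm (c, (h.equiv (ψ x)).2)
  have hS : ContDiff ℝ ∞ S := h.equiv.symm.contDiff.comp (contDiff_id.prodMk contDiff_const)
  have hSx : S (χ (f x)) = ψ x := by
    simp only [S]
    rw [hw x h1]; simp
  have ht : S (χ (f x)) ∈ ψ.target := by rw [hSx]; exact ψ.map_source h1
  have hσ : ContMDiffAt 𝓘(ℝ, C) 𝓘(ℝ, E) ∞ (ψ.symm ∘ S ∘ χ) (f x) := by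
    refine ContMDiffAt.comp _ (contMDiffAt_symm_of_mem_maximalAtlas hψ ht)
      (hS.contMDiff.contMDiffAt.comp _ (contMDiffAt_of_mem_maximalAtlas hχ h2))
  refine ⟨ψ.symm ∘ S ∘ χ, hσ, ?_, ?_⟩
  · show ψ.symm (S (χ (f x))) = x
    rw [hSx, ψ.left_inv h1]
  · have hc : ContinuousAt (S ∘ χ) (f x) :=
      hS.continuous.continuousAt.comp (χ.continuousAt h2)
    filter_upwards [hc.preimage_mem_nhds (ψ.open_target.mem_nhds ht),
      χ.open_source.mem_nhds h2] with y hy hy'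
    have hy1 : ψ.symm (S (χ y)) ∈ ψ.source := ψ.map_target hy
    apply χ.injOn (h.source_subset_preimage_source hy1) hy'
    show χ (f (ψ.symm (S (χ y)))) = χ y
    rw [hw _ hy1, ψ.right_inv (show S (χ y) ∈ ψ.target from hy)]
    simp [S]

end Limits

/-! ### Functoriality: identities and composition -/

section MapLaws

variable {D V D₁ M C W C₁ N B U B₁ L : Type*} [NormedAddCommGroup D] [NormedSpace ℝ D]
  [TopologicalSpace V] [ChartedSpace D V] [NormedAddCommGroup D₁] [NormedSpace ℝ D₁]
  [TopologicalSpace M] [ChartedSpace D₁ M] [NormedAddCommGroup C] [NormedSpace ℝ C]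
  [TopologicalSpace W] [ChartedSpace C W] [NormedAddCommGroup C₁] [NormedSpace ℝ C₁]
  [TopologicalSpace N] [ChartedSpace C₁ N] [NormedAddCommGroup B] [NormedSpace ℝ B]
  [TopologicalSpace U] [ChartedSpace B U] [NormedAddCommGroup B₁] [NormedSpace ℝ B₁]
  [TopologicalSpace L] [ChartedSpace B₁ L] {i : SmoothEmbedding D V D₁ M}
  {j : SmoothEmbedding C W C₁ N} {k : SmoothEmbedding B U B₁ L} {f : M → N} {g : V → W}
  {f' : N → L} {g' : W → U}

theorem NormalBundle.mk'_congr {v v' : V} (h : v = v') {w : TangentSpace 𝓘(ℝ, D₁) (i v)}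
    {w' : TangentSpace 𝓘(ℝ, D₁) (i v')} (hw : modelVec w = modelVec w') :
    NormalBundle.mk' i v w = .mk' i v' w' := by
  subst h
  obtain rfl : w = w' := hw
  rfl

theorem DNC.map_id (p : DNC i) : DNC.map i i (id : M → M) (id : V → V) p = p := by
  cases p with
  | gen x t ht => rfl
  | nor n =>
    obtain ⟨w, hw⟩ := DNC.exists_mk' n
    rw [hw]
    refine congrArg DNC.nor ((NormalBundle.map_mk' mdifferentiableAt_id mdifferentiableAt_id
      (fun _ ↦ rfl) w).trans ?_)
    refine NormalBundle.mk'_congr rfl ?_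
    rw [mfderiv_id]; rfl

theorem DNC.map_map (hf : MDifferentiable 𝓘(ℝ, D₁) 𝓘(ℝ, C₁) f)
    (hg : MDifferentiable 𝓘(ℝ, D) 𝓘(ℝ, C) g) (hfg : ∀ v, f (i v) = j (g v))
    (hf' : MDifferentiable 𝓘(ℝ, C₁) 𝓘(ℝ, B₁) f') (hg' : MDifferentiable 𝓘(ℝ, C) 𝓘(ℝ, B) g')
    (hfg' : ∀ v, f' (j v) = k (g' v)) (p : DNC i) :
    DNC.map j k f' g' (DNC.map i j f g p) = DNC.map i k (f' ∘ f) (g' ∘ g) p := by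
  cases p with
  | gen x t ht => rfl
  | nor n =>
    obtain ⟨w, hw⟩ := DNC.exists_mk' n
    rw [hw]
    refine congrArg DNC.nor ?_
    rw [NormalBundle.map_mk' (hf _) (hg _) hfg,
      NormalBundle.map_mk' ((hf' _).comp _ (hf _)) ((hg' _).comp _ (hg _))
        fun v ↦ by simp [hfg, hfg']]
    refine (NormalBundle.map_mk' (hf' _) (hg' _) hfg' _).trans (NormalBundle.mk'_congr rfl ?_)
    rw [mfderiv_comp _ (hf' _) (hf _)]
    have : ∀ (y y' : N) (h : y = y') (u : C₁),
      modelVec (mfderiv 𝓘(ℝ, C₁) 𝓘(ℝ, B₁) f' y (u : TangentSpace 𝓘(ℝ, C₁) y)) =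
      modelVec (mfderiv 𝓘(ℝ, C₁) 𝓘(ℝ, B₁) f' y' (u : TangentSpace 𝓘(ℝ, C₁) y')) := by
      rintro y _ rfl u; rfl
    exact this _ _ (hfg _).symm _

/-- Commutation relations between maps of pairs are preserved by the deformation. -/
theorem DNC.map_map_eq {f₁ : M → L} {g₁ : V → U} (hf : MDifferentiable 𝓘(ℝ, D₁) 𝓘(ℝ, C₁) f)
    (hg : MDifferentiable 𝓘(ℝ, D) 𝓘(ℝ, C) g) (hfg : ∀ v, f (i v) = j (g v))
    (hf' : MDifferentiable 𝓘(ℝ, C₁) 𝓘(ℝ, B₁) f') (hg' : MDifferentiable 𝓘(ℝ, C) 𝓘(ℝ, B) g')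
    (hfg' : ∀ v, f' (j v) = k (g' v)) (h : ∀ x, f' (f x) = f₁ x) (h' : ∀ x, g' (g x) = g₁ x)
    (p : DNC i) : DNC.map j k f' g' (DNC.map i j f g p) = DNC.map i k f₁ g₁ p := by
  rw [DNC.map_map hf hg hfg hf' hg' hfg']
  congr 1
  · exact funext h
  · exact funext h'

end MapLaws

/-! ### The deformation of a submersion; the embedding of the normal bundle -/

section SubmersionChart

variable {E' V E M E₀' V₀ E₀ M₀ : Type*} [NormedAddCommGroup E'] [NormedSpace ℝ E']
  [TopologicalSpace V] [ChartedSpace E' V] [NormedAddCommGroup E] [NormedSpace ℝ E]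
  [TopologicalSpace M] [ChartedSpace E M] [NormedAddCommGroup E₀'] [NormedSpace ℝ E₀']
  [TopologicalSpace V₀] [ChartedSpace E₀' V₀] [NormedAddCommGroup E₀] [NormedSpace ℝ E₀]
  [TopologicalSpace M₀] [ChartedSpace E₀ M₀] [FiniteDimensional ℝ E] [FiniteDimensional ℝ E₀]
  [IsManifold 𝓘(ℝ, E) ∞ M] [IsManifold 𝓘(ℝ, E₀) ∞ M₀]
  {i : SmoothEmbedding E' V E M} {i₀ : SmoothEmbedding E₀' V₀ E₀ M₀} {f : M → M₀} {g : V → V₀}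

namespace SubmersionChart

variable (C : SubmersionChart i i₀ f)

theorem p_scale (t : ℝ) (e : E) : C.p (C.A.scale t e) = C.B.scale t (C.p e) := by
  simp [AdaptedChart.scale, C.p_P]

theorem scale_σ (t : ℝ) (e : E₀) : C.A.scale t (C.σ e) = C.σ (C.B.scale t e) := by
  simp [AdaptedChart.scale, C.P_σ]

theorem dchart_eq (hf : MDifferentiable 𝓘(ℝ, E) 𝓘(ℝ, E₀) f) {x : M} (hx : x ∈ C.A.ψ.source)
    (w : TangentSpace 𝓘(ℝ, E) x) :
    dchart C.B.ψ (f x) (mfderiv 𝓘(ℝ, E) 𝓘(ℝ, E₀) f x w) = C.p (dchart C.A.ψ x w) := by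
  have := dchart_mfderiv (hf x) C.A.mem hx C.B.mem (C.mapsTo x hx) C.p.differentiableAt
    (by filter_upwards [C.A.ψ.open_source.mem_nhds hx] with y hy using C.eq y hy) w
  rwa [C.p.fderiv] at this

theorem coord_map (hf : MDifferentiable 𝓘(ℝ, E) 𝓘(ℝ, E₀) f)
    (hg : MDifferentiable 𝓘(ℝ, E') 𝓘(ℝ, E₀') g) (hfg : ∀ v, f (i v) = i₀ (g v))
    {n : NormalBundle i} (hn : i n.base ∈ C.A.ψ.source) :
    C.B.coord (n.map i i₀ f g) = C.p (C.A.coord n) := by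
  obtain ⟨w, hw⟩ := DNC.exists_mk' n
  have hn' : i₀ (g n.base) ∈ C.B.ψ.source := by rw [← hfg]; exact C.mapsTo _ hn
  rw [hw, NormalBundle.map_mk' (hf _) (hg _) hfg]
  have e1 : C.B.coord (.mk' i₀ (g n.base) (mfderiv 𝓘(ℝ, E) 𝓘(ℝ, E₀) f (i n.base) w)) =
      C.B.ψ (i₀ (g n.base)) + C.B.P (dchart C.B.ψ (i₀ (g n.base))
        (mfderiv 𝓘(ℝ, E) 𝓘(ℝ, E₀) f (i n.base) w)) := C.B.coord_mk hn' _
  refine e1.trans ?_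
  rw [C.A.coord_mk hn, map_add, C.p_P, ← C.dchart_eq hf hn, ← C.eq _ hn, hfg]

/-- In a submersion chart, the deformation of `f` is linear. -/
theorem dnc_map (hf : MDifferentiable 𝓘(ℝ, E) 𝓘(ℝ, E₀) f)
    (hg : MDifferentiable 𝓘(ℝ, E') 𝓘(ℝ, E₀') g) (hfg : ∀ v, f (i v) = i₀ (g v)) {q : DNC i}
    (hq : q.pt ∈ C.A.ψ.source) :
    C.B.dnc (DNC.map i i₀ f g q) = (C.p (C.A.dnc q).1, (C.A.dnc q).2) := by
  cases q with
  | gen x t ht =>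
    show (C.B.scale t⁻¹ (C.B.ψ (f x)), t) = (C.p (C.A.scale t⁻¹ (C.A.ψ x)), t)
    rw [C.p_scale, C.eq x hq]
  | nor n =>
    show (C.B.coord (n.map i i₀ f g), (0 : ℝ)) = (C.p (C.A.coord n), 0)
    rw [C.coord_map hf hg hfg hq]

end SubmersionChart

/-- The deformation of a submersion of pairs is a submersion. -/
theorem DNC.isSubmersion_map (hf : Manifold.IsSubmersion 𝓘(ℝ, E) 𝓘(ℝ, E₀) ∞ f)
    (hg : Manifold.IsSubmersion 𝓘(ℝ, E') 𝓘(ℝ, E₀') ∞ g) (hfg : ∀ v, f (i v) = i₀ (g v)) :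
    Manifold.IsSubmersion 𝓘(ℝ, E × ℝ) 𝓘(ℝ, E₀ × ℝ) ∞ (DNC.map i i₀ f g) := by
  have hfd := hf.contMDiff.mdifferentiable (by simp)
  have hgd := hg.contMDiff.mdifferentiable (by simp)
  refine isSubmersion_of_linear_charts fun q ↦ ?_
  have hsurj : ∀ p : E →L[ℝ] E₀, Function.Surjective p →
      Function.Surjective (p.prodMap (ContinuousLinearMap.id ℝ ℝ)) := fun p hp ⟨e, t⟩ ↦ by
    obtain ⟨e', rfl⟩ := hp e
    exact ⟨(e', t), rfl⟩
  cases q with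
  | gen x t ht =>
    obtain ⟨F, _, _, hF⟩ := hf
    have h := hF x
    let p : E →L[ℝ] E₀ := (ContinuousLinearMap.fst ℝ E₀ F).comp (h.equiv : E →L[ℝ] E₀ × F)
    have hp : Function.Surjective p := fun e ↦ ⟨h.equiv.symm (e, 0), by simp [p]⟩
    refine ⟨genHomeo i h.domChart_mem_maximalAtlas, genHomeo i₀ h.codChart_mem_maximalAtlas,
      p.prodMap (ContinuousLinearMap.id ℝ ℝ), (mem_genHomeo_source _).2
        ⟨h.mem_domChart_source, ht⟩, genHomeo_mem _, genHomeo_mem _, hsurj p hp, fun q hq ↦ ?_⟩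
    rw [mem_genHomeo_source] at hq
    rw [eq_gen hq.2]
    refine ⟨(mem_genHomeo_source _).2 ⟨h.source_subset_preimage_source hq.1, hq.2⟩, ?_⟩
    show (h.codChart (f q.pt), q.param) = (p (h.domChart q.pt), q.param)
    have := h.writtenInCharts (show h.domChart q.pt ∈ (h.domChart.extend 𝓘(ℝ, E)).target by
      simpa using h.domChart.map_source hq.1)
    have e : h.domChart.symm (h.domChart q.pt) = q.pt := h.domChart.left_inv hq.1
    have h2 : h.codChart (f q.pt) = (h.equiv (h.domChart q.pt)).1 := by simpa [e] using this
    rw [h2]; rfl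
  | nor n =>
    obtain ⟨C, hC⟩ := exists_submersionChart i i₀ hf hg hfg n.base
    refine ⟨C.A.dnc, C.B.dnc, C.p.prodMap (ContinuousLinearMap.id ℝ ℝ), C.A.mem_dnc_source.2 hC,
      C.A.dnc_mem, C.B.dnc_mem, hsurj _ fun e ↦ ⟨_, C.p_σ e⟩, fun q hq ↦ ?_⟩
    rw [C.A.mem_dnc_source] at hq
    rw [C.B.mem_dnc_source, DNC.pt_map hfg]
    exact ⟨C.mapsTo _ hq, C.dnc_map hfd hgd hfg hq⟩

/-- The submersion charts also make the map of normal bundles linear, with the same linear map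
`C.p`. -/
theorem NormalBundle.isSubmersion_map (hf : Manifold.IsSubmersion 𝓘(ℝ, E) 𝓘(ℝ, E₀) ∞ f)
    (hg : Manifold.IsSubmersion 𝓘(ℝ, E') 𝓘(ℝ, E₀') ∞ g) (hfg : ∀ v, f (i v) = i₀ (g v)) :
    Manifold.IsSubmersion 𝓘(ℝ, E) 𝓘(ℝ, E₀) ∞ (NormalBundle.map i i₀ f g) := by
  have hfd := hf.contMDiff.mdifferentiable (by simp)
  have hgd := hg.contMDiff.mdifferentiable (by simp)
  refine isSubmersion_of_linear_charts fun n ↦ ?_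
  obtain ⟨C, hC⟩ := exists_submersionChart i i₀ hf hg hfg n.base
  refine ⟨C.A.normal n, C.B.normal (n.map i i₀ f g), C.p, hC, C.A.normal_mem n, C.B.normal_mem _,
    fun e ↦ ⟨_, C.p_σ e⟩, fun m hm ↦ ⟨?_, C.coord_map hfd hgd hfg hm⟩⟩
  show i₀ (g m.base) ∈ C.B.ψ.source
  rw [← hfg]
  exact C.mapsTo _ hm

/-- The normal bundle is embedded in the deformation space. -/
theorem DNC.isSmoothEmbedding_nor :
    Manifold.IsSmoothEmbedding 𝓘(ℝ, E) 𝓘(ℝ, E × ℝ) ∞ (DNC.nor : NormalBundle i → DNC i) := by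
  refine isSmoothEmbedding_of_linear_charts (fun n m h ↦ by injection h) fun n ↦ ?_
  obtain ⟨A, hA⟩ := exists_adaptedChart i n.base
  exact ⟨A.normal n, A.dnc, ContinuousLinearMap.inl ℝ E ℝ, hA, A.normal_mem n, A.dnc_mem,
    fun a b h ↦ congrArg Prod.fst h, rfl, fun m hm ↦ rfl⟩

end SubmersionChart

/-! ### Extension of the product to an open set of pairs of arrows -/

section Groupoid

variable {E E₀ G G₀ : Type*} [NormedAddCommGroup E] [NormedSpace ℝ E]
  [NormedAddCommGroup E₀] [NormedSpace ℝ E₀] [TopologicalSpace G] [ChartedSpace E G]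
  [TopologicalSpace G₀] [ChartedSpace E₀ G₀] [IsManifold 𝓘(ℝ, E) ∞ G]
  [IsManifold 𝓘(ℝ, E₀) ∞ G₀] {𝒢 : LieGroupoid E E₀ G G₀}

theorem LieGroupoid.contMDiff_s (𝒢 : LieGroupoid E E₀ G G₀) :
    ContMDiff 𝓘(ℝ, E) 𝓘(ℝ, E₀) ∞ 𝒢.s := 𝒢.isSubmersion_s.contMDiff

namespace LieGroupoid.VertChart

variable (C : VertChart 𝒢)

/-- The coordinate of the point `adjust q`. -/
def adjustCoord (q : G × G) : E := C.ψ q.1 + C.σ (C.χ (𝒢.r q.2) - C.p (C.ψ q.1))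

/-- The domain of definition of `adjust`. -/
def dom : Set (G × G) :=
  (C.ψ.source ×ˢ (𝒢.r ⁻¹' C.χ.source)) ∩ C.adjustCoord ⁻¹' C.ψ.target

/-- For arrows `x` and `y`, an arrow near `x` (if `r y` is near `s x`) with source `r y`. It is `x`
if `s x = r y`. -/
def adjust (q : G × G) : G := C.ψ.symm (C.adjustCoord q)

/-- A smooth extension of the product to an open set. -/
def mulExt (q : G × G) : G := 𝒢.mul (C.adjust q) q.2

theorem contMDiffOn_adjustCoord : ContMDiffOn (𝓘(ℝ, E).prod 𝓘(ℝ, E)) 𝓘(ℝ, E) ∞ C.adjustCoord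
    (C.ψ.source ×ˢ (𝒢.r ⁻¹' C.χ.source)) := by
  have h1 : ContMDiffOn (𝓘(ℝ, E).prod 𝓘(ℝ, E)) 𝓘(ℝ, E) ∞ (fun q : G × G ↦ C.ψ q.1)
      (C.ψ.source ×ˢ (𝒢.r ⁻¹' C.χ.source)) :=
    (contMDiffOn_of_mem_maximalAtlas C.mem).comp contMDiffOn_fst fun q hq ↦ hq.1
  have h2 : ContMDiffOn (𝓘(ℝ, E).prod 𝓘(ℝ, E)) 𝓘(ℝ, E₀) ∞ (fun q : G × G ↦ C.χ (𝒢.r q.2))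
      (C.ψ.source ×ˢ (𝒢.r ⁻¹' C.χ.source)) :=
    (contMDiffOn_of_mem_maximalAtlas C.mem').comp (𝒢.contMDiff_r.comp_contMDiffOn contMDiffOn_snd)
      fun q hq ↦ hq.2
  exact h1.add (C.σ.contMDiff.comp_contMDiffOn (h2.sub (C.p.contMDiff.comp_contMDiffOn h1)))

theorem isOpen_dom : IsOpen C.dom :=
  C.contMDiffOn_adjustCoord.continuousOn.isOpen_inter_preimage
    (C.ψ.open_source.prod (C.χ.open_source.preimage 𝒢.contMDiff_r.continuous)) C.ψ.open_target

theorem contMDiffOn_adjust :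
    ContMDiffOn (𝓘(ℝ, E).prod 𝓘(ℝ, E)) 𝓘(ℝ, E) ∞ C.adjust C.dom :=
  (contMDiffOn_symm_of_mem_maximalAtlas C.mem).comp
    (C.contMDiffOn_adjustCoord.mono inter_subset_left) fun _ hq ↦ hq.2

theorem s_adjust {q : G × G} (hq : q ∈ C.dom) : 𝒢.s (C.adjust q) = 𝒢.r q.2 := by
  have h := C.ψ.map_target hq.2
  apply C.χ.injOn (C.s_mem _ h) hq.1.2
  show C.χ (𝒢.s (C.ψ.symm (C.adjustCoord q))) = _
  rw [C.s_eq _ h, C.ψ.right_inv hq.2]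
  simp [adjustCoord, C.p_σ]

theorem adjustCoord_of_comp {q : G × G} (h1 : q.1 ∈ C.ψ.source) (h : 𝒢.s q.1 = 𝒢.r q.2) :
    C.adjustCoord q = C.ψ q.1 := by
  simp [adjustCoord, ← h, C.s_eq _ h1]

theorem adjust_of_comp {q : G × G} (h1 : q.1 ∈ C.ψ.source) (h : 𝒢.s q.1 = 𝒢.r q.2) :
    C.adjust q = q.1 := by
  rw [adjust, C.adjustCoord_of_comp h1 h, C.ψ.left_inv h1]

theorem mem_dom {q : G × G} (h1 : q.1 ∈ C.ψ.source) (h : 𝒢.s q.1 = 𝒢.r q.2) : q ∈ C.dom := by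
  refine ⟨⟨h1, ?_⟩, ?_⟩
  · show 𝒢.r q.2 ∈ C.χ.source
    rw [← h]; exact C.s_mem _ h1
  · show C.adjustCoord q ∈ C.ψ.target
    rw [C.adjustCoord_of_comp h1 h]; exact C.ψ.map_source h1

theorem mulExt_of_comp {q : G × G} (h1 : q.1 ∈ C.ψ.source) (h : 𝒢.s q.1 = 𝒢.r q.2) :
    C.mulExt q = 𝒢.mul q.1 q.2 := by
  rw [mulExt, C.adjust_of_comp h1 h]

/-- After the first arrow is adjusted the pair is composable, so the smoothness of the product on
composable pairs is enough. The gain is an open domain, on which the extension can be differentiated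
and deformed. -/
theorem contMDiffOn_mulExt :
    ContMDiffOn (𝓘(ℝ, E).prod 𝓘(ℝ, E)) 𝓘(ℝ, E) ∞ C.mulExt C.dom :=
  𝒢.contMDiffOn_mul.comp (C.contMDiffOn_adjust.prodMk contMDiffOn_snd) fun _ hq ↦ C.s_adjust hq

end LieGroupoid.VertChart

end Groupoid

/-! ### The deformation of a map defined on a vector space -/

section Deform

variable {E' V E M W : Type*} [NormedAddCommGroup E'] [NormedSpace ℝ E'] [TopologicalSpace V]
  [ChartedSpace E' V] [NormedAddCommGroup E] [NormedSpace ℝ E] [TopologicalSpace M]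
  [ChartedSpace E M] [NormedAddCommGroup W] [NormedSpace ℝ W]

open Classical in
/-- The deformation of a map `f : (W, ker Q) → (M, V)`. -/
noncomputable def deform (i : SmoothEmbedding E' V E M) (f : W → M) (Q : W →L[ℝ] W) (q : W × ℝ) :
    DNC i :=
  if ht : q.2 ≠ 0 then .gen (f (scaleBy Q q.2 q.1)) q.2 ht
  else if h : ∃ v, i v = f (q.1 - Q q.1) then
    .nor (.mk' i h.choose (mfderiv 𝓘(ℝ, W) 𝓘(ℝ, E) f (q.1 - Q q.1) (Q q.1) : E))
  -- A junk value, not met at the points where `f` sends the kernel of `Q` to the submanifold.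
  else .gen (f q.1) 1 one_ne_zero

variable {i : SmoothEmbedding E' V E M} {f : W → M} {Q : W →L[ℝ] W} {T : Set W}

theorem deform_of_ne {w : W} {t : ℝ} (ht : t ≠ 0) :
    deform i f Q (w, t) = .gen (f (scaleBy Q t w)) t ht := dif_pos ht

theorem deform_zero {w : W} {v : V} (h : i v = f (w - Q w)) :
    deform i f Q (w, 0) =
      .nor (.mk' i v (mfderiv 𝓘(ℝ, W) 𝓘(ℝ, E) f (w - Q w) (Q w) : E)) := by
  have h' : ∃ v, i v = f (w - Q w) := ⟨v, h⟩
  unfold deform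
  rw [dif_neg (by simp), dif_pos h']
  refine congrArg DNC.nor (NormalBundle.mk'_congr (i.injective (h'.choose_spec.trans h.symm)) rfl)

theorem pt_deform {q : W × ℝ} (hfQ : scaleBy Q q.2 q.1 ∈ T)
    (hQ : ∀ w ∈ T, Q w = 0 → f w ∈ range i) (hQQ : ∀ w, Q (Q w) = Q w) :
    (deform i f Q q).pt = f (scaleBy Q q.2 q.1) := by
  obtain ⟨w, t⟩ := q
  by_cases ht : t = 0
  · subst ht
    have hT : w - Q w ∈ T := by rw [← scaleBy_zero]; exact hfQ
    obtain ⟨v, hv⟩ := hQ _ hT (by simp [hQQ])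
    rw [deform_zero hv, scaleBy_zero]; exact hv
  · rw [deform_of_ne ht]; rfl

theorem contMDiffOn_deform [FiniteDimensional ℝ E] [IsManifold 𝓘(ℝ, E) ∞ M] (hT : IsOpen T)
    (hf : ContMDiffOn 𝓘(ℝ, W) 𝓘(ℝ, E) ∞ f T) (hQ : ∀ w ∈ T, Q w = 0 → f w ∈ range i)
    (hQQ : ∀ w, Q (Q w) = Q w) :
    ContMDiffOn 𝓘(ℝ, W × ℝ) 𝓘(ℝ, E × ℝ) ∞ (deform i f Q) {q | scaleBy Q q.2 q.1 ∈ T} := by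
  refine contMDiffOn_deformation hT hf (fun w t ht _ ↦ deform_of_ne ht) fun w hw ↦ ?_
  obtain ⟨v, hv⟩ := hQ _ hw (by simp [hQQ])
  exact ⟨v, _, deform_zero hv, hv, rfl⟩

end Deform

/-! ### Lifting curves through a submersion -/

section Curves

variable {E M E₀ M₀ : Type*} [NormedAddCommGroup E] [NormedSpace ℝ E] [TopologicalSpace M]
  [ChartedSpace E M] [NormedAddCommGroup E₀] [NormedSpace ℝ E₀] [TopologicalSpace M₀]
  [ChartedSpace E₀ M₀] [IsManifold 𝓘(ℝ, E) ∞ M] [IsManifold 𝓘(ℝ, E₀) ∞ M₀] {f : M → M₀}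

/-- Curves can be lifted through a submersion, with a given velocity. -/
theorem HasVelocity.exists_lift (hf : Manifold.IsSubmersion 𝓘(ℝ, E) 𝓘(ℝ, E₀) ∞ f) {x : M}
    {w : TangentSpace 𝓘(ℝ, E) x} {γ : ℝ → M₀}
    (hγ : HasVelocity γ (f x) (mfderiv 𝓘(ℝ, E) 𝓘(ℝ, E₀) f x w)) :
    ∃ α, HasVelocity α x w ∧ ∀ᶠ t in 𝓝 0, f (α t) = γ t := by
  have hfd := hf.contMDiff.mdifferentiable (by simp) x
  obtain ⟨F, _, _, hF⟩ := hf
  have h := hF x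
  have h1 := h.mem_domChart_source
  have h2 := h.mem_codChart_source
  set ψ := h.domChart
  set χ := h.codChart
  have hψ : ψ ∈ IsManifold.maximalAtlas 𝓘(ℝ, E) ∞ M := h.domChart_mem_maximalAtlas
  have hχ : χ ∈ IsManifold.maximalAtlas 𝓘(ℝ, E₀) ∞ M₀ := h.codChart_mem_maximalAtlas
  let p : E →L[ℝ] E₀ := (ContinuousLinearMap.fst ℝ E₀ F).comp (h.equiv : E →L[ℝ] E₀ × F)
  let σ : E₀ →L[ℝ] E := (h.equiv.symm : E₀ × F →L[ℝ] E).comp (ContinuousLinearMap.inl ℝ E₀ F)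
  have hpσ : ∀ e, p (σ e) = e := fun e ↦ by simp [p, σ]
  have hw : ∀ y ∈ ψ.source, χ (f y) = p (ψ y) := fun y hy ↦ by
    have := h.writtenInCharts (show ψ y ∈ (ψ.extend 𝓘(ℝ, E)).target by
      simpa using ψ.map_source hy)
    have e : h.domChart.symm (ψ y) = y := ψ.left_inv hy
    simpa [e, p] using this
  let d : E := dchart ψ x w
  have hd : dchart χ (f x) (mfderiv 𝓘(ℝ, E) 𝓘(ℝ, E₀) f x w) = p d := by
    have := dchart_mfderiv hfd hψ h1 hχ h2 p.differentiableAt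
      (by filter_upwards [ψ.open_source.mem_nhds h1] with y hy using hw y hy) w
    rwa [p.fderiv] at this
  -- The line with velocity `d`, corrected along `σ` so that `p (c t)` is the coordinate of `γ t`.
  -- The correction has zero velocity because `γ` has velocity `p d` in the chart.
  let c : ℝ → E := fun t ↦ ψ x + t • d + σ ((χ ∘ γ) t - p (ψ x) - t • p d)
  have hγχ := hγ.hasDerivAt_chart hχ h2
  rw [hd] at hγχ
  have hc0 : c 0 = ψ x := by simp [c, hγ.1, hw x h1]
  have hc : HasDerivAt c (dchart ψ x w) 0 := by
    have l1 : HasDerivAt (fun t : ℝ ↦ t • d) d 0 := by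
      simpa using (hasDerivAt_id (0 : ℝ)).smul_const d
    have l2 : HasDerivAt (fun t : ℝ ↦ t • p d) (p d) 0 := by
      simpa using (hasDerivAt_id (0 : ℝ)).smul_const (p d)
    have l3 := σ.hasFDerivAt.comp_hasDerivAt 0 ((hγχ.sub_const (p (ψ x))).sub l2)
    have := (l1.const_add (ψ x)).add l3
    rw [sub_self, map_zero, add_zero] at this
    exact this
  have hv := HasVelocity.of_chart hψ h1 hc0 hc
  refine ⟨_, hv, ?_⟩
  filter_upwards [hc.continuousAt.preimage_mem_nhds (ψ.open_target.mem_nhds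
      (by rw [hc0]; exact ψ.map_source h1)),
    hγ.tendsto.eventually (χ.open_source.mem_nhds h2)] with t ht ht'
  have hs : ψ.symm (c t) ∈ ψ.source := ψ.map_target ht
  apply χ.injOn (h.source_subset_preimage_source hs) ht'
  show χ (f (ψ.symm (c t))) = χ (γ t)
  rw [hw _ hs, ψ.right_inv ht]
  simp [c, hpσ]

end Curves

/-! ### Deformation of a partially defined operation, through curves -/

section PartialOperation

variable {D V D₁ M C₁ N V₀ C : Type*} [NormedAddCommGroup D] [NormedSpace ℝ D]
  [TopologicalSpace V] [ChartedSpace D V] [NormedAddCommGroup D₁] [NormedSpace ℝ D₁]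
  [TopologicalSpace M] [ChartedSpace D₁ M] [NormedAddCommGroup C₁] [NormedSpace ℝ C₁]
  [TopologicalSpace N] [ChartedSpace C₁ N] [FiniteDimensional ℝ D₁]
  [IsManifold 𝓘(ℝ, D₁) ∞ M] [IsManifold 𝓘(ℝ, C₁) ∞ N] {i : SmoothEmbedding D V D₁ M}
  {f g : M → N} {m : M → M → M} {f' g' : V → V₀} {n : V → V → V} {Φ : DNC i → DNC i → DNC i}

/-- A continuous extension of `((x, t), (y, t)) ↦ (m x y, t)` is given, on the normal bundle, by the
differential of `m`. -/
theorem isDNCMul_of_continuous (hf : Manifold.IsSubmersion 𝓘(ℝ, D₁) 𝓘(ℝ, C₁) ∞ f)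
    (hg : MDifferentiable 𝓘(ℝ, D₁) 𝓘(ℝ, C₁) g)
    (hm : MDifferentiableOn (𝓘(ℝ, D₁).prod 𝓘(ℝ, D₁)) 𝓘(ℝ, D₁)
      (fun p : M × M ↦ m p.1 p.2) {p | f p.1 = g p.2})
    (hfg : ∀ a b, f' a = g' b → f (i a) = g (i b))
    (hmn : ∀ a b, f' a = g' b → m (i a) (i b) = i (n a b))
    (hΦ : ∀ x y t ht, f x = g y → Φ (.gen x t ht) (.gen y t ht) = .gen (m x y) t ht)
    (hc : ∀ (a b : NormalBundle i) (α β : ℝ → M), f' a.base = g' b.base →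
      (∀ᶠ t in 𝓝[≠] (0 : ℝ), f (α t) = g (β t)) →
      Filter.Tendsto (fun t ↦ DNC.genD i (α t, t)) (𝓝[≠] 0) (𝓝 (.nor a)) →
      Filter.Tendsto (fun t ↦ DNC.genD i (β t, t)) (𝓝[≠] 0) (𝓝 (.nor b)) →
      Filter.Tendsto (fun t ↦ Φ (DNC.genD i (α t, t)) (DNC.genD i (β t, t))) (𝓝[≠] 0)
        (𝓝 (Φ (.nor a) (.nor b))) ∧ (Φ (.nor a) (.nor b)).pt = i (n a.base b.base)) :
    IsDNCMul (C₁ := C₁) i f g m f' g' n Φ := by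
  refine ⟨hΦ, fun a b w z hab hwz ↦ ?_⟩
  obtain ⟨β, hβ⟩ := HasVelocity.exists_curve _ z
  have hγ : HasVelocity (g ∘ β) (f (i a)) (mfderiv 𝓘(ℝ, D₁) 𝓘(ℝ, C₁) f (i a) w) := by
    have h1 := hβ.comp (hg (i b))
    exact ⟨h1.1.trans (hfg a b hab).symm, h1.2.1, h1.2.2.trans hwz.symm⟩
  -- The condition on `w` and `z` says that the pair is tangent to `f x = g y`. Lifting `g ∘ β`
  -- through the submersion `f`, with velocity `w`, gives a curve of pairs in the domain of `m`.
  obtain ⟨α, hα, hαβ⟩ := HasVelocity.exists_lift hf hγ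
  have h1 := hα.prodMk hβ (hm (i a, i b) (hfg a b hab)) hαβ
  have h2 : HasVelocity (fun t ↦ m (α t) (β t)) (i (n a b)) (mfderivWithin
      (𝓘(ℝ, D₁).prod 𝓘(ℝ, D₁)) 𝓘(ℝ, D₁) (fun p : M × M ↦ m p.1 p.2) {p | f p.1 = g p.2}
      (i a, i b) ((w, z) : D₁ × D₁)) :=
    ⟨h1.1.trans (hmn a b hab), h1.2.1, h1.2.2⟩
  obtain ⟨h3, h4⟩ := hc (.mk' i a w) (.mk' i b z) α β hab (nhdsWithin_le_nhds hαβ)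
    (DNC.tendsto_genD hα) (DNC.tendsto_genD hβ)
  -- The points `(m (α t) (β t), t)` tend to the value of `Φ` by continuity, and to the class of the
  -- velocity of `m (α t) (β t)` by `tendsto_genD`.
  refine DNC.eq_of_tendsto h3 ((DNC.tendsto_genD h2).congr' ?_) h4
  filter_upwards [self_mem_nhdsWithin, nhdsWithin_le_nhds hαβ] with t ht ht'
  have ht : t ≠ 0 := ht
  rw [DNC.genD_of_ne ht, DNC.genD_of_ne ht, DNC.genD_of_ne ht]
  exact (hΦ _ _ _ _ ht').symm

/-- Lifting of nets through a submersion. -/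
theorem exists_tendsto_lift {X : Type*} {l : Filter X}
    (hf : Manifold.IsSubmersion 𝓘(ℝ, D₁) 𝓘(ℝ, C₁) ∞ f) {x : M} {γ : X → N}
    (hγ : Filter.Tendsto γ l (𝓝 (f x))) :
    ∃ α : X → M, Filter.Tendsto α l (𝓝 x) ∧ ∀ᶠ t in l, f (α t) = γ t := by
  obtain ⟨σ, h1, h2, h3⟩ := exists_local_section hf x
  refine ⟨σ ∘ γ, ?_, hγ.eventually h3⟩
  have := h1.continuousAt.tendsto
  rw [h2] at this
  exact this.comp hγ

end PartialOperation

/-! ### The product of the deformation groupoid in charts -/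

section Groupoid

variable {E E₀ G G₀ : Type*} [NormedAddCommGroup E] [NormedSpace ℝ E]
  [NormedAddCommGroup E₀] [NormedSpace ℝ E₀] [TopologicalSpace G] [ChartedSpace E G]
  [TopologicalSpace G₀] [ChartedSpace E₀ G₀] [IsManifold 𝓘(ℝ, E) ∞ G]
  [IsManifold 𝓘(ℝ, E₀) ∞ G₀]
  {E' E₀' H H₀ : Type*} [NormedAddCommGroup E'] [NormedSpace ℝ E']
  [NormedAddCommGroup E₀'] [NormedSpace ℝ E₀'] [TopologicalSpace H] [ChartedSpace E' H]
  [TopologicalSpace H₀] [ChartedSpace E₀' H₀] [IsManifold 𝓘(ℝ, E') ∞ H]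
  [IsManifold 𝓘(ℝ, E₀') ∞ H₀] [FiniteDimensional ℝ E] [FiniteDimensional ℝ E₀]
  {ℋ : LieGroupoid E' E₀' H H₀} {𝒢 : LieGroupoid E E₀ G G₀} (ι : LieSubgroupoid ℋ 𝒢)

namespace SubmersionChart

variable {ι}

/-- The chart of the groupoid underlying a chart of the pair of groupoids. -/
def vertChart (C : SubmersionChart ι.hom ι.base 𝒢.s) : LieGroupoid.VertChart 𝒢 where
  ψ := C.A.ψ
  χ := C.B.ψ
  mem := C.A.mem
  mem' := C.B.mem
  p := C.p
  σ := C.σ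
  p_σ := C.p_σ
  s_mem := C.mapsTo
  s_eq := C.eq

variable (C : SubmersionChart ι.hom ι.base 𝒢.s) (B : AdaptedChart ι.hom)

/-- The extended product in coordinates. -/
noncomputable def mulCoord (w : E × E) : G := C.vertChart.mulExt (C.A.ψ.symm w.1, B.ψ.symm w.2)

/-- The domain of the extended product in coordinates. -/
def mulDom : Set (E × E) :=
  (C.A.ψ.target ×ˢ B.ψ.target) ∩
    (fun w : E × E ↦ (C.A.ψ.symm w.1, B.ψ.symm w.2)) ⁻¹' C.vertChart.dom

theorem contMDiffOn_symm_prod : ContMDiffOn 𝓘(ℝ, E × E) (𝓘(ℝ, E).prod 𝓘(ℝ, E)) ∞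
    (fun w : E × E ↦ (C.A.ψ.symm w.1, B.ψ.symm w.2)) (C.A.ψ.target ×ˢ B.ψ.target) :=
  ((contMDiffOn_symm_of_mem_maximalAtlas C.A.mem).comp contDiff_fst.contMDiff.contMDiffOn
    fun _ hw ↦ hw.1).prodMk ((contMDiffOn_symm_of_mem_maximalAtlas B.mem).comp
      contDiff_snd.contMDiff.contMDiffOn fun _ hw ↦ hw.2)

theorem isOpen_mulDom : IsOpen (C.mulDom B) :=
  (C.contMDiffOn_symm_prod B).continuousOn.isOpen_inter_preimage
    (C.A.ψ.open_target.prod B.ψ.open_target) C.vertChart.isOpen_dom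

theorem contMDiffOn_mulCoord :
    ContMDiffOn 𝓘(ℝ, E × E) 𝓘(ℝ, E) ∞ (C.mulCoord B) (C.mulDom B) :=
  C.vertChart.contMDiffOn_mulExt.comp ((C.contMDiffOn_symm_prod B).mono inter_subset_left)
    fun _ hw ↦ hw.2

theorem prodMap_idem (w : E × E) :
    C.A.P.prodMap B.P (C.A.P.prodMap B.P w) = C.A.P.prodMap B.P w :=
  Prod.ext (C.A.idem _) (B.idem _)

/-- This is the reason for the conditions `p_P` and `P_σ`: every term of the adjusted coordinate is
killed by `A.P` when both arrows come from `H`. The adjustment therefore stays in `H`. -/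
theorem adjust_mem_range {h k : H} (hd : (ι.hom h, ι.hom k) ∈ C.vertChart.dom) :
    C.vertChart.adjust (ι.hom h, ι.hom k) ∈ range ι.hom := by
  have h1 := C.A.ψ.map_target hd.2
  refine (C.A.slice _ h1).2 ?_
  have e1 : C.A.ψ (C.A.ψ.symm (C.vertChart.adjustCoord (ι.hom h, ι.hom k))) = _ :=
    C.A.ψ.right_inv hd.2
  have e2 : C.A.P (C.A.ψ (ι.hom h)) = 0 := (C.A.slice _ hd.1.1).1 ⟨h, rfl⟩
  have e3 : C.B.P (C.B.ψ (𝒢.r (ι.hom k))) = 0 :=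
    (C.B.slice _ hd.1.2).1 ⟨ℋ.r k, (ι.r_hom k).symm⟩
  refine (congrArg C.A.P e1).trans ?_
  show C.A.P (C.A.ψ (ι.hom h) + C.σ (C.B.ψ (𝒢.r (ι.hom k)) - C.p (C.A.ψ (ι.hom h)))) = 0
  rw [map_add, e2, C.P_σ, map_sub, e3, ← C.p_P, e2]
  simp

/-- The adjusted first arrow is in `H` and is composable in `H` with the second, since units of `H`
inject into those of `G`. So the extended product is a map of pairs into `(G, H)` and can be
deformed. -/
theorem mulCoord_mem_range {w : E × E} (hw : w ∈ C.mulDom B) (h0 : C.A.P.prodMap B.P w = 0) :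
    C.mulCoord B w ∈ range ι.hom := by
  obtain ⟨⟨h1, h2⟩, h3⟩ := hw
  have e1 : C.A.ψ.symm w.1 ∈ range ι.hom := (C.A.slice _ (C.A.ψ.map_target h1)).2 (by
    rw [C.A.ψ.right_inv h1]; exact congrArg Prod.fst h0)
  have e2 : B.ψ.symm w.2 ∈ range ι.hom := (B.slice _ (B.ψ.map_target h2)).2 (by
    rw [B.ψ.right_inv h2]; exact congrArg Prod.snd h0)
  obtain ⟨h, hh⟩ := e1
  obtain ⟨k, hk⟩ := e2
  have h3 : (C.A.ψ.symm w.1, B.ψ.symm w.2) ∈ C.vertChart.dom := h3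
  show 𝒢.mul (C.vertChart.adjust (C.A.ψ.symm w.1, B.ψ.symm w.2)) (B.ψ.symm w.2) ∈ range ι.hom
  rw [← hh, ← hk] at h3 ⊢
  obtain ⟨h', hh'⟩ := C.adjust_mem_range h3
  have hs : 𝒢.s (C.vertChart.adjust (ι.hom h, ι.hom k)) = 𝒢.r (ι.hom k) :=
    C.vertChart.s_adjust h3
  rw [← hh'] at hs ⊢
  refine ⟨ℋ.mul h' k, (ι.mul_hom _ _ (ι.base.injective ?_)).symm⟩
  rw [← ι.s_hom, ← ι.r_hom, hs]

/-- The product of the deformation, in charts. -/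
noncomputable def dncMul (a b : DNC ι.hom) : DNC ι.hom :=
  deform ι.hom (C.mulCoord B) (C.A.P.prodMap B.P) (((C.A.dnc a).1, (B.dnc b).1), (C.A.dnc a).2)

theorem scaleBy_dnc {a b : DNC ι.hom} (ha : a.pt ∈ C.A.ψ.source) (hb : b.pt ∈ B.ψ.source)
    (hab : a.param = b.param) : scaleBy (C.A.P.prodMap B.P) (C.A.dnc a).2
      ((C.A.dnc a).1, (B.dnc b).1) = (C.A.ψ a.pt, B.ψ b.pt) := by
  have h1 := C.A.scale_dnc ha
  have h2 := B.scale_dnc hb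
  rw [B.dnc_snd, ← hab, ← C.A.dnc_snd] at h2
  exact Prod.ext h1 h2

theorem mem_mulDom {a b : G} (ha : a ∈ C.A.ψ.source) (hb : b ∈ B.ψ.source) (hab : 𝒢.s a = 𝒢.r b) :
    (C.A.ψ a, B.ψ b) ∈ C.mulDom B := by
  refine ⟨⟨C.A.ψ.map_source ha, B.ψ.map_source hb⟩, ?_⟩
  show (C.A.ψ.symm (C.A.ψ a), B.ψ.symm (B.ψ b)) ∈ C.vertChart.dom
  rw [C.A.ψ.left_inv ha, B.ψ.left_inv hb]
  exact C.vertChart.mem_dom ha hab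

theorem mulCoord_of_comp {a b : G} (ha : a ∈ C.A.ψ.source) (hb : b ∈ B.ψ.source)
    (hab : 𝒢.s a = 𝒢.r b) : C.mulCoord B (C.A.ψ a, B.ψ b) = 𝒢.mul a b := by
  show C.vertChart.mulExt (C.A.ψ.symm (C.A.ψ a), B.ψ.symm (B.ψ b)) = _
  rw [C.A.ψ.left_inv ha, B.ψ.left_inv hb]
  exact C.vertChart.mulExt_of_comp ha hab

/-- The open set on which the product of the deformation in charts is well behaved. -/
def dncMulDom : Set (DNC ι.hom × DNC ι.hom) :=
  (C.A.dnc.source ×ˢ B.dnc.source) ∩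
    (fun q ↦ scaleBy (C.A.P.prodMap B.P) (C.A.dnc q.1).2
      ((C.A.dnc q.1).1, (B.dnc q.2).1)) ⁻¹' C.mulDom B

theorem contMDiffOn_dnc_prod :
    ContMDiffOn (𝓘(ℝ, E × ℝ).prod 𝓘(ℝ, E × ℝ)) 𝓘(ℝ, (E × E) × ℝ) ∞
      (fun q : DNC ι.hom × DNC ι.hom ↦
        (((C.A.dnc q.1).1, (B.dnc q.2).1), (C.A.dnc q.1).2)) (C.A.dnc.source ×ˢ B.dnc.source) := by
  have h1 : ContMDiffOn (𝓘(ℝ, E × ℝ).prod 𝓘(ℝ, E × ℝ)) 𝓘(ℝ, E × ℝ) ∞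
      (fun q : DNC ι.hom × DNC ι.hom ↦ C.A.dnc q.1) (C.A.dnc.source ×ˢ B.dnc.source) :=
    (contMDiffOn_of_mem_maximalAtlas C.A.dnc_mem).comp contMDiffOn_fst fun _ hq ↦ hq.1
  have h2 : ContMDiffOn (𝓘(ℝ, E × ℝ).prod 𝓘(ℝ, E × ℝ)) 𝓘(ℝ, E × ℝ) ∞
      (fun q : DNC ι.hom × DNC ι.hom ↦ B.dnc q.2) (C.A.dnc.source ×ˢ B.dnc.source) :=
    (contMDiffOn_of_mem_maximalAtlas B.dnc_mem).comp contMDiffOn_snd fun _ hq ↦ hq.2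
  exact ((contDiff_fst.contMDiff.comp_contMDiffOn h1).prodMk_space
    (contDiff_fst.contMDiff.comp_contMDiffOn h2)).prodMk_space
      (contDiff_snd.contMDiff.comp_contMDiffOn h1)

theorem isOpen_dncMulDom : IsOpen (C.dncMulDom B) := by
  have h := (C.contMDiffOn_dnc_prod B).continuousOn
  exact ((contDiff_scaleBy (C.A.P.prodMap B.P)).continuous.comp_continuousOn h).isOpen_inter_preimage
    (C.A.dnc.open_source.prod B.dnc.open_source) (C.isOpen_mulDom B)

theorem contMDiffOn_dncMul : ContMDiffOn (𝓘(ℝ, E × ℝ).prod 𝓘(ℝ, E × ℝ)) 𝓘(ℝ, E × ℝ) ∞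
    (fun q : DNC ι.hom × DNC ι.hom ↦ C.dncMul B q.1 q.2) (C.dncMulDom B) :=
  (contMDiffOn_deform (C.isOpen_mulDom B) (C.contMDiffOn_mulCoord B)
    (fun _ hw h0 ↦ C.mulCoord_mem_range B hw h0) (C.prodMap_idem B)).comp
    ((C.contMDiffOn_dnc_prod B).mono inter_subset_left) fun _ hq ↦ hq.2

theorem mem_dncMulDom {a b : DNC ι.hom} (ha : a.pt ∈ C.A.ψ.source) (hb : b.pt ∈ B.ψ.source)
    (h : a.param = b.param) (hab : 𝒢.s a.pt = 𝒢.r b.pt) : (a, b) ∈ C.dncMulDom B := by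
  refine ⟨⟨C.A.mem_dnc_source.2 ha, B.mem_dnc_source.2 hb⟩, ?_⟩
  show scaleBy (C.A.P.prodMap B.P) (C.A.dnc a).2 ((C.A.dnc a).1, (B.dnc b).1) ∈ C.mulDom B
  rw [C.scaleBy_dnc B ha hb h]
  exact C.mem_mulDom B ha hb hab

theorem pt_dncMul {a b : DNC ι.hom} (ha : a.pt ∈ C.A.ψ.source) (hb : b.pt ∈ B.ψ.source)
    (h : a.param = b.param) (hab : 𝒢.s a.pt = 𝒢.r b.pt) :
    (C.dncMul B a b).pt = 𝒢.mul a.pt b.pt := by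
  have h1 : scaleBy (C.A.P.prodMap B.P) (C.A.dnc a).2 ((C.A.dnc a).1, (B.dnc b).1) ∈ C.mulDom B :=
    (C.mem_dncMulDom B ha hb h hab).2
  rw [dncMul, pt_deform h1 (fun _ hw h0 ↦ C.mulCoord_mem_range B hw h0) (C.prodMap_idem B)]
  refine (congrArg (C.mulCoord B) (C.scaleBy_dnc B ha hb h)).trans ?_
  exact C.mulCoord_of_comp B ha hb hab

theorem dncMul_gen {x y : G} {t : ℝ} (ht : t ≠ 0) (hx : x ∈ C.A.ψ.source) (hy : y ∈ B.ψ.source)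
    (hxy : 𝒢.s x = 𝒢.r y) :
    C.dncMul B (.gen x t ht) (.gen y t ht) = .gen (𝒢.mul x y) t ht := by
  have h2 := C.pt_dncMul B (a := .gen x t ht) (b := .gen y t ht) hx hy rfl hxy
  have h1 : C.dncMul B (.gen x t ht) (.gen y t ht) = .gen (C.mulCoord B
      (scaleBy (C.A.P.prodMap B.P) t (C.A.scale t⁻¹ (C.A.ψ x), B.scale t⁻¹ (B.ψ y)))) t ht :=
    deform_of_ne ht
  rw [h1] at h2 ⊢
  exact congrArg (fun z ↦ DNC.gen z t ht) h2

end SubmersionChart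

/-! ### The structure maps of the deformation groupoid -/

namespace LieSubgroupoid

/-- The source map of the deformation groupoid. -/
noncomputable def dncS : DNC ι.hom → DNC ι.base := DNC.map ι.hom ι.base 𝒢.s ℋ.s

/-- The range map of the deformation groupoid. -/
noncomputable def dncR : DNC ι.hom → DNC ι.base := DNC.map ι.hom ι.base 𝒢.r ℋ.r

/-- The units of the deformation groupoid. -/
noncomputable def dncU : DNC ι.base → DNC ι.hom := DNC.map ι.base ι.hom 𝒢.u ℋ.u

/-- The inversion of the deformation groupoid. -/
noncomputable def dncInv : DNC ι.hom → DNC ι.hom := DNC.map ι.hom ι.hom 𝒢.inv ℋ.inv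

theorem exists_chart (h : H) :
    ∃ C : SubmersionChart ι.hom ι.base 𝒢.s, ι.hom h ∈ C.A.ψ.source :=
  exists_submersionChart ι.hom ι.base 𝒢.isSubmersion_s ℋ.isSubmersion_s ι.s_hom h

/-- The product of the deformation groupoid. -/
noncomputable def dncMul : DNC ι.hom → DNC ι.hom → DNC ι.hom
  -- Composable arrows have the same parameter. The second parameter may thus be ignored here, and
  -- the mixed cases receive an arbitrary value.
  | .gen x t ht, .gen y _ _ => .gen (𝒢.mul x y) t ht
  -- The chosen charts are irrelevant for composable arrows, by `dncMul_eq_chart`.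
  | .nor m, .nor n =>
    (ι.exists_chart m.base).choose.dncMul (ι.exists_chart n.base).choose.A (.nor m) (.nor n)
  | a, _ => a

@[simp] theorem param_dncS (a : DNC ι.hom) : (ι.dncS a).param = a.param := DNC.param_map a

@[simp] theorem param_dncR (a : DNC ι.hom) : (ι.dncR a).param = a.param := DNC.param_map a

theorem pt_dncS (a : DNC ι.hom) : (ι.dncS a).pt = 𝒢.s a.pt := DNC.pt_map ι.s_hom a

theorem pt_dncR (a : DNC ι.hom) : (ι.dncR a).pt = 𝒢.r a.pt := DNC.pt_map ι.r_hom a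

theorem pt_dncU (a : DNC ι.base) : (ι.dncU a).pt = 𝒢.u a.pt := DNC.pt_map ι.u_base a

theorem pt_dncInv (a : DNC ι.hom) : (ι.dncInv a).pt = 𝒢.inv a.pt := DNC.pt_map ι.inv_hom a

theorem isSubmersion_dncS : Manifold.IsSubmersion 𝓘(ℝ, E × ℝ) 𝓘(ℝ, E₀ × ℝ) ∞ ι.dncS :=
  DNC.isSubmersion_map 𝒢.isSubmersion_s ℋ.isSubmersion_s ι.s_hom

theorem contMDiff_dncS : ContMDiff 𝓘(ℝ, E × ℝ) 𝓘(ℝ, E₀ × ℝ) ∞ ι.dncS :=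
  ι.isSubmersion_dncS.contMDiff

theorem contMDiff_dncR : ContMDiff 𝓘(ℝ, E × ℝ) 𝓘(ℝ, E₀ × ℝ) ∞ ι.dncR :=
  DNC.contMDiff_map 𝒢.contMDiff_r (ℋ.contMDiff_r.mdifferentiable (by simp)) ι.r_hom

theorem contMDiff_dncU : ContMDiff 𝓘(ℝ, E₀ × ℝ) 𝓘(ℝ, E × ℝ) ∞ ι.dncU :=
  DNC.contMDiff_map 𝒢.contMDiff_u (ℋ.contMDiff_u.mdifferentiable (by simp)) ι.u_base

theorem contMDiff_dncInv : ContMDiff 𝓘(ℝ, E × ℝ) 𝓘(ℝ, E × ℝ) ∞ ι.dncInv :=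
  DNC.contMDiff_map 𝒢.contMDiff_inv (ℋ.contMDiff_inv.mdifferentiable (by simp)) ι.inv_hom

variable {ι}

theorem param_eq_of_comp {a b : DNC ι.hom} (h : ι.dncS a = ι.dncR b) : a.param = b.param := by
  simpa using congrArg DNC.param h

theorem comp_pt {a b : DNC ι.hom} (h : ι.dncS a = ι.dncR b) : 𝒢.s a.pt = 𝒢.r b.pt := by
  rw [← pt_dncS, ← pt_dncR, h]

theorem dncMul_of_ne {a b : DNC ι.hom} (ha : a.param ≠ 0) (h : ι.dncS a = ι.dncR b) :
    ι.dncMul a b = .gen (𝒢.mul a.pt b.pt) a.param ha := by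
  have h1 := param_eq_of_comp h
  cases a with
  | nor n => exact (ha rfl).elim
  | gen x t ht =>
    cases b with
    | nor n => exact (ha h1).elim
    | gen y t' ht' => rfl

/-- Approximation of a composable pair over `t = 0` by composable pairs for `t ≠ 0`. -/
theorem exists_tendsto_comp {a b : DNC ι.hom} (h : ι.dncS a = ι.dncR b) (h0 : a.param = 0) :
    ∃ α β : ℝ → DNC ι.hom, Filter.Tendsto α (𝓝[≠] 0) (𝓝 a) ∧ Filter.Tendsto β (𝓝[≠] 0) (𝓝 b) ∧
      ∀ᶠ t in 𝓝[≠] (0 : ℝ), ι.dncS (α t) = ι.dncR (β t) ∧ (α t).param ≠ 0 := by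
  obtain ⟨n, rfl⟩ := DNC.exists_nor ((param_eq_of_comp h).symm.trans h0)
  obtain ⟨β, hβ⟩ := DNC.exists_tendsto n
  have h1 : Filter.Tendsto (fun t ↦ ι.dncR (DNC.genD ι.hom (β t, t))) (𝓝[≠] 0) (𝓝 (ι.dncS a)) := by
    rw [h]
    exact (ι.contMDiff_dncR.continuous.tendsto _).comp hβ
  obtain ⟨α, hα, hαβ⟩ := exists_tendsto_lift ι.isSubmersion_dncS h1
  refine ⟨α, _, hα, hβ, ?_⟩
  filter_upwards [hαβ, self_mem_nhdsWithin] with t ht ht0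
  refine ⟨ht, ?_⟩
  rw [param_eq_of_comp ht, DNC.genD_of_ne ht0]
  exact ht0

/-- For `t ≠ 0` the product in charts is the product of `G`, and it is continuous on the open set
`C.dncMulDom B`. Its value over `t = 0` is thus a limit of products formed in `G`. -/
theorem tendsto_chart_dncMul {X : Type*} {l : Filter X} {α β : X → DNC ι.hom} {a b : DNC ι.hom}
    (C : SubmersionChart ι.hom ι.base 𝒢.s) (B : AdaptedChart ι.hom)
    (ha : a.pt ∈ C.A.ψ.source) (hb : b.pt ∈ B.ψ.source)
    (hα : Filter.Tendsto α l (𝓝 a)) (hβ : Filter.Tendsto β l (𝓝 b)) (h : ι.dncS a = ι.dncR b)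
    (hαβ : ∀ᶠ t in l, ι.dncS (α t) = ι.dncR (β t) ∧ (α t).param ≠ 0) :
    Filter.Tendsto (fun t ↦ ι.dncMul (α t) (β t)) l (𝓝 (C.dncMul B a b)) := by
  have h1 := C.mem_dncMulDom B ha hb (param_eq_of_comp h) (comp_pt h)
  have h2 := ((C.contMDiffOn_dncMul B).continuousOn.continuousAt
    ((C.isOpen_dncMulDom B).mem_nhds h1)).tendsto.comp (hα.prodMk_nhds hβ)
  refine h2.congr' ?_
  have p1 := (DNC.contMDiff_pt.continuous.tendsto a).comp hα
  have p2 := (DNC.contMDiff_pt.continuous.tendsto b).comp hβ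
  filter_upwards [hαβ, p1.eventually (C.A.ψ.open_source.mem_nhds ha),
    p2.eventually (B.ψ.open_source.mem_nhds hb)] with t ht h3 h4
  have h3 : (α t).pt ∈ C.A.ψ.source := h3
  have h4 : (β t).pt ∈ B.ψ.source := h4
  rw [dncMul_of_ne ht.2 ht.1, ← C.dncMul_gen B ht.2 h3 h4 (comp_pt ht.1)]
  have e1 : DNC.gen (DNC.pt (β t)) (DNC.param (α t)) ht.2 = β t := by
    have := param_eq_of_comp ht.1
    have h5 : (β t).param ≠ 0 := this ▸ ht.2
    conv_rhs => rw [DNC.eq_gen h5]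
    simp [this]
  have e2 := DNC.eq_gen ht.2
  exact (congrArg₂ (C.dncMul B) e2 e1.symm)

/-- Over `t = 0`, the products in two choices of charts are limits of the same net of products with
`t ≠ 0`, and they have the same image in `G`. Hence they are equal. -/
theorem dncMul_eq_chart {a b : DNC ι.hom}
    (C : SubmersionChart ι.hom ι.base 𝒢.s) (B : AdaptedChart ι.hom)
    (ha : a.pt ∈ C.A.ψ.source) (hb : b.pt ∈ B.ψ.source) (h : ι.dncS a = ι.dncR b) :
    ι.dncMul a b = C.dncMul B a b := by
  by_cases h0 : a.param = 0
  · obtain ⟨α, β, hα, hβ, hαβ⟩ := exists_tendsto_comp h h0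
    obtain ⟨m, rfl⟩ := DNC.exists_nor h0
    obtain ⟨n, rfl⟩ := DNC.exists_nor ((param_eq_of_comp h).symm.trans h0)
    have h1 := (ι.exists_chart m.base).choose_spec
    have h2 := (ι.exists_chart n.base).choose_spec
    exact DNC.eq_of_tendsto (tendsto_chart_dncMul _ _ h1 h2 hα hβ h hαβ)
      (tendsto_chart_dncMul C B ha hb hα hβ h hαβ) (by
        rw [C.pt_dncMul B ha hb rfl (comp_pt h)]
        exact SubmersionChart.pt_dncMul _ _ h1 h2 rfl (comp_pt h))
  · rw [dncMul_of_ne h0 h, ← C.dncMul_gen B h0 ha hb (comp_pt h)]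
    have e1 : DNC.gen (DNC.pt b) (DNC.param a) h0 = b := by
      have := param_eq_of_comp h
      have h5 : b.param ≠ 0 := this ▸ h0
      conv_rhs => rw [DNC.eq_gen h5]
      simp [this]
    exact (congrArg₂ (C.dncMul B) (DNC.eq_gen h0) e1.symm).symm

theorem pt_dncMul {a b : DNC ι.hom} (h : ι.dncS a = ι.dncR b) :
    (ι.dncMul a b).pt = 𝒢.mul a.pt b.pt := by
  by_cases h0 : a.param = 0
  · obtain ⟨m, rfl⟩ := DNC.exists_nor h0
    obtain ⟨n, rfl⟩ := DNC.exists_nor ((param_eq_of_comp h).symm.trans h0)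
    exact SubmersionChart.pt_dncMul _ _ (ι.exists_chart m.base).choose_spec
      (ι.exists_chart n.base).choose_spec rfl (comp_pt h)
  · rw [dncMul_of_ne h0 h]; rfl

/-- Near `t = 0` the product agrees with the product in charts, which is smooth on an open set. Near
`t ≠ 0` it is the extended product of `G`, with the parameter carried along. -/
theorem contMDiffOn_dncMul : ContMDiffOn (𝓘(ℝ, E × ℝ).prod 𝓘(ℝ, E × ℝ)) 𝓘(ℝ, E × ℝ) ∞
    (fun q : DNC ι.hom × DNC ι.hom ↦ ι.dncMul q.1 q.2) {q | ι.dncS q.1 = ι.dncR q.2} := by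
  rintro ⟨a, b⟩ hab
  have hab : ι.dncS a = ι.dncR b := hab
  by_cases h0 : a.param = 0
  · obtain ⟨m, rfl⟩ := DNC.exists_nor h0
    obtain ⟨n, rfl⟩ := DNC.exists_nor ((param_eq_of_comp hab).symm.trans h0)
    obtain ⟨C, hC⟩ := ι.exists_chart m.base
    obtain ⟨B, hB⟩ := exists_adaptedChart ι.hom n.base
    have hd := (C.isOpen_dncMulDom B).mem_nhds (C.mem_dncMulDom B (a := .nor m) (b := .nor n)
      hC hB rfl (comp_pt hab))
    have h1 := ((C.contMDiffOn_dncMul B).contMDiffAt hd).contMDiffWithinAt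
      (s := {q | ι.dncS q.1 = ι.dncR q.2})
    refine h1.congr_of_eventuallyEq ?_ (dncMul_eq_chart C B hC hB hab)
    filter_upwards [self_mem_nhdsWithin, nhdsWithin_le_nhds hd] with q hq hq'
    exact dncMul_eq_chart C B (C.A.mem_dnc_source.1 hq'.1.1) (B.mem_dnc_source.1 hq'.1.2) hq
  · obtain ⟨C, hC⟩ := 𝒢.exists_vertChart a.pt
    have hd : C.dom ∈ 𝓝 (a.pt, b.pt) := C.isOpen_dom.mem_nhds (C.mem_dom hC (comp_pt hab))
    have hp : ContMDiffAt (𝓘(ℝ, E × ℝ).prod 𝓘(ℝ, E × ℝ)) (𝓘(ℝ, E).prod 𝓘(ℝ, E)) ∞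
        (fun q : DNC ι.hom × DNC ι.hom ↦ (q.1.pt, q.2.pt)) (a, b) :=
      ((DNC.contMDiff_pt.comp contMDiff_fst).prodMk (DNC.contMDiff_pt.comp contMDiff_snd)).contMDiffAt
    have ht : ContMDiffAt (𝓘(ℝ, E × ℝ).prod 𝓘(ℝ, E × ℝ)) 𝓘(ℝ, ℝ) ∞
        (fun q : DNC ι.hom × DNC ι.hom ↦ q.1.param) (a, b) :=
      (DNC.contMDiff_param.comp contMDiff_fst).contMDiffAt
    have hmul := (ContMDiffAt.comp (g := C.mulExt) (a, b) (C.contMDiffOn_mulExt.contMDiffAt hd) hp)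
    have hg : ContMDiffAt (𝓘(ℝ, E).prod 𝓘(ℝ, ℝ)) 𝓘(ℝ, E × ℝ) ∞ (DNC.genD ι.hom)
        (C.mulExt (a.pt, b.pt), a.param) :=
      DNC.contMDiffOn_genD.contMDiffAt ((isOpen_ne.preimage continuous_snd).mem_nhds h0)
    have h1 := (ContMDiffAt.comp (g := DNC.genD ι.hom) (a, b) hg (hmul.prodMk ht)).contMDiffWithinAt
      (s := {q | ι.dncS q.1 = ι.dncR q.2})
    have key : ∀ q : DNC ι.hom × DNC ι.hom, ι.dncS q.1 = ι.dncR q.2 → q.1.param ≠ 0 →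
        q.1.pt ∈ C.ψ.source → ι.dncMul q.1 q.2 =
        DNC.genD ι.hom (C.mulExt (q.1.pt, q.2.pt), q.1.param) := fun q hq h3 h4 ↦ by
      rw [dncMul_of_ne h3 hq, DNC.genD_of_ne h3, C.mulExt_of_comp h4 (comp_pt hq)]
    refine h1.congr_of_eventuallyEq ?_ (key (a, b) hab h0 hC)
    have n1 := ht.continuousAt.eventually_ne h0
    have n2 : ∀ᶠ q : DNC ι.hom × DNC ι.hom in 𝓝 (a, b), q.1.pt ∈ C.ψ.source :=
      (continuous_fst.continuousAt.comp hp.continuousAt).eventually (C.ψ.open_source.mem_nhds hC)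
    filter_upwards [self_mem_nhdsWithin, nhdsWithin_le_nhds n1, nhdsWithin_le_nhds n2]
      with q hq h3 h4 using key q hq h3 h4

theorem tendsto_dncMul {X : Type*} {l : Filter X} {α β : X → DNC ι.hom} {a b : DNC ι.hom}
    (hα : Filter.Tendsto α l (𝓝 a)) (hβ : Filter.Tendsto β l (𝓝 b)) (h : ι.dncS a = ι.dncR b)
    (hαβ : ∀ᶠ t in l, ι.dncS (α t) = ι.dncR (β t)) :
    Filter.Tendsto (fun t ↦ ι.dncMul (α t) (β t)) l (𝓝 (ι.dncMul a b)) := by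
  have h1 := (contMDiffOn_dncMul (ι := ι) (a, b) h).continuousWithinAt
  exact h1.tendsto.comp (tendsto_nhdsWithin_iff.2 ⟨hα.prodMk_nhds hβ, hαβ⟩)

end LieSubgroupoid

end Groupoid

/-! ### The groupoid laws of the deformation, and its functorial description -/

section Groupoid

variable {E E₀ G G₀ : Type*} [NormedAddCommGroup E] [NormedSpace ℝ E]
  [NormedAddCommGroup E₀] [NormedSpace ℝ E₀] [TopologicalSpace G] [ChartedSpace E G]
  [TopologicalSpace G₀] [ChartedSpace E₀ G₀] [IsManifold 𝓘(ℝ, E) ∞ G]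
  [IsManifold 𝓘(ℝ, E₀) ∞ G₀]
  {E' E₀' H H₀ : Type*} [NormedAddCommGroup E'] [NormedSpace ℝ E']
  [NormedAddCommGroup E₀'] [NormedSpace ℝ E₀'] [TopologicalSpace H] [ChartedSpace E' H]
  [TopologicalSpace H₀] [ChartedSpace E₀' H₀] [IsManifold 𝓘(ℝ, E') ∞ H]
  [IsManifold 𝓘(ℝ, E₀') ∞ H₀] [FiniteDimensional ℝ E] [FiniteDimensional ℝ E₀]
  {ℋ : LieGroupoid E' E₀' H H₀} {𝒢 : LieGroupoid E E₀ G G₀}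

theorem LieGroupoid.mdifferentiable_structure {E E₀ G G₀ : Type*} [NormedAddCommGroup E]
    [NormedSpace ℝ E] [NormedAddCommGroup E₀] [NormedSpace ℝ E₀] [TopologicalSpace G]
    [ChartedSpace E G] [TopologicalSpace G₀] [ChartedSpace E₀ G₀] [IsManifold 𝓘(ℝ, E) ∞ G]
    [IsManifold 𝓘(ℝ, E₀) ∞ G₀] (𝒢 : LieGroupoid E E₀ G G₀) :
    MDifferentiable 𝓘(ℝ, E) 𝓘(ℝ, E₀) 𝒢.s ∧ MDifferentiable 𝓘(ℝ, E) 𝓘(ℝ, E₀) 𝒢.r ∧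
    MDifferentiable 𝓘(ℝ, E₀) 𝓘(ℝ, E) 𝒢.u ∧ MDifferentiable 𝓘(ℝ, E) 𝓘(ℝ, E) 𝒢.inv :=
  ⟨𝒢.contMDiff_s.mdifferentiable (by simp), 𝒢.contMDiff_r.mdifferentiable (by simp),
    𝒢.contMDiff_u.mdifferentiable (by simp), 𝒢.contMDiff_inv.mdifferentiable (by simp)⟩

namespace LieSubgroupoid

section Laws

variable (ι : LieSubgroupoid ℋ 𝒢)

theorem dncS_dncU (x : DNC ι.base) : ι.dncS (ι.dncU x) = x := by
  obtain ⟨a1, a2, a3, a4⟩ := 𝒢.mdifferentiable_structure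
  obtain ⟨b1, b2, b3, b4⟩ := ℋ.mdifferentiable_structure
  exact (DNC.map_map_eq a3 b3 ι.u_base a1 b1 ι.s_hom 𝒢.s_u ℋ.s_u x).trans (DNC.map_id x)

theorem dncR_dncU (x : DNC ι.base) : ι.dncR (ι.dncU x) = x := by
  obtain ⟨a1, a2, a3, a4⟩ := 𝒢.mdifferentiable_structure
  obtain ⟨b1, b2, b3, b4⟩ := ℋ.mdifferentiable_structure
  exact (DNC.map_map_eq a3 b3 ι.u_base a2 b2 ι.r_hom 𝒢.r_u ℋ.r_u x).trans (DNC.map_id x)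

theorem dncS_dncInv (a : DNC ι.hom) : ι.dncS (ι.dncInv a) = ι.dncR a := by
  obtain ⟨a1, a2, a3, a4⟩ := 𝒢.mdifferentiable_structure
  obtain ⟨b1, b2, b3, b4⟩ := ℋ.mdifferentiable_structure
  exact DNC.map_map_eq a4 b4 ι.inv_hom a1 b1 ι.s_hom 𝒢.s_inv ℋ.s_inv a

theorem dncR_dncInv (a : DNC ι.hom) : ι.dncR (ι.dncInv a) = ι.dncS a := by
  obtain ⟨a1, a2, a3, a4⟩ := 𝒢.mdifferentiable_structure
  obtain ⟨b1, b2, b3, b4⟩ := ℋ.mdifferentiable_structure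
  exact DNC.map_map_eq a4 b4 ι.inv_hom a2 b2 ι.r_hom 𝒢.r_inv ℋ.r_inv a

theorem dncInv_dncInv (a : DNC ι.hom) : ι.dncInv (ι.dncInv a) = a := by
  obtain ⟨a1, a2, a3, a4⟩ := 𝒢.mdifferentiable_structure
  obtain ⟨b1, b2, b3, b4⟩ := ℋ.mdifferentiable_structure
  exact (DNC.map_map_eq a4 b4 ι.inv_hom a4 b4 ι.inv_hom 𝒢.inv_inv ℋ.inv_inv a).trans (DNC.map_id a)

variable {ι}

theorem dncMul_of_ne' {a b : DNC ι.hom} (h : ι.dncS a = ι.dncR b) (ha : a.param ≠ 0) :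
    (ι.dncMul a b).param = a.param := by
  rw [dncMul_of_ne ha h]; rfl

theorem dnc_ext_of_ne {i : SmoothEmbedding E' H E G} {a b : DNC i} (ha : a.param ≠ 0)
    (h : a.param = b.param) (hpt : a.pt = b.pt) : a = b := by
  rw [DNC.eq_gen ha, DNC.eq_gen (p := b) (h ▸ ha)]
  simp [h, hpt]

/-- The law of `G` gives the case `t ≠ 0`. A composable pair over `t = 0` is a limit of composable
pairs with `t ≠ 0`, and both sides have the same image in `G₀`. -/
theorem dncS_dncMul {a b : DNC ι.hom} (h : ι.dncS a = ι.dncR b) :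
    ι.dncS (ι.dncMul a b) = ι.dncS b := by
  have hne : ∀ a b : DNC ι.hom, ι.dncS a = ι.dncR b → a.param ≠ 0 →
      ι.dncS (ι.dncMul a b) = ι.dncS b := fun a b h h0 ↦ by
    have hb : b.param ≠ 0 := param_eq_of_comp h ▸ h0
    rw [dncMul_of_ne h0 h]
    conv_rhs => rw [DNC.eq_gen hb]
    show DNC.gen _ _ _ = DNC.gen _ _ _
    simp [𝒢.s_mul _ _ (comp_pt h), param_eq_of_comp h]
  by_cases h0 : a.param = 0
  · obtain ⟨α, β, hα, hβ, hαβ⟩ := exists_tendsto_comp h h0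
    have h1 := tendsto_dncMul hα hβ h (hαβ.mono fun _ h ↦ h.1)
    refine DNC.eq_of_tendsto ((ι.contMDiff_dncS.continuous.tendsto _).comp h1)
      (((ι.contMDiff_dncS.continuous.tendsto _).comp hβ).congr' ?_) ?_
    · filter_upwards [hαβ] with t ht using (hne _ _ ht.1 ht.2).symm
    · rw [pt_dncS, pt_dncS, pt_dncMul h, 𝒢.s_mul _ _ (comp_pt h)]
  · exact hne a b h h0

theorem dncR_dncMul {a b : DNC ι.hom} (h : ι.dncS a = ι.dncR b) :
    ι.dncR (ι.dncMul a b) = ι.dncR a := by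
  have hne : ∀ a b : DNC ι.hom, ι.dncS a = ι.dncR b → a.param ≠ 0 →
      ι.dncR (ι.dncMul a b) = ι.dncR a := fun a b h h0 ↦ by
    rw [dncMul_of_ne h0 h]
    conv_rhs => rw [DNC.eq_gen h0]
    show DNC.gen _ _ _ = DNC.gen _ _ _
    simp [𝒢.r_mul _ _ (comp_pt h)]
  by_cases h0 : a.param = 0
  · obtain ⟨α, β, hα, hβ, hαβ⟩ := exists_tendsto_comp h h0
    have h1 := tendsto_dncMul hα hβ h (hαβ.mono fun _ h ↦ h.1)
    refine DNC.eq_of_tendsto ((ι.contMDiff_dncR.continuous.tendsto _).comp h1)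
      (((ι.contMDiff_dncR.continuous.tendsto _).comp hα).congr' ?_) ?_
    · filter_upwards [hαβ] with t ht using (hne _ _ ht.1 ht.2).symm
    · rw [pt_dncR, pt_dncR, pt_dncMul h, 𝒢.r_mul _ _ (comp_pt h)]
  · exact hne a b h h0

/-- An identity between continuous maps to `DNC` which lift a given map to `G` may be checked
for `t ≠ 0`. -/
theorem dnc_eq_of_ne {F F' : DNC ι.hom → DNC ι.hom} {a : DNC ι.hom}
    (hF : ∀ α : ℝ → DNC ι.hom, Filter.Tendsto α (𝓝[≠] 0) (𝓝 a) →
      Filter.Tendsto (F ∘ α) (𝓝[≠] 0) (𝓝 (F a)))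
    (hF' : ∀ α : ℝ → DNC ι.hom, Filter.Tendsto α (𝓝[≠] 0) (𝓝 a) →
      Filter.Tendsto (F' ∘ α) (𝓝[≠] 0) (𝓝 (F' a)))
    (hpt : (F a).pt = (F' a).pt) (hne : ∀ a, a.param ≠ 0 → F a = F' a) : F a = F' a := by
  by_cases h0 : a.param = 0
  · obtain ⟨n, rfl⟩ := DNC.exists_nor h0
    obtain ⟨α, hα⟩ := DNC.exists_tendsto n
    refine DNC.eq_of_tendsto (hF _ hα) ((hF' _ hα).congr' ?_) hpt
    filter_upwards [self_mem_nhdsWithin] with t ht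
    refine (hne (DNC.genD ι.hom (α t, t)) ?_).symm
    rw [DNC.genD_of_ne ht]
    exact ht
  · exact hne a h0

/-- For the laws in one arrow, both sides are continuous in `a`: the pair being multiplied is
composable for every `a`, so the product is continuous along it. -/
theorem dncMul_dncU (a : DNC ι.hom) : ι.dncMul a (ι.dncU (ι.dncS a)) = a := by
  have hc : ∀ a : DNC ι.hom, ι.dncS a = ι.dncR (ι.dncU (ι.dncS a)) := fun a ↦
    (ι.dncR_dncU _).symm
  refine dnc_eq_of_ne (F := fun a ↦ ι.dncMul a (ι.dncU (ι.dncS a))) (F' := id) (fun α hα ↦ ?_)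
    (fun α hα ↦ hα) ?_ fun a ha ↦ ?_
  · exact tendsto_dncMul hα (((ι.contMDiff_dncU.comp ι.contMDiff_dncS).continuous.tendsto _).comp hα)
      (hc a) (.of_forall fun t ↦ hc _)
  · show (ι.dncMul a (ι.dncU (ι.dncS a))).pt = a.pt
    rw [pt_dncMul (hc a), pt_dncU, pt_dncS, 𝒢.mul_u]
  · refine (dnc_ext_of_ne ha ?_ ?_).symm
    · exact (dncMul_of_ne' (hc a) ha).symm
    · show a.pt = (ι.dncMul a (ι.dncU (ι.dncS a))).pt
      rw [pt_dncMul (hc a), pt_dncU, pt_dncS, 𝒢.mul_u]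

theorem dncU_dncMul (a : DNC ι.hom) : ι.dncMul (ι.dncU (ι.dncR a)) a = a := by
  have hc : ∀ a : DNC ι.hom, ι.dncS (ι.dncU (ι.dncR a)) = ι.dncR a := fun a ↦ ι.dncS_dncU _
  have hpt : (ι.dncMul (ι.dncU (ι.dncR a)) a).pt = a.pt := by
    rw [pt_dncMul (hc a), pt_dncU, pt_dncR, 𝒢.u_mul]
  refine dnc_eq_of_ne (F := fun a ↦ ι.dncMul (ι.dncU (ι.dncR a)) a) (F' := id) (fun α hα ↦ ?_)
    (fun α hα ↦ hα) hpt fun a ha ↦ ?_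
  · exact tendsto_dncMul (((ι.contMDiff_dncU.comp ι.contMDiff_dncR).continuous.tendsto _).comp hα) hα
      (hc a) (.of_forall fun t ↦ hc _)
  · have ha' : (ι.dncU (ι.dncR a)).param = a.param := param_eq_of_comp (hc a)
    refine (dnc_ext_of_ne ha ?_ ?_).symm
    · exact ((dncMul_of_ne' (hc a) (ha' ▸ ha)).trans ha').symm
    · show a.pt = (ι.dncMul (ι.dncU (ι.dncR a)) a).pt
      rw [pt_dncMul (hc a), pt_dncU, pt_dncR, 𝒢.u_mul]

theorem dncInv_dncMul (a : DNC ι.hom) : ι.dncMul (ι.dncInv a) a = ι.dncU (ι.dncS a) := by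
  have hc : ∀ a : DNC ι.hom, ι.dncS (ι.dncInv a) = ι.dncR a := fun a ↦ ι.dncS_dncInv _
  have hpt : ∀ a, (ι.dncMul (ι.dncInv a) a).pt = (ι.dncU (ι.dncS a)).pt := fun a ↦ by
    rw [pt_dncMul (hc a), pt_dncU, pt_dncS, pt_dncInv, 𝒢.inv_mul]
  refine dnc_eq_of_ne (F := fun a ↦ ι.dncMul (ι.dncInv a) a) (F' := fun a ↦ ι.dncU (ι.dncS a))
    (fun α hα ↦ ?_) (fun α hα ↦ ?_) (hpt a) fun a ha ↦ ?_
  · exact tendsto_dncMul ((ι.contMDiff_dncInv.continuous.tendsto _).comp hα) hα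
      (hc a) (.of_forall fun t ↦ hc _)
  · exact ((ι.contMDiff_dncU.comp ι.contMDiff_dncS).continuous.tendsto _).comp hα
  · have ha' : (ι.dncInv a).param = a.param := param_eq_of_comp (hc a)
    have hu : (ι.dncU (ι.dncS a)).param = a.param := by
      show (DNC.map _ _ _ _ _).param = _
      rw [DNC.param_map, param_dncS]
    have hm := (dncMul_of_ne' (hc a) (ha' ▸ ha)).trans ha'
    exact dnc_ext_of_ne (hm ▸ ha) (hm.trans hu.symm) (hpt a)

theorem dncMul_assoc {a b c : DNC ι.hom} (hab : ι.dncS a = ι.dncR b) (hbc : ι.dncS b = ι.dncR c) :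
    ι.dncMul (ι.dncMul a b) c = ι.dncMul a (ι.dncMul b c) := by
  have c1 : ∀ {a b c : DNC ι.hom}, ι.dncS a = ι.dncR b → ι.dncS b = ι.dncR c →
      ι.dncS (ι.dncMul a b) = ι.dncR c := fun hab hbc ↦ (dncS_dncMul hab).trans hbc
  have c2 : ∀ {a b c : DNC ι.hom}, ι.dncS a = ι.dncR b → ι.dncS b = ι.dncR c →
      ι.dncS a = ι.dncR (ι.dncMul b c) := fun hab hbc ↦ hab.trans (dncR_dncMul hbc).symm
  have hpt : ∀ {a b c : DNC ι.hom}, ι.dncS a = ι.dncR b → ι.dncS b = ι.dncR c →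
      (ι.dncMul (ι.dncMul a b) c).pt = (ι.dncMul a (ι.dncMul b c)).pt := fun hab hbc ↦ by
    rw [pt_dncMul (c1 hab hbc), pt_dncMul (c2 hab hbc), pt_dncMul hab, pt_dncMul hbc,
      𝒢.mul_assoc _ _ _ (comp_pt hab) (comp_pt hbc)]
  have hne : ∀ {a b c : DNC ι.hom}, ι.dncS a = ι.dncR b → ι.dncS b = ι.dncR c → a.param ≠ 0 →
      ι.dncMul (ι.dncMul a b) c = ι.dncMul a (ι.dncMul b c) := fun {a b c} hab hbc ha ↦ by
    have h1 := dncMul_of_ne' hab ha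
    have h2 := dncMul_of_ne' (c1 hab hbc) (h1 ▸ ha)
    have h3 := dncMul_of_ne' (c2 hab hbc) ha
    exact dnc_ext_of_ne (by rwa [h2, h1]) (by rw [h2, h1, h3]) (hpt hab hbc)
  by_cases h0 : a.param = 0
  · obtain ⟨β, γ, hβ, hγ, hβγ⟩ := exists_tendsto_comp hbc ((param_eq_of_comp hab).symm.trans h0)
    have h1 : Filter.Tendsto (fun t ↦ ι.dncR (β t)) (𝓝[≠] 0) (𝓝 (ι.dncS a)) := by
      rw [hab]
      exact (ι.contMDiff_dncR.continuous.tendsto _).comp hβ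
    -- Lifting the range of `β` through the source, which is a submersion, completes the
    -- approximating pairs `(β, γ)` to composable triples.
    obtain ⟨α, hα, hαβ⟩ := exists_tendsto_lift ι.isSubmersion_dncS h1
    have m1 := tendsto_dncMul hα hβ hab hαβ
    have m2 := tendsto_dncMul hβ hγ hbc (hβγ.mono fun _ h ↦ h.1)
    have m3 := tendsto_dncMul m1 hγ (c1 hab hbc) (by
      filter_upwards [hαβ, hβγ] with t h1 h2 using c1 h1 h2.1)
    have m4 := tendsto_dncMul hα m2 (c2 hab hbc) (by
      filter_upwards [hαβ, hβγ] with t h1 h2 using c2 h1 h2.1)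
    refine DNC.eq_of_tendsto m3 (m4.congr' ?_) (hpt hab hbc)
    filter_upwards [hαβ, hβγ] with t h1 h2
    exact (hne h1 h2.1 (by rw [param_eq_of_comp h1]; exact h2.2)).symm
  · exact hne hab hbc h0

variable (ι) in
/-- The deformation to the normal cone of a Lie subgroupoid is a Lie groupoid. -/
noncomputable def dnc : LieGroupoid (E × ℝ) (E₀ × ℝ) (DNC ι.hom) (DNC ι.base) where
  s := ι.dncS
  r := ι.dncR
  u := ι.dncU
  inv := ι.dncInv
  mul := ι.dncMul
  s_u := ι.dncS_dncU
  r_u := ι.dncR_dncU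
  s_inv := ι.dncS_dncInv
  r_inv := ι.dncR_dncInv
  inv_inv := ι.dncInv_dncInv
  s_mul _ _ := dncS_dncMul
  r_mul _ _ := dncR_dncMul
  mul_u := dncMul_dncU
  u_mul := dncU_dncMul
  inv_mul := dncInv_dncMul
  mul_assoc _ _ _ := dncMul_assoc
  secondCountable_arrows := by
    have := 𝒢.secondCountable_arrows
    exact DNC.secondCountableTopology
  secondCountable_units := by
    have := 𝒢.secondCountable_units
    exact DNC.secondCountableTopology
  t2_units := by
    have := 𝒢.t2_units
    infer_instance
  isSubmersion_s := ι.isSubmersion_dncS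
  contMDiff_r := ι.contMDiff_dncR
  contMDiff_u := ι.contMDiff_dncU
  contMDiff_inv := ι.contMDiff_dncInv
  contMDiffOn_mul := contMDiffOn_dncMul

variable (ι) in
-- The source, range, units and inversion are functorial by construction. For the product,
-- continuity along composable curves is enough, by `isDNCMul_of_continuous`.
theorem isDNC_dnc : ι.IsDNC ι.dnc := by
  obtain ⟨a1, a2, a3, a4⟩ := 𝒢.mdifferentiable_structure
  obtain ⟨b1, b2, b3, b4⟩ := ℋ.mdifferentiable_structure
  refine ⟨DNC.isDNCMap_map a1 b1 ι.s_hom, DNC.isDNCMap_map a2 b2 ι.r_hom,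
    DNC.isDNCMap_map a3 b3 ι.u_base, DNC.isDNCMap_map a4 b4 ι.inv_hom, ?_⟩
  have hcomp : ∀ (a b : NormalBundle ι.hom) (α β : ℝ → G), ℋ.s a.base = ℋ.r b.base →
      (∀ᶠ t in 𝓝[≠] (0 : ℝ), 𝒢.s (α t) = 𝒢.r (β t)) →
      Filter.Tendsto (fun t ↦ DNC.genD ι.hom (α t, t)) (𝓝[≠] 0) (𝓝 (.nor a)) →
      Filter.Tendsto (fun t ↦ DNC.genD ι.hom (β t, t)) (𝓝[≠] 0) (𝓝 (.nor b)) →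
      (∀ᶠ t in 𝓝[≠] (0 : ℝ), ι.dncS (DNC.genD ι.hom (α t, t)) = ι.dncR (DNC.genD ι.hom (β t, t)))
      ∧ ι.dncS (.nor a) = ι.dncR (.nor b) := fun a b α β hab hαβ hα hβ ↦ by
    have h1 : ∀ᶠ t in 𝓝[≠] (0 : ℝ),
        ι.dncS (DNC.genD ι.hom (α t, t)) = ι.dncR (DNC.genD ι.hom (β t, t)) := by
      filter_upwards [hαβ, self_mem_nhdsWithin] with t ht h0
      have h0 : t ≠ 0 := h0
      rw [DNC.genD_of_ne h0, DNC.genD_of_ne h0]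
      exact congrArg (fun x ↦ DNC.gen x t h0) ht
    -- Two normal vectors whose base arrows are composable in `H` are composable in the deformation
    -- if they are limits of composable arrows: the source of one and the range of the other are
    -- then limits of the same net.
    refine ⟨h1, DNC.eq_of_tendsto ((ι.contMDiff_dncS.continuous.tendsto _).comp hα)
      (((ι.contMDiff_dncR.continuous.tendsto _).comp hβ).congr' (h1.mono fun _ h ↦ h.symm)) ?_⟩
    exact congrArg ι.base hab
  refine isDNCMul_of_continuous 𝒢.isSubmersion_s a2
    (𝒢.contMDiffOn_mul.mdifferentiableOn (by simp)) (fun a b hab ↦ ?_) (fun a b hab ↦ ?_)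
    (fun _ _ _ _ _ ↦ rfl) fun a b α β hab hαβ hα hβ ↦ ?_
  · rw [ι.s_hom, ι.r_hom, hab]
  · exact ι.mul_hom _ _ hab
  · obtain ⟨h1, h2⟩ := hcomp a b α β hab hαβ hα hβ
    refine ⟨tendsto_dncMul hα hβ h2 h1, ?_⟩
    rw [← ι.mul_hom _ _ hab]
    exact pt_dncMul h2

end Laws

/-! ### The normal groupoid as the fibre over `t = 0` -/

section Normal

/-- A map to the normal bundle is smooth if it is smooth as a map to the deformation space. -/
theorem _root_.NormalBundle.contMDiffWithinAt_of_nor {V M B K X : Type*} [TopologicalSpace V]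
    [ChartedSpace E' V] [TopologicalSpace M] [ChartedSpace E M] [IsManifold 𝓘(ℝ, E) ∞ M]
    [NormedAddCommGroup B] [NormedSpace ℝ B] [TopologicalSpace K] [TopologicalSpace X]
    [ChartedSpace K X] {I : ModelWithCorners ℝ B K}
    {i : SmoothEmbedding E' V E M} {f : X → NormalBundle i} {S : Set X} {x : X}
    (hf : ContMDiffWithinAt I 𝓘(ℝ, E × ℝ) ∞ (fun x ↦ (DNC.nor (f x) : DNC i)) S x) :
    ContMDiffWithinAt I 𝓘(ℝ, E) ∞ f S x := by
  obtain ⟨A, hA⟩ := exists_adaptedChart i (f x).base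
  have hs : DNC.nor (f x) ∈ A.dnc.source := A.mem_dnc_source.2 hA
  have ht : Prod.fst (A.dnc (.nor (f x))) ∈ (A.normal (f x)).target :=
    (A.normal (f x)).map_source hA
  have h1 : ContMDiffAt 𝓘(ℝ, E × ℝ) 𝓘(ℝ, E) ∞ ((A.normal (f x)).symm ∘ Prod.fst ∘ A.dnc)
      (.nor (f x)) :=
    ContMDiffAt.comp (g := (A.normal (f x)).symm) (f := Prod.fst ∘ A.dnc) _
      (contMDiffAt_symm_of_mem_maximalAtlas (A.normal_mem (f x)) ht)
      (contDiff_fst.contMDiff.contMDiffAt.comp _ (contMDiffAt_of_mem_maximalAtlas A.dnc_mem hs))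
  have hρ : ∀ m : NormalBundle i, i m.base ∈ A.ψ.source →
      m = ((A.normal (f x)).symm ∘ Prod.fst ∘ A.dnc) (.nor m) := fun m hm ↦
    ((A.normal (f x)).left_inv hm).symm
  have h2 := ContMDiffAt.comp_contMDiffWithinAt (g := (A.normal (f x)).symm ∘ Prod.fst ∘ A.dnc)
    (f := fun x ↦ (DNC.nor (f x) : DNC i)) x h1 hf
  refine h2.congr_of_eventuallyEq ?_ (hρ _ hA)
  filter_upwards [hf.continuousWithinAt.preimage_mem_nhdsWithin (A.dnc.open_source.mem_nhds hs)]
    with y hy using hρ _ ((A.mem_dnc_source (p := .nor (f y))).1 hy)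

theorem _root_.NormalBundle.contMDiff_of_nor {V M B X : Type*} [TopologicalSpace V]
    [ChartedSpace E' V] [TopologicalSpace M] [ChartedSpace E M] [IsManifold 𝓘(ℝ, E) ∞ M]
    [NormedAddCommGroup B] [NormedSpace ℝ B] [TopologicalSpace X]
    [ChartedSpace B X] {i : SmoothEmbedding E' V E M} {f : X → NormalBundle i}
    (hf : ContMDiff 𝓘(ℝ, B) 𝓘(ℝ, E × ℝ) ∞ fun x ↦ (DNC.nor (f x) : DNC i)) :
    ContMDiff 𝓘(ℝ, B) 𝓘(ℝ, E) ∞ f := fun x ↦ NormalBundle.contMDiffWithinAt_of_nor (hf x)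

variable (ι : LieSubgroupoid ℋ 𝒢)

/-- The product of the normal groupoid. -/
noncomputable def normalMul (m n : NormalBundle ι.hom) : NormalBundle ι.hom :=
  match ι.dncMul (.nor m) (.nor n) with
  | .nor k => k
  | .gen _ _ _ => m

variable {ι} in
-- A product has the parameter of its factors, so for composable pairs the second branch of
-- `normalMul` is not met. The laws of the normal groupoid then follow from those of the deformation
-- by injectivity of `DNC.nor`.
theorem nor_normalMul {m n : NormalBundle ι.hom} (h : ι.dncS (.nor m) = ι.dncR (.nor n)) :
    DNC.nor (ι.normalMul m n) = ι.dncMul (.nor m) (.nor n) := by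
  have h0 : (ι.dncMul (.nor m) (.nor n)).param = 0 := by
    have h1 := congrArg DNC.param (dncS_dncMul h)
    simpa using h1
  obtain ⟨k, hk⟩ := DNC.exists_nor h0
  unfold normalMul
  rw [hk]

/-- The normal groupoid. -/
noncomputable def normal : LieGroupoid E E₀ (NormalBundle ι.hom) (NormalBundle ι.base) where
  s := NormalBundle.map ι.hom ι.base 𝒢.s ℋ.s
  r := NormalBundle.map ι.hom ι.base 𝒢.r ℋ.r
  u := NormalBundle.map ι.base ι.hom 𝒢.u ℋ.u
  inv := NormalBundle.map ι.hom ι.hom 𝒢.inv ℋ.inv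
  mul := ι.normalMul
  s_u x := DNC.nor.inj (ι.dncS_dncU (.nor x))
  r_u x := DNC.nor.inj (ι.dncR_dncU (.nor x))
  s_inv a := DNC.nor.inj (ι.dncS_dncInv (.nor a))
  r_inv a := DNC.nor.inj (ι.dncR_dncInv (.nor a))
  inv_inv a := DNC.nor.inj (ι.dncInv_dncInv (.nor a))
  s_mul a b h := DNC.nor.inj <| by
    have h : ι.dncS (.nor a) = ι.dncR (.nor b) := congrArg DNC.nor h
    exact (congrArg ι.dncS (nor_normalMul h)).trans (dncS_dncMul h)
  r_mul a b h := DNC.nor.inj <| by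
    have h : ι.dncS (.nor a) = ι.dncR (.nor b) := congrArg DNC.nor h
    exact (congrArg ι.dncR (nor_normalMul h)).trans (dncR_dncMul h)
  mul_u a := DNC.nor.inj <|
    (nor_normalMul (ι.dncR_dncU (ι.dncS (.nor a))).symm).trans (dncMul_dncU (.nor a))
  u_mul a := DNC.nor.inj <|
    (nor_normalMul (ι.dncS_dncU (ι.dncR (.nor a)))).trans (dncU_dncMul (.nor a))
  inv_mul a := DNC.nor.inj <|
    (nor_normalMul (ι.dncS_dncInv (.nor a))).trans (dncInv_dncMul (.nor a))
  mul_assoc a b c h h' := DNC.nor.inj <| by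
    have h : ι.dncS (.nor a) = ι.dncR (.nor b) := congrArg DNC.nor h
    have h' : ι.dncS (.nor b) = ι.dncR (.nor c) := congrArg DNC.nor h'
    have e1 := nor_normalMul h
    have e2 := nor_normalMul h'
    have e3 := nor_normalMul (m := ι.normalMul a b) (n := c) (by rw [e1, dncS_dncMul h, h'])
    have e4 := nor_normalMul (m := a) (n := ι.normalMul b c) (by rw [e2, dncR_dncMul h', h])
    rw [e3, e4, e1, e2, dncMul_assoc h h']
  secondCountable_arrows := by
    have := 𝒢.secondCountable_arrows
    have := DNC.secondCountableTopology (i := ι.hom)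
    exact (DNC.isSmoothEmbedding_nor (i := ι.hom)).isEmbedding.secondCountableTopology
  secondCountable_units := by
    have := 𝒢.secondCountable_units
    have := DNC.secondCountableTopology (i := ι.base)
    exact (DNC.isSmoothEmbedding_nor (i := ι.base)).isEmbedding.secondCountableTopology
  t2_units := by
    have := 𝒢.t2_units
    exact (DNC.isSmoothEmbedding_nor (i := ι.base)).isEmbedding.t2Space
  isSubmersion_s := NormalBundle.isSubmersion_map 𝒢.isSubmersion_s ℋ.isSubmersion_s ι.s_hom
  contMDiff_r := NormalBundle.contMDiff_of_nor
    (ι.contMDiff_dncR.comp (DNC.isSmoothEmbedding_nor (i := ι.hom)).isImmersion.contMDiff)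
  contMDiff_u := NormalBundle.contMDiff_of_nor
    (ι.contMDiff_dncU.comp (DNC.isSmoothEmbedding_nor (i := ι.base)).isImmersion.contMDiff)
  contMDiff_inv := NormalBundle.contMDiff_of_nor
    (ι.contMDiff_dncInv.comp (DNC.isSmoothEmbedding_nor (i := ι.hom)).isImmersion.contMDiff)
  contMDiffOn_mul p hp := by
    have hn := (DNC.isSmoothEmbedding_nor (i := ι.hom)).isImmersion.contMDiff
    have h1 : ContMDiffOn (𝓘(ℝ, E).prod 𝓘(ℝ, E)) (𝓘(ℝ, E × ℝ).prod 𝓘(ℝ, E × ℝ)) ∞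
        (fun q : NormalBundle ι.hom × NormalBundle ι.hom ↦
          ((DNC.nor q.1 : DNC ι.hom), (DNC.nor q.2 : DNC ι.hom)))
        {q | NormalBundle.map ι.hom ι.base 𝒢.s ℋ.s q.1 =
          NormalBundle.map ι.hom ι.base 𝒢.r ℋ.r q.2} :=
      ((hn.comp contMDiff_fst).prodMk (hn.comp contMDiff_snd)).contMDiffOn
    have h2 := (contMDiffOn_dncMul (ι := ι)).comp h1 fun q hq ↦ congrArg DNC.nor hq
    refine NormalBundle.contMDiffWithinAt_of_nor ((h2 p hp).congr (fun q hq ↦ ?_) ?_)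
    · exact nor_normalMul (congrArg DNC.nor hq)
    · exact nor_normalMul (congrArg DNC.nor hp)

/-- The normal groupoid as a Lie subgroupoid of the deformation groupoid. -/
noncomputable def normalInclusion : LieSubgroupoid ι.normal ι.dnc where
  hom := ⟨DNC.nor, DNC.isSmoothEmbedding_nor⟩
  base := ⟨DNC.nor, DNC.isSmoothEmbedding_nor⟩
  s_hom _ := rfl
  r_hom _ := rfl
  u_base _ := rfl
  inv_hom _ := rfl
  mul_hom _ _ h := (nor_normalMul (congrArg DNC.nor h)).symm

end Normal

end LieSubgroupoid

end Groupoid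

/-! ### Vector fields in charts, and brackets of related vector fields -/

section VectorFields

theorem minSmoothness_two_le : minSmoothness ℝ 2 ≤ ∞ := by
  rw [minSmoothness_of_isRCLikeNormedField]
  exact WithTop.coe_le_coe.2 (le_top (a := (2 : ℕ∞)))

variable {E M : Type*} [NormedAddCommGroup E] [NormedSpace ℝ E] [TopologicalSpace M]
  [ChartedSpace E M] [IsManifold 𝓘(ℝ, E) ∞ M]

/-- A change of chart acts on the vector coordinate by the derivative of the transition map at the
base point, which depends smoothly on that point. -/
theorem contMDiffAt_dchart_iff {B K X : Type*} [NormedAddCommGroup B] [NormedSpace ℝ B]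
    [TopologicalSpace K] [TopologicalSpace X] [ChartedSpace K X] {I : ModelWithCorners ℝ B K}
    {ψ ψ' : OpenPartialHomeomorph M E} (hψ : ψ ∈ IsManifold.maximalAtlas 𝓘(ℝ, E) ∞ M)
    (hψ' : ψ' ∈ IsManifold.maximalAtlas 𝓘(ℝ, E) ∞ M) {f : X → TangentBundle 𝓘(ℝ, E) M} {x : X}
    (hx : (f x).1 ∈ ψ.source) (hx' : (f x).1 ∈ ψ'.source)
    (hf : ContMDiffAt I 𝓘(ℝ, E) ∞ (fun y ↦ (f y).1) x)
    (h : ContMDiffAt I 𝓘(ℝ, E) ∞ (fun y ↦ dchart ψ (f y).1 (f y).2) x) :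
    ContMDiffAt I 𝓘(ℝ, E) ∞ (fun y ↦ dchart ψ' (f y).1 (f y).2) x := by
  have hs : ψ (f x).1 ∈ (ψ.symm.trans ψ').source := by simp [hx, hx']
  have hτ := ((contDiffOn_transition hψ hψ').fderiv_of_isOpen (ψ.symm.trans ψ').open_source
    (m := ∞) (by simp)).contDiffAt ((ψ.symm.trans ψ').open_source.mem_nhds hs)
  have h1 : ContMDiffAt I 𝓘(ℝ, E →L[ℝ] E) ∞
      (fun y ↦ fderiv ℝ (ψ' ∘ ψ.symm) (ψ (f y).1)) x :=
    ContMDiffAt.comp (g := fderiv ℝ (ψ' ∘ ψ.symm)) (f := fun y ↦ ψ (f y).1) x hτ.contMDiffAt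
      (ContMDiffAt.comp x (contMDiffAt_of_mem_maximalAtlas hψ hx) hf)
  refine (h1.clm_apply h).congr_of_eventuallyEq ?_
  filter_upwards [hf.continuousAt.preimage_mem_nhds (ψ.open_source.mem_nhds hx),
    hf.continuousAt.preimage_mem_nhds (ψ'.open_source.mem_nhds hx')] with y hy hy'
  exact dchart_eq_fderiv hψ hψ' hy hy' _

/-- Smoothness of maps to the tangent bundle, in a chart. -/
theorem contMDiffAt_tangentBundle_iff {B K X : Type*} [NormedAddCommGroup B] [NormedSpace ℝ B]
    [TopologicalSpace K] [TopologicalSpace X] [ChartedSpace K X] {I : ModelWithCorners ℝ B K}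
    {ψ : OpenPartialHomeomorph M E} (hψ : ψ ∈ IsManifold.maximalAtlas 𝓘(ℝ, E) ∞ M)
    {f : X → TangentBundle 𝓘(ℝ, E) M} {x : X} (hx : (f x).1 ∈ ψ.source) :
    ContMDiffAt I 𝓘(ℝ, E).tangent ∞ f x ↔ ContMDiffAt I 𝓘(ℝ, E) ∞ (fun y ↦ (f y).1) x ∧
      ContMDiffAt I 𝓘(ℝ, E) ∞ (fun y ↦ dchart ψ (f y).1 (f y).2) x := by
  have h0 := IsManifold.chart_mem_maximalAtlas (I := 𝓘(ℝ, E)) (n := ∞) (f x).1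
  have hc := mem_chart_source E (f x).1
  refine (Bundle.contMDiffAt_totalSpace (F := E)).trans ?_
  refine and_congr_right fun hf ↦ ?_
  have heq : (fun y ↦ (trivializationAt E (TangentSpace 𝓘(ℝ, E)) (f x).1 (f y)).2) =ᶠ[𝓝 x]
      fun y ↦ dchart (chartAt E (f x).1) (f y).1 (f y).2 := by
    filter_upwards [hf.continuousAt.preimage_mem_nhds
      ((chartAt E (f x).1).open_source.mem_nhds hc)] with y hy
    have hd : MDifferentiableAt 𝓘(ℝ, E) 𝓘(ℝ, E) (chartAt E (f x).1) (f y).1 :=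
      (mdifferentiable_of_mem h0).mdifferentiableAt hy
    have e : mfderiv 𝓘(ℝ, E) 𝓘(ℝ, E) (chartAt E (f x).1) (f y).1 =
        fderivWithin ℝ (writtenInExtChartAt 𝓘(ℝ, E) 𝓘(ℝ, E) (f y).1 (chartAt E (f x).1))
          (range 𝓘(ℝ, E)) (extChartAt 𝓘(ℝ, E) (f y).1 (f y).1) := by
      unfold mfderiv
      exact if_pos hd
    exact (DFunLike.congr_fun e (f y).2).symm
  constructor
  · exact fun h ↦ contMDiffAt_dchart_iff h0 hψ hc hx hf (h.congr_of_eventuallyEq heq.symm)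
  · exact fun h ↦ (contMDiffAt_dchart_iff hψ h0 hx hc hf h).congr_of_eventuallyEq heq

/-- A vector field in a chart. -/
noncomputable def chartField (ψ : OpenPartialHomeomorph M E)
    (V : ∀ x : M, TangentSpace 𝓘(ℝ, E) x) (e : E) : E :=
  dchart ψ (ψ.symm e) (V (ψ.symm e))

/-- Smoothness of a vector field at a point. -/
def SmoothFieldAt (V : ∀ x : M, TangentSpace 𝓘(ℝ, E) x) (x : M) : Prop :=
  ContMDiffAt 𝓘(ℝ, E) 𝓘(ℝ, E).tangent ∞ (fun y ↦ (⟨y, V y⟩ : TangentBundle 𝓘(ℝ, E) M)) x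

variable {ψ : OpenPartialHomeomorph M E} {V W : ∀ x : M, TangentSpace 𝓘(ℝ, E) x} {x : M}

theorem smoothFieldAt_iff (hψ : ψ ∈ IsManifold.maximalAtlas 𝓘(ℝ, E) ∞ M) (hx : x ∈ ψ.source) :
    SmoothFieldAt V x ↔ ContMDiffAt 𝓘(ℝ, E) 𝓘(ℝ, E) ∞ (fun y ↦ dchart ψ y (V y)) x := by
  unfold SmoothFieldAt
  rw [contMDiffAt_tangentBundle_iff hψ (f := fun y ↦ (⟨y, V y⟩ : TangentBundle 𝓘(ℝ, E) M)) hx]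
  exact and_iff_right contMDiffAt_id

theorem chartField_apply (hx : x ∈ ψ.source) : chartField ψ V (ψ x) = dchart ψ x (V x) := by
  unfold chartField
  rw [ψ.left_inv hx]

theorem SmoothFieldAt.contDiffAt (hV : SmoothFieldAt V x)
    (hψ : ψ ∈ IsManifold.maximalAtlas 𝓘(ℝ, E) ∞ M) (hx : x ∈ ψ.source) :
    ContDiffAt ℝ ∞ (chartField ψ V) (ψ x) := by
  rw [smoothFieldAt_iff hψ hx] at hV
  rw [← contMDiffAt_iff_contDiffAt]
  have h := contMDiffAt_symm_of_mem_maximalAtlas hψ (ψ.map_source hx)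
  rw [← ψ.left_inv hx] at hV
  exact ContMDiffAt.comp (g := fun y ↦ dchart ψ y (V y)) (ψ x) hV h

theorem SmoothFieldAt.mdifferentiableAt (hV : SmoothFieldAt V x) :
    MDifferentiableAt 𝓘(ℝ, E) 𝓘(ℝ, E).tangent
      (fun y ↦ (⟨y, V y⟩ : TangentBundle 𝓘(ℝ, E) M)) x :=
  ContMDiffAt.mdifferentiableAt hV (by simp)

variable [CompleteSpace E]

/-- The Lie bracket in a chart. -/
theorem dchart_mlieBracket (hψ : ψ ∈ IsManifold.maximalAtlas 𝓘(ℝ, E) ∞ M) (hx : x ∈ ψ.source)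
    (hV : SmoothFieldAt V x) (hW : SmoothFieldAt W x) :
    dchart ψ x (VectorField.mlieBracket 𝓘(ℝ, E) V W x) =
      VectorField.lieBracket ℝ (chartField ψ V) (chartField ψ W) (ψ x) := by
  have hm := mdifferentiable_of_mem hψ
  -- The expression of a field in a chart is its pullback by the inverse chart. The invariance of
  -- the bracket under pullback reduces it to the bracket in the model space.
  have hpull : ∀ (U : ∀ x : M, TangentSpace 𝓘(ℝ, E) x), ∀ e ∈ ψ.target,
      VectorField.mpullback 𝓘(ℝ, E) 𝓘(ℝ, E) ψ.symm U e = chartField ψ U e := fun U e he ↦ by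
    let L : E ≃L[ℝ] TangentSpace 𝓘(ℝ, E) (ψ.symm e) := hm.symm.mfderiv he
    show (mfderiv 𝓘(ℝ, E) 𝓘(ℝ, E) ψ.symm e).inverse (U (ψ.symm e)) = chartField ψ U e
    have hL : mfderiv 𝓘(ℝ, E) 𝓘(ℝ, E) ψ.symm e =
        (L : E →L[ℝ] TangentSpace 𝓘(ℝ, E) (ψ.symm e)) := by ext; rfl
    rw [hL]
    refine (congrArg (fun T ↦ T (U (ψ.symm e))) (ContinuousLinearMap.inverse_equiv L)).trans ?_
    refine (L.symm_apply_eq).2 ?_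
    have h := hm.symm_comp_deriv (ψ.map_target he)
    rw [ψ.right_inv he] at h
    exact (DFunLike.congr_fun h (U (ψ.symm e))).symm
  have hI : IsManifold 𝓘(ℝ, E) (minSmoothness ℝ 2) M := by
    simp only [minSmoothness_of_isRCLikeNormedField]
    infer_instance
  have hI' : IsManifold 𝓘(ℝ, E) (minSmoothness ℝ 2) E := inferInstance
  have hs := ψ.map_source hx
  have hl : ψ.symm (ψ x) = x := ψ.left_inv hx
  have h1 := VectorField.mpullback_mlieBracket (I := 𝓘(ℝ, E)) (I' := 𝓘(ℝ, E)) (n := ∞)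
    (f := ψ.symm) (V := V) (W := W) (x₀ := ψ x) (by rw [hl]; exact hV.mdifferentiableAt)
    (by rw [hl]; exact hW.mdifferentiableAt) (contMDiffAt_symm_of_mem_maximalAtlas hψ hs)
    minSmoothness_two_le
  rw [hpull _ _ hs, chartField_apply hx] at h1
  rw [h1]
  have e1 := Filter.EventuallyEq.mlieBracket_vectorField_eq (I := 𝓘(ℝ, E)) (x := ψ x)
    (V₁ := VectorField.mpullback 𝓘(ℝ, E) 𝓘(ℝ, E) ψ.symm V) (V := chartField ψ V)
    (W₁ := VectorField.mpullback 𝓘(ℝ, E) 𝓘(ℝ, E) ψ.symm W) (W := chartField ψ W)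
    (by filter_upwards [ψ.open_target.mem_nhds hs] with e he using hpull V e he)
    (by filter_upwards [ψ.open_target.mem_nhds hs] with e he using hpull W e he)
  rw [e1]
  have h2 := VectorField.mlieBracketWithin_eq_lieBracketWithin (𝕜 := ℝ) (V := chartField ψ V)
    (W := chartField ψ W) (s := univ)
  refine (congrFun VectorField.mlieBracketWithin_univ (ψ x)).symm.trans ?_
  exact (congrFun h2 (ψ x)).trans (congrFun VectorField.lieBracketWithin_univ (ψ x))

theorem SmoothFieldAt.mlieBracket (hV : ∀ᶠ y in 𝓝 x, SmoothFieldAt V y)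
    (hW : ∀ᶠ y in 𝓝 x, SmoothFieldAt W y) :
    SmoothFieldAt (VectorField.mlieBracket 𝓘(ℝ, E) V W) x := by
  have hψ := IsManifold.chart_mem_maximalAtlas (I := 𝓘(ℝ, E)) (n := ∞) x
  have hx := mem_chart_source E x
  rw [smoothFieldAt_iff hψ hx]
  have h1 := (hV.self_of_nhds.contDiffAt hψ hx).lieBracket_vectorField
    (hW.self_of_nhds.contDiffAt hψ hx) (m := ∞) (by simp)
  refine (ContMDiffAt.comp x h1.contMDiffAt
    (contMDiffAt_of_mem_maximalAtlas hψ hx)).congr_of_eventuallyEq ?_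
  filter_upwards [hV, hW, (chartAt E x).open_source.mem_nhds hx] with y hVy hWy hy
  exact dchart_mlieBracket hψ hy hVy hWy

/-- The derivative of `f` intertwines Lie brackets of vector fields `V`, `W` with those of `V'` and
`W'`, if they are `f`-related along curves with velocities `V x` and `W x`. -/
theorem mfderiv_mlieBracket_of_related {C N : Type*} [NormedAddCommGroup C] [NormedSpace ℝ C]
    [TopologicalSpace N] [ChartedSpace C N] [IsManifold 𝓘(ℝ, C) ∞ N] [CompleteSpace C]
    {f : M → N} {V' W' : ∀ y : N, TangentSpace 𝓘(ℝ, C) y}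
    (hf : ContMDiffAt 𝓘(ℝ, E) 𝓘(ℝ, C) ∞ f x) (hV : SmoothFieldAt V x) (hW : SmoothFieldAt W x)
    (hV' : SmoothFieldAt V' (f x)) (hW' : SmoothFieldAt W' (f x)) {β γ : ℝ → M}
    (hβ : HasVelocity β x (V x)) (hγ : HasVelocity γ x (W x))
    (hβW : ∀ᶠ t in 𝓝 0, mfderiv 𝓘(ℝ, E) 𝓘(ℝ, C) f (β t) (W (β t)) = W' (f (β t)))
    (hγV : ∀ᶠ t in 𝓝 0, mfderiv 𝓘(ℝ, E) 𝓘(ℝ, C) f (γ t) (V (γ t)) = V' (f (γ t))) :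
    mfderiv 𝓘(ℝ, E) 𝓘(ℝ, C) f x (VectorField.mlieBracket 𝓘(ℝ, E) V W x) =
      VectorField.mlieBracket 𝓘(ℝ, C) V' W' (f x) := by
  have hψ := IsManifold.chart_mem_maximalAtlas (I := 𝓘(ℝ, E)) (n := ∞) x
  have hx := mem_chart_source E x
  have hχ := IsManifold.chart_mem_maximalAtlas (I := 𝓘(ℝ, C)) (n := ∞) (f x)
  have hfx := mem_chart_source C (f x)
  set ψ := chartAt E x
  set χ := chartAt C (f x)
  let F : E → C := χ ∘ f ∘ ψ.symm
  have hsx := ψ.map_source hx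
  have hF : ContDiffAt ℝ ∞ F (ψ x) := by
    rw [← contMDiffAt_iff_contDiffAt]
    have h1 := contMDiffAt_symm_of_mem_maximalAtlas hψ hsx
    have hl : ψ.symm (ψ x) = x := ψ.left_inv hx
    have h2 : ContMDiffAt 𝓘(ℝ, E) 𝓘(ℝ, C) ∞ f (ψ.symm (ψ x)) := by rwa [hl]
    have h3 : ContMDiffAt 𝓘(ℝ, C) 𝓘(ℝ, C) ∞ χ (f (ψ.symm (ψ x))) := by
      rw [hl]; exact contMDiffAt_of_mem_maximalAtlas hχ hfx
    exact h3.comp (ψ x) (h2.comp (ψ x) h1)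
  have hcomm : ∀ᶠ y in 𝓝 x, χ (f y) = F (ψ y) := by
    filter_upwards [ψ.open_source.mem_nhds hx] with y hy
    simp only [F, Function.comp_apply, ψ.left_inv hy]
  have hfd : ∀ᶠ y in 𝓝 x, MDifferentiableAt 𝓘(ℝ, E) 𝓘(ℝ, C) f y := by
    filter_upwards [(contMDiffAt_iff_contMDiffAt_nhds (n := 1) (by simp)).1
      (hf.of_le (by simp))] with y hy using hy.mdifferentiableAt (by simp)
  have hFd : ∀ᶠ y in 𝓝 x, DifferentiableAt ℝ F (ψ y) := by
    have h1 : ∀ᶠ e in 𝓝 (ψ x), ContDiffAt ℝ 1 F e := (hF.of_le (by simp)).eventually (by simp)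
    filter_upwards [(ψ.continuousAt hx).eventually h1] with y hy
    exact hy.differentiableAt (by simp)
  have key : ∀ᶠ y in 𝓝 x, ∀ w : TangentSpace 𝓘(ℝ, E) y, f y ∈ χ.source ∧
      dchart χ (f y) (mfderiv 𝓘(ℝ, E) 𝓘(ℝ, C) f y w) = fderiv ℝ F (ψ y) (dchart ψ y w) := by
    filter_upwards [hfd, hFd, ψ.open_source.mem_nhds hx, hcomm.eventually_nhds,
      hf.continuousAt.preimage_mem_nhds (χ.open_source.mem_nhds hfx)] with y h1 h2 h3 h4 h5 w
    exact ⟨h5, dchart_mfderiv h1 hψ h3 hχ h5 h2 h4 w⟩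
  -- In coordinates the bracket is `DW · V - DV · W`. Only the derivative of `e ↦ dF_e(W e)` in the
  -- direction of `V` is needed, and it can be computed along one curve with velocity `V x`. The
  -- fields need not be related on a neighbourhood of `x`.
  have curve : ∀ {V W : ∀ x : M, TangentSpace 𝓘(ℝ, E) x}
      {V' W' : ∀ y : N, TangentSpace 𝓘(ℝ, C) y} {β : ℝ → M}, SmoothFieldAt W x →
      SmoothFieldAt W' (f x) → HasVelocity β x (V x) →
      (∀ᶠ t in 𝓝 0, mfderiv 𝓘(ℝ, E) 𝓘(ℝ, C) f (β t) (W (β t)) = W' (f (β t))) →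
      mfderiv 𝓘(ℝ, E) 𝓘(ℝ, C) f x (V x) = V' (f x) →
      fderiv ℝ (fun e ↦ fderiv ℝ F e (chartField ψ W e)) (ψ x) (chartField ψ V (ψ x)) =
        fderiv ℝ (chartField χ W') (χ (f x)) (chartField χ V' (χ (f x))) := by
    intro V W V' W' β hW hW' hβ hβW hVV'
    have hk : DifferentiableAt ℝ (fun e ↦ fderiv ℝ F e (chartField ψ W e)) (ψ x) :=
      ((hF.fderiv_right (m := ∞) (by simp)).clm_apply (hW.contDiffAt hψ hx)).differentiableAt
        (by simp)
    have hk' : DifferentiableAt ℝ (chartField χ W') (χ (f x)) :=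
      (hW'.contDiffAt hχ hfx).differentiableAt (by simp)
    have hβ0 : β 0 = x := hβ.1
    have d1 := hβ.hasDerivAt_chart hψ hx
    have d2 := (hβ.comp (hf.mdifferentiableAt (by simp))).hasDerivAt_chart hχ hfx
    have e1 : HasDerivAt (fun t ↦ fderiv ℝ F (ψ (β t)) (chartField ψ W (ψ (β t))))
        (fderiv ℝ (fun e ↦ fderiv ℝ F e (chartField ψ W e)) (ψ x) (dchart ψ x (V x))) 0 :=
      HasFDerivAt.comp_hasDerivAt_of_eq (l := fun e ↦ fderiv ℝ F e (chartField ψ W e))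
        (f := ψ ∘ β) 0 hk.hasFDerivAt d1 (by simp [hβ0])
    have e2 : HasDerivAt (fun t ↦ chartField χ W' (χ (f (β t))))
        (fderiv ℝ (chartField χ W') (χ (f x))
          (dchart χ (f x) (mfderiv 𝓘(ℝ, E) 𝓘(ℝ, C) f x (V x)))) 0 :=
      HasFDerivAt.comp_hasDerivAt_of_eq (l := chartField χ W')
        (f := χ ∘ f ∘ β) 0 hk'.hasFDerivAt d2 (by simp [hβ0])
    rw [chartField_apply hx, chartField_apply hfx, ← hVV']
    refine (e1.congr_of_eventuallyEq ?_).unique e2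
    filter_upwards [hβW, hβ.tendsto.eventually key,
      hβ.tendsto.eventually (ψ.open_source.mem_nhds hx)] with t h1 h2 h3
    have h4 := h2 (W (β t))
    rw [chartField_apply h3, chartField_apply h4.1, ← h4.2, h1]
  have hVx : mfderiv 𝓘(ℝ, E) 𝓘(ℝ, C) f x (V x) = V' (f x) := by
    have := hγV.self_of_nhds
    rwa [hγ.1] at this
  have hWx : mfderiv 𝓘(ℝ, E) 𝓘(ℝ, C) f x (W x) = W' (f x) := by
    have := hβW.self_of_nhds
    rwa [hβ.1] at this
  apply (dchart_bijective hχ hfx).1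
  -- `fderiv_apply_lieBracket` contains the symmetry of the second derivative of `F`, by which the
  -- second-order terms cancel.
  rw [(key.self_of_nhds _).2, dchart_mlieBracket hψ hx hV hW, dchart_mlieBracket hχ hfx hV' hW',
    VectorField.fderiv_apply_lieBracket hF minSmoothness_two_le
      ((hW.contDiffAt hψ hx).differentiableAt (by simp))
      ((hV.contDiffAt hψ hx).differentiableAt (by simp)), curve hW hW' hβ hβW hVx, curve hV hV' hγ hγV hWx]
  rfl

end VectorFields

theorem HasVelocity.congr_point {E M : Type*} [NormedAddCommGroup E] [NormedSpace ℝ E]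
    [TopologicalSpace M] [ChartedSpace E M] {α : ℝ → M} {x y : M} (h : x = y) {w : E}
    (hα : HasVelocity α x (w : TangentSpace 𝓘(ℝ, E) x)) :
    HasVelocity α y (w : TangentSpace 𝓘(ℝ, E) y) := by
  subst h; exact hα

theorem tangentBundle_mk_congr {E M : Type*} [NormedAddCommGroup E] [NormedSpace ℝ E]
    [TopologicalSpace M] [ChartedSpace E M] {x y : M} (h : x = y) (w : E) :
    (⟨x, w⟩ : TangentBundle 𝓘(ℝ, E) M) = ⟨y, w⟩ := by
  subst h; rfl

/-- Differentiation in one variable with smooth dependence on a parameter; used for right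
translations, where the parameter is the translating arrow. -/
theorem contMDiffAt_fderiv_apply {B K X E W : Type*} [NormedAddCommGroup B] [NormedSpace ℝ B]
    [TopologicalSpace K] [TopologicalSpace X] [ChartedSpace K X] {I : ModelWithCorners ℝ B K}
    [IsManifold I 1 X] [NormedAddCommGroup E] [NormedSpace ℝ E] [NormedAddCommGroup W]
    [NormedSpace ℝ W] {k : X → E → W} {g v : X → E} {x : X}
    (hk : ContMDiffAt (I.prod 𝓘(ℝ, E)) 𝓘(ℝ, W) ∞ (Function.uncurry k) (x, g x))
    (hg : ContMDiffAt I 𝓘(ℝ, E) ∞ g x) (hv : ContMDiffAt I 𝓘(ℝ, E) ∞ v x) :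
    ContMDiffAt I 𝓘(ℝ, W) ∞ (fun y ↦ fderiv ℝ (k y) (g y) (v y)) x := by
  have h := ContMDiffAt.mfderiv (m := ∞) k g hk hg (by simp)
  simp only [inTangentCoordinates_model_space, mfderiv_eq_fderiv] at h
  exact h.clm_apply hv

/-! ### The smooth structure of the Lie algebroid -/

section Algebroid

variable {E E₀ G G₀ : Type*} [NormedAddCommGroup E] [NormedSpace ℝ E]
  [NormedAddCommGroup E₀] [NormedSpace ℝ E₀] [TopologicalSpace G] [ChartedSpace E G]
  [TopologicalSpace G₀] [ChartedSpace E₀ G₀] [IsManifold 𝓘(ℝ, E) ∞ G]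
  [IsManifold 𝓘(ℝ, E₀) ∞ G₀] {𝒢 : LieGroupoid E E₀ G G₀}

namespace LieGroupoid

section Charts

variable (C : VertChart 𝒢)

/-- A chart of the Lie algebroid, as a partial homeomorphism. -/
noncomputable def VertChart.alg : OpenPartialHomeomorph 𝒢.Alg E :=
  𝒢.algAtlas.homeo (e := C.algChart) ⟨C, rfl⟩

theorem VertChart.alg_mem : C.alg ∈ IsManifold.maximalAtlas 𝓘(ℝ, E) ∞ 𝒢.Alg :=
  𝒢.algAtlas.homeo_mem (e := C.algChart) ⟨C, rfl⟩

theorem VertChart.mem_alg_source {a : 𝒢.Alg} : a ∈ C.alg.source ↔ 𝒢.u a.base ∈ C.ψ.source :=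
  Iff.rfl

theorem VertChart.mem_alg_target {e : E} :
    e ∈ C.alg.target ↔ C.p e ∈ C.χ.target ∧ 𝒢.u (C.χ.symm (C.p e)) ∈ C.ψ.source :=
  Iff.rfl

theorem VertChart.alg_apply (a : 𝒢.Alg) :
    C.alg a = C.σ (C.χ a.base) + dchart C.ψ (𝒢.u a.base) a.vec := rfl

theorem contMDiff_base : ContMDiff 𝓘(ℝ, E) 𝓘(ℝ, E₀) ∞ (Alg.base (𝒢 := 𝒢)) := by
  intro a
  obtain ⟨C, hC⟩ := 𝒢.exists_vertChart (𝒢.u a.base)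
  have h1 : ContMDiffAt 𝓘(ℝ, E) 𝓘(ℝ, E₀) ∞ (fun b : 𝒢.Alg ↦ C.χ.symm (C.p (C.alg b))) a := by
    have h2 := contMDiffAt_of_mem_maximalAtlas C.alg_mem (x := a) (C.mem_alg_source.2 hC)
    have h3 := contMDiffAt_symm_of_mem_maximalAtlas C.mem' (C.coord_mem hC).1
    exact ContMDiffAt.comp (g := C.χ.symm) (f := fun b : 𝒢.Alg ↦ C.p (C.alg b)) a h3
      (C.p.contDiff.contMDiff.contMDiffAt.comp a h2)
  refine h1.congr_of_eventuallyEq ?_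
  filter_upwards [C.alg.open_source.mem_nhds (C.mem_alg_source.2 hC)] with b hb
  refine (C.χ.left_inv (C.base_mem hb)).symm.trans (congrArg C.χ.symm ?_)
  exact (C.p_coord hb).symm

/-- The total space of the Lie algebroid has the smooth structure induced by the tangent bundle. -/
theorem contMDiffAt_alg_iff {B K X : Type*} [NormedAddCommGroup B] [NormedSpace ℝ B]
    [TopologicalSpace K] [TopologicalSpace X] [ChartedSpace K X] {I : ModelWithCorners ℝ B K}
    {f : X → 𝒢.Alg} {x : X} :
    ContMDiffAt I 𝓘(ℝ, E) ∞ f x ↔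
      ContMDiffAt I 𝓘(ℝ, E).tangent ∞ (fun y ↦ (f y).toTangent) x := by
  obtain ⟨C, hC⟩ := 𝒢.exists_vertChart (𝒢.u (f x).base)
  rw [contMDiffAt_tangentBundle_iff C.mem (f := fun y ↦ (f y).toTangent) hC]
  constructor
  · intro h
    have hb : ContMDiffAt I 𝓘(ℝ, E₀) ∞ (fun y ↦ (f y).base) x := (contMDiff_base _).comp x h
    have hu : ContMDiffAt I 𝓘(ℝ, E) ∞ (fun y ↦ 𝒢.u (f y).base) x :=
      (𝒢.contMDiff_u _).comp x hb
    refine ⟨hu, ?_⟩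
    have h1 : ContMDiffAt I 𝓘(ℝ, E) ∞ (fun y ↦ C.alg (f y)) x :=
      ContMDiffAt.comp x (contMDiffAt_of_mem_maximalAtlas C.alg_mem (C.mem_alg_source.2 hC)) h
    have h2 : ContMDiffAt I 𝓘(ℝ, E) ∞ (fun y ↦ C.σ (C.χ (f y).base)) x :=
      C.σ.contDiff.contMDiff.contMDiffAt.comp x
        (ContMDiffAt.comp x (contMDiffAt_of_mem_maximalAtlas C.mem' (C.base_mem hC)) hb)
    refine (h1.sub h2).congr_of_eventuallyEq (Filter.Eventually.of_forall fun y ↦ ?_)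
    simp only [C.alg_apply, add_sub_cancel_left]
    rfl
  · rintro ⟨h1, h2⟩
    have hb : ContMDiffAt I 𝓘(ℝ, E₀) ∞ (fun y ↦ (f y).base) x := by
      refine ((𝒢.contMDiff_s _).comp x h1).congr_of_eventuallyEq
        (Filter.Eventually.of_forall fun y ↦ (𝒢.s_u _).symm)
    have h3 : ContMDiffAt I 𝓘(ℝ, E) ∞ (fun y ↦ C.alg (f y)) x :=
      (C.σ.contDiff.contMDiff.contMDiffAt.comp x
        (ContMDiffAt.comp x (contMDiffAt_of_mem_maximalAtlas C.mem' (C.base_mem hC)) hb)).add h2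
    have h4 := contMDiffAt_symm_of_mem_maximalAtlas C.alg_mem
      (C.alg.map_source (C.mem_alg_source.2 hC))
    refine (ContMDiffAt.comp (g := C.alg.symm) (f := fun y ↦ C.alg (f y)) x h4
      h3).congr_of_eventuallyEq ?_
    filter_upwards [h1.continuousAt.preimage_mem_nhds (C.ψ.open_source.mem_nhds hC)] with y hy
    exact (C.alg.left_inv (C.mem_alg_source.2 hy)).symm

theorem contMDiff_alg_iff {B K X : Type*} [NormedAddCommGroup B] [NormedSpace ℝ B]
    [TopologicalSpace K] [TopologicalSpace X] [ChartedSpace K X] {I : ModelWithCorners ℝ B K}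
    {f : X → 𝒢.Alg} :
    ContMDiff I 𝓘(ℝ, E) ∞ f ↔ ContMDiff I 𝓘(ℝ, E).tangent ∞ (fun y ↦ (f y).toTangent) :=
  forall_congr' fun _ ↦ contMDiffAt_alg_iff

end Charts

/-! ### Right-invariant vector fields -/

section RightInvariant

/-- A vector killed by `T s` is the velocity of a curve in a source fibre: lift the constant curve
through the submersion `s`. -/
theorem exists_fibre_curve {x : G₀} (v : 𝒢.fiber x) :
    ∃ c, HasVelocity c (𝒢.u x) v.1 ∧ ∀ᶠ t in 𝓝 (0 : ℝ), 𝒢.s (c t) = x := by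
  have h0 : mfderiv 𝓘(ℝ, E) 𝓘(ℝ, E₀) 𝒢.s (𝒢.u x) v.1 = 0 := v.2
  have h : HasVelocity (fun _ ↦ x) (𝒢.s (𝒢.u x)) (mfderiv 𝓘(ℝ, E) 𝓘(ℝ, E₀) 𝒢.s (𝒢.u x) v.1) := by
    rw [h0]
    exact ⟨(𝒢.s_u x).symm, mdifferentiableAt_const, by rw [mfderiv_const]; rfl⟩
  exact HasVelocity.exists_lift 𝒢.isSubmersion_s h

variable {X Y Z : ∀ x, 𝒢.fiber x} {a b : G}

/-- The curve stays in the source fibre where right translation by `a` is defined, so the translated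
curve has velocity `T R_a`. The properties of `Z_X` below are read off such curves. -/
theorem hasVelocity_rightInvariant {c : ℝ → G} (hc : HasVelocity c (𝒢.u (𝒢.r a)) (X (𝒢.r a)).1)
    (hs : ∀ᶠ t in 𝓝 (0 : ℝ), 𝒢.s (c t) = 𝒢.r a) :
    HasVelocity (fun t ↦ 𝒢.mul (c t) a) a (𝒢.rightInvariant X a) := by
  have h1 : MDifferentiableWithinAt 𝓘(ℝ, E) 𝓘(ℝ, E) (fun b ↦ 𝒢.mul b a) {b | 𝒢.s b = 𝒢.r a}
      (𝒢.u (𝒢.r a)) := by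
    have h2 : ContMDiffOn 𝓘(ℝ, E) (𝓘(ℝ, E).prod 𝓘(ℝ, E)) ∞ (fun b ↦ (b, a))
        {b | 𝒢.s b = 𝒢.r a} := (contMDiff_id.prodMk contMDiff_const).contMDiffOn
    exact (𝒢.contMDiffOn_mul.comp h2 fun b hb ↦ hb).mdifferentiableOn (by simp) _ (𝒢.s_u _)
  exact (hc.compWithin h1 hs).congr_point (𝒢.u_mul a)

/-- An integral curve to first order of a right invariant vector field. -/
theorem exists_rightInvariant_curve (X : ∀ x, 𝒢.fiber x) (a : G) :
    ∃ c, HasVelocity c (𝒢.u (𝒢.r a)) (X (𝒢.r a)).1 ∧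
      (∀ᶠ t in 𝓝 (0 : ℝ), 𝒢.s (c t) = 𝒢.r a) ∧
      HasVelocity (fun t ↦ 𝒢.mul (c t) a) a (𝒢.rightInvariant X a) := by
  obtain ⟨c, hc, hs⟩ := exists_fibre_curve (X (𝒢.r a))
  exact ⟨c, hc, hs, hasVelocity_rightInvariant hc hs⟩

/-- The translated curve has constant source. -/
theorem mfderiv_s_rightInvariant :
    mfderiv 𝓘(ℝ, E) 𝓘(ℝ, E₀) 𝒢.s a (𝒢.rightInvariant X a) = 0 := by
  obtain ⟨c, hc, hs, h⟩ := exists_rightInvariant_curve X a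
  refine (h.comp (𝒢.mdifferentiable_structure.1 a)).unique
    (HasVelocity.congr (α := fun _ ↦ 𝒢.s a) ⟨rfl, mdifferentiableAt_const, ?_⟩ ?_)
  · rw [mfderiv_const]; rfl
  · filter_upwards [hs] with t ht using 𝒢.s_mul _ _ ht

/-- The translated curve has the same range as the curve through the unit. -/
theorem mfderiv_r_rightInvariant :
    modelVec (mfderiv 𝓘(ℝ, E) 𝓘(ℝ, E₀) 𝒢.r a (𝒢.rightInvariant X a)) =
      modelVec (𝒢.anchor ⟨𝒢.r a, X (𝒢.r a)⟩) := by
  obtain ⟨c, hc, hs, h⟩ := exists_rightInvariant_curve X a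
  refine (h.comp (𝒢.mdifferentiable_structure.2.1 a)).unique
    (((hc.comp (𝒢.mdifferentiable_structure.2.1 _)).congr_point (𝒢.r_u _)).congr ?_)
  filter_upwards [hs] with t ht using 𝒢.r_mul _ _ ht

/-- Right translation by a unit is the identity of the source fibre. -/
theorem rightInvariant_unit (X : ∀ x, 𝒢.fiber x) (x : G₀) :
    𝒢.rightInvariant X (𝒢.u x) = (X x).1 := by
  have key : ∀ y, y = x → ∀ c : ℝ → G, HasVelocity c (𝒢.u y) (X y).1 →
      HasVelocity c (𝒢.u x) (X x).1 := by
    rintro y rfl c hc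
    exact hc
  obtain ⟨c, hc, hs, h⟩ := exists_rightInvariant_curve X (𝒢.u x)
  refine h.unique ((key _ (𝒢.r_u x) c hc).congr ?_)
  filter_upwards [hs] with t ht
  rw [𝒢.r_u] at ht
  have := 𝒢.mul_u (c t)
  rwa [ht] at this

theorem rightInvariant_add : 𝒢.rightInvariant (X + Y) = 𝒢.rightInvariant X + 𝒢.rightInvariant Y :=
  funext fun _ ↦ map_add _ _ _

theorem rightInvariant_smul (f : G₀ → ℝ) :
    𝒢.rightInvariant (fun x ↦ f x • X x) = (f ∘ 𝒢.r) • 𝒢.rightInvariant X :=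
  funext fun _ ↦ map_smul _ _ _

theorem VertChart.mdifferentiableAt_mulExt (C : VertChart 𝒢) (hb : b ∈ C.ψ.source)
    (h : 𝒢.s b = 𝒢.r a) : ContMDiffAt 𝓘(ℝ, E) 𝓘(ℝ, E) ∞ (fun b ↦ C.mulExt (b, a)) b := by
  have h1 := (C.contMDiffOn_mulExt _ (C.mem_dom (q := (b, a)) hb h)).contMDiffAt
    (C.isOpen_dom.mem_nhds (C.mem_dom (q := (b, a)) hb h))
  exact ContMDiffAt.comp (g := C.mulExt) (f := fun b ↦ (b, a)) b h1
    (contMDiffAt_id.prodMk contMDiffAt_const)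

/-- Right translations preserve right invariant vector fields. -/
theorem VertChart.mfderiv_mulExt (C : VertChart 𝒢) (hb : b ∈ C.ψ.source) (h : 𝒢.s b = 𝒢.r a) :
    mfderiv 𝓘(ℝ, E) 𝓘(ℝ, E) (fun b ↦ C.mulExt (b, a)) b (𝒢.rightInvariant X b) =
      𝒢.rightInvariant X (C.mulExt (b, a)) := by
  obtain ⟨c, hc, hs, hcb⟩ := exists_rightInvariant_curve X b
  have h1 := hcb.comp ((C.mdifferentiableAt_mulExt hb h).mdifferentiableAt (by simp))
  have h2 : C.mulExt (b, a) = 𝒢.mul b a := C.mulExt_of_comp (q := (b, a)) hb h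
  have h3 : 𝒢.r (C.mulExt (b, a)) = 𝒢.r b := by rw [h2, 𝒢.r_mul _ _ h]
  have key : ∀ x y, x = y → ∀ c : ℝ → G, HasVelocity c (𝒢.u x) (X x).1 →
      HasVelocity c (𝒢.u y) (X y).1 := by
    rintro x _ rfl c hc
    exact hc
  refine h1.unique ((hasVelocity_rightInvariant (key _ _ h3.symm c hc) (by rwa [h3])).congr ?_)
  filter_upwards [hs, hcb.tendsto.eventually (C.ψ.open_source.mem_nhds hb)] with t ht ht'
  have h4 : 𝒢.s (𝒢.mul (c t) b) = 𝒢.r a := by rw [𝒢.s_mul _ _ ht, h]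
  refine (C.mulExt_of_comp (q := (𝒢.mul (c t) b, a)) ht' h4).trans ?_
  rw [h2]
  exact 𝒢.mul_assoc _ _ _ ht h

/-- The right invariant vector field of a smooth section is smooth. -/
theorem IsSmoothSection.smoothFieldAt (hX : 𝒢.IsSmoothSection X) (a : G) :
    SmoothFieldAt (𝒢.rightInvariant X) a := by
  obtain ⟨C, hC⟩ := 𝒢.exists_vertChart (𝒢.u (𝒢.r a))
  have hψ := IsManifold.chart_mem_maximalAtlas (I := 𝓘(ℝ, E)) (n := ∞) a
  have ha := mem_chart_source E a
  set ψ := chartAt E a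
  rw [smoothFieldAt_iff hψ ha]
  -- Right translation by `b`, extended to an open set and read in charts. `Z_X(b)` is its
  -- derivative at the unit of `r b`, applied to the coordinate of `X (r b)`, and all of this is
  -- smooth in `b`.
  let k : G → E → E := fun b e ↦ ψ (C.mulExt (C.ψ.symm e, b))
  have hXr := contMDiffAt_alg_iff.1 (ContMDiffAt.comp a (hX (𝒢.r a)) (𝒢.contMDiff_r a))
  obtain ⟨h1, h2⟩ := (contMDiffAt_tangentBundle_iff C.mem
    (f := fun b ↦ (⟨𝒢.r b, X (𝒢.r b)⟩ : 𝒢.Alg).toTangent) hC).1 hXr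
  have h1 : ContMDiffAt 𝓘(ℝ, E) 𝓘(ℝ, E) ∞ (fun b ↦ 𝒢.u (𝒢.r b)) a := h1
  have hd : (𝒢.u (𝒢.r a), a) ∈ C.dom := C.mem_dom (q := (𝒢.u (𝒢.r a), a)) hC (𝒢.s_u _)
  have hext : C.mulExt (𝒢.u (𝒢.r a), a) = a :=
    (C.mulExt_of_comp (q := (𝒢.u (𝒢.r a), a)) hC (𝒢.s_u _)).trans (𝒢.u_mul a)
  have hk : ∀ b, 𝒢.u (𝒢.r b) ∈ C.ψ.source → b ∈ ψ.source →
      ContMDiffAt (𝓘(ℝ, E).prod 𝓘(ℝ, E)) 𝓘(ℝ, E) ∞ (Function.uncurry k)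
        (b, C.ψ (𝒢.u (𝒢.r b))) := by
    intro b hb hb'
    have hd : (𝒢.u (𝒢.r b), b) ∈ C.dom := C.mem_dom (q := (𝒢.u (𝒢.r b), b)) hb (𝒢.s_u _)
    have hext : C.mulExt (𝒢.u (𝒢.r b), b) = b :=
      (C.mulExt_of_comp (q := (𝒢.u (𝒢.r b), b)) hb (𝒢.s_u _)).trans (𝒢.u_mul b)
    have hl : C.ψ.symm (C.ψ (𝒢.u (𝒢.r b))) = 𝒢.u (𝒢.r b) := C.ψ.left_inv hb
    have e1 : ContMDiffAt (𝓘(ℝ, E).prod 𝓘(ℝ, E)) (𝓘(ℝ, E).prod 𝓘(ℝ, E)) ∞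
        (fun q : G × E ↦ (C.ψ.symm q.2, q.1)) (b, C.ψ (𝒢.u (𝒢.r b))) :=
      (ContMDiffAt.comp (g := C.ψ.symm) (f := Prod.snd) (b, C.ψ (𝒢.u (𝒢.r b)))
        (contMDiffAt_symm_of_mem_maximalAtlas C.mem (C.ψ.map_source hb))
        contMDiffAt_snd).prodMk contMDiffAt_fst
    have e2 : ContMDiffAt (𝓘(ℝ, E).prod 𝓘(ℝ, E)) 𝓘(ℝ, E) ∞ C.mulExt
        (C.ψ.symm (C.ψ (𝒢.u (𝒢.r b))), b) := by
      rw [hl]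
      exact (C.contMDiffOn_mulExt _ hd).contMDiffAt (C.isOpen_dom.mem_nhds hd)
    have e3 : ContMDiffAt 𝓘(ℝ, E) 𝓘(ℝ, E) ∞ ψ
        (C.mulExt (C.ψ.symm (C.ψ (𝒢.u (𝒢.r b))), b)) := by
      rw [hl, hext]
      exact contMDiffAt_of_mem_maximalAtlas hψ hb'
    exact ContMDiffAt.comp (g := ψ) (f := fun q : G × E ↦ C.mulExt (C.ψ.symm q.2, q.1)) _ e3
      (ContMDiffAt.comp (g := C.mulExt) (f := fun q : G × E ↦ (C.ψ.symm q.2, q.1)) _ e2 e1)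
  refine (contMDiffAt_fderiv_apply (k := k) (g := fun b ↦ C.ψ (𝒢.u (𝒢.r b))) (hk a hC ha)
    (ContMDiffAt.comp (g := C.ψ) (f := fun b ↦ 𝒢.u (𝒢.r b)) a
      (contMDiffAt_of_mem_maximalAtlas C.mem hC) h1) h2).congr_of_eventuallyEq ?_
  filter_upwards [ψ.open_source.mem_nhds ha,
    h1.continuousAt.preimage_mem_nhds (C.ψ.open_source.mem_nhds hC)] with b hb hb'
  obtain ⟨c, hc, hs, hcb⟩ := exists_rightInvariant_curve X b
  have e1 := hcb.hasDerivAt_chart hψ hb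
  have e2 := hc.hasDerivAt_chart C.mem hb'
  have e3 : ContMDiffAt 𝓘(ℝ, E) 𝓘(ℝ, E) ∞ (k b) (C.ψ (𝒢.u (𝒢.r b))) :=
    ContMDiffAt.comp (g := Function.uncurry k) (f := fun e ↦ (b, e)) (C.ψ (𝒢.u (𝒢.r b)))
      (hk b hb' hb) (contMDiffAt_const.prodMk contMDiffAt_id)
  have e4 : HasFDerivAt (k b) (fderiv ℝ (k b) (C.ψ (𝒢.u (𝒢.r b)))) (C.ψ (𝒢.u (𝒢.r b))) :=
    (e3.contDiffAt.differentiableAt (by simp)).hasFDerivAt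
  have e5 := HasFDerivAt.comp_hasDerivAt_of_eq (l := k b) (f := C.ψ ∘ c) 0 e4 e2
    (congrArg C.ψ hc.1).symm
  refine e1.unique (e5.congr_of_eventuallyEq ?_)
  filter_upwards [hs, hc.tendsto.eventually (C.ψ.open_source.mem_nhds hb')] with t ht ht'
  show ψ (𝒢.mul (c t) b) = ψ (C.mulExt (C.ψ.symm (C.ψ (c t)), b))
  rw [C.ψ.left_inv ht', C.mulExt_of_comp (q := (c t, b)) ht' ht]

end RightInvariant

end LieGroupoid

end Algebroid

/-! ### The bracket of sections and the Lie algebroid of a Lie groupoid -/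

section Algebroid

variable {E E₀ G G₀ : Type*} [NormedAddCommGroup E] [NormedSpace ℝ E]
  [NormedAddCommGroup E₀] [NormedSpace ℝ E₀] [TopologicalSpace G] [ChartedSpace E G]
  [TopologicalSpace G₀] [ChartedSpace E₀ G₀] [IsManifold 𝓘(ℝ, E) ∞ G]
  [IsManifold 𝓘(ℝ, E₀) ∞ G₀] {𝒢 : LieGroupoid E E₀ G G₀}

namespace LieGroupoid

/-- The component of an element of the Lie algebroid in the fibre at `x`, when it lies in this
fibre. -/
noncomputable def Alg.at (a : 𝒢.Alg) (x : G₀) : 𝒢.fiber x := by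
  classical exact if h : a.base = x then h ▸ a.vec else 0

@[simp]
theorem Alg.at_mk (x : G₀) (v : 𝒢.fiber x) : (⟨x, v⟩ : 𝒢.Alg).at x = v := dif_pos rfl

theorem Alg.at_section (X : ∀ x, 𝒢.fiber x) : (fun x ↦ (⟨x, X x⟩ : 𝒢.Alg).at x) = X :=
  funext fun x ↦ Alg.at_mk x (X x)

theorem Alg.mk_at {a : 𝒢.Alg} {x : G₀} (h : a.base = x) : (⟨x, a.at x⟩ : 𝒢.Alg) = a := by
  subst h
  rw [show a.at a.base = a.vec from dif_pos rfl]

theorem exists_section {X : G₀ → 𝒢.Alg} (hX : _root_.IsSmoothSection E₀ E Alg.base X) :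
    ∃ X' : ∀ x, 𝒢.fiber x, 𝒢.IsSmoothSection X' ∧ X = fun x ↦ ⟨x, X' x⟩ := by
  have h : X = fun x ↦ ⟨x, (X x).at x⟩ := funext fun x ↦ (Alg.mk_at (hX.2 x)).symm
  have h1 := hX.1
  rw [h] at h1
  exact ⟨fun x ↦ (X x).at x, h1, h⟩

variable {X Y Z : ∀ x, 𝒢.fiber x}

theorem isSmoothSection_iff : 𝒢.IsSmoothSection X ↔
    ContMDiff 𝓘(ℝ, E₀) 𝓘(ℝ, E).tangent ∞
      fun x ↦ (⟨𝒢.u x, (X x).1⟩ : TangentBundle 𝓘(ℝ, E) G) :=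
  contMDiff_alg_iff

theorem isSmoothSection_of_smoothFieldAt {V : ∀ a, TangentSpace 𝓘(ℝ, E) a}
    (hV : ∀ a, SmoothFieldAt V a) (h : ∀ x, (X x).1 = V (𝒢.u x)) : 𝒢.IsSmoothSection X := by
  rw [isSmoothSection_iff]
  have h1 : ContMDiff 𝓘(ℝ, E) 𝓘(ℝ, E).tangent ∞ fun a ↦ (⟨a, V a⟩ : TangentBundle 𝓘(ℝ, E) G) := hV
  simp_rw [h]
  exact h1.comp 𝒢.contMDiff_u

theorem _root_.smoothFieldAt_zero {M : Type*} [TopologicalSpace M] [ChartedSpace E M]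
    [IsManifold 𝓘(ℝ, E) ∞ M] (x : M) :
    SmoothFieldAt (E := E) (0 : ∀ x : M, TangentSpace 𝓘(ℝ, E) x) x :=
  (Bundle.contMDiff_zeroSection ℝ (TangentSpace 𝓘(ℝ, E) : M → Type _)).contMDiffAt

variable [CompleteSpace E] [CompleteSpace E₀]

/-- Right-invariant fields are `s`-related to the zero field, hence so is their bracket. -/
theorem bracket_mem (hX : 𝒢.IsSmoothSection X) (hY : 𝒢.IsSmoothSection Y) (x : G₀) :
    𝒢.bracket X Y x ∈ 𝒢.fiber x := by
  obtain ⟨β, hβ⟩ := HasVelocity.exists_curve (𝒢.u x) (𝒢.rightInvariant X (𝒢.u x))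
  obtain ⟨γ, hγ⟩ := HasVelocity.exists_curve (𝒢.u x) (𝒢.rightInvariant Y (𝒢.u x))
  have h := mfderiv_mlieBracket_of_related (𝒢.contMDiff_s (𝒢.u x)) (hX.smoothFieldAt _)
    (hY.smoothFieldAt _) (smoothFieldAt_zero _) (smoothFieldAt_zero _) hβ hγ
    (Filter.Eventually.of_forall fun t ↦ mfderiv_s_rightInvariant)
    (Filter.Eventually.of_forall fun t ↦ mfderiv_s_rightInvariant)
  rw [VectorField.mlieBracket_zero_left] at h
  exact h

variable (𝒢) in
/-- The bracket of two smooth sections of the Lie algebroid, as a section. -/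
noncomputable def bracketSection (X Y : ∀ x, 𝒢.fiber x) (x : G₀) : 𝒢.fiber x := by
  classical exact if h : 𝒢.bracket X Y x ∈ 𝒢.fiber x then ⟨𝒢.bracket X Y x, h⟩ else 0

theorem coe_bracketSection (hX : 𝒢.IsSmoothSection X) (hY : 𝒢.IsSmoothSection Y) (x : G₀) :
    (𝒢.bracketSection X Y x).1 = 𝒢.bracket X Y x := by
  rw [bracketSection, dif_pos (bracket_mem hX hY x)]

/-- The bracket of right-invariant fields is right-invariant. The extended translation `mulExt (·,
a)` relates each of the two fields to itself at points of the source fibre over `r a`, to which the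
fields are tangent; relatedness along curves in this fibre suffices. Consequently iterated brackets
of sections are iterated brackets of vector fields, and the Jacobi identity is inherited. -/
theorem rightInvariant_bracketSection (hX : 𝒢.IsSmoothSection X) (hY : 𝒢.IsSmoothSection Y) :
    𝒢.rightInvariant (𝒢.bracketSection X Y) =
      VectorField.mlieBracket 𝓘(ℝ, E) (𝒢.rightInvariant X) (𝒢.rightInvariant Y) := by
  funext a
  obtain ⟨C, hC⟩ := 𝒢.exists_vertChart (𝒢.u (𝒢.r a))
  have hs : 𝒢.s (𝒢.u (𝒢.r a)) = 𝒢.r a := 𝒢.s_u _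
  have hext : C.mulExt (𝒢.u (𝒢.r a), a) = a :=
    (C.mulExt_of_comp (q := (𝒢.u (𝒢.r a), a)) hC hs).trans (𝒢.u_mul a)
  have hf := C.mdifferentiableAt_mulExt hC hs
  have key : ∀ (X : ∀ x, 𝒢.fiber x), ∃ β, HasVelocity β (𝒢.u (𝒢.r a))
      (𝒢.rightInvariant X (𝒢.u (𝒢.r a))) ∧ ∀ᶠ t in 𝓝 (0 : ℝ), 𝒢.s (β t) = 𝒢.r a := fun X ↦ by
    rw [rightInvariant_unit]
    exact exists_fibre_curve (X (𝒢.r a))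
  obtain ⟨β, hβ, hβs⟩ := key X
  obtain ⟨γ, hγ, hγs⟩ := key Y
  have h := mfderiv_mlieBracket_of_related hf (hX.smoothFieldAt _) (hY.smoothFieldAt _)
    (hX.smoothFieldAt _) (hY.smoothFieldAt _) hβ hγ
    (by filter_upwards [hβs, hβ.tendsto.eventually (C.ψ.open_source.mem_nhds hC)] with t h1 h2
          using C.mfderiv_mulExt h2 h1)
    (by filter_upwards [hγs, hγ.tendsto.eventually (C.ψ.open_source.mem_nhds hC)] with t h1 h2
          using C.mfderiv_mulExt h2 h1)
  have h2 := C.mfderiv_mulExt (X := 𝒢.bracketSection X Y) hC hs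
  rw [rightInvariant_unit, coe_bracketSection hX hY] at h2
  have h3 := h2.symm.trans h
  have tr : ∀ x y : G, x = y → ∀ V W : ∀ a : G, TangentSpace 𝓘(ℝ, E) a, V x = W x → V y = W y := by
    rintro x _ rfl V W h
    exact h
  exact tr _ _ hext _ _ h3

theorem IsSmoothSection.bracketSection (hX : 𝒢.IsSmoothSection X) (hY : 𝒢.IsSmoothSection Y) :
    𝒢.IsSmoothSection (𝒢.bracketSection X Y) :=
  isSmoothSection_of_smoothFieldAt
    (fun _ ↦ SmoothFieldAt.mlieBracket (Filter.Eventually.of_forall hX.smoothFieldAt)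
      (Filter.Eventually.of_forall hY.smoothFieldAt)) (coe_bracketSection hX hY)

/-- The field `Z_X` is `r`-related to the vector field on `G₀` given by the anchor of `X`. -/
theorem mfderiv_r_bracket (hX : 𝒢.IsSmoothSection X) (hY : 𝒢.IsSmoothSection Y) (x : G₀) :
    modelVec (𝒢.anchor ⟨x, 𝒢.bracketSection X Y x⟩) =
      modelVec (VectorField.mlieBracket 𝓘(ℝ, E₀) (fun z ↦ modelVec (F := E₀) (𝒢.anchor ⟨z, X z⟩))
        (fun z ↦ modelVec (F := E₀) (𝒢.anchor ⟨z, Y z⟩)) x) := by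
  have key : ∀ {X : ∀ x, 𝒢.fiber x}, 𝒢.IsSmoothSection X → ∀ x, SmoothFieldAt (E := E₀)
      (fun z ↦ modelVec (F := E₀) (𝒢.anchor ⟨z, X z⟩)) x := fun {X} hX x ↦ by
    have h1 := (𝒢.contMDiff_r.contMDiff_tangentMap (m := ∞) (by simp)).comp
      (isSmoothSection_iff.1 hX) x
    refine h1.congr_of_eventuallyEq (Filter.Eventually.of_forall fun z ↦ ?_)
    exact tangentBundle_mk_congr (𝒢.r_u z).symm _
  obtain ⟨β, hβ⟩ := HasVelocity.exists_curve (𝒢.u x) (𝒢.rightInvariant X (𝒢.u x))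
  obtain ⟨γ, hγ⟩ := HasVelocity.exists_curve (𝒢.u x) (𝒢.rightInvariant Y (𝒢.u x))
  have hr : ∀ (X : ∀ x, 𝒢.fiber x) (a : G), mfderiv 𝓘(ℝ, E) 𝓘(ℝ, E₀) 𝒢.r a
      (𝒢.rightInvariant X a) = modelVec (F := E₀) (𝒢.anchor ⟨𝒢.r a, X (𝒢.r a)⟩) :=
    fun X a ↦ by
      have h := mfderiv_r_rightInvariant (𝒢 := 𝒢) (X := X) (a := a)
      exact h
  have h := mfderiv_mlieBracket_of_related (𝒢.contMDiff_r (𝒢.u x)) (hX.smoothFieldAt _)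
    (hY.smoothFieldAt _) (key hX _) (key hY _) hβ hγ
    (Filter.Eventually.of_forall fun t ↦ hr Y (β t))
    (Filter.Eventually.of_forall fun t ↦ hr X (γ t))
  have h2 : modelVec (𝒢.anchor ⟨x, 𝒢.bracketSection X Y x⟩) =
      modelVec (mfderiv 𝓘(ℝ, E) 𝓘(ℝ, E₀) 𝒢.r (𝒢.u x) (𝒢.bracket X Y x)) :=
    congrArg (fun w : TangentSpace 𝓘(ℝ, E) (𝒢.u x) ↦
      modelVec (mfderiv 𝓘(ℝ, E) 𝓘(ℝ, E₀) 𝒢.r (𝒢.u x) w)) (coe_bracketSection hX hY x)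
  have tr : ∀ x y : G₀, x = y → ∀ V : ∀ a : G₀, TangentSpace 𝓘(ℝ, E₀) a,
      modelVec (V x) = modelVec (V y) := by
    rintro x _ rfl V
    rfl
  exact (h2.trans (congrArg modelVec h)).trans (tr _ _ (𝒢.r_u x) _)

theorem bracketSection_add (hX : 𝒢.IsSmoothSection X) (hY : 𝒢.IsSmoothSection Y)
    (hZ : 𝒢.IsSmoothSection Z) : 𝒢.bracketSection X (Y + Z) =
      𝒢.bracketSection X Y + 𝒢.bracketSection X Z := by
  have hYZ : 𝒢.IsSmoothSection (Y + Z) := by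
    refine isSmoothSection_of_smoothFieldAt (V := 𝒢.rightInvariant Y + 𝒢.rightInvariant Z)
      (fun a ↦ ?_) fun x ↦ ?_
    · exact ContMDiffAt.add_section (hY.smoothFieldAt a) (hZ.smoothFieldAt a)
    · rw [← rightInvariant_add, rightInvariant_unit]
  funext x
  apply Subtype.ext
  rw [coe_bracketSection hX hYZ]
  show _ = (𝒢.bracketSection X Y x).1 + (𝒢.bracketSection X Z x).1
  rw [coe_bracketSection hX hY, coe_bracketSection hX hZ, bracket, rightInvariant_add]
  exact VectorField.mlieBracket_add_right (hY.smoothFieldAt _).mdifferentiableAt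
    (hZ.smoothFieldAt _).mdifferentiableAt

theorem bracketSection_swap (hX : 𝒢.IsSmoothSection X) (hY : 𝒢.IsSmoothSection Y) :
    𝒢.bracketSection X Y = -𝒢.bracketSection Y X := by
  funext x
  apply Subtype.ext
  show _ = -(𝒢.bracketSection Y X x).1
  rw [coe_bracketSection hX hY, coe_bracketSection hY hX]
  exact VectorField.mlieBracket_swap_apply

theorem bracketSection_jacobi (hX : 𝒢.IsSmoothSection X) (hY : 𝒢.IsSmoothSection Y)
    (hZ : 𝒢.IsSmoothSection Z) : 𝒢.bracketSection X (𝒢.bracketSection Y Z) =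
      𝒢.bracketSection (𝒢.bracketSection X Y) Z + 𝒢.bracketSection Y (𝒢.bracketSection X Z) := by
  funext x
  apply Subtype.ext
  show _ = (𝒢.bracketSection (𝒢.bracketSection X Y) Z x).1 +
    (𝒢.bracketSection Y (𝒢.bracketSection X Z) x).1
  rw [coe_bracketSection hX (hY.bracketSection hZ), coe_bracketSection (hX.bracketSection hY) hZ,
    coe_bracketSection hY (hX.bracketSection hZ), bracket, bracket, bracket,
    rightInvariant_bracketSection hY hZ, rightInvariant_bracketSection hX hY,
    rightInvariant_bracketSection hX hZ]
  have h3 : minSmoothness ℝ 3 = 3 := minSmoothness_of_isRCLikeNormedField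
  have : IsManifold 𝓘(ℝ, E) (minSmoothness ℝ 3) G := by
    rw [h3]; exact IsManifold.of_le (n := ∞) (WithTop.coe_le_coe.2 (le_top (a := (3 : ℕ∞))))
  exact VectorField.leibniz_identity_mlieBracket_apply
    (ContMDiffAt.of_le (hX.smoothFieldAt _) minSmoothness_two_le)
    (ContMDiffAt.of_le (hY.smoothFieldAt _) minSmoothness_two_le)
    (ContMDiffAt.of_le (hZ.smoothFieldAt _) minSmoothness_two_le)

/-- The right-invariant field of `f • Y` is `(f ∘ r) • Z_Y`, and the derivative of `f ∘ r` along `X`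
is that of `f` along the anchor of `X`. The rule is then the Leibniz rule for vector fields. -/
theorem bracketSection_smul (hX : 𝒢.IsSmoothSection X) (hY : 𝒢.IsSmoothSection Y) {f : G₀ → ℝ}
    (hf : ContMDiff 𝓘(ℝ, E₀) 𝓘(ℝ, ℝ) ∞ f) (x : G₀) :
    𝒢.bracketSection X (fun z ↦ f z • Y z) x = f x • 𝒢.bracketSection X Y x +
      modelVec (F := ℝ)
        (mfderiv 𝓘(ℝ, E₀) 𝓘(ℝ, ℝ) f x (modelVec (F := E₀) (𝒢.anchor ⟨x, X x⟩))) • Y x := by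
  have hfr : ContMDiff 𝓘(ℝ, E) 𝓘(ℝ, ℝ) ∞ (f ∘ 𝒢.r) := hf.comp 𝒢.contMDiff_r
  have hfY : 𝒢.IsSmoothSection (fun z ↦ f z • Y z) := by
    refine isSmoothSection_of_smoothFieldAt (V := (f ∘ 𝒢.r) • 𝒢.rightInvariant Y)
      (fun a ↦ ?_) fun x ↦ ?_
    · exact ContMDiffAt.smul_section (hfr a) (hY.smoothFieldAt a)
    · rw [← rightInvariant_smul, rightInvariant_unit]
  apply Subtype.ext
  rw [coe_bracketSection hX hfY]
  show _ = f x • (𝒢.bracketSection X Y x).1 + _ • (Y x).1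
  rw [coe_bracketSection hX hY, bracket, rightInvariant_smul]
  refine (VectorField.mlieBracket_smul_right (hfr.mdifferentiable (by simp) _)
    (hY.smoothFieldAt _).mdifferentiableAt).trans ?_
  have tr : ∀ y, y = x → ∀ w : E₀, mfderiv 𝓘(ℝ, E₀) 𝓘(ℝ, ℝ) f y (w : TangentSpace 𝓘(ℝ, E₀) y) =
      modelVec (F := ℝ) (mfderiv 𝓘(ℝ, E₀) 𝓘(ℝ, ℝ) f x (w : TangentSpace 𝓘(ℝ, E₀) x)) := by
    rintro y rfl w
    rfl
  have e1 : mfderiv 𝓘(ℝ, E) 𝓘(ℝ, ℝ) (f ∘ 𝒢.r) (𝒢.u x) (X x).1 = modelVec (F := ℝ)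
      (mfderiv 𝓘(ℝ, E₀) 𝓘(ℝ, ℝ) f x (modelVec (F := E₀) (𝒢.anchor ⟨x, X x⟩))) := by
    rw [mfderiv_comp (𝒢.u x) (hf.mdifferentiable (by simp) _) (𝒢.mdifferentiable_structure.2.1 _)]
    exact tr _ (𝒢.r_u x) _
  have e2 : (f ∘ 𝒢.r) (𝒢.u x) = f x := congrArg f (𝒢.r_u x)
  rw [add_comm, rightInvariant_unit, rightInvariant_unit, e2]
  exact congrArg (fun c : ℝ ↦ f x • VectorField.mlieBracket 𝓘(ℝ, E) (𝒢.rightInvariant X)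
    (𝒢.rightInvariant Y) (𝒢.u x) + c • (Y x).1) e1

variable [FiniteDimensional ℝ E]

/-- In a chart where the source is the linear map `p`, all the fibres become `ker p`. The map `q` is
the projection `1 - σp` on `ker p` followed by an identification with `ℝⁿ`; it forgets the part
`σ(χ(x))` of the coordinate. -/
theorem exists_trivialization (𝒢 : LieGroupoid E E₀ G G₀) (y : G₀) :
    ∃ (U : Set G₀) (n : ℕ) (Θ : 𝒢.Alg → EuclideanSpace ℝ (Fin n))
      (Ξ : G₀ × EuclideanSpace ℝ (Fin n) → 𝒢.Alg), IsOpen U ∧ y ∈ U ∧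
      ContMDiffOn 𝓘(ℝ, E) 𝓘(ℝ, EuclideanSpace ℝ (Fin n)) ∞ Θ (Alg.base ⁻¹' U) ∧
      ContMDiffOn (𝓘(ℝ, E₀).prod 𝓘(ℝ, EuclideanSpace ℝ (Fin n))) 𝓘(ℝ, E) ∞ Ξ (U ×ˢ univ) ∧
      (∀ a : 𝒢.Alg, a.base ∈ U → Ξ (a.base, Θ a) = a) ∧
      (∀ z ∈ U, ∀ w, (Ξ (z, w)).base = z ∧ Θ (Ξ (z, w)) = w) ∧
      ∀ z ∈ U, ∀ (v w : 𝒢.fiber z) (c : ℝ),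
        Θ ⟨z, v + w⟩ = Θ ⟨z, v⟩ + Θ ⟨z, w⟩ ∧ Θ ⟨z, c • v⟩ = c • Θ ⟨z, v⟩ := by
  obtain ⟨C, hC⟩ := 𝒢.exists_vertChart (𝒢.u y)
  let L : C.p.ker ≃L[ℝ] EuclideanSpace ℝ (Fin (Module.finrank ℝ C.p.ker)) :=
    ContinuousLinearEquiv.ofFinrankEq (by simp)
  let q₀ : E →L[ℝ] C.p.ker :=
    (ContinuousLinearMap.id ℝ E - C.σ.comp C.p).codRestrict C.p.ker fun e ↦ by simp [C.p_σ]
  let q : E →L[ℝ] EuclideanSpace ℝ (Fin (Module.finrank ℝ C.p.ker)) :=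
    (L : C.p.ker →L[ℝ] _).comp q₀
  let k : EuclideanSpace ℝ (Fin (Module.finrank ℝ C.p.ker)) →L[ℝ] E :=
    C.p.ker.subtypeL.comp (L.symm : _ →L[ℝ] C.p.ker)
  have hpk : ∀ w, C.p (k w) = 0 := fun w ↦ (L.symm w).2
  have hkq : ∀ e, k (q e) = e - C.σ (C.p e) := fun e ↦ by
    show ((L.symm (L (q₀ e)) : C.p.ker) : E) = _
    rw [L.symm_apply_apply]
    rfl
  have hqk : ∀ w, q (k w) = w := fun w ↦ by
    show L (q₀ (k w)) = w
    have : q₀ (k w) = L.symm w := Subtype.ext (by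
      show k w - C.σ (C.p (k w)) = k w
      simp [hpk])
    rw [this, L.apply_symm_apply]
  have hqσ : ∀ e, q (C.σ e) = 0 := fun e ↦ by
    have : q₀ (C.σ e) = 0 := Subtype.ext (by
      show C.σ e - C.σ (C.p (C.σ e)) = 0
      simp [C.p_σ])
    show L (q₀ (C.σ e)) = 0
    rw [this, map_zero]
  have htgt : ∀ z, 𝒢.u z ∈ C.ψ.source → ∀ w, C.σ (C.χ z) + k w ∈ C.alg.target := fun z hz w ↦ by
    rw [C.mem_alg_target, map_add, C.p_σ, hpk, add_zero, C.χ.left_inv (C.base_mem hz)]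
    exact ⟨C.χ.map_source (C.base_mem hz), hz⟩
  have hΘ : ∀ a : 𝒢.Alg, q (C.alg a) = q (dchart C.ψ (𝒢.u a.base) a.vec) := fun a ↦ by
    rw [C.alg_apply, map_add, hqσ, zero_add]
  refine ⟨𝒢.u ⁻¹' C.ψ.source, _, fun a ↦ q (C.alg a),
    fun z ↦ C.alg.symm (C.σ (C.χ z.1) + k z.2),
    C.ψ.open_source.preimage 𝒢.contMDiff_u.continuous, hC, ?_, ?_, ?_, ?_, ?_⟩
  · exact q.contDiff.contMDiff.comp_contMDiffOn (contMDiffOn_of_mem_maximalAtlas C.alg_mem)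
  · refine (contMDiffOn_symm_of_mem_maximalAtlas C.alg_mem).comp ?_ fun z hz ↦ htgt _ hz.1 _
    refine ContMDiffOn.add (C.σ.contDiff.contMDiff.comp_contMDiffOn ?_)
      (k.contDiff.contMDiff.comp_contMDiffOn contMDiffOn_snd)
    exact (contMDiffOn_of_mem_maximalAtlas C.mem').comp contMDiffOn_fst fun z hz ↦ C.base_mem hz.1
  · intro a ha
    show C.alg.symm (C.σ (C.χ a.base) + k (q (C.alg a))) = a
    have h : C.p (C.alg a) = C.χ a.base := C.p_coord ha
    rw [hkq, h, add_sub_cancel]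
    exact C.alg.left_inv ha
  · intro z hz w
    have h1 : C.alg (C.alg.symm (C.σ (C.χ z) + k w)) = C.σ (C.χ z) + k w :=
      C.alg.right_inv (htgt z hz w)
    constructor
    · have h2 : 𝒢.u (C.alg.symm (C.σ (C.χ z) + k w)).base ∈ C.ψ.source :=
        C.alg.map_target (htgt z hz w)
      apply C.χ.injOn (C.base_mem h2) (C.base_mem hz)
      rw [← C.p_coord h2]
      refine (congrArg C.p h1).trans ?_
      rw [map_add, C.p_σ, hpk, add_zero]
    · show q (C.alg _) = w
      rw [h1, map_add, hqσ, hqk, zero_add]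
  · intro z hz v w c
    simp only [hΘ]
    exact ⟨(congrArg q (map_add (dchart C.ψ (𝒢.u z)) v.1 w.1)).trans (map_add q _ _),
      (congrArg q (map_smul (dchart C.ψ (𝒢.u z)) c v.1)).trans (map_smul q _ _)⟩

variable (𝒢) in
/-- The Lie algebroid of a Lie groupoid. -/
noncomputable def algebroid : LieAlgebroid E E₀ 𝒢.Alg G₀ where
  proj := Alg.base
  zero x := ⟨x, 0⟩
  -- For elements of different fibres `b.at a.base` is zero, and the sum has the junk value `a`.
  add a b := ⟨a.base, a.vec + b.at a.base⟩
  smul c a := ⟨a.base, c • a.vec⟩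
  contMDiff_proj := contMDiff_base
  proj_zero _ := rfl
  proj_add _ _ _ := rfl
  proj_smul _ _ := rfl
  locallyTrivial y := by
    obtain ⟨U, n, Θ, Ξ, hU, hy, hΘ, hΞ, h1, h2, h3⟩ := 𝒢.exists_trivialization y
    refine ⟨U, n, Θ, Ξ, hU, hy, hΘ, hΞ, h1, h2, fun z hz ↦ ?_, ?_, fun c a ha ↦ ?_⟩
    · simpa using (h3 z hz 0 0 0).2
    · rintro ⟨x, v⟩ ⟨_, w⟩ hx rfl
      simpa using (h3 x hx v w 0).1
    · exact (h3 a.base ha a.vec 0 c).2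
  anchor := 𝒢.anchor
  contMDiff_anchor := by
    have h1 := (𝒢.contMDiff_r.contMDiff_tangentMap (m := ∞) (by simp)).comp
      (contMDiff_alg_iff.1 (contMDiff_id (M := 𝒢.Alg)))
    refine h1.congr fun a ↦ ?_
    exact tangentBundle_mk_congr (𝒢.r_u a.base).symm _
  anchor_add := by
    rintro ⟨x, v⟩ ⟨_, w⟩ rfl
    refine (congrArg (fun z ↦ modelVec (𝒢.anchor ⟨x, v + z⟩)) (Alg.at_mk x w)).trans ?_
    exact map_add (mfderiv 𝓘(ℝ, E) 𝓘(ℝ, E₀) 𝒢.r (𝒢.u _)) v.1 w.1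
  anchor_smul c a := map_smul (mfderiv 𝓘(ℝ, E) 𝓘(ℝ, E₀) 𝒢.r (𝒢.u a.base)) c a.vec.1
  bracket X Y y := ⟨y, 𝒢.bracketSection (fun x ↦ (X x).at x) (fun x ↦ (Y x).at x) y⟩
  bracket_section := by
    intro X Y hX hY
    obtain ⟨X, hX', rfl⟩ := exists_section hX
    obtain ⟨Y, hY', rfl⟩ := exists_section hY
    simp only [Alg.at_mk]
    exact ⟨hX'.bracketSection hY', fun _ ↦ rfl⟩
  bracket_add := by
    intro X Y Z hX hY hZ y
    obtain ⟨X, hX', rfl⟩ := exists_section hX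
    obtain ⟨Y, hY', rfl⟩ := exists_section hY
    obtain ⟨Z, hZ', rfl⟩ := exists_section hZ
    simp only [Alg.at_mk]
    exact congrArg _ (congrFun (bracketSection_add hX' hY' hZ') y)
  bracket_swap := by
    intro X Y hX hY y
    obtain ⟨X, hX', rfl⟩ := exists_section hX
    obtain ⟨Y, hY', rfl⟩ := exists_section hY
    simp only [Alg.at_mk, bracketSection_swap hX' hY', neg_smul, one_smul]
    rfl
  jacobi := by
    intro X Y Z hX hY hZ y
    obtain ⟨X, hX', rfl⟩ := exists_section hX
    obtain ⟨Y, hY', rfl⟩ := exists_section hY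
    obtain ⟨Z, hZ', rfl⟩ := exists_section hZ
    simp only [Alg.at_mk]
    exact congrArg _ (congrFun (bracketSection_jacobi hX' hY' hZ') y)
  anchor_bracket := by
    intro X Y hX hY y
    obtain ⟨X, hX', rfl⟩ := exists_section hX
    obtain ⟨Y, hY', rfl⟩ := exists_section hY
    exact (congrArg₂ (fun X Y ↦ modelVec (𝒢.anchor ⟨y, 𝒢.bracketSection X Y y⟩))
      (Alg.at_section X) (Alg.at_section Y)).trans (mfderiv_r_bracket hX' hY' y)
  leibniz := by
    intro X Y hX hY f hf y
    obtain ⟨X, hX', rfl⟩ := exists_section hX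
    obtain ⟨Y, hY', rfl⟩ := exists_section hY
    simp only [Alg.at_mk]
    exact congrArg _ (bracketSection_smul hX' hY' hf y)

end LieGroupoid

end Algebroid

/-! ### Morphisms of Lie groupoids and their Lie algebroids -/

section Morphism

variable {E E₀ G G₀ : Type*} [NormedAddCommGroup E] [NormedSpace ℝ E]
  [NormedAddCommGroup E₀] [NormedSpace ℝ E₀] [TopologicalSpace G] [ChartedSpace E G]
  [TopologicalSpace G₀] [ChartedSpace E₀ G₀] [IsManifold 𝓘(ℝ, E) ∞ G]
  [IsManifold 𝓘(ℝ, E₀) ∞ G₀]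
  {D D₀ K K₀ : Type*} [NormedAddCommGroup D] [NormedSpace ℝ D]
  [NormedAddCommGroup D₀] [NormedSpace ℝ D₀] [TopologicalSpace K] [ChartedSpace D K]
  [TopologicalSpace K₀] [ChartedSpace D₀ K₀] [IsManifold 𝓘(ℝ, D) ∞ K]
  [IsManifold 𝓘(ℝ, D₀) ∞ K₀]
  {𝒢 : LieGroupoid E E₀ G G₀} {𝒦 : LieGroupoid D D₀ K K₀} {f : K → G} {f₀ : K₀ → G₀}

namespace LieGroupoid

/-- A morphism of Lie groupoids maps the fibres of the Lie algebroid to each other. -/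
theorem mfderiv_mem_fiber {x : K₀} (hf : MDifferentiableAt 𝓘(ℝ, D) 𝓘(ℝ, E) f (𝒦.u x))
    (hf₀ : MDifferentiableAt 𝓘(ℝ, D₀) 𝓘(ℝ, E₀) f₀ x) (hs : ∀ a, 𝒢.s (f a) = f₀ (𝒦.s a))
    (hu : 𝒢.u (f₀ x) = f (𝒦.u x)) {w : TangentSpace 𝓘(ℝ, D) (𝒦.u x)} (hw : w ∈ 𝒦.fiber x) :
    (mfderiv 𝓘(ℝ, D) 𝓘(ℝ, E) f (𝒦.u x) w : TangentSpace 𝓘(ℝ, E) (𝒢.u (f₀ x))) ∈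
      𝒢.fiber (f₀ x) := by
  have hf₀ : MDifferentiableAt 𝓘(ℝ, D₀) 𝓘(ℝ, E₀) f₀ (𝒦.s (𝒦.u x)) := by rwa [𝒦.s_u]
  have h1 := mfderiv_comp (𝒦.u x) (𝒢.mdifferentiable_structure.1 _) hf
  have h2 := mfderiv_comp (𝒦.u x) hf₀ (𝒦.mdifferentiable_structure.1 (𝒦.u x))
  have h3 : 𝒢.s ∘ f = f₀ ∘ 𝒦.s := funext hs
  rw [h3, h2] at h1
  have h4 : mfderiv 𝓘(ℝ, D) 𝓘(ℝ, D₀) 𝒦.s (𝒦.u x) w = 0 := hw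
  have h6 : mfderiv 𝓘(ℝ, E) 𝓘(ℝ, E₀) 𝒢.s (f (𝒦.u x))
      (mfderiv 𝓘(ℝ, D) 𝓘(ℝ, E) f (𝒦.u x) w) = 0 :=
    (DFunLike.congr_fun h1 w).symm.trans
      ((congrArg (mfderiv 𝓘(ℝ, D₀) 𝓘(ℝ, E₀) f₀ (𝒦.s (𝒦.u x))) h4).trans (map_zero _))
  have tr : ∀ y z, y = z → ∀ w : E, mfderiv 𝓘(ℝ, E) 𝓘(ℝ, E₀) 𝒢.s y
      (w : TangentSpace 𝓘(ℝ, E) y) = 0 → mfderiv 𝓘(ℝ, E) 𝓘(ℝ, E₀) 𝒢.s z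
      (w : TangentSpace 𝓘(ℝ, E) z) = 0 := by
    rintro y _ rfl w h
    exact h
  exact tr _ _ hu.symm _ h6

variable {X X' : ∀ x, 𝒦.fiber x} {Y Y' : ∀ x, 𝒢.fiber x}

/-- A morphism of Lie groupoids relates the right invariant vector fields of related sections. -/
theorem mfderiv_rightInvariant (hf : MDifferentiable 𝓘(ℝ, D) 𝓘(ℝ, E) f)
    (hs : ∀ a, 𝒢.s (f a) = f₀ (𝒦.s a)) (hr : ∀ a, 𝒢.r (f a) = f₀ (𝒦.r a))
    (hu : ∀ x, 𝒢.u (f₀ x) = f (𝒦.u x))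
    (hm : ∀ a b, 𝒦.s a = 𝒦.r b → 𝒢.mul (f a) (f b) = f (𝒦.mul a b))
    (hXY : ∀ x, modelVec (Y (f₀ x)).1 =
      modelVec (mfderiv 𝓘(ℝ, D) 𝓘(ℝ, E) f (𝒦.u x) (X x).1)) (a : K) :
    mfderiv 𝓘(ℝ, D) 𝓘(ℝ, E) f a (𝒦.rightInvariant X a) = 𝒢.rightInvariant Y (f a) := by
  obtain ⟨c, hc, hcs, h⟩ := exists_rightInvariant_curve X a
  have key : ∀ z, z = f₀ (𝒦.r a) → ∀ c, HasVelocity c (f (𝒦.u (𝒦.r a)))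
      (mfderiv 𝓘(ℝ, D) 𝓘(ℝ, E) f (𝒦.u (𝒦.r a)) (X (𝒦.r a)).1) →
      HasVelocity c (𝒢.u z) (Y z).1 := by
    rintro z rfl c hc
    have h1 := hc.congr_point (hu (𝒦.r a)).symm
    exact ⟨h1.1, h1.2.1, h1.2.2.trans (hXY _).symm⟩
  have h1 := hasVelocity_rightInvariant (key _ (hr a) _ (hc.comp (hf _))) (by
    filter_upwards [hcs] with t ht
    rw [hr, ← ht]
    exact hs _)
  refine (h.comp (hf a)).unique (h1.congr ?_)
  filter_upwards [hcs] with t ht using (hm _ _ ht).symm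

variable [CompleteSpace E] [CompleteSpace D]

/-- A morphism of Lie groupoids is compatible with the brackets of related sections. -/
theorem mfderiv_bracket (hf : ContMDiff 𝓘(ℝ, D) 𝓘(ℝ, E) ∞ f)
    (hs : ∀ a, 𝒢.s (f a) = f₀ (𝒦.s a)) (hr : ∀ a, 𝒢.r (f a) = f₀ (𝒦.r a))
    (hu : ∀ x, 𝒢.u (f₀ x) = f (𝒦.u x))
    (hm : ∀ a b, 𝒦.s a = 𝒦.r b → 𝒢.mul (f a) (f b) = f (𝒦.mul a b))
    (hX : 𝒦.IsSmoothSection X) (hX' : 𝒦.IsSmoothSection X') (hY : 𝒢.IsSmoothSection Y)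
    (hY' : 𝒢.IsSmoothSection Y')
    (hXY : ∀ x, modelVec (Y (f₀ x)).1 = modelVec (mfderiv 𝓘(ℝ, D) 𝓘(ℝ, E) f (𝒦.u x) (X x).1))
    (hXY' : ∀ x, modelVec (Y' (f₀ x)).1 = modelVec (mfderiv 𝓘(ℝ, D) 𝓘(ℝ, E) f (𝒦.u x) (X' x).1))
    (x : K₀) : modelVec (𝒢.bracket Y Y' (f₀ x)) =
      modelVec (mfderiv 𝓘(ℝ, D) 𝓘(ℝ, E) f (𝒦.u x) (𝒦.bracket X X' x)) := by
  have hfd := hf.mdifferentiable (by simp)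
  obtain ⟨β, hβ⟩ := HasVelocity.exists_curve (𝒦.u x) (𝒦.rightInvariant X (𝒦.u x))
  obtain ⟨γ, hγ⟩ := HasVelocity.exists_curve (𝒦.u x) (𝒦.rightInvariant X' (𝒦.u x))
  have h := mfderiv_mlieBracket_of_related (hf (𝒦.u x)) (hX.smoothFieldAt _)
    (hX'.smoothFieldAt _) (hY.smoothFieldAt _) (hY'.smoothFieldAt _) hβ hγ
    (.of_forall fun t ↦ mfderiv_rightInvariant hfd hs hr hu hm hXY' _)
    (.of_forall fun t ↦ mfderiv_rightInvariant hfd hs hr hu hm hXY _)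
  have tr : ∀ y z : G, y = z → ∀ V : ∀ a : G, TangentSpace 𝓘(ℝ, E) a,
      modelVec (V y) = modelVec (V z) := by
    rintro y _ rfl V
    rfl
  exact (tr _ _ (hu x) _).trans (congrArg modelVec h).symm

end LieGroupoid

end Morphism

/-- A bijection given by the identity in charts is a diffeomorphism. It is enough to have charts
around the fibres of compatible projections. -/
theorem exists_diffeomorph_of_charts {E X Y Z : Type*} [NormedAddCommGroup E] [NormedSpace ℝ E]
    [TopologicalSpace X] [ChartedSpace E X] [TopologicalSpace Y] [ChartedSpace E Y]
    {Φ : X → Y} {πX : X → Z} {πY : Y → Z} (hπ : ∀ x, πY (Φ x) = πX x)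
    (h : ∀ z, ∃ (ψ : OpenPartialHomeomorph X E) (χ : OpenPartialHomeomorph Y E),
      ψ ∈ IsManifold.maximalAtlas 𝓘(ℝ, E) ∞ X ∧ χ ∈ IsManifold.maximalAtlas 𝓘(ℝ, E) ∞ Y ∧
      (∀ x, πX x = z → x ∈ ψ.source) ∧ (∀ y, πY y = z → y ∈ χ.source) ∧ ψ.target = χ.target ∧
      ∀ x ∈ ψ.source, Φ x ∈ χ.source ∧ χ (Φ x) = ψ x) :
    ∃ Φ' : Diffeomorph 𝓘(ℝ, E) 𝓘(ℝ, E) X Y ∞, ∀ x, Φ' x = Φ x := by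
  -- Points with the same image have the same projection, so they lie in the domain of one chart.
  -- This is why the charts are asked to contain whole fibres.
  have hinj : Function.Injective Φ := fun x x' hx ↦ by
    obtain ⟨ψ, χ, -, -, h1, -, -, h2⟩ := h (πX x)
    have hx1 := h1 x rfl
    have hx2 := h1 x' (by rw [← hπ, ← hπ, hx])
    apply ψ.injOn hx1 hx2
    rw [← (h2 x hx1).2, ← (h2 x' hx2).2, hx]
  have hloc : ∀ y, ∃ (ψ : OpenPartialHomeomorph X E) (χ : OpenPartialHomeomorph Y E),
      ψ ∈ IsManifold.maximalAtlas 𝓘(ℝ, E) ∞ X ∧ χ ∈ IsManifold.maximalAtlas 𝓘(ℝ, E) ∞ Y ∧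
      y ∈ χ.source ∧ ∀ y' ∈ χ.source, χ y' ∈ ψ.target ∧ Φ (ψ.symm (χ y')) = y' := fun y ↦ by
    obtain ⟨ψ, χ, hψ, hχ, -, h1, h2, h3⟩ := h (πY y)
    refine ⟨ψ, χ, hψ, hχ, h1 y rfl, fun y' hy' ↦ ?_⟩
    have ht : χ y' ∈ ψ.target := h2 ▸ χ.map_source hy'
    obtain ⟨h4, h5⟩ := h3 _ (ψ.map_target ht)
    exact ⟨ht, χ.injOn h4 hy' (by rw [h5, ψ.right_inv ht])⟩
  have hsurj : Function.Surjective Φ := fun y ↦ by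
    obtain ⟨ψ, χ, -, -, hy, h1⟩ := hloc y
    exact ⟨_, (h1 y hy).2⟩
  let e := Equiv.ofBijective Φ ⟨hinj, hsurj⟩
  refine ⟨⟨e, fun x ↦ ?_, fun y ↦ ?_⟩, fun x ↦ rfl⟩
  · obtain ⟨ψ, χ, hψ, hχ, h1, -, -, h2⟩ := h (πX x)
    have hx := h1 x rfl
    have hc : ContMDiffAt 𝓘(ℝ, E) 𝓘(ℝ, E) ∞ (χ.symm ∘ ψ) x := by
      refine ContMDiffAt.comp x ?_ (contMDiffAt_of_mem_maximalAtlas hψ hx)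
      rw [← (h2 x hx).2]
      exact contMDiffAt_symm_of_mem_maximalAtlas hχ (χ.map_source (h2 x hx).1)
    refine hc.congr_of_eventuallyEq ?_
    filter_upwards [ψ.open_source.mem_nhds hx] with x' hx'
    show Φ x' = χ.symm (ψ x')
    rw [← (h2 x' hx').2, χ.left_inv (h2 x' hx').1]
  · obtain ⟨ψ, χ, hψ, hχ, hy, h1⟩ := hloc y
    have hc : ContMDiffAt 𝓘(ℝ, E) 𝓘(ℝ, E) ∞ (ψ.symm ∘ χ) y :=
      ContMDiffAt.comp y (contMDiffAt_symm_of_mem_maximalAtlas hψ (h1 y hy).1)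
        (contMDiffAt_of_mem_maximalAtlas hχ hy)
    refine hc.congr_of_eventuallyEq ?_
    filter_upwards [χ.open_source.mem_nhds hy] with y' hy'
    apply e.injective
    exact (e.apply_symm_apply y').trans (h1 y' hy').2.symm

/-! ### Charts of a submanifold deduced from adapted charts -/

section Restriction

variable {E' V E M : Type*} [NormedAddCommGroup E'] [NormedSpace ℝ E'] [TopologicalSpace V]
  [ChartedSpace E' V] [NormedAddCommGroup E] [NormedSpace ℝ E] [TopologicalSpace M]
  [ChartedSpace E M] [FiniteDimensional ℝ E'] [FiniteDimensional ℝ E]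
  {i : SmoothEmbedding E' V E M}

namespace AdaptedChart

variable (A : AdaptedChart i)

/-- The model space of the submanifold, identified with the kernel of `P`. -/
noncomputable def kerEquiv : E' ≃L[ℝ] A.P.ker :=
  ContinuousLinearEquiv.ofFinrankEq A.finrank_ker.symm

/-- The inclusion of the model space of the submanifold. -/
noncomputable def incl : E' →L[ℝ] E :=
  A.P.ker.subtypeL.comp (A.kerEquiv : E' →L[ℝ] A.P.ker)

/-- The projection on the model space of the submanifold. -/
noncomputable def retr : E →L[ℝ] E' :=
  (A.kerEquiv.symm : A.P.ker →L[ℝ] E').comp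
    ((ContinuousLinearMap.id ℝ E - A.P).codRestrict A.P.ker fun e ↦ by simp [A.idem])

@[simp] theorem P_incl (e : E') : A.P (A.incl e) = 0 := (A.kerEquiv e).2

theorem incl_retr (e : E) : A.incl (A.retr e) = e - A.P e := by
  show ((A.kerEquiv (A.kerEquiv.symm _) : A.P.ker) : E) = _
  rw [A.kerEquiv.apply_symm_apply]
  rfl

theorem incl_injective : Function.Injective A.incl :=
  Subtype.val_injective.comp A.kerEquiv.injective

@[simp] theorem retr_incl (e : E') : A.retr (A.incl e) = e :=
  A.incl_injective (by simp [A.incl_retr])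

theorem exists_incl {e : E} (he : A.P e = 0) : ∃ e', A.incl e' = e :=
  ⟨A.retr e, by simp [A.incl_retr, he]⟩

theorem P_apply_map {v : V} (hv : i v ∈ A.ψ.source) : A.P (A.ψ (i v)) = 0 :=
  (A.slice _ hv).1 ⟨v, rfl⟩

theorem apply_invFun [Nonempty V] {e : E'} (he : A.incl e ∈ A.ψ.target) :
    i (Function.invFun i (A.ψ.symm (A.incl e))) = A.ψ.symm (A.incl e) :=
  Function.invFun_eq ((A.slice _ (A.ψ.map_target he)).2 (by rw [A.ψ.right_inv he, A.P_incl]))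

/-- The chart of the submanifold obtained from an adapted chart. -/
noncomputable def restrict [Nonempty V] : OpenPartialHomeomorph V E' where
  toFun v := A.retr (A.ψ (i v))
  invFun e := Function.invFun i (A.ψ.symm (A.incl e))
  source := i ⁻¹' A.ψ.source
  target := A.incl ⁻¹' A.ψ.target
  map_source' v hv := by
    show A.incl (A.retr (A.ψ (i v))) ∈ A.ψ.target
    rw [A.incl_retr, A.P_apply_map hv, sub_zero]
    exact A.ψ.map_source hv
  map_target' e he := by
    show i _ ∈ A.ψ.source
    rw [A.apply_invFun he]
    exact A.ψ.map_target he
  left_inv' v hv := by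
    apply i.injective
    have h : A.incl (A.retr (A.ψ (i v))) = A.ψ (i v) := by
      rw [A.incl_retr, A.P_apply_map hv, sub_zero]
    rw [A.apply_invFun (by rw [h]; exact A.ψ.map_source hv), h, A.ψ.left_inv hv]
  right_inv' e he := by
    show A.retr (A.ψ (i _)) = e
    rw [A.apply_invFun he, A.ψ.right_inv he, A.retr_incl]
  open_source := A.ψ.open_source.preimage i.isSmoothEmbedding.isEmbedding.continuous
  open_target := A.ψ.open_target.preimage A.incl.continuous
  continuousOn_toFun := A.retr.continuous.comp_continuousOn (A.ψ.continuousOn.comp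
    i.isSmoothEmbedding.isEmbedding.continuous.continuousOn fun _ h ↦ h)
  continuousOn_invFun := by
    rw [i.isSmoothEmbedding.isEmbedding.isInducing.continuousOn_iff]
    exact (A.ψ.continuousOn_symm.comp A.incl.continuous.continuousOn fun _ h ↦ h).congr
      fun e he ↦ A.apply_invFun he

variable [Nonempty V]

theorem restrict_apply (v : V) : A.restrict v = A.retr (A.ψ (i v)) := rfl

theorem mem_restrict_source {v : V} : v ∈ A.restrict.source ↔ i v ∈ A.ψ.source := Iff.rfl

theorem incl_restrict {v : V} (hv : i v ∈ A.ψ.source) : A.incl (A.restrict v) = A.ψ (i v) := by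
  rw [restrict_apply, A.incl_retr, A.P_apply_map hv, sub_zero]

/-- The inverse is smooth because `i` is an immersion: a continuous map to `V` is smooth as soon as
its composition with `i` is, and here this composition is `A.ψ.symm ∘ A.incl`. -/
theorem restrict_mem [IsManifold 𝓘(ℝ, E') ∞ V] :
    A.restrict ∈ IsManifold.maximalAtlas 𝓘(ℝ, E') ∞ V := by
  refine mem_maximalAtlas_of_contMDiffOn ?_ fun e he ↦ ContMDiffAt.contMDiffWithinAt ?_
  · exact A.retr.contDiff.contMDiff.comp_contMDiffOn ((contMDiffOn_of_mem_maximalAtlas A.mem).comp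
      i.isSmoothEmbedding.isImmersion.contMDiff.contMDiffOn fun _ h ↦ h)
  · rw [ContMDiffAt.iff_comp_isImmersionAt (i.isSmoothEmbedding.isImmersion.isImmersionAt _)]
    have ho := A.restrict.open_target.mem_nhds he
    refine ⟨(A.restrict.continuousOn_symm e he).continuousAt ho, ?_⟩
    have h1 : ContMDiffAt 𝓘(ℝ, E') 𝓘(ℝ, E) ∞ (A.ψ.symm ∘ A.incl) e :=
      ContMDiffAt.comp e (contMDiffAt_symm_of_mem_maximalAtlas A.mem he)
        A.incl.contDiff.contMDiff.contMDiffAt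
    refine h1.congr_of_eventuallyEq ?_
    filter_upwards [ho] with y hy using A.apply_invFun hy

theorem dchart_restrict [IsManifold 𝓘(ℝ, E') ∞ V] {v : V} (hv : i v ∈ A.ψ.source)
    (w : TangentSpace 𝓘(ℝ, E') v) : A.incl (dchart A.restrict v w) =
      dchart A.ψ (i v) (mfderiv 𝓘(ℝ, E') 𝓘(ℝ, E) i v w) := by
  have h := dchart_mfderiv (g := A.incl) (i.mdifferentiableAt v) A.restrict_mem hv A.mem hv
    A.incl.differentiableAt (by
      filter_upwards [A.restrict.open_source.mem_nhds hv] with y hy using (A.incl_restrict hy).symm) w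
  rw [ContinuousLinearMap.fderiv] at h
  exact h.symm

end AdaptedChart

end Restriction

/-! ### The embedding of Lie algebroids and its adapted charts -/

section Groupoid

variable {E E₀ G G₀ : Type*} [NormedAddCommGroup E] [NormedSpace ℝ E]
  [NormedAddCommGroup E₀] [NormedSpace ℝ E₀] [TopologicalSpace G] [ChartedSpace E G]
  [TopologicalSpace G₀] [ChartedSpace E₀ G₀] [IsManifold 𝓘(ℝ, E) ∞ G]
  [IsManifold 𝓘(ℝ, E₀) ∞ G₀]
  {E' E₀' H H₀ : Type*} [NormedAddCommGroup E'] [NormedSpace ℝ E']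
  [NormedAddCommGroup E₀'] [NormedSpace ℝ E₀'] [TopologicalSpace H] [ChartedSpace E' H]
  [TopologicalSpace H₀] [ChartedSpace E₀' H₀] [IsManifold 𝓘(ℝ, E') ∞ H]
  [IsManifold 𝓘(ℝ, E₀') ∞ H₀] [FiniteDimensional ℝ E] [FiniteDimensional ℝ E₀]
  {ℋ : LieGroupoid E' E₀' H H₀} {𝒢 : LieGroupoid E E₀ G G₀} (ι : LieSubgroupoid ℋ 𝒢)

namespace SubmersionChart

variable {ι} [FiniteDimensional ℝ E'] [FiniteDimensional ℝ E₀'] [Nonempty H] [Nonempty H₀]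
  (C : SubmersionChart ι.hom ι.base 𝒢.s)

/-- The section `σ` sends `ker B.P` into `ker A.P`, so nothing is lost when it is restricted to the
model spaces of `H₀` and `H`. -/
theorem incl_retr_σ (e : E₀') : C.A.incl (C.A.retr (C.σ (C.B.incl e))) = C.σ (C.B.incl e) := by
  rw [C.A.incl_retr, C.P_σ, C.B.P_incl, map_zero, sub_zero]

theorem incl_retr_p (e : E') : C.B.incl (C.B.retr (C.p (C.A.incl e))) = C.p (C.A.incl e) := by
  rw [C.B.incl_retr, ← C.p_P, C.A.P_incl, map_zero, sub_zero]

/-- The chart of the subgroupoid underlying a chart of the pair of groupoids. -/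
noncomputable def subVertChart : LieGroupoid.VertChart ℋ where
  ψ := C.A.restrict
  χ := C.B.restrict
  mem := C.A.restrict_mem
  mem' := C.B.restrict_mem
  p := C.B.retr.comp (C.p.comp C.A.incl)
  σ := C.A.retr.comp (C.σ.comp C.B.incl)
  p_σ e := by
    simp only [ContinuousLinearMap.comp_apply, C.incl_retr_σ, C.p_σ, C.B.retr_incl]
  s_mem h hh := by
    show ι.base (ℋ.s h) ∈ C.B.ψ.source
    rw [← ι.s_hom]
    exact C.mapsTo _ hh
  s_eq h hh := by
    simp only [ContinuousLinearMap.comp_apply, C.A.incl_restrict hh, C.B.restrict_apply, ← ι.s_hom,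
      C.eq _ hh]

end SubmersionChart

namespace LieSubgroupoid

theorem tangent_mem_fiber (a : ℋ.Alg) :
    (mfderiv 𝓘(ℝ, E') 𝓘(ℝ, E) ι.hom (ℋ.u a.base) a.vec.1 :
      TangentSpace 𝓘(ℝ, E) (𝒢.u (ι.base a.base))) ∈ 𝒢.fiber (ι.base a.base) :=
  LieGroupoid.mfderiv_mem_fiber (ι.hom.mdifferentiableAt _) (ι.base.mdifferentiableAt _) ι.s_hom
    (ι.u_base _) a.vec.2

/-- The map of Lie algebroids given by the differential of the inclusion of the subgroupoid. -/
noncomputable def algMap (a : ℋ.Alg) : 𝒢.Alg :=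
  ⟨ι.base a.base, ⟨_, ι.tangent_mem_fiber a⟩⟩

theorem toTangent_algMap (a : ℋ.Alg) :
    (ι.algMap a).toTangent = tangentMap 𝓘(ℝ, E') 𝓘(ℝ, E) ι.hom a.toTangent :=
  tangentBundle_mk_congr (ι.u_base a.base) _

section

variable {ι} [FiniteDimensional ℝ E'] [FiniteDimensional ℝ E₀'] [Nonempty H] [Nonempty H₀]
  (C : SubmersionChart ι.hom ι.base 𝒢.s)

theorem _root_.SubmersionChart.mem_alg_source_iff {a : ℋ.Alg} :
    a ∈ C.subVertChart.alg.source ↔ ι.algMap a ∈ C.vertChart.alg.source := by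
  rw [C.subVertChart.mem_alg_source, C.vertChart.mem_alg_source]
  show ι.hom (ℋ.u a.base) ∈ C.A.ψ.source ↔ 𝒢.u (ι.base a.base) ∈ C.A.ψ.source
  rw [ι.u_base]

/-- In these charts the map of Lie algebroids is the injective linear map `C.A.incl`; this is what
makes it an embedding. -/
theorem _root_.SubmersionChart.alg_algMap {a : ℋ.Alg} (ha : a ∈ C.subVertChart.alg.source) :
    C.vertChart.alg (ι.algMap a) = C.A.incl (C.subVertChart.alg a) := by
  rw [C.vertChart.alg_apply, C.subVertChart.alg_apply, map_add]
  have hb := C.subVertChart.base_mem ha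
  congr 1
  · show C.σ (C.B.ψ (ι.base a.base)) = C.A.incl (C.A.retr (C.σ (C.B.incl (C.B.restrict a.base))))
    rw [C.incl_retr_σ, C.B.incl_restrict hb]
  · exact (dchart_congr_point C.A.ψ (ι.u_base a.base) _).trans (C.A.dchart_restrict ha a.vec.1).symm

end

section

variable {ι} [FiniteDimensional ℝ E'] [FiniteDimensional ℝ E₀']
  (C : SubmersionChart ι.hom ι.base 𝒢.s)

/-- If `P` kills the coordinate of `b`, then `B.P` kills `χ(b.base)`, since `p P = B.P p`; thus the
base point lies in `H₀`. The coordinate is moreover in the model space of `H`, where it is the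
coordinate of an element of `𝔄H`. So the chart of `𝔄G` is adapted to `𝔄H`, with the same projection
as the chart of `G`. -/
theorem _root_.SubmersionChart.mem_range_algMap_iff {b : 𝒢.Alg}
    (hb : b ∈ C.vertChart.alg.source) :
    b ∈ range ι.algMap ↔ C.A.P (C.vertChart.alg b) = 0 := by
  constructor
  · rintro ⟨a, rfl⟩
    have : Nonempty H₀ := ⟨a.base⟩
    have : Nonempty H := ⟨ℋ.u a.base⟩
    rw [C.alg_algMap (C.mem_alg_source_iff.2 hb), C.A.P_incl]
  · intro h
    have h1 : C.p (C.vertChart.alg b) = C.B.ψ b.base := C.vertChart.p_coord hb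
    have h2 : C.B.P (C.B.ψ b.base) = 0 := by rw [← h1, ← C.p_P, h, map_zero]
    have h3 : b.base ∈ C.B.ψ.source := C.vertChart.base_mem hb
    obtain ⟨x, hx⟩ := (C.B.slice _ h3).2 h2
    have : Nonempty H₀ := ⟨x⟩
    have : Nonempty H := ⟨ℋ.u x⟩
    obtain ⟨e, he⟩ := C.A.exists_incl h
    have hu : 𝒢.u b.base = ι.hom (ℋ.u x) := by rw [← hx, ι.u_base]
    have hus : ι.hom (ℋ.u x) ∈ C.A.ψ.source := by rw [← hu]; exact hb
    have hp : C.subVertChart.p e = C.B.restrict x := by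
      apply C.B.incl_injective
      rw [C.B.incl_restrict (by rwa [hx])]
      refine (C.incl_retr_p e).trans ?_
      rw [he, h1, hx]
    have het : e ∈ C.subVertChart.alg.target := by
      rw [C.subVertChart.mem_alg_target, hp]
      refine ⟨C.B.restrict.map_source (by rw [C.B.mem_restrict_source, hx]; exact h3), ?_⟩
      have : C.B.restrict.symm (C.B.restrict x) = x :=
        C.B.restrict.left_inv (by rw [C.B.mem_restrict_source, hx]; exact h3)
      show ι.hom (ℋ.u (C.B.restrict.symm (C.B.restrict x))) ∈ C.A.ψ.source
      rwa [this]
    have hes := C.subVertChart.alg.map_target het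
    refine ⟨C.subVertChart.alg.symm e,
      C.vertChart.alg.injOn (C.mem_alg_source_iff.1 hes) hb ?_⟩
    rw [C.alg_algMap hes, C.subVertChart.alg.right_inv het, he]

end

variable [FiniteDimensional ℝ E'] [FiniteDimensional ℝ E₀']

theorem algMap_injective : Function.Injective ι.algMap := by
  intro a b hab
  have h1 : a.base = b.base := ι.base.injective (congrArg LieGroupoid.Alg.base hab)
  have : Nonempty H₀ := ⟨a.base⟩
  have : Nonempty H := ⟨ℋ.u a.base⟩
  obtain ⟨C, hC⟩ := ι.exists_chart (ℋ.u a.base)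
  have ha : a ∈ C.subVertChart.alg.source := hC
  have hb : b ∈ C.subVertChart.alg.source := C.mem_alg_source_iff.2 (hab ▸ C.mem_alg_source_iff.1 ha)
  apply C.subVertChart.alg.injOn ha hb
  apply C.A.incl_injective
  rw [← C.alg_algMap ha, ← C.alg_algMap hb, hab]

/-- The embedding of Lie algebroids given by the differential of the inclusion of the
subgroupoid. -/
noncomputable def algEmbedding : SmoothEmbedding E' ℋ.Alg E 𝒢.Alg where
  toFun := ι.algMap
  isSmoothEmbedding := by
    refine isSmoothEmbedding_of_linear_charts ι.algMap_injective fun a ↦ ?_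
    have : Nonempty H₀ := ⟨a.base⟩
    have : Nonempty H := ⟨ℋ.u a.base⟩
    obtain ⟨C, hC⟩ := ι.exists_chart (ℋ.u a.base)
    exact ⟨C.subVertChart.alg, C.vertChart.alg, C.A.incl, hC, C.subVertChart.alg_mem,
      C.vertChart.alg_mem, C.A.incl_injective, ext fun b ↦ C.mem_alg_source_iff,
      fun b hb ↦ C.alg_algMap hb⟩

theorem isAlgMap_algEmbedding : ι.IsAlgMap ι.algEmbedding :=
  fun a ↦ ⟨rfl, ι.toTangent_algMap a⟩

variable {ι} in
/-- The chart of the Lie algebroid deduced from a chart of the pair of groupoids is adapted to the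
Lie algebroid of the subgroupoid. -/
noncomputable def _root_.SubmersionChart.algChart
    (C : SubmersionChart ι.hom ι.base 𝒢.s) : AdaptedChart ι.algEmbedding where
  ψ := C.vertChart.alg
  mem := C.vertChart.alg_mem
  P := C.A.P
  idem := C.A.idem
  finrank_ker := C.A.finrank_ker
  slice _ hb := C.mem_range_algMap_iff hb

end LieSubgroupoid

end Groupoid

/-! ### The differential of the projection from the deformation space -/

section Deformation

variable {E' V E M : Type*} [NormedAddCommGroup E'] [NormedSpace ℝ E'] [TopologicalSpace V]
  [ChartedSpace E' V] [NormedAddCommGroup E] [NormedSpace ℝ E] [TopologicalSpace M]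
  [ChartedSpace E M] [FiniteDimensional ℝ E] [IsManifold 𝓘(ℝ, E) ∞ M]
  {i : SmoothEmbedding E' V E M}

/-- The projection reads `(e, t) ↦ A.scale t e`, which is linear in `e` for fixed `t`. Elements of
the Lie algebroid of the deformation are vectors of this kind, as the source preserves the
parameter. -/
theorem AdaptedChart.dchart_pt (A : AdaptedChart i) {p : DNC i} (hp : p ∈ A.dnc.source)
    (w : TangentSpace 𝓘(ℝ, E × ℝ) p) (hw : (dchart A.dnc p w).2 = 0) :
    dchart A.ψ p.pt (mfderiv 𝓘(ℝ, E × ℝ) 𝓘(ℝ, E) DNC.pt p w) =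
      A.scale p.param (dchart A.dnc p w).1 := by
  have h := dchart_mfderiv (DNC.contMDiff_pt.mdifferentiableAt (by simp)) A.dnc_mem hp A.mem
    (A.mem_dnc_source.1 hp) (A.contDiff_scale.differentiable (by simp) (A.dnc p))
    (by filter_upwards [A.dnc.open_source.mem_nhds hp] with q hq using
      (A.scale_dnc (A.mem_dnc_source.1 hq)).symm) w
  rw [h]
  have e : dchart A.dnc p w = ((dchart A.dnc p w).1, 0) := by rw [← hw]
  have h1 : HasFDerivAt (fun q : E × ℝ ↦ A.scale q.2 q.1)
      (fderiv ℝ (fun q : E × ℝ ↦ A.scale q.2 q.1) (A.dnc p)) (A.dnc p) :=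
    (A.contDiff_scale.differentiable (by simp) _).hasFDerivAt
  set x := (dchart A.dnc p w).1
  have h2 : HasDerivAt (fun t : ℝ ↦ ((A.dnc p).1 + t • x, (A.dnc p).2)) (x, (0 : ℝ)) 0 := by
    refine HasDerivAt.prodMk ?_ (hasDerivAt_const _ _)
    simpa using ((hasDerivAt_id (0 : ℝ)).smul_const x).const_add (A.dnc p).1
  have h3 := h1.comp_hasDerivAt_of_eq 0 h2 (by simp)
  have h4 : HasDerivAt (fun t : ℝ ↦ A.scale (A.dnc p).2 ((A.dnc p).1 + t • x))
      (A.scale (A.dnc p).2 x) 0 := by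
    have : ∀ t : ℝ, A.scale (A.dnc p).2 ((A.dnc p).1 + t • x) =
        A.scale (A.dnc p).2 (A.dnc p).1 + t • A.scale (A.dnc p).2 x := fun t ↦ by
      simp only [AdaptedChart.scale, map_add, map_smul, smul_add, smul_sub, smul_comm t]
      abel
    simp only [this]
    simpa using ((hasDerivAt_id (0 : ℝ)).smul_const
      (A.scale (A.dnc p).2 x)).const_add (A.scale (A.dnc p).2 (A.dnc p).1)
  rw [e, ← A.dnc_snd]
  exact h3.unique h4

theorem DNC.dchart_pt_of_ne {ψ : OpenPartialHomeomorph M E}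
    (hψ : ψ ∈ IsManifold.maximalAtlas 𝓘(ℝ, E) ∞ M) {p : DNC i}
    (hp : p ∈ (DNC.genHomeo i hψ).source) (w : TangentSpace 𝓘(ℝ, E × ℝ) p) :
    dchart ψ p.pt (mfderiv 𝓘(ℝ, E × ℝ) 𝓘(ℝ, E) DNC.pt p w) =
      (dchart (DNC.genHomeo i hψ) p w).1 := by
  have h := dchart_mfderiv (DNC.contMDiff_pt.mdifferentiableAt (by simp)) (DNC.genHomeo_mem hψ) hp hψ
    ((DNC.mem_genHomeo_source hψ).1 hp).1 (g := Prod.fst) differentiableAt_fst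
    (by
      filter_upwards [(DNC.genHomeo i hψ).open_source.mem_nhds hp] with q hq
      rw [DNC.eq_gen ((DNC.mem_genHomeo_source hψ).1 hq).2]
      rfl) w
  rw [h, fderiv_fst]
  rfl

end Deformation

/-! ### The isomorphism of the Lie algebroid of the deformation with the deformation of the Lie
algebroids -/

section Groupoid

variable {E E₀ G G₀ : Type*} [NormedAddCommGroup E] [NormedSpace ℝ E]
  [NormedAddCommGroup E₀] [NormedSpace ℝ E₀] [TopologicalSpace G] [ChartedSpace E G]
  [TopologicalSpace G₀] [ChartedSpace E₀ G₀] [IsManifold 𝓘(ℝ, E) ∞ G]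
  [IsManifold 𝓘(ℝ, E₀) ∞ G₀]
  {E' E₀' H H₀ : Type*} [NormedAddCommGroup E'] [NormedSpace ℝ E']
  [NormedAddCommGroup E₀'] [NormedSpace ℝ E₀'] [TopologicalSpace H] [ChartedSpace E' H]
  [TopologicalSpace H₀] [ChartedSpace E₀' H₀] [IsManifold 𝓘(ℝ, E') ∞ H]
  [IsManifold 𝓘(ℝ, E₀') ∞ H₀] [FiniteDimensional ℝ E] [FiniteDimensional ℝ E₀]
  {ℋ : LieGroupoid E' E₀' H H₀} {𝒢 : LieGroupoid E E₀ G G₀} (ι : LieSubgroupoid ℋ 𝒢)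

theorem LieSubgroupoid.dnc_s_pt (a : DNC ι.hom) : 𝒢.s a.pt = (ι.dnc.s a).pt := (ι.pt_dncS a).symm

theorem LieSubgroupoid.dnc_u_pt (a : DNC ι.base) : 𝒢.u a.pt = (ι.dnc.u a).pt := (ι.pt_dncU a).symm

theorem LieSubgroupoid.dnc_u_param (a : DNC ι.base) : (ι.dnc.u a).param = a.param :=
  DNC.param_map _

theorem LieSubgroupoid.dnc_s_param (a : DNC ι.hom) : (ι.dnc.s a).param = a.param :=
  DNC.param_map _

/-- The map from the Lie algebroid of the deformation groupoid to the Lie algebroid of the groupoid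
given by the differential of the projection. -/
noncomputable def LieSubgroupoid.ptAlg (a : ι.dnc.Alg) : 𝒢.Alg :=
  ⟨a.base.pt, ⟨_, LieGroupoid.mfderiv_mem_fiber (𝒢 := 𝒢) (𝒦 := ι.dnc) (f := DNC.pt) (f₀ := DNC.pt)
    (DNC.contMDiff_pt.mdifferentiableAt (by simp)) (DNC.contMDiff_pt.mdifferentiableAt (by simp))
    ι.dnc_s_pt (ι.dnc_u_pt _) a.vec.2⟩⟩

namespace SubmersionChart

variable {ι} (C : SubmersionChart ι.hom ι.base 𝒢.s)

/-- The chart of the deformation groupoid given by a chart of a pair of groupoids. -/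
noncomputable def dncVertChart : LieGroupoid.VertChart ι.dnc where
  ψ := C.A.dnc
  χ := C.B.dnc
  mem := C.A.dnc_mem
  mem' := C.B.dnc_mem
  p := C.p.prodMap (ContinuousLinearMap.id ℝ ℝ)
  σ := C.σ.prodMap (ContinuousLinearMap.id ℝ ℝ)
  p_σ e := Prod.ext (C.p_σ e.1) rfl
  s_mem a ha := by
    rw [C.B.mem_dnc_source, ← ι.dnc_s_pt]
    exact C.mapsTo _ (C.A.mem_dnc_source.1 ha)
  s_eq a ha := C.dnc_map 𝒢.mdifferentiable_structure.1 ℋ.mdifferentiable_structure.1 ι.s_hom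
    (C.A.mem_dnc_source.1 ha)

theorem mem_dncVertChart_source {a : ι.dnc.Alg} :
    a ∈ C.dncVertChart.alg.source ↔ ι.ptAlg a ∈ C.vertChart.alg.source := by
  rw [C.dncVertChart.mem_alg_source, C.vertChart.mem_alg_source]
  show ι.dnc.u a.base ∈ C.A.dnc.source ↔ 𝒢.u a.base.pt ∈ C.A.ψ.source
  rw [C.A.mem_dnc_source, ι.dnc_u_pt]

theorem dchart_dnc_snd {a : ι.dnc.Alg} (ha : a ∈ C.dncVertChart.alg.source) :
    (dchart C.A.dnc (ι.dnc.u a.base) a.vec.1).2 = 0 :=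
  congrArg Prod.snd ((C.dncVertChart.mem_fiber_iff ha a.vec.1).1 a.vec.2)

theorem dncVertChart_alg_snd {a : ι.dnc.Alg} (ha : a ∈ C.dncVertChart.alg.source) :
    (C.dncVertChart.alg a).2 = a.base.param := by
  rw [C.dncVertChart.alg_apply]
  show (C.B.dnc a.base).2 + (dchart C.A.dnc (ι.dnc.u a.base) a.vec.1).2 = _
  rw [C.dchart_dnc_snd ha, C.B.dnc_snd, add_zero]

/-- The relation on which the isomorphism rests. If `(e, t)` is the coordinate of an element of the
Lie algebroid of the deformation, then `A.scale t e` is the coordinate of its image in `𝔄G`. Points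
of `DNC(𝔄G, 𝔄H)` satisfy the same relation in the chart with the same `P`. -/
theorem scale_dncVertChart_alg {a : ι.dnc.Alg} (ha : a ∈ C.dncVertChart.alg.source) :
    C.A.scale (C.dncVertChart.alg a).2 (C.dncVertChart.alg a).1 =
      C.vertChart.alg (ι.ptAlg a) := by
  have hb : a.base.pt ∈ C.B.ψ.source := C.B.mem_dnc_source.1 (C.dncVertChart.base_mem ha)
  have h1 : dchart C.A.ψ (𝒢.u a.base.pt) (ι.ptAlg a).vec.1 =
      C.A.scale a.base.param (dchart C.A.dnc (ι.dnc.u a.base) a.vec.1).1 := by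
    have h2 := C.A.dchart_pt ha a.vec.1 (C.dchart_dnc_snd ha)
    rw [ι.dnc_u_param] at h2
    exact (dchart_congr_point C.A.ψ (ι.dnc_u_pt a.base) _).trans h2
  rw [C.dncVertChart_alg_snd ha, C.dncVertChart.alg_apply, C.vertChart.alg_apply]
  have h3 : C.σ (C.B.ψ a.base.pt) = C.A.scale a.base.param (C.σ (C.B.dnc a.base).1) := by
    rw [C.scale_σ, ← C.B.dnc_snd, C.B.scale_dnc hb]
  have h4 : ∀ x y, C.A.scale a.base.param (x + y) =
      C.A.scale a.base.param x + C.A.scale a.base.param y := fun x y ↦ by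
    simp only [AdaptedChart.scale, map_add, smul_add]; abel
  refine (h4 _ _).trans ?_
  exact congrArg₂ (· + ·) h3.symm h1.symm

variable [FiniteDimensional ℝ E'] [FiniteDimensional ℝ E₀']

/-- Both targets consist of the `(e, t)` for which `A.scale t e` is in the target of the chart of
`𝔄G`; the map `p` commutes with the scalings. -/
theorem dncVertChart_alg_target : C.dncVertChart.alg.target = C.algChart.dnc.target := by
  ext e
  rw [C.dncVertChart.mem_alg_target, C.algChart.mem_dnc_target]
  have h1 : e ∈ C.algChart.dnc.target ↔ _ := C.vertChart.mem_alg_target (e := C.A.scale e.2 e.1)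
  show ((C.p e.1, e.2) ∈ C.B.dnc.target ∧ ι.dnc.u (C.B.dnc.symm (C.p e.1, e.2)) ∈ C.A.dnc.source) ↔
    (C.p (C.A.scale e.2 e.1) ∈ C.B.ψ.target ∧
      𝒢.u (C.B.ψ.symm (C.p (C.A.scale e.2 e.1))) ∈ C.A.ψ.source)
  rw [C.p_scale, C.B.mem_dnc_target, C.A.mem_dnc_source, ← ι.dnc_u_pt]
  refine and_congr_right fun h ↦ ?_
  rw [C.B.pt_dnc_symm (q := (C.p e.1, e.2)) h]

/-- The local expression of the isomorphism of the Lie algebroid of the deformation groupoid with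
the deformation of the Lie algebroids. -/
noncomputable def dncIso (a : ι.dnc.Alg) : DNC ι.algEmbedding :=
  C.algChart.dnc.symm (C.dncVertChart.alg a)

omit C in
theorem _root_.LieSubgroupoid.pt_map_base (b : DNC ι.algEmbedding) :
    (DNC.map ι.algEmbedding ι.base LieGroupoid.Alg.base LieGroupoid.Alg.base b).pt = b.pt.base :=
  DNC.pt_map (f := LieGroupoid.Alg.base) (g := LieGroupoid.Alg.base) (fun _ ↦ rfl) b

variable {a : ι.dnc.Alg} (ha : a ∈ C.dncVertChart.alg.source)
include ha

theorem dnc_dncIso : C.dncIso a ∈ C.algChart.dnc.source ∧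
    C.algChart.dnc (C.dncIso a) = C.dncVertChart.alg a := by
  have h : C.dncVertChart.alg a ∈ C.algChart.dnc.target := by
    rw [← C.dncVertChart_alg_target]
    exact C.dncVertChart.alg.map_source ha
  exact ⟨C.algChart.dnc.map_target h, C.algChart.dnc.right_inv h⟩

theorem param_dncIso : (C.dncIso a).param = a.base.param := by
  rw [← C.algChart.dnc_snd, (C.dnc_dncIso ha).2, C.dncVertChart_alg_snd ha]

theorem pt_dncIso : (C.dncIso a).pt = ι.ptAlg a := by
  obtain ⟨h1, h2⟩ := C.dnc_dncIso ha
  have h3 := C.algChart.mem_dnc_source.1 h1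
  have h4 := C.algChart.scale_dnc h3
  rw [h2] at h4
  exact C.vertChart.alg.injOn h3 (C.mem_dncVertChart_source.1 ha)
    (h4.symm.trans (C.scale_dncVertChart_alg ha))

theorem dncIso_of_ne (h : a.base.param ≠ 0) : C.dncIso a = .gen (ι.ptAlg a) a.base.param h := by
  refine DNC.eq_gen (p := C.dncIso a) (by rwa [C.param_dncIso ha]) |>.trans ?_
  simp only [C.pt_dncIso ha, C.param_dncIso ha]

theorem continuousAt_dncIso : ContinuousAt C.dncIso a := by
  refine ContinuousAt.comp (g := C.algChart.dnc.symm) ?_ (C.dncVertChart.alg.continuousAt ha)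
  refine C.algChart.dnc.continuousAt_symm ?_
  rw [← C.dncVertChart_alg_target]
  exact C.dncVertChart.alg.map_source ha

/-- The parameter is a coordinate of a chart with open target, so it can be moved away from zero. -/
theorem frequently_param_ne : ∃ᶠ b : ι.dnc.Alg in 𝓝 a, b.base.param ≠ 0 := by
  by_cases h0 : a.base.param = 0
  · have h1 : C.dncVertChart.alg a = ((C.dncVertChart.alg a).1, 0) := by
      rw [← h0, ← C.dncVertChart_alg_snd ha]
    have ht := C.dncVertChart.alg.map_source ha
    have h2 : Filter.Tendsto (fun t : ℝ ↦ ((C.dncVertChart.alg a).1, t)) (𝓝[≠] 0)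
        (𝓝 (C.dncVertChart.alg a)) := by
      conv_rhs => rw [h1]
      exact (by fun_prop : Continuous fun t : ℝ ↦ ((C.dncVertChart.alg a).1, t)).continuousWithinAt
    have h3 := (C.dncVertChart.alg.continuousAt_symm ht).tendsto.comp h2
    rw [C.dncVertChart.alg.left_inv ha] at h3
    refine h3.frequently (Filter.Eventually.frequently ?_)
    filter_upwards [h2.eventually (C.dncVertChart.alg.open_target.mem_nhds ht),
      self_mem_nhdsWithin] with t h4 h5
    have h6 := C.dncVertChart_alg_snd (C.dncVertChart.alg.map_target h4)
    rw [C.dncVertChart.alg.right_inv h4] at h6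
    intro h7
    exact h5 (h6.trans h7)
  · exact fun h ↦ h.self_of_nhds h0

/-- For `t ≠ 0` the local expression is given by `ptAlg`, which involves no chart. By density it
does not depend on the chart for `t = 0` either. -/
theorem dncIso_eq (C' : SubmersionChart ι.hom ι.base 𝒢.s) (ha' : a ∈ C'.dncVertChart.alg.source) :
    C.dncIso a = C'.dncIso a := by
  have hne : (𝓝[{b : ι.dnc.Alg | b.base.param ≠ 0}] a).NeBot :=
    mem_closure_iff_nhdsWithin_neBot.1 (mem_closure_iff_frequently.2 (C.frequently_param_ne ha))
  have h1 := (C.continuousAt_dncIso ha).tendsto.mono_left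
    (nhdsWithin_le_nhds (s := {b : ι.dnc.Alg | b.base.param ≠ 0}))
  have h2 := (C'.continuousAt_dncIso ha').tendsto.mono_left
    (nhdsWithin_le_nhds (s := {b : ι.dnc.Alg | b.base.param ≠ 0}))
  refine DNC.eq_of_tendsto h1 (h2.congr' ?_) ((C.pt_dncIso ha).trans (C'.pt_dncIso ha').symm)
  filter_upwards [nhdsWithin_le_nhds (C.dncVertChart.alg.open_source.mem_nhds ha),
    nhdsWithin_le_nhds (C'.dncVertChart.alg.open_source.mem_nhds ha'),
    self_mem_nhdsWithin] with b hb hb' h0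
  rw [C.dncIso_of_ne hb h0, C'.dncIso_of_ne hb' h0]

omit ha in
/-- The projections of the Lie algebroids in charts. -/
noncomputable def algSubmersionChart :
    SubmersionChart ι.algEmbedding ι.base (LieGroupoid.Alg.base (𝒢 := 𝒢)) where
  A := C.algChart
  B := C.B
  p := C.p
  σ := C.σ
  p_σ := C.p_σ
  p_P := C.p_P
  P_σ := C.P_σ
  mapsTo _ hb := C.vertChart.base_mem hb
  eq _ hb := (C.vertChart.p_coord hb).symm

/-- In the two charts, the projections of both Lie algebroids are the same linear map `C.p × id`. -/
theorem map_base_dncIso :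
    DNC.map ι.algEmbedding ι.base LieGroupoid.Alg.base LieGroupoid.Alg.base (C.dncIso a) =
      a.base := by
  obtain ⟨h1, h2⟩ := C.dnc_dncIso ha
  have h3 := C.algSubmersionChart.dnc_map (LieGroupoid.contMDiff_base.mdifferentiable (by simp))
    (LieGroupoid.contMDiff_base.mdifferentiable (by simp)) (fun _ ↦ rfl)
    (C.algChart.mem_dnc_source.1 h1)
  have h4 : C.B.dnc a.base = (C.p (C.dncVertChart.alg a).1, (C.dncVertChart.alg a).2) :=
    (C.dncVertChart.p_coord ha).symm
  refine C.B.dnc.injOn ?_ (C.dncVertChart.base_mem ha) (h3.trans ?_)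
  · rw [C.B.mem_dnc_source, LieSubgroupoid.pt_map_base]
    exact C.vertChart.base_mem (C.algChart.mem_dnc_source.1 h1)
  · rw [h4, ← h2]
    rfl

end SubmersionChart

namespace LieGroupoid.VertChart

variable {ι} (C : VertChart 𝒢)

/-- The chart of the part `t ≠ 0` of the deformation groupoid given by a chart of the groupoid. -/
noncomputable def gen (ι : LieSubgroupoid ℋ 𝒢) : VertChart ι.dnc where
  ψ := DNC.genHomeo ι.hom C.mem
  χ := DNC.genHomeo ι.base C.mem'
  mem := DNC.genHomeo_mem C.mem
  mem' := DNC.genHomeo_mem C.mem'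
  p := C.p.prodMap (ContinuousLinearMap.id ℝ ℝ)
  σ := C.σ.prodMap (ContinuousLinearMap.id ℝ ℝ)
  p_σ e := Prod.ext (C.p_σ e.1) rfl
  s_mem a ha := by
    rw [DNC.mem_genHomeo_source] at ha ⊢
    rw [← ι.dnc_s_pt, ι.dnc_s_param]
    exact ⟨C.s_mem _ ha.1, ha.2⟩
  s_eq a ha := by
    rw [DNC.mem_genHomeo_source] at ha
    rw [DNC.eq_gen ha.2]
    exact Prod.ext (C.s_eq _ ha.1) rfl

theorem mem_gen_source {a : ι.dnc.Alg} :
    a ∈ (C.gen ι).alg.source ↔ ι.ptAlg a ∈ C.alg.source ∧ a.base.param ≠ 0 := by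
  rw [(C.gen ι).mem_alg_source, C.mem_alg_source]
  show ι.dnc.u a.base ∈ (DNC.genHomeo ι.hom C.mem).source ↔ 𝒢.u a.base.pt ∈ C.ψ.source ∧ _
  rw [DNC.mem_genHomeo_source, ι.dnc_u_pt, ι.dnc_u_param]

/-- In product charts over `t ≠ 0` the isomorphism is again the identity, so these charts complete
those around `t = 0`. -/
theorem gen_alg_apply {a : ι.dnc.Alg} (ha : a ∈ (C.gen ι).alg.source) :
    (C.gen ι).alg a = (C.alg (ι.ptAlg a), a.base.param) := by
  have h0 := (C.mem_gen_source.1 ha).2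
  have h1 : (dchart (DNC.genHomeo ι.hom C.mem) (ι.dnc.u a.base) a.vec.1).2 = 0 :=
    congrArg Prod.snd (((C.gen ι).mem_fiber_iff ha a.vec.1).1 a.vec.2)
  have h2 : dchart C.ψ (𝒢.u a.base.pt) (ι.ptAlg a).vec.1 =
      (dchart (DNC.genHomeo ι.hom C.mem) (ι.dnc.u a.base) a.vec.1).1 :=
    (dchart_congr_point C.ψ (ι.dnc_u_pt a.base) _).trans (DNC.dchart_pt_of_ne C.mem ha a.vec.1)
  have h3 : DNC.genHomeo ι.base C.mem' a.base = (C.χ a.base.pt, a.base.param) := by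
    conv_lhs => rw [DNC.eq_gen h0]
    rfl
  have h4 : (C.gen ι).alg a = _ := (C.gen ι).alg_apply a
  refine h4.trans (Prod.ext ?_ ?_)
  · show C.σ (DNC.genHomeo ι.base C.mem' a.base).1 + _ = C.alg (ι.ptAlg a)
    rw [h3, C.alg_apply]
    exact congrArg₂ (· + ·) rfl h2.symm
  · show (DNC.genHomeo ι.base C.mem' a.base).2 + _ = a.base.param
    rw [h3]
    exact (congrArg (a.base.param + ·) h1).trans (add_zero _)

end LieGroupoid.VertChart

namespace LieSubgroupoid

variable [FiniteDimensional ℝ E'] [FiniteDimensional ℝ E₀']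

open Classical in
/-- The isomorphism of the Lie algebroid of the deformation groupoid with the deformation of the
Lie algebroids, as a map. -/
noncomputable def dncIso (a : ι.dnc.Alg) : DNC ι.algEmbedding :=
  if h : a.base.param = 0 then
    (ι.exists_chart (ℋ.u (DNC.exists_nor h).choose.base)).choose.dncIso a
  else .gen (ι.ptAlg a) a.base.param h

variable {ι}

theorem mem_source_of_base {C : SubmersionChart ι.hom ι.base 𝒢.s} {n : NormalBundle ι.base}
    (hC : ι.hom (ℋ.u n.base) ∈ C.A.ψ.source) {a : ι.dnc.Alg} (ha : a.base = .nor n) :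
    a ∈ C.dncVertChart.alg.source := by
  rw [C.dncVertChart.mem_alg_source]
  show ι.dnc.u a.base ∈ C.A.dnc.source
  rw [C.A.mem_dnc_source, ← ι.dnc_u_pt, ha, DNC.pt_nor, ι.u_base]
  exact hC

theorem dncIso_of_ne {a : ι.dnc.Alg} (h : a.base.param ≠ 0) :
    ι.dncIso a = .gen (ι.ptAlg a) a.base.param h := dif_neg h

theorem _root_.SubmersionChart.dncIso_of_mem (C : SubmersionChart ι.hom ι.base 𝒢.s) {a : ι.dnc.Alg}
    (ha : a ∈ C.dncVertChart.alg.source) : ι.dncIso a = C.dncIso a := by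
  by_cases h : a.base.param = 0
  · have h1 : ι.dncIso a = _ := dif_pos h
    rw [h1]
    refine SubmersionChart.dncIso_eq _ (mem_source_of_base ?_ (DNC.exists_nor h).choose_spec) C ha
    exact (ι.exists_chart _).choose_spec
  · rw [dncIso_of_ne h, C.dncIso_of_ne ha h]

theorem exists_chart_of_param_eq_zero {a : ι.dnc.Alg} (h : a.base.param = 0) :
    ∃ C : SubmersionChart ι.hom ι.base 𝒢.s, a ∈ C.dncVertChart.alg.source := by
  obtain ⟨n, hn⟩ := DNC.exists_nor h
  obtain ⟨C, hC⟩ := ι.exists_chart (ℋ.u n.base)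
  exact ⟨C, mem_source_of_base hC hn⟩

theorem param_dncIso (a : ι.dnc.Alg) : (ι.dncIso a).param = a.base.param := by
  by_cases h : a.base.param = 0
  · obtain ⟨C, hC⟩ := exists_chart_of_param_eq_zero h
    rw [C.dncIso_of_mem hC, C.param_dncIso hC]
  · rw [dncIso_of_ne h]; rfl

theorem pt_dncIso (a : ι.dnc.Alg) : (ι.dncIso a).pt = ι.ptAlg a := by
  by_cases h : a.base.param = 0
  · obtain ⟨C, hC⟩ := exists_chart_of_param_eq_zero h
    rw [C.dncIso_of_mem hC, C.pt_dncIso hC]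
  · rw [dncIso_of_ne h]; rfl

theorem map_base_dncIso (a : ι.dnc.Alg) :
    DNC.map ι.algEmbedding ι.base LieGroupoid.Alg.base LieGroupoid.Alg.base (ι.dncIso a) =
      a.base := by
  by_cases h : a.base.param = 0
  · obtain ⟨C, hC⟩ := exists_chart_of_param_eq_zero h
    rw [C.dncIso_of_mem hC, C.map_base_dncIso hC]
  · rw [dncIso_of_ne h]
    exact (DNC.eq_gen h).symm

variable (ι) in
-- The map is the identity between charts with equal targets: charts of the pair `(G, H)` around `t
-- = 0`, product charts elsewhere. Their domains contain entire fibres over points of `DNC(G₀, H₀)`,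
-- so bijectivity can also be checked in them.
theorem exists_dncDiffeomorph : ∃ Φ : Diffeomorph 𝓘(ℝ, E × ℝ) 𝓘(ℝ, E × ℝ) ι.dnc.Alg
    (DNC ι.algEmbedding) ∞, ∀ a, Φ a = ι.dncIso a := by
  refine exists_diffeomorph_of_charts map_base_dncIso fun z ↦ ?_
  by_cases h : z.param = 0
  · obtain ⟨n, rfl⟩ := DNC.exists_nor h
    obtain ⟨C, hC⟩ := ι.exists_chart (ℋ.u n.base)
    refine ⟨C.dncVertChart.alg, C.algChart.dnc, C.dncVertChart.alg_mem, C.algChart.dnc_mem,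
      fun a ha ↦ mem_source_of_base hC ha, fun b hb ↦ ?_, C.dncVertChart_alg_target, fun a ha ↦ ?_⟩
    · rw [C.algChart.mem_dnc_source]
      show 𝒢.u b.pt.base ∈ C.A.ψ.source
      have h1 := congrArg DNC.pt hb
      rw [pt_map_base, DNC.pt_nor] at h1
      rw [h1, ι.u_base]
      exact hC
    · rw [C.dncIso_of_mem ha]
      exact C.dnc_dncIso ha
  · obtain ⟨C, hC⟩ := 𝒢.exists_vertChart (𝒢.u z.pt)
    have hsrc : ∀ a ∈ (C.gen ι).alg.source, ι.dncIso a ∈ (DNC.genHomeo ι.algEmbedding C.alg_mem).source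
        ∧ DNC.genHomeo ι.algEmbedding C.alg_mem (ι.dncIso a) = (C.gen ι).alg a := fun a ha ↦ by
      have h1 := C.mem_gen_source.1 ha
      rw [DNC.mem_genHomeo_source, pt_dncIso, param_dncIso, C.gen_alg_apply ha, dncIso_of_ne h1.2]
      exact ⟨h1, rfl⟩
    refine ⟨(C.gen ι).alg, DNC.genHomeo ι.algEmbedding C.alg_mem, (C.gen ι).alg_mem,
      DNC.genHomeo_mem C.alg_mem, fun a ha ↦ ?_, fun b hb ↦ ?_, ?_, hsrc⟩
    · rw [C.mem_gen_source, ha]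
      refine ⟨?_, h⟩
      rw [C.mem_alg_source]
      show 𝒢.u a.base.pt ∈ _
      rw [ha]
      exact hC
    · rw [DNC.mem_genHomeo_source, C.mem_alg_source, ← pt_map_base, hb]
      refine ⟨hC, ?_⟩
      rw [← hb, DNC.param_map] at h
      exact h
    · ext ⟨e, t⟩
      rw [(C.gen ι).mem_alg_target]
      show (C.p e ∈ C.χ.target ∧ t ≠ 0) ∧ ι.dnc.u ((DNC.genHomeo ι.base C.mem').symm (C.p e, t)) ∈
        (DNC.genHomeo ι.hom C.mem).source ↔ e ∈ C.alg.target ∧ t ≠ 0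
      rw [DNC.mem_genHomeo_source, ← ι.dnc_u_pt, ι.dnc_u_param, C.mem_alg_target]
      constructor
      · rintro ⟨⟨h1, h2⟩, h3, -⟩
        rw [DNC.genHomeo_symm_apply C.mem' h2] at h3
        exact ⟨⟨h1, h3⟩, h2⟩
      · rintro ⟨⟨h1, h3⟩, h2⟩
        rw [DNC.genHomeo_symm_apply C.mem' h2]
        exact ⟨⟨h1, h2⟩, h3, h2⟩

end LieSubgroupoid

end Groupoid

/-! ### Smoothness of the operations of a Lie algebroid, and transport of structure -/

namespace LieAlgebroid

variable {F F₀ A M : Type*} [NormedAddCommGroup F] [NormedSpace ℝ F]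
  [NormedAddCommGroup F₀] [NormedSpace ℝ F₀] [TopologicalSpace A] [ChartedSpace F A]
  [TopologicalSpace M] [ChartedSpace F₀ M] [IsManifold 𝓘(ℝ, F₀) ∞ M]
  (𝓛 : LieAlgebroid F F₀ A M)

/-- In a local trivialization the operation is that of `ℝⁿ`. The same argument serves for the zero
section and for the addition. -/
theorem contMDiff_smul (c : ℝ) : ContMDiff 𝓘(ℝ, F) 𝓘(ℝ, F) ∞ (𝓛.smul c) := by
  intro a
  obtain ⟨U, n, Θ, Ξ, hU, hy, hΘ, hΞ, h1, -, -, -, h2⟩ := 𝓛.locallyTrivial (𝓛.proj a)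
  have hO : IsOpen (𝓛.proj ⁻¹' U) := hU.preimage 𝓛.contMDiff_proj.continuous
  have h3 : ContMDiffOn 𝓘(ℝ, F) 𝓘(ℝ, F) ∞ (fun b ↦ Ξ (𝓛.proj b, c • Θ b)) (𝓛.proj ⁻¹' U) := by
    refine hΞ.comp (𝓛.contMDiff_proj.contMDiffOn.prodMk ?_) fun b hb ↦ ⟨hb, mem_univ _⟩
    exact (contDiff_const_smul c).contMDiff.comp_contMDiffOn hΘ
  refine (h3.contMDiffAt (hO.mem_nhds hy)).congr_of_eventuallyEq ?_
  filter_upwards [hO.mem_nhds hy] with b hb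
  rw [← h2 c b hb, ← 𝓛.proj_smul c b, h1]
  rw [𝓛.proj_smul]
  exact hb

theorem contMDiff_zero : ContMDiff 𝓘(ℝ, F₀) 𝓘(ℝ, F) ∞ 𝓛.zero := by
  intro y
  obtain ⟨U, n, Θ, Ξ, hU, hy, hΘ, hΞ, h1, -, h2, -, -⟩ := 𝓛.locallyTrivial y
  have h3 : ContMDiffOn 𝓘(ℝ, F₀) 𝓘(ℝ, F) ∞ (fun z ↦ Ξ (z, 0)) U :=
    hΞ.comp (contMDiffOn_id.prodMk contMDiffOn_const) fun b hb ↦ ⟨hb, mem_univ _⟩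
  refine (h3.contMDiffAt (hU.mem_nhds hy)).congr_of_eventuallyEq ?_
  filter_upwards [hU.mem_nhds hy] with z hz
  have h4 := h1 (𝓛.zero z) (by rwa [𝓛.proj_zero])
  rw [h2 z hz, 𝓛.proj_zero] at h4
  exact h4.symm

theorem contMDiffOn_add : ContMDiffOn (𝓘(ℝ, F).prod 𝓘(ℝ, F)) 𝓘(ℝ, F) ∞
    (fun p : A × A ↦ 𝓛.add p.1 p.2) {p | 𝓛.proj p.1 = 𝓛.proj p.2} := by
  rintro ⟨a, b⟩ hab
  have hab : 𝓛.proj a = 𝓛.proj b := hab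
  obtain ⟨U, n, Θ, Ξ, hU, hy, hΘ, hΞ, h1, -, -, h2, -⟩ := 𝓛.locallyTrivial (𝓛.proj a)
  have hO : IsOpen (𝓛.proj ⁻¹' U) := hU.preimage 𝓛.contMDiff_proj.continuous
  have h3 : ContMDiffOn (𝓘(ℝ, F).prod 𝓘(ℝ, F)) 𝓘(ℝ, F) ∞
      (fun p : A × A ↦ Ξ (𝓛.proj p.1, Θ p.1 + Θ p.2)) ((𝓛.proj ⁻¹' U) ×ˢ (𝓛.proj ⁻¹' U)) := by
    refine hΞ.comp ((𝓛.contMDiff_proj.comp_contMDiffOn contMDiffOn_fst).prodMk ?_)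
      fun p hp ↦ ⟨hp.1, mem_univ _⟩
    exact (hΘ.comp contMDiffOn_fst fun p hp ↦ hp.1).add (hΘ.comp contMDiffOn_snd fun p hp ↦ hp.2)
  have heq : ∀ p : A × A, 𝓛.proj p.1 ∈ U → 𝓛.proj p.1 = 𝓛.proj p.2 →
      𝓛.add p.1 p.2 = Ξ (𝓛.proj p.1, Θ p.1 + Θ p.2) := fun p hp hpp ↦ by
    rw [← h2 _ _ hp hpp, ← 𝓛.proj_add _ _ hpp, h1]
    rwa [𝓛.proj_add _ _ hpp]
  have hn : (𝓛.proj ⁻¹' U) ×ˢ (𝓛.proj ⁻¹' U) ∈ 𝓝 (a, b) :=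
    (hO.prod hO).mem_nhds ⟨hy, by rw [mem_preimage, ← hab]; exact hy⟩
  refine ((h3.contMDiffAt hn).contMDiffWithinAt).congr_of_eventuallyEq ?_ (heq _ hy hab)
  filter_upwards [nhdsWithin_le_nhds hn, self_mem_nhdsWithin] with p hp hpp using heq p hp.1 hpp

theorem tendsto_add {X : Type*} {l : Filter X} {α β : X → A} {a b : A}
    (hα : Filter.Tendsto α l (𝓝 a)) (hβ : Filter.Tendsto β l (𝓝 b)) (h : 𝓛.proj a = 𝓛.proj b)
    (hαβ : ∀ᶠ t in l, 𝓛.proj (α t) = 𝓛.proj (β t)) :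
    Filter.Tendsto (fun t ↦ 𝓛.add (α t) (β t)) l (𝓝 (𝓛.add a b)) := by
  have h1 := (𝓛.contMDiffOn_add.continuousOn (a, b) h).tendsto
  exact h1.comp (tendsto_nhdsWithin_iff.2 ⟨hα.prodMk_nhds hβ, hαβ⟩)

variable {F' A' : Type*} [NormedAddCommGroup F'] [NormedSpace ℝ F'] [TopologicalSpace A']
  [ChartedSpace F' A'] (Φ : Diffeomorph 𝓘(ℝ, F) 𝓘(ℝ, F') A A' ∞)

/-- Smooth sections correspond to each other under a diffeomorphism over the base. -/
theorem isSmoothSection_symm {proj : A → M} {X : M → A'}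
    (hX : IsSmoothSection F₀ F' (proj ∘ Φ.symm) X) :
    IsSmoothSection F₀ F proj (fun y ↦ Φ.symm (X y)) :=
  ⟨Φ.symm.contMDiff.comp hX.1, hX.2⟩

/-- The Lie algebroid structure deduced from another one by a diffeomorphism of total spaces. -/
noncomputable def transport : LieAlgebroid F' F₀ A' M where
  proj := 𝓛.proj ∘ Φ.symm
  zero y := Φ (𝓛.zero y)
  add a b := Φ (𝓛.add (Φ.symm a) (Φ.symm b))
  smul c a := Φ (𝓛.smul c (Φ.symm a))
  contMDiff_proj := 𝓛.contMDiff_proj.comp Φ.symm.contMDiff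
  proj_zero y := by simp [𝓛.proj_zero]
  proj_add a b h := by simp [𝓛.proj_add _ _ h]
  proj_smul c a := by simp [𝓛.proj_smul]
  locallyTrivial y := by
    obtain ⟨U, n, Θ, Ξ, hU, hy, hΘ, hΞ, h1, h2, h3, h4, h5⟩ := 𝓛.locallyTrivial y
    refine ⟨U, n, Θ ∘ Φ.symm, Φ ∘ Ξ, hU, hy, hΘ.comp Φ.symm.contMDiff.contMDiffOn fun _ h ↦ h,
      Φ.contMDiff.comp_contMDiffOn hΞ, fun a ha ↦ ?_, fun z hz w ↦ ?_, fun z hz ↦ ?_,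
      fun a b ha hab ↦ ?_, fun c a ha ↦ ?_⟩
    · simp [h1 (Φ.symm a) ha]
    · simpa using h2 z hz w
    · simpa using h3 z hz
    · simpa using h4 _ _ ha hab
    · simpa using h5 c _ ha
  anchor a := 𝓛.anchor (Φ.symm a)
  contMDiff_anchor := 𝓛.contMDiff_anchor.comp Φ.symm.contMDiff
  anchor_add a b h :=
    (congrArg (fun c ↦ modelVec (𝓛.anchor c)) (Φ.symm_apply_apply _)).trans (𝓛.anchor_add _ _ h)
  anchor_smul c a :=
    (congrArg (fun c ↦ modelVec (𝓛.anchor c)) (Φ.symm_apply_apply _)).trans (𝓛.anchor_smul _ _)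
  bracket X Y y := Φ (𝓛.bracket (fun y ↦ Φ.symm (X y)) (fun y ↦ Φ.symm (Y y)) y)
  bracket_section X Y hX hY := by
    have h := 𝓛.bracket_section _ _ (isSmoothSection_symm Φ hX) (isSmoothSection_symm Φ hY)
    exact ⟨Φ.contMDiff.comp h.1, fun y ↦ by simpa using h.2 y⟩
  bracket_add X Y Z hX hY hZ y := by
    simpa using 𝓛.bracket_add _ _ _ (isSmoothSection_symm Φ hX) (isSmoothSection_symm Φ hY)
      (isSmoothSection_symm Φ hZ) y
  bracket_swap X Y hX hY y := by
    simpa using 𝓛.bracket_swap _ _ (isSmoothSection_symm Φ hX) (isSmoothSection_symm Φ hY) y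
  jacobi X Y Z hX hY hZ y := by
    simpa using 𝓛.jacobi _ _ _ (isSmoothSection_symm Φ hX) (isSmoothSection_symm Φ hY)
      (isSmoothSection_symm Φ hZ) y
  anchor_bracket X Y hX hY y :=
    (congrArg (fun c ↦ modelVec (𝓛.anchor c)) (Φ.symm_apply_apply _)).trans
      (𝓛.anchor_bracket _ _ (isSmoothSection_symm Φ hX) (isSmoothSection_symm Φ hY) y)
  leibniz X Y hX hY f hf y := by
    have h := 𝓛.leibniz _ _ (isSmoothSection_symm Φ hX) (isSmoothSection_symm Φ hY) f hf y
    simp only [Φ.symm_apply_apply]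
    exact congrArg Φ h

end LieAlgebroid

/-! ### The transported structure is tautologically isomorphic to the original one -/

section Algebroid

variable {E E₀ G G₀ : Type*} [NormedAddCommGroup E] [NormedSpace ℝ E]
  [NormedAddCommGroup E₀] [NormedSpace ℝ E₀] [TopologicalSpace G] [ChartedSpace E G]
  [TopologicalSpace G₀] [ChartedSpace E₀ G₀] [IsManifold 𝓘(ℝ, E) ∞ G]
  [IsManifold 𝓘(ℝ, E₀) ∞ G₀] [FiniteDimensional ℝ E] [CompleteSpace E] [CompleteSpace E₀]

namespace LieGroupoid

variable (𝒢 : LieGroupoid E E₀ G G₀)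

theorem isIsoOf_transport {F A : Type*} [NormedAddCommGroup F] [NormedSpace ℝ F]
    [TopologicalSpace A] [ChartedSpace F A] (Φ : Diffeomorph 𝓘(ℝ, E) 𝓘(ℝ, F) 𝒢.Alg A ∞) :
    (𝒢.algebroid.transport Φ).IsIsoOf 𝒢 Φ where
  proj_eq a := congrArg Alg.base (Φ.symm_apply_apply a)
  zero_eq _ := rfl
  add_eq x v w := by
    show _ = Φ (𝒢.algebroid.add (Φ.symm (Φ ⟨x, v⟩)) (Φ.symm (Φ ⟨x, w⟩)))
    rw [Φ.symm_apply_apply, Φ.symm_apply_apply]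
    show _ = Φ ⟨x, v + (⟨x, w⟩ : 𝒢.Alg).at x⟩
    rw [Alg.at_mk]
  smul_eq c x v := by
    show _ = Φ (𝒢.algebroid.smul c (Φ.symm (Φ ⟨x, v⟩)))
    rw [Φ.symm_apply_apply]
    rfl
  anchor_eq a := congrArg (fun c ↦ modelVec (𝒢.anchor c)) (Φ.symm_apply_apply a)
  bracket_eq X Y hX hY x := by
    refine ⟨𝒢.bracketSection X Y x, coe_bracketSection hX hY x, ?_⟩
    show Φ ⟨x, 𝒢.bracketSection (fun y ↦ (Φ.symm (Φ ⟨y, X y⟩)).at y)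
      (fun y ↦ (Φ.symm (Φ ⟨y, Y y⟩)).at y) x⟩ = _
    simp only [Φ.symm_apply_apply, Alg.at_mk]

omit [CompleteSpace E] [CompleteSpace E₀] in
theorem isSubmersion_base :
    Manifold.IsSubmersion 𝓘(ℝ, E) 𝓘(ℝ, E₀) ∞ (Alg.base (𝒢 := 𝒢)) := by
  refine isSubmersion_of_linear_charts fun a ↦ ?_
  obtain ⟨C, hC⟩ := 𝒢.exists_vertChart (𝒢.u a.base)
  exact ⟨C.alg, C.χ, C.p, hC, C.alg_mem, C.mem', fun e ↦ ⟨C.σ e, C.p_σ e⟩,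
    fun b hb ↦ ⟨C.base_mem hb, (C.p_coord hb).symm⟩⟩

end LieGroupoid

end Algebroid

/-- Continuous maps between deformation spaces over the same map are equal if they preserve the
parameter. -/
theorem DNC.map_ext {D V D₁ M C W C₁ N : Type*} [NormedAddCommGroup D] [NormedSpace ℝ D]
    [TopologicalSpace V] [ChartedSpace D V] [NormedAddCommGroup D₁] [NormedSpace ℝ D₁]
    [TopologicalSpace M] [ChartedSpace D₁ M] [NormedAddCommGroup C] [NormedSpace ℝ C]
    [TopologicalSpace W] [ChartedSpace C W] [NormedAddCommGroup C₁] [NormedSpace ℝ C₁]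
    [TopologicalSpace N] [ChartedSpace C₁ N] [FiniteDimensional ℝ D₁] [FiniteDimensional ℝ C₁]
    [IsManifold 𝓘(ℝ, D₁) ∞ M] [IsManifold 𝓘(ℝ, C₁) ∞ N] {i : SmoothEmbedding D V D₁ M}
    {j : SmoothEmbedding C W C₁ N} {F F' : DNC i → DNC j} (hF : Continuous F) (hF' : Continuous F')
    (hpt : ∀ p, (F p).pt = (F' p).pt) (hparam : ∀ p, (F p).param = p.param)
    (hparam' : ∀ p, (F' p).param = p.param) : F = F' := by
  have hne : ∀ p : DNC i, p.param ≠ 0 → F p = F' p := fun p hp ↦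
    by
    rw [DNC.eq_gen (p := F p) (by rwa [hparam]), DNC.eq_gen (p := F' p) (by rwa [hparam'])]
    simp only [hpt, hparam, hparam']
  funext p
  by_cases h0 : p.param = 0
  · obtain ⟨n, rfl⟩ := DNC.exists_nor h0
    obtain ⟨α, hα⟩ := DNC.exists_tendsto n
    refine DNC.eq_of_tendsto ((hF.tendsto _).comp hα) (((hF'.tendsto _).comp hα).congr' ?_) (hpt _)
    filter_upwards [self_mem_nhdsWithin] with t ht
    have ht : t ≠ 0 := ht
    refine (hne _ ?_).symm
    show (DNC.genD i (α t, t)).param ≠ 0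
    rw [DNC.genD_of_ne ht]
    exact ht
  · exact hne p h0

/-! ### Naturality of the anchor -/

section Morphism

variable {E E₀ G G₀ : Type*} [NormedAddCommGroup E] [NormedSpace ℝ E]
  [NormedAddCommGroup E₀] [NormedSpace ℝ E₀] [TopologicalSpace G] [ChartedSpace E G]
  [TopologicalSpace G₀] [ChartedSpace E₀ G₀] [IsManifold 𝓘(ℝ, E) ∞ G]
  [IsManifold 𝓘(ℝ, E₀) ∞ G₀]
  {D D₀ K K₀ : Type*} [NormedAddCommGroup D] [NormedSpace ℝ D]
  [NormedAddCommGroup D₀] [NormedSpace ℝ D₀] [TopologicalSpace K] [ChartedSpace D K]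
  [TopologicalSpace K₀] [ChartedSpace D₀ K₀] [IsManifold 𝓘(ℝ, D) ∞ K]
  [IsManifold 𝓘(ℝ, D₀) ∞ K₀]
  {𝒢 : LieGroupoid E E₀ G G₀} {𝒦 : LieGroupoid D D₀ K K₀} {f : K → G} {f₀ : K₀ → G₀}

/-- A morphism of Lie groupoids is compatible with the anchors. -/
theorem LieGroupoid.mfderiv_anchor (hf : MDifferentiable 𝓘(ℝ, D) 𝓘(ℝ, E) f)
    (hf₀ : MDifferentiable 𝓘(ℝ, D₀) 𝓘(ℝ, E₀) f₀) (hr : ∀ a, 𝒢.r (f a) = f₀ (𝒦.r a))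
    (hu : ∀ x, 𝒢.u (f₀ x) = f (𝒦.u x)) (a : 𝒦.Alg) (b : 𝒢.Alg) (hb : b.base = f₀ a.base)
    (hab : modelVec b.vec.1 = modelVec (mfderiv 𝓘(ℝ, D) 𝓘(ℝ, E) f (𝒦.u a.base) a.vec.1)) :
    modelVec (𝒢.anchor b) =
      modelVec (mfderiv 𝓘(ℝ, D₀) 𝓘(ℝ, E₀) f₀ a.base (𝒦.anchor a)) := by
  have h1 := mfderiv_comp (𝒦.u a.base) (𝒢.mdifferentiable_structure.2.1 _) (hf _)
  have h2 := mfderiv_comp (𝒦.u a.base) (hf₀ _) (𝒦.mdifferentiable_structure.2.1 (𝒦.u a.base))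
  have h3 : 𝒢.r ∘ f = f₀ ∘ 𝒦.r := funext hr
  rw [h3, h2] at h1
  have tr : ∀ y z, y = z → ∀ w : E, modelVec (mfderiv 𝓘(ℝ, E) 𝓘(ℝ, E₀) 𝒢.r y
      (w : TangentSpace 𝓘(ℝ, E) y)) = modelVec (mfderiv 𝓘(ℝ, E) 𝓘(ℝ, E₀) 𝒢.r z
      (w : TangentSpace 𝓘(ℝ, E) z)) := by
    rintro y _ rfl w
    rfl
  have tr' : ∀ y z, y = z → ∀ w : D₀, modelVec (mfderiv 𝓘(ℝ, D₀) 𝓘(ℝ, E₀) f₀ y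
      (w : TangentSpace 𝓘(ℝ, D₀) y)) = modelVec (mfderiv 𝓘(ℝ, D₀) 𝓘(ℝ, E₀) f₀ z
      (w : TangentSpace 𝓘(ℝ, D₀) z)) := by
    rintro y _ rfl w
    rfl
  have e1 : modelVec (𝒢.anchor b) = modelVec (mfderiv 𝓘(ℝ, E) 𝓘(ℝ, E₀) 𝒢.r (f (𝒦.u a.base))
      (mfderiv 𝓘(ℝ, D) 𝓘(ℝ, E) f (𝒦.u a.base) a.vec.1)) := by
    have hu' : 𝒢.u b.base = f (𝒦.u a.base) := by rw [hb, hu]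
    refine (tr _ _ hu' (modelVec b.vec.1)).trans ?_
    rw [hab]
    rfl
  refine e1.trans ((congrArg modelVec (DFunLike.congr_fun h1 a.vec.1)).symm.trans ?_)
  exact tr' _ _ (𝒦.r_u a.base) _

end Morphism

/-! ### Identification of the transported structure on the deformation of the Lie algebroids -/

section Groupoid

variable {E E₀ G G₀ : Type*} [NormedAddCommGroup E] [NormedSpace ℝ E]
  [NormedAddCommGroup E₀] [NormedSpace ℝ E₀] [TopologicalSpace G] [ChartedSpace E G]
  [TopologicalSpace G₀] [ChartedSpace E₀ G₀] [IsManifold 𝓘(ℝ, E) ∞ G]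
  [IsManifold 𝓘(ℝ, E₀) ∞ G₀]
  {E' E₀' H H₀ : Type*} [NormedAddCommGroup E'] [NormedSpace ℝ E']
  [NormedAddCommGroup E₀'] [NormedSpace ℝ E₀'] [TopologicalSpace H] [ChartedSpace E' H]
  [TopologicalSpace H₀] [ChartedSpace E₀' H₀] [IsManifold 𝓘(ℝ, E') ∞ H]
  [IsManifold 𝓘(ℝ, E₀') ∞ H₀] [FiniteDimensional ℝ E] [FiniteDimensional ℝ E₀]
  {ℋ : LieGroupoid E' E₀' H H₀} {𝒢 : LieGroupoid E E₀ G G₀} (ι : LieSubgroupoid ℋ 𝒢)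

namespace LieSubgroupoid

/-- The element of the Lie algebroid of the deformation groupoid given by an element of the Lie
algebroid of the groupoid and a nonzero parameter. -/
noncomputable def genAlg (a : 𝒢.Alg) (t : ℝ) (ht : t ≠ 0) : ι.dnc.Alg :=
  ⟨.gen a.base t ht, ⟨_, LieGroupoid.mfderiv_mem_fiber (𝒢 := ι.dnc) (𝒦 := 𝒢)
    (f := fun b ↦ DNC.gen b t ht) (f₀ := fun x ↦ DNC.gen x t ht)
    ((DNC.contMDiff_gen ht).mdifferentiableAt (by simp))
    ((DNC.contMDiff_gen ht).mdifferentiableAt (by simp)) (fun _ ↦ rfl) rfl a.vec.2⟩⟩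

/-- Differentiate the identity `pt ∘ (b ↦ (b, t)) = id`. -/
theorem ptAlg_genAlg (a : 𝒢.Alg) (t : ℝ) (ht : t ≠ 0) : ι.ptAlg (ι.genAlg a t ht) = a := by
  have h1 := mfderiv_comp (𝒢.u a.base)
    ((DNC.contMDiff_pt (i := ι.hom)).mdifferentiableAt (by simp) (x := .gen (𝒢.u a.base) t ht))
    ((DNC.contMDiff_gen ht).mdifferentiableAt (by simp))
  have h2 : DNC.pt ∘ (fun b ↦ (DNC.gen b t ht : DNC ι.hom)) = id := rfl
  rw [h2, mfderiv_id] at h1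
  obtain ⟨x, v⟩ := a
  show (⟨x, _⟩ : 𝒢.Alg) = ⟨x, v⟩
  congr 1
  exact Subtype.ext (DFunLike.congr_fun h1 v.1).symm

variable [FiniteDimensional ℝ E'] [FiniteDimensional ℝ E₀']

theorem dncIso_genAlg (a : 𝒢.Alg) (t : ℝ) (ht : t ≠ 0) :
    ι.dncIso (ι.genAlg a t ht) = .gen a t ht := by
  rw [dncIso_of_ne (show (ι.genAlg a t ht).base.param ≠ 0 from ht), ptAlg_genAlg]
  rfl

variable [CompleteSpace E] [CompleteSpace E₀] [CompleteSpace E'] [CompleteSpace E₀']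

omit [FiniteDimensional ℝ E'] [FiniteDimensional ℝ E₀'] [CompleteSpace E'] [CompleteSpace E₀'] in
theorem ptAlg_add {a b : ι.dnc.Alg} (h : a.base = b.base) :
    ι.ptAlg (ι.dnc.algebroid.add a b) = 𝒢.algebroid.add (ι.ptAlg a) (ι.ptAlg b) := by
  obtain ⟨x, v⟩ := a
  obtain ⟨_, w⟩ := b
  obtain rfl : x = _ := h
  have h1 : ι.dnc.algebroid.add ⟨x, v⟩ ⟨x, w⟩ = ⟨x, v + w⟩ :=
    congrArg (fun z ↦ (⟨x, v + z⟩ : ι.dnc.Alg)) (LieGroupoid.Alg.at_mk x w)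
  have h2 : ∀ v' w', 𝒢.algebroid.add ⟨x.pt, v'⟩ ⟨x.pt, w'⟩ = ⟨x.pt, v' + w'⟩ := fun v' w' ↦
    congrArg (fun z ↦ (⟨x.pt, v' + z⟩ : 𝒢.Alg)) (LieGroupoid.Alg.at_mk x.pt w')
  rw [h1]
  refine Eq.trans ?_ (h2 _ _).symm
  refine congrArg (LieGroupoid.Alg.mk x.pt) (Subtype.ext ?_)
  exact map_add (mfderiv 𝓘(ℝ, E × ℝ) 𝓘(ℝ, E) DNC.pt (ι.dnc.u x)) v.1 w.1

omit [FiniteDimensional ℝ E'] [FiniteDimensional ℝ E₀'] [CompleteSpace E'] [CompleteSpace E₀'] in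
theorem ptAlg_smul (c : ℝ) (a : ι.dnc.Alg) :
    ι.ptAlg (ι.dnc.algebroid.smul c a) = 𝒢.algebroid.smul c (ι.ptAlg a) := by
  refine congrArg (LieGroupoid.Alg.mk a.base.pt) (Subtype.ext ?_)
  exact map_smul (mfderiv 𝓘(ℝ, E × ℝ) 𝓘(ℝ, E) DNC.pt (ι.dnc.u a.base)) c a.vec.1

omit [FiniteDimensional ℝ E'] [FiniteDimensional ℝ E₀'] [CompleteSpace E'] [CompleteSpace E₀'] in
theorem ptAlg_zero (x : DNC ι.base) : ι.ptAlg (ι.dnc.algebroid.zero x) = 𝒢.algebroid.zero x.pt := by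
  refine congrArg (LieGroupoid.Alg.mk x.pt) (Subtype.ext ?_)
  exact map_zero (mfderiv 𝓘(ℝ, E × ℝ) 𝓘(ℝ, E) DNC.pt (ι.dnc.u x))

theorem algMap_zero (x : H₀) : ι.algMap ⟨x, 0⟩ = ⟨ι.base x, 0⟩ := by
  refine congrArg (LieGroupoid.Alg.mk (ι.base x)) (Subtype.ext ?_)
  exact map_zero (mfderiv 𝓘(ℝ, E') 𝓘(ℝ, E) ι.hom (ℋ.u x))

theorem algMap_smul (c : ℝ) (a : ℋ.Alg) :
    ι.algMap ⟨a.base, c • a.vec⟩ = ⟨(ι.algMap a).base, c • (ι.algMap a).vec⟩ := by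
  refine congrArg (LieGroupoid.Alg.mk (ι.base a.base)) (Subtype.ext ?_)
  exact map_smul (mfderiv 𝓘(ℝ, E') 𝓘(ℝ, E) ι.hom (ℋ.u a.base)) c a.vec.1

theorem algMap_add (x : H₀) (v w : ℋ.fiber x) :
    ι.algMap ⟨x, v + w⟩ = 𝒢.algebroid.add (ι.algMap ⟨x, v⟩) (ι.algMap ⟨x, w⟩) := by
  have h : ∀ v' w', 𝒢.algebroid.add ⟨ι.base x, v'⟩ ⟨ι.base x, w'⟩ = ⟨ι.base x, v' + w'⟩ :=
    fun v' w' ↦ congrArg (fun z ↦ (⟨ι.base x, v' + z⟩ : 𝒢.Alg)) (LieGroupoid.Alg.at_mk _ w')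
  refine Eq.trans ?_ (h _ _).symm
  refine congrArg (LieGroupoid.Alg.mk (ι.base x)) (Subtype.ext ?_)
  exact map_add (mfderiv 𝓘(ℝ, E') 𝓘(ℝ, E) ι.hom (ℋ.u x)) v.1 w.1

section

variable {ι} (Φ : Diffeomorph 𝓘(ℝ, E × ℝ) 𝓘(ℝ, E × ℝ) ι.dnc.Alg (DNC ι.algEmbedding) ∞)
  (hΦ : ∀ a, Φ a = ι.dncIso a)
include hΦ

theorem symm_gen (a : 𝒢.Alg) (t : ℝ) (ht : t ≠ 0) : Φ.symm (.gen a t ht) = ι.genAlg a t ht := by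
  rw [← ι.dncIso_genAlg a t ht, ← hΦ, Φ.symm_apply_apply]

theorem ptAlg_symm (b : DNC ι.algEmbedding) : ι.ptAlg (Φ.symm b) = b.pt := by
  rw [← pt_dncIso, ← hΦ, Φ.apply_symm_apply]

theorem param_symm (b : DNC ι.algEmbedding) : (Φ.symm b).base.param = b.param := by
  rw [← param_dncIso, ← hΦ, Φ.apply_symm_apply]

theorem base_symm (b : DNC ι.algEmbedding) : (Φ.symm b).base =
    DNC.map ι.algEmbedding ι.base LieGroupoid.Alg.base LieGroupoid.Alg.base b := by
  rw [← map_base_dncIso, ← hΦ, Φ.apply_symm_apply]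

theorem pt_add {a b : DNC ι.algEmbedding}
    (h : (ι.dnc.algebroid.transport Φ).proj a = (ι.dnc.algebroid.transport Φ).proj b) :
    ((ι.dnc.algebroid.transport Φ).add a b).pt = 𝒢.algebroid.add a.pt b.pt := by
  show (Φ (ι.dnc.algebroid.add (Φ.symm a) (Φ.symm b))).pt = _
  rw [hΦ, pt_dncIso, ptAlg_add _ h, ptAlg_symm Φ hΦ, ptAlg_symm Φ hΦ]

theorem param_add (a b : DNC ι.algEmbedding) :
    ((ι.dnc.algebroid.transport Φ).add a b).param = a.param := by
  show (Φ (ι.dnc.algebroid.add (Φ.symm a) (Φ.symm b))).param = _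
  rw [hΦ, param_dncIso, ← param_symm Φ hΦ]
  rfl

/-- The transported addition is continuous, by local triviality. For `t ≠ 0` it is the addition of
`𝔄G`, since `ptAlg` is linear on the fibres. A continuous extension is necessarily given by the
differential for `t = 0`. -/
theorem isDNCMul_transport_add (m : 𝒢.Alg → 𝒢.Alg → 𝒢.Alg) (n : ℋ.Alg → ℋ.Alg → ℋ.Alg)
    (hm : ∀ x v w, m ⟨x, v⟩ ⟨x, w⟩ = ⟨x, v + w⟩) (hn : ∀ x v w, n ⟨x, v⟩ ⟨x, w⟩ = ⟨x, v + w⟩) :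
    IsDNCMul (C₁ := E₀) ι.algEmbedding LieGroupoid.Alg.base LieGroupoid.Alg.base m
      LieGroupoid.Alg.base LieGroupoid.Alg.base n (ι.dnc.algebroid.transport Φ).add := by
  have hm' : ∀ a b : 𝒢.Alg, a.base = b.base → m a b = 𝒢.algebroid.add a b := by
    rintro ⟨x, v⟩ ⟨_, w⟩ rfl
    rw [hm]
    exact congrArg (fun z ↦ (⟨x, v + z⟩ : 𝒢.Alg)) (LieGroupoid.Alg.at_mk _ w).symm
  have hmn : ∀ a b : ℋ.Alg, a.base = b.base → m (ι.algMap a) (ι.algMap b) = ι.algMap (n a b) := by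
    rintro ⟨x, v⟩ ⟨_, w⟩ rfl
    rw [hn, ι.algMap_add]
    exact hm' _ _ rfl
  have hproj : ∀ a, (ι.dnc.algebroid.transport Φ).proj a =
      DNC.map ι.algEmbedding ι.base LieGroupoid.Alg.base LieGroupoid.Alg.base a := base_symm Φ hΦ
  have hgen : ∀ (x y : 𝒢.Alg) (t : ℝ) (ht : t ≠ 0), x.base = y.base →
      (ι.dnc.algebroid.transport Φ).proj (.gen x t ht) =
        (ι.dnc.algebroid.transport Φ).proj (.gen y t ht) := fun x y t ht hxy ↦ by
    rw [hproj, hproj]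
    exact congrArg (fun x ↦ DNC.gen x t ht) hxy
  refine isDNCMul_of_continuous 𝒢.isSubmersion_base
    (LieGroupoid.contMDiff_base.mdifferentiable (by simp)) ?_ ?_ hmn ?_ ?_
  · exact ((𝒢.algebroid.contMDiffOn_add).mdifferentiableOn (by simp)).congr fun p hp ↦ hm' _ _ hp
  · intro a b hab
    exact congrArg ι.base hab
  · intro x y t ht hxy
    refine dnc_ext_of_ne ?_ ?_ ?_
    · rw [param_add Φ hΦ]; exact ht
    · rw [param_add Φ hΦ]; rfl
    · rw [pt_add Φ hΦ (hgen x y t ht hxy)]; exact (hm' x y hxy).symm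
  · intro a b α β hab hαβ hα hβ
    have h1 : ∀ᶠ t in 𝓝[≠] (0 : ℝ),
        (ι.dnc.algebroid.transport Φ).proj (DNC.genD ι.algEmbedding (α t, t)) =
          (ι.dnc.algebroid.transport Φ).proj (DNC.genD ι.algEmbedding (β t, t)) := by
      filter_upwards [hαβ, self_mem_nhdsWithin] with t ht h0
      have h0 : t ≠ 0 := h0
      rw [DNC.genD_of_ne h0, DNC.genD_of_ne h0]
      exact hgen _ _ t h0 ht
    have hc := (ι.dnc.algebroid.transport Φ).contMDiff_proj.continuous
    have h2 : (ι.dnc.algebroid.transport Φ).proj (.nor a) =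
        (ι.dnc.algebroid.transport Φ).proj (.nor b) := by
      refine DNC.eq_of_tendsto ((hc.tendsto _).comp hα)
        (((hc.tendsto _).comp hβ).congr' (h1.mono fun _ h ↦ h.symm)) ?_
      rw [hproj, hproj]
      exact congrArg ι.base hab
    refine ⟨(ι.dnc.algebroid.transport Φ).tendsto_add hα hβ h2 h1, ?_⟩
    rw [pt_add Φ hΦ h2]
    exact (hm' _ _ (congrArg ι.base hab)).symm.trans (hmn _ _ hab)

/-- The zero section and the scalar multiplications are continuous, preserve the parameter and lift
those of `𝔄G`, so they are the functorial ones by `DNC.map_ext`. For the anchor and the bracket with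
`t ≠ 0`, the map `b ↦ (b, t)` is a morphism of Lie groupoids from `G` to the deformation, and
naturality applies. -/
theorem isDNCAlg_transport : LieSubgroupoid.IsDNCAlg (ι.dnc.algebroid.transport Φ) := by
  have hproj : (ι.dnc.algebroid.transport Φ).proj =
      DNC.map ι.algEmbedding ι.base LieGroupoid.Alg.base LieGroupoid.Alg.base :=
    funext (base_symm Φ hΦ)
  refine ⟨?_, ?_, fun c ↦ ?_, isDNCMul_transport_add Φ hΦ, fun a t ht ↦ ?_, ?_⟩
  · rw [hproj]
    exact DNC.isDNCMap_map (LieGroupoid.contMDiff_base.mdifferentiable (by simp))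
      (LieGroupoid.contMDiff_base.mdifferentiable (by simp)) fun _ ↦ rfl
  · have h1 := 𝒢.algebroid.contMDiff_zero
    have h2 := ℋ.algebroid.contMDiff_zero.mdifferentiable (by simp)
    have h3 : ∀ x : H₀, 𝒢.algebroid.zero (ι.base x) = ι.algEmbedding (ℋ.algebroid.zero x) :=
      fun x ↦ (ι.algMap_zero x).symm
    have h4 : (ι.dnc.algebroid.transport Φ).zero =
        DNC.map ι.base ι.algEmbedding 𝒢.algebroid.zero ℋ.algebroid.zero := by
      refine DNC.map_ext (ι.dnc.algebroid.transport Φ).contMDiff_zero.continuous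
        (DNC.contMDiff_map h1 h2 h3).continuous (fun p ↦ ?_) (fun p ↦ ?_) fun p ↦ DNC.param_map _
      · rw [DNC.pt_map h3]
        show (Φ (ι.dnc.algebroid.zero p)).pt = _
        rw [hΦ, pt_dncIso, ptAlg_zero]
      · show (Φ (ι.dnc.algebroid.zero p)).param = _
        rw [hΦ, param_dncIso]
        rfl
    rw [h4]
    exact DNC.isDNCMap_map (h1.mdifferentiable (by simp)) h2 h3
  · have h1 := 𝒢.algebroid.contMDiff_smul c
    have h2 := (ℋ.algebroid.contMDiff_smul c).mdifferentiable (by simp)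
    have h3 : ∀ a : ℋ.Alg, 𝒢.algebroid.smul c (ι.algEmbedding a) =
        ι.algEmbedding (ℋ.algebroid.smul c a) := fun a ↦ (ι.algMap_smul c a).symm
    have h4 : (ι.dnc.algebroid.transport Φ).smul c =
        DNC.map ι.algEmbedding ι.algEmbedding (𝒢.algebroid.smul c) (ℋ.algebroid.smul c) := by
      refine DNC.map_ext ((ι.dnc.algebroid.transport Φ).contMDiff_smul c).continuous
        (DNC.contMDiff_map h1 h2 h3).continuous (fun p ↦ ?_) (fun p ↦ ?_) fun p ↦ DNC.param_map _
      · rw [DNC.pt_map h3]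
        show (Φ (ι.dnc.algebroid.smul c (Φ.symm p))).pt = _
        rw [hΦ, pt_dncIso, ptAlg_smul, ptAlg_symm Φ hΦ]
      · show (Φ (ι.dnc.algebroid.smul c (Φ.symm p))).param = _
        rw [hΦ, param_dncIso, ← param_symm Φ hΦ]
        rfl
    rw [h4]
    exact DNC.isDNCMap_map (h1.mdifferentiable (by simp)) h2 h3
  · refine (congrArg (fun b ↦ modelVec (ι.dnc.anchor b)) (symm_gen Φ hΦ a t ht)).trans ?_
    exact LieGroupoid.mfderiv_anchor (𝒢 := ι.dnc) (𝒦 := 𝒢) (f := fun b ↦ DNC.gen b t ht)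
      (f₀ := fun x ↦ DNC.gen x t ht) ((DNC.contMDiff_gen ht).mdifferentiable (by simp))
      ((DNC.contMDiff_gen ht).mdifferentiable (by simp)) (fun _ ↦ rfl) (fun _ ↦ rfl) a _ rfl rfl
  · intro X Y hX hY t ht X' Y' hXX' hYY' x
    -- A smooth section over the deformation gives, at fixed `t`, the smooth section `X'` of `𝔄G`,
    -- by projection. Through the inverse of `Φ` it gives a section `Z`, which is related to `X'` by
    -- `b ↦ (b, t)`.
    have key : ∀ (X : DNC ι.base → DNC ι.algEmbedding) (X' : ∀ x, 𝒢.fiber x),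
        IsSmoothSection (E₀ × ℝ) (E × ℝ) (ι.dnc.algebroid.transport Φ).proj X →
        (∀ x, X (.gen x t ht) = .gen ⟨x, X' x⟩ t ht) → 𝒢.IsSmoothSection X' ∧
        ∃ Z : ∀ y, ι.dnc.fiber y, ι.dnc.IsSmoothSection Z ∧ (fun y ↦ (Φ.symm (X y)).at y) = Z ∧
        ∀ x, Z (.gen x t ht) = (ι.genAlg ⟨x, X' x⟩ t ht).vec := by
      intro X X' hX hXX'
      constructor
      · have h1 := (DNC.contMDiff_pt (i := ι.algEmbedding)).comp
          (hX.1.comp (DNC.contMDiff_gen (i := ι.base) ht))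
        refine h1.congr fun x ↦ ?_
        simp [hXX']
      · obtain ⟨Z, hZ, hXZ⟩ := LieGroupoid.exists_section (LieAlgebroid.isSmoothSection_symm Φ hX)
        refine ⟨Z, hZ, ?_, fun x ↦ ?_⟩
        · funext y
          rw [congrFun hXZ y, LieGroupoid.Alg.at_mk]
        · have h1 := congrFun hXZ (.gen x t ht)
          simp only [hXX', symm_gen Φ hΦ] at h1
          have h2 := congrArg (fun a : ι.dnc.Alg ↦ a.at (.gen x t ht)) h1
          simp only [LieGroupoid.Alg.at_mk] at h2
          rw [← h2]
          exact LieGroupoid.Alg.at_mk _ _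
    obtain ⟨hX', Z, hZ, hXZ, hZX⟩ := key X X' hX hXX'
    obtain ⟨hY', W, hW, hYW, hWY⟩ := key Y Y' hY hYY'
    refine ⟨𝒢.bracketSection X' Y' x, LieGroupoid.coe_bracketSection hX' hY' x, ?_⟩
    show Φ ⟨.gen x t ht, ι.dnc.bracketSection (fun y ↦ (Φ.symm (X y)).at y)
      (fun y ↦ (Φ.symm (Y y)).at y) (.gen x t ht)⟩ = _
    rw [hXZ, hYW, ← ι.dncIso_genAlg, ← hΦ]
    congr 1
    refine congrArg (LieGroupoid.Alg.mk (DNC.gen x t ht)) (Subtype.ext ?_)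
    rw [LieGroupoid.coe_bracketSection hZ hW]
    have h := LieGroupoid.mfderiv_bracket (𝒢 := ι.dnc) (𝒦 := 𝒢) (f := fun b ↦ DNC.gen b t ht)
      (f₀ := fun x ↦ DNC.gen x t ht) (DNC.contMDiff_gen ht) (fun _ ↦ rfl) (fun _ ↦ rfl)
      (fun _ ↦ rfl) (fun _ _ _ ↦ rfl) hX' hY' hZ hW
      (fun x ↦ congrArg (fun v : ι.dnc.fiber _ ↦ modelVec v.1) (hZX x))
      (fun x ↦ congrArg (fun v : ι.dnc.fiber _ ↦ modelVec v.1) (hWY x)) x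
    refine Eq.trans h ?_
    rw [← LieGroupoid.coe_bracketSection hX' hY' x]
    rfl

end

end LieSubgroupoid

end Groupoid

theorem mainTheorem5 {E E₀ E' E₀' G G₀ H H₀ : Type*}
    [NormedAddCommGroup E] [NormedSpace ℝ E] [FiniteDimensional ℝ E]
    [NormedAddCommGroup E₀] [NormedSpace ℝ E₀] [FiniteDimensional ℝ E₀]
    [NormedAddCommGroup E'] [NormedSpace ℝ E'] [FiniteDimensional ℝ E']
    [NormedAddCommGroup E₀'] [NormedSpace ℝ E₀'] [FiniteDimensional ℝ E₀']
    [TopologicalSpace G] [ChartedSpace E G] [IsManifold 𝓘(ℝ, E) ∞ G]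
    [TopologicalSpace G₀] [ChartedSpace E₀ G₀] [IsManifold 𝓘(ℝ, E₀) ∞ G₀]
    [TopologicalSpace H] [ChartedSpace E' H] [IsManifold 𝓘(ℝ, E') ∞ H]
    [TopologicalSpace H₀] [ChartedSpace E₀' H₀] [IsManifold 𝓘(ℝ, E₀') ∞ H₀]
    (𝒢 : LieGroupoid E E₀ G G₀) (ℋ : LieGroupoid E' E₀' H H₀) (ι : LieSubgroupoid ℋ 𝒢) :
    ∃ 𝒟 : LieGroupoid (E × ℝ) (E₀ × ℝ) (DNC ι.hom) (DNC ι.base), ι.IsDNC 𝒟 ∧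
      (∃ (𝒩 : LieGroupoid E E₀ (NormalBundle ι.hom) (NormalBundle ι.base))
        (κ : LieSubgroupoid 𝒩 𝒟), (∀ n, κ.hom n = .nor n) ∧ ∀ n, κ.base n = .nor n) ∧
      ∃ j : SmoothEmbedding E' ℋ.Alg E 𝒢.Alg, ι.IsAlgMap j ∧
        ∃ 𝓛 : LieAlgebroid (E × ℝ) (E₀ × ℝ) (DNC j) (DNC ι.base),
          LieSubgroupoid.IsDNCAlg 𝓛 ∧
          ∃ Φ : Diffeomorph 𝓘(ℝ, E × ℝ) 𝓘(ℝ, E × ℝ) 𝒟.Alg (DNC j) ∞, 𝓛.IsIsoOf 𝒟 Φ ∧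
            ∀ (x : G₀) (t : ℝ) (ht : t ≠ 0) (w : 𝒢.fiber x) (v : 𝒟.fiber (.gen x t ht)),
              modelVec v.1 = modelVec (mfderiv 𝓘(ℝ, E) 𝓘(ℝ, E × ℝ)
                (fun a ↦ (DNC.gen a t ht : DNC ι.hom)) (𝒢.u x) w.1) →
              Φ ⟨.gen x t ht, v⟩ = .gen ⟨x, w⟩ t ht := by
  
  have := FiniteDimensional.complete ℝ E
  have := FiniteDimensional.complete ℝ E₀
  have := FiniteDimensional.complete ℝ E'
  have := FiniteDimensional.complete ℝ E₀'
  obtain ⟨Φ, hΦ⟩ := ι.exists_dncDiffeomorph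
  -- As the structure on the deformation of the Lie algebroids is transported by `Φ`, the
  -- isomorphism costs nothing; the content is in `isDNCAlg_transport`.
  refine ⟨ι.dnc, ι.isDNC_dnc, ⟨ι.normal, ι.normalInclusion, fun _ ↦ rfl, fun _ ↦ rfl⟩,
    ι.algEmbedding, ι.isAlgMap_algEmbedding, ι.dnc.algebroid.transport Φ,
    LieSubgroupoid.isDNCAlg_transport Φ hΦ, Φ, ι.dnc.isIsoOf_transport Φ,
    fun x t ht w v hvw ↦ ?_⟩
  -- The hypothesis on `v` says that it is the image of `w` under the differential of `a ↦ (a, t)`,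
  -- which is the definition of `genAlg`.
  have hv : (⟨.gen x t ht, v⟩ : ι.dnc.Alg) = ι.genAlg ⟨x, w⟩ t ht :=
    congrArg (LieGroupoid.Alg.mk (DNC.gen x t ht)) (Subtype.ext hvw)
  rw [hv, hΦ, ι.dncIso_genAlg]
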